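/- **Setting.** Let $(\Sigma,dh)$ be a connected, oriented Riemannian surface, compact or complete, of constant Gauss curvature $\kappa$. Let $J$ be rotation by $+\pi/2$ on $T\Sigma$. Let $V=S^1(T\Sigma)$ be the unit tangent bundle and $\omega$ its Levi-Civita connection form, so $\ker\omega$ is the horizontal plane field and $\omega(Z)=1$, where $Z$ generates the rotation of the fibres. The *magnetic Lorentzian extension* of $\Sigma$ is $V$ with the metric $dg=dh\oplus(-d\theta^2)$, that is $dg(\xi,\eta)=\langle dp\,\xi,dp\,\eta\rangle-\omega(\xi)\omega(\eta)$, with $p:V\to\Sigma$ the projection. For $v\in V$ and $z=e^{i\theta}\in S^1$ put $zv=\cos\theta\,v+\sin\theta\,Jv$ and let $\ell(v,z)\subset T_vV$ be the line spanned by the sum of the horizontal lift of $zv$ and $Z_v$. The *Lorentz prolongation* is the bundle $\pi:M\to V$ of null lines of $dg$, with the plane field $\mathcal D_{(v,\ell)}=(d\pi)^{-1}(\ell)$. We identify $M$ with $V\times S^1$ through $(v,z)\mapsto(v,\ell(v,z))$. Put $\mathcal E=[\mathcal D,\mathcal D]$, and let $\mathcal W\subset\mathcal E$ be the Cauchy characteristic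 of $\mathcal E$ (the directions $w\in\mathcal E$ with $[w,\mathcal E]\subset\mathcal E$). On $M$ let $\Theta=\partial/\partial\theta$, and let $\tilde Y_{(v,z)}$ be the horizontal lift of $J(zv)$, tangent to the slices $z=\mathrm{const}$. **Types.** Let $W$ be a smooth vector field spanning $\mathcal W$, with flow $\phi_t$, and let $\langle\cdot,\cdot\rangle$ be a continuous fibrewise metric on $\mathcal E/\mathcal W$, on which $d\phi_t$ acts. The Engel structure $\mathcal D$ is called * *elliptic* if the conformal distortion of $d\phi_t$ on $\mathcal E/\mathcal W$ is bounded uniformly in $t\in\mathbb R$ and the point: there is $C$ with $\|d\phi_t u\|\le C\|d\phi_t v\|$ for all $t$, all points $P$ and all $u,v\in(\mathcal E/\mathcal W)_P$ with $\|u\|=\|v\|$; * *genuine-parabolic* if there are a continuous orthonormal frame $\ell_1,\ell_2$ of $\mathcal E/\mathcal W$ and $c,T_0>0$ with $\pm\langle d\phi_{\pm t}\ell_1,d\phi_{\pm t}\ell_2\rangle/\langle d\phi_{\pm t}\ell_1,d\phi_{\pm t}\ell_1\rangle\ge ct$ at all points and for all $t\ge T_0$ (both signs), and $\ell_1$ lies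 nowhere in $\mathcal D/\mathcal W$; * *genuine-hyperbolic* if there are continuous, $d\phi_t$-invariant, everywhere distinct line subbundles $l^u,l^s$ of $\mathcal E/\mathcal W$ and $c,c',T_0>0$ with $\|d\phi_tv^u\|/\|d\phi_tv^s\|\ge c'e^{ct}\|v^u\|/\|v^s\|$ for all points $P$, all $t\ge T_0$, $v^u\in l^u_P$ and $0\ne v^s\in l^s_P$, and $\mathcal D/\mathcal W$ is nowhere equal to $l^u$ or $l^s$. **Theorem.** For each $v\in V$ the map $z\mapsto\ell(v,z)$ is a bijection of $S^1$ onto the null lines in $T_vV$, and $\mathcal D$ is an Engel structure on $M$: it is a smooth plane field, $\mathcal E$ is a smooth distribution of rank $3$, and $[\mathcal E,\mathcal E]=TM$. (a) There is a smooth vector field $W_0$ spanning $\mathcal W$ which projects, at $(v,z)$, to $zv\in T\Sigma$, and its flow $\phi_t$ is complete. The fields $\Theta,\tilde Y$ are smooth and form a frame of $\mathcal E/\mathcal W$, and there is a continuous fibrewise metric for which this frame is orthonormal. The linear holonomy of $\mathcal W$ in this frame is $$d\phi_t\equiv\exp\left(t\begin{pmatrix}0&-\kappa(\kappa+1)\\1&0\end{pmatrix}\right)\pmod{\mathcal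 W}$$ (the columns are the images of $\Theta$ and $\tilde Y$), so that its behaviour is governed by the sign of $\kappa(\kappa+1)$. (b) Let $W$ be any smooth vector field spanning $\mathcal W$ and take any continuous fibrewise metric on $\mathcal E/\mathcal W$; if $\Sigma$ is not compact, assume also that the length of the projection of $W$ to $T\Sigma$ is bounded above and away from $0$, and that the fibrewise metric is uniformly comparable with the one for which $\Theta,\tilde Y$ is an orthonormal frame. Then the flow of $W$ is complete, and, with respect to $W$ and this metric, $\mathcal D$ is 1. elliptic if and only if $\kappa>0$ or $\kappa<-1$; 2. genuine-parabolic if and only if $\kappa=0$ or $\kappa=-1$; 3. genuine-hyperbolic if and only if $-1<\kappa<0$. -/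

import Mathlib

open Bundle Set Filter Topology VectorField
open scoped Manifold ContDiff

noncomputable section

section LeviCivita

variable {E : Type*} [NormedAddCommGroup E] [NormedSpace ℝ E] [FiniteDimensional ℝ E]
  {H : Type*} [TopologicalSpace H] {I : ModelWithCorners ℝ E H}
  {S : Type*} [TopologicalSpace S] [ChartedSpace H S]
  [RiemannianBundle (fun x : S => TangentSpace I x)]

/-- The right-hand side of the Koszul formula for `2 ⟨∇_A s, B⟩`. -/
def koszul (A s B : ∀ x : S, TangentSpace I x) (x : S) : ℝ :=
  d% (fun y => inner ℝ (s y) (B y)) x (A x)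
    + d% (fun y => inner ℝ (A y) (B y)) x (s x)
    - d% (fun y => inner ℝ (A y) (s y)) x (B x)
    + inner ℝ (mlieBracket I A s x) (B x)
    - inner ℝ (mlieBracket I A B x) (s x)
    - inner ℝ (mlieBracket I s B x) (A x)

variable [IsManifold I ∞ S] [IsContMDiffRiemannianBundle I ∞ E (fun x : S => TangentSpace I x)]

theorem mdiffAt_inner {s B : ∀ x : S, TangentSpace I x} {x : S}
    (hs : MDiffAt (T% s) x) (hB : MDiffAt (T% B) x) :
    MDiffAt (fun y => inner ℝ (s y) (B y)) x :=
  haveI : IsContMDiffRiemannianBundle I 1 E (fun x : S => TangentSpace I x) :=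
    IsContMDiffRiemannianBundle.of_le (n := ∞) (by exact_mod_cast le_top)
  MDifferentiableAt.inner_bundle (E := fun x : S => TangentSpace I x) hs hB

theorem koszul_tensorial_left (s B : ∀ x : S, TangentSpace I x) (x : S)
    (hs : MDiffAt (T% s) x) (hB : MDiffAt (T% B) x) :
    TensorialAt I E (fun A => koszul A s B x) x where
  smul {f A} hf hA := by
    have h2 := mdiffAt_inner hA hB
    have h3 := mdiffAt_inner hA hs
    simp only [koszul, Pi.smul_apply', real_inner_smul_left, real_inner_smul_right,
      mvfderiv_fun_mul hf h2, mvfderiv_fun_mul hf h3, mlieBracket_smul_left hf hA, inner_add_left,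
      map_smul]
    simp [real_inner_smul_left]
    ring
  add {A A'} hA hA' := by
    have h2 := mdiffAt_inner hA hB
    have h3 := mdiffAt_inner hA hs
    have h2' := mdiffAt_inner hA' hB
    have h3' := mdiffAt_inner hA' hs
    simp only [koszul, Pi.add_apply, inner_add_left, inner_add_right, mvfderiv_fun_add h2 h2', mvfderiv_fun_add h3 h3',
      mlieBracket_add_left hA hA', map_add]
    simp
    ring

theorem koszul_tensorial_right (A s : ∀ x : S, TangentSpace I x) (x : S)
    (hA : MDiffAt (T% A) x) (hs : MDiffAt (T% s) x) :
    TensorialAt I E (fun B => koszul A s B x) x where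
  smul {f B} hf hB := by
    have h2 := mdiffAt_inner hA hB
    have h3 := mdiffAt_inner hs hB
    simp only [koszul, Pi.smul_apply', real_inner_smul_left, real_inner_smul_right,
      mvfderiv_fun_mul hf h2, mvfderiv_fun_mul hf h3, mlieBracket_smul_right hf hB, inner_add_left,
      map_smul]
    simp [real_inner_smul_left]
    rw [real_inner_comm (A x) (B x), real_inner_comm (s x) (B x)]
    ring
  add {B B'} hB hB' := by
    have h2 := mdiffAt_inner hA hB
    have h3 := mdiffAt_inner hs hB
    have h2' := mdiffAt_inner hA hB'
    have h3' := mdiffAt_inner hs hB'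
    simp only [koszul, Pi.add_apply, inner_add_left, inner_add_right, mvfderiv_fun_add h2 h2', mvfderiv_fun_add h3 h3',
      mlieBracket_add_right hB hB', map_add]
    simp
    ring

instance tangentSpace_finiteDimensional (x : S) : FiniteDimensional ℝ (TangentSpace I x) :=
  inferInstanceAs (FiniteDimensional ℝ E)

open Classical in
/-- The Levi-Civita derivative: `leviCivitaFun s x u = ∇_u s` is the vector at `x` with
`2 ⟨∇_u s, B⟩ = koszul A s B x` whenever `A x = u` (and zero where `s` is not differentiable). -/
def leviCivitaFun (s : ∀ x : S, TangentSpace I x) (x : S) :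
    TangentSpace I x →L[ℝ] TangentSpace I x :=
  if hs : MDiffAt (T% s) x then
    ∑ i, ((1 / 2 : ℝ) • (TensorialAt.mkHom₂ (I := I) (F := E) (F' := E)
        (fun A B => koszul A s B x) x
        (fun B hB => koszul_tensorial_left s B x hs hB)
        (fun A hA => koszul_tensorial_right A s x hA hs)).flip
          (stdOrthonormalBasis ℝ (TangentSpace I x) i)).smulRight
            (stdOrthonormalBasis ℝ (TangentSpace I x) i)
  else 0

theorem inner_leviCivitaFun {A s B : ∀ x : S, TangentSpace I x} {x : S}
    (hA : MDiffAt (T% A) x) (hs : MDiffAt (T% s) x) (hB : MDiffAt (T% B) x) :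
    inner ℝ (leviCivitaFun s x (A x)) (B x) = koszul A s B x / 2 := by
  set T := TensorialAt.mkHom₂ (I := I) (F := E) (F' := E)
        (fun A B => koszul A s B x) x
        (fun B hB => koszul_tensorial_left s B x hs hB)
        (fun A hA => koszul_tensorial_right A s x hA hs) with hT
  have hTAB : T (A x) (B x) = koszul A s B x :=
    TensorialAt.mkHom₂_apply (I := I) (F := E) (F' := E) _ _ hA hB
  rw [← hTAB, leviCivitaFun, dif_pos hs, ← hT]
  conv_rhs => rw [← (stdOrthonormalBasis ℝ (TangentSpace I x)).sum_repr' (B x)]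
  simp only [map_sum, map_smul, ContinuousLinearMap.sum_apply, sum_inner,
    ContinuousLinearMap.smulRight_apply, real_inner_smul_left, ContinuousLinearMap.smul_apply,
    ContinuousLinearMap.flip_apply, smul_eq_mul, Finset.sum_div]
  refine Finset.sum_congr rfl fun i _ => ?_
  ring

theorem eq_of_inner_mdiff {x : S} {u w : TangentSpace I x}
    (h : ∀ B : ∀ x : S, TangentSpace I x, MDiffAt (T% B) x → inner ℝ u (B x) = inner ℝ w (B x)) :
    u = w := by
  refine ext_inner_right ℝ fun v => ?_
  have := h (FiberBundle.extend E v) (FiberBundle.mdifferentiableAt_extend (I := I) ..)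
  simpa using this

theorem leviCivitaFun_add {s s' : ∀ x : S, TangentSpace I x} {x : S}
    (hs : MDiffAt (T% s) x) (hs' : MDiffAt (T% s') x) :
    leviCivitaFun (s + s') x = leviCivitaFun s x + leviCivitaFun s' x := by
  ext1 u
  refine eq_of_inner_mdiff fun B hB => ?_
  have hA := FiberBundle.mdifferentiableAt_extend (F := E) (I := I) u
  have hss : MDiffAt (T% (s + s')) x := mdifferentiableAt_add_section hs hs'
  have e := inner_leviCivitaFun hA hs hB
  have e' := inner_leviCivitaFun hA hs' hB
  have e'' := inner_leviCivitaFun hA hss hB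
  have h1 := mdiffAt_inner hs hB
  have h1' := mdiffAt_inner hs' hB
  have h2 := mdiffAt_inner hA hs
  have h2' := mdiffAt_inner hA hs'
  rw [FiberBundle.extend_apply_self] at e e' e''
  rw [ContinuousLinearMap.add_apply, inner_add_left, e, e', e'']
  simp only [koszul, Pi.add_apply, inner_add_left, inner_add_right, mvfderiv_fun_add h1 h1',
    mvfderiv_fun_add h2 h2', mlieBracket_add_left hs hs', mlieBracket_add_right hs hs', map_add]
  simp
  ring

theorem leviCivitaFun_leibniz {s : ∀ x : S, TangentSpace I x} {g : S → ℝ} {x : S}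
    (hs : MDiffAt (T% s) x) (hg : MDiffAt g x) :
    leviCivitaFun (g • s) x = g x • leviCivitaFun s x + (d% g x).smulRight (s x) := by
  ext1 u
  refine eq_of_inner_mdiff fun B hB => ?_
  have hA := FiberBundle.mdifferentiableAt_extend (F := E) (I := I) u
  have hss : MDiffAt (T% (g • s)) x := hg.smul_section hs
  have e := inner_leviCivitaFun hA hs hB
  have e'' := inner_leviCivitaFun hA hss hB
  have h1 := mdiffAt_inner hs hB
  have h2 := mdiffAt_inner hA hs
  rw [FiberBundle.extend_apply_self] at e e''
  rw [ContinuousLinearMap.add_apply, inner_add_left, ContinuousLinearMap.smul_apply,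
    real_inner_smul_left, ContinuousLinearMap.smulRight_apply, real_inner_smul_left, e, e'']
  simp only [koszul, Pi.smul_apply', real_inner_smul_left, real_inner_smul_right,
    mvfderiv_fun_mul hg h1, mvfderiv_fun_mul hg h2, mlieBracket_smul_left hg hs,
    mlieBracket_smul_right hg hs, inner_add_left, map_smul]
  simp
  rw [real_inner_comm (s x) u]
  ring

/-- The Levi-Civita connection; `leviCivita s x u = ∇_u s`. It is torsion-free and metric by the
two theorems below. -/
def leviCivita : CovariantDerivative I E (fun x : S => TangentSpace I x) where
  toFun := leviCivitaFun
  isCovariantDerivativeOnUniv :=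
    { add := fun hs hs' _ => leviCivitaFun_add hs hs'
      leibniz := fun hs hg _ => leviCivitaFun_leibniz hs hg }

theorem leviCivita_torsion : (leviCivita (I := I) (S := S)).torsion = 0 := by
  rw [CovariantDerivative.torsion_eq_zero_iff]
  intro X Y x hX hY
  refine eq_of_inner_mdiff fun B hB => ?_
  have e := inner_leviCivitaFun hX hY hB
  have e' := inner_leviCivitaFun hY hX hB
  change inner ℝ (leviCivitaFun Y x (X x) - leviCivitaFun X x (Y x)) (B x) = _
  rw [inner_sub_left, e, e']
  have hc : (fun y => inner ℝ (X y) (Y y)) = fun y => inner ℝ (Y y) (X y) := by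
    ext y; exact real_inner_comm _ _
  simp only [koszul, hc]
  rw [mlieBracket_swap (V := Y) (W := X)]
  simp
  ring

theorem leviCivita_metric {s s' : ∀ x : S, TangentSpace I x} {x : S}
    (hs : MDiffAt (T% s) x) (hs' : MDiffAt (T% s') x) (u : TangentSpace I x) :
    d% (fun y => inner ℝ (s y) (s' y)) x u
      = inner ℝ (leviCivita s x u) (s' x) + inner ℝ (s x) (leviCivita s' x u) := by
  have hA := FiberBundle.mdifferentiableAt_extend (F := E) (I := I) u
  have e := inner_leviCivitaFun hA hs hs'
  have e' := inner_leviCivitaFun hA hs' hs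
  rw [FiberBundle.extend_apply_self] at e e'
  change _ = inner ℝ (leviCivitaFun s x u) (s' x) + inner ℝ (s x) (leviCivitaFun s' x u)
  rw [real_inner_comm (leviCivitaFun s' x u), e, e']
  have hc : (fun y => inner ℝ (s' y) (s y)) = fun y => inner ℝ (s y) (s' y) := by
    ext y; exact real_inner_comm _ _
  simp only [koszul, hc, FiberBundle.extend_apply_self]
  rw [mlieBracket_swap (V := s') (W := s)]
  simp
  ring

end LeviCivita

section SectionsAlongMaps

variable {E : Type*} [NormedAddCommGroup E] [NormedSpace ℝ E]
  {H : Type*} [TopologicalSpace H] {I : ModelWithCorners ℝ E H}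
  {S : Type*} [TopologicalSpace S] [ChartedSpace H S] [IsManifold I ∞ S]
  {E' : Type*} [NormedAddCommGroup E'] [NormedSpace ℝ E']
  {H' : Type*} [TopologicalSpace H'] {I' : ModelWithCorners ℝ E' H'}
  {N : Type*} [TopologicalSpace N] [ChartedSpace H' N]

/-- A linear combination, with smooth coefficients, of two smooth vector fields along a map is
smooth. -/
theorem contMDiffOn_combination {b : N → S} {σ τ : ∀ n, TangentSpace I (b n)} {f g : N → ℝ}
    {U : Set N}
    (hσ : ContMDiffOn I' I.tangent ∞ (fun n => (⟨b n, σ n⟩ : TangentBundle I S)) U)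
    (hτ : ContMDiffOn I' I.tangent ∞ (fun n => (⟨b n, τ n⟩ : TangentBundle I S)) U)
    (hf : ContMDiffOn I' 𝓘(ℝ) ∞ f U) (hg : ContMDiffOn I' 𝓘(ℝ) ∞ g U) :
    ContMDiffOn I' I.tangent ∞
      (fun n => (⟨b n, f n • σ n + g n • τ n⟩ : TangentBundle I S)) U := by
  intro n hn
  have hσn := contMDiffWithinAt_totalSpace.1 (hσ n hn)
  have hτn := contMDiffWithinAt_totalSpace.1 (hτ n hn)
  refine contMDiffWithinAt_totalSpace.2 ⟨hσn.1, ?_⟩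
  set e := trivializationAt E (fun x : S => TangentSpace I x) (b n) with he
  have key : ∀ m, b m ∈ e.baseSet →
      (e (⟨b m, f m • σ m + g m • τ m⟩ : TangentBundle I S)).2
        = f m • (e (⟨b m, σ m⟩ : TangentBundle I S)).2
          + g m • (e (⟨b m, τ m⟩ : TangentBundle I S)).2 := by
    intro m hm
    rw [(e.linear ℝ hm).map_add, (e.linear ℝ hm).map_smul, (e.linear ℝ hm).map_smul]
  refine (((hf n hn).smul hσn.2).add ((hg n hn).smul hτn.2)).congr_of_eventuallyEq ?_ ?_
  · have : ∀ᶠ m in 𝓝[U] n, b m ∈ e.baseSet :=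
      hσn.1.continuousWithinAt.eventually
        (e.open_baseSet.mem_nhds (FiberBundle.mem_baseSet_trivializationAt' (b n)))
    filter_upwards [this] with m hm using key m hm
  · exact key n (FiberBundle.mem_baseSet_trivializationAt' (b n))

end SectionsAlongMaps

section UnitTangent

variable {S : Type*} [TopologicalSpace S] [ChartedSpace (EuclideanSpace ℝ (Fin 2)) S]
  [IsManifold (𝓡 2) ∞ S] [RiemannianBundle (fun x : S => TangentSpace (𝓡 2) x)]

variable (S) in
/-- An orientation of a Riemannian surface, given by the field `J` of rotations by a right angle in
the positive direction. -/
structure SurfaceOrientation where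
  /-- the rotation by a right angle -/
  J : ∀ x : S, TangentSpace (𝓡 2) x →ₗ[ℝ] TangentSpace (𝓡 2) x
  inner_J : ∀ (x : S) (u v : TangentSpace (𝓡 2) x), inner ℝ (J x u) (J x v) = inner ℝ u v
  J_J : ∀ (x : S) (u : TangentSpace (𝓡 2) x), J x (J x u) = -u
  contMDiff_J : ContMDiff (𝓡 2).tangent (𝓡 2).tangent ∞
    (fun v : TangentBundle (𝓡 2) S => (⟨v.1, J v.1 v.2⟩ : TangentBundle (𝓡 2) S))

namespace SurfaceOrientation

variable (o : SurfaceOrientation S)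

theorem inner_J_self {x : S} (u : TangentSpace (𝓡 2) x) : inner ℝ u (o.J x u) = 0 := by
  have h := o.inner_J x u (o.J x u)
  rw [o.J_J, inner_neg_right, real_inner_comm] at h
  linarith

theorem norm_J {x : S} (u : TangentSpace (𝓡 2) x) : ‖o.J x u‖ = ‖u‖ := by
  rw [norm_eq_sqrt_real_inner, norm_eq_sqrt_real_inner, o.inner_J]

theorem norm_combination {x : S} {e : TangentSpace (𝓡 2) x} (he : ‖e‖ = 1) (a b : ℝ)
    (hab : a ^ 2 + b ^ 2 = 1) : ‖a • e + b • o.J x e‖ = 1 := by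
  have h : inner ℝ (a • e + b • o.J x e) (a • e + b • o.J x e) = 1 := by
    simp only [inner_add_left, inner_add_right, real_inner_smul_left, real_inner_smul_right,
      o.inner_J, o.inner_J_self, real_inner_comm e (o.J x e)]
    rw [real_inner_self_eq_norm_sq, he]
    linear_combination hab
  rw [norm_eq_sqrt_real_inner, h, Real.sqrt_one]

theorem inner_combination {x : S} {e : TangentSpace (𝓡 2) x} (he : ‖e‖ = 1) (a b : ℝ) :
    inner ℝ e (a • e + b • o.J x e) = a := by
  rw [inner_add_right, real_inner_smul_right, real_inner_smul_right, o.inner_J_self,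
    real_inner_self_eq_norm_sq, he]
  ring

theorem inner_J_combination {x : S} {e : TangentSpace (𝓡 2) x} (he : ‖e‖ = 1) (a b : ℝ) :
    inner ℝ (o.J x e) (a • e + b • o.J x e) = b := by
  rw [inner_add_right, real_inner_smul_right, real_inner_smul_right, o.inner_J,
    real_inner_comm e (o.J x e), o.inner_J_self, real_inner_self_eq_norm_sq, he]
  ring

theorem expand {x : S} {e : TangentSpace (𝓡 2) x} (he : ‖e‖ = 1) (v : TangentSpace (𝓡 2) x) :
    v = (inner ℝ e v) • e + (inner ℝ (o.J x e) v) • o.J x e := by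
  have hfr : Module.finrank ℝ (TangentSpace (𝓡 2) x) = 2 := by
    change Module.finrank ℝ (EuclideanSpace ℝ (Fin 2)) = 2
    simp
  have hon : Orthonormal ℝ ![e, o.J x e] := by
    rw [orthonormal_iff_ite]
    intro i j
    fin_cases i <;> fin_cases j <;>
      simp [o.norm_J, he, o.inner_J_self, real_inner_comm e (o.J x e)]
  let B := basisOfOrthonormalOfCardEqFinrank hon (by simp [hfr])
  have hB : Orthonormal ℝ B := by simpa [B] using hon
  have := (B.toOrthonormalBasis hB).sum_repr' v
  simpa [Fin.sum_univ_two, B] using this.symm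

end SurfaceOrientation

/-- The unit tangent bundle of an oriented Riemannian surface. (The orientation only enters through
the charts that make it a manifold.) -/
@[ext] structure UnitTangent (o : SurfaceOrientation S) where
  /-- the underlying tangent vector -/
  val : TangentBundle (𝓡 2) S
  norm_val : ‖val.2‖ = 1

namespace UnitTangent

variable {o : SurfaceOrientation S}

instance : TopologicalSpace (UnitTangent o) := TopologicalSpace.induced UnitTangent.val inferInstance

theorem isInducing_val : IsInducing (UnitTangent.val : UnitTangent o → TangentBundle (𝓡 2) S) :=
  ⟨rfl⟩

/-- A local unit vector field extending (a positive multiple of) a given tangent vector. -/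
def frame (v₀ : TangentBundle (𝓡 2) S) (x : S) : TangentSpace (𝓡 2) x :=
  ‖FiberBundle.extend (EuclideanSpace ℝ (Fin 2)) v₀.2 x‖⁻¹ •
    FiberBundle.extend (EuclideanSpace ℝ (Fin 2)) v₀.2 x

theorem extend_ne_zero {v₀ : TangentBundle (𝓡 2) S} (h₀ : ‖v₀.2‖ = 1) {x : S}
    (hx : x ∈ (chartAt (EuclideanSpace ℝ (Fin 2)) v₀.1).source) :
    FiberBundle.extend (EuclideanSpace ℝ (Fin 2)) v₀.2 x ≠ 0 := by
  intro h
  set t := trivializationAt (EuclideanSpace ℝ (Fin 2)) (fun x : S => TangentSpace (𝓡 2) x) v₀.1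
    with ht
  have hxt : x ∈ t.baseSet := by simpa [ht] using hx
  have h0t : v₀.1 ∈ t.baseSet := FiberBundle.mem_baseSet_trivializationAt' v₀.1
  have h1 : (t ⟨x, FiberBundle.extend (EuclideanSpace ℝ (Fin 2)) v₀.2 x⟩).2
      = (t ⟨v₀.1, v₀.2⟩).2 := by
    simp [FiberBundle.extend, ← ht, hxt]
  rw [h, (t.linear ℝ hxt).map_zero] at h1
  have h2 : (t ⟨v₀.1, v₀.2⟩).2 = (t ⟨v₀.1, 0⟩).2 := by
    rw [(t.linear ℝ h0t).map_zero, ← h1]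
  have h3 : v₀.2 = 0 := by
    have := (t.continuousLinearEquivAt ℝ v₀.1 h0t).injective (a₁ := v₀.2) (a₂ := 0) (by simpa using h2)
    exact this
  rw [h3, norm_zero] at h₀
  exact zero_ne_one h₀

theorem norm_frame {v₀ : TangentBundle (𝓡 2) S} (h₀ : ‖v₀.2‖ = 1) {x : S}
    (hx : x ∈ (chartAt (EuclideanSpace ℝ (Fin 2)) v₀.1).source) : ‖frame v₀ x‖ = 1 := by
  rw [frame, norm_smul, norm_inv, norm_norm, inv_mul_cancel₀]
  exact norm_ne_zero_iff.2 (extend_ne_zero h₀ hx)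

theorem frame_self {v₀ : TangentBundle (𝓡 2) S} (h₀ : ‖v₀.2‖ = 1) : frame v₀ v₀.1 = v₀.2 := by
  simp [frame, h₀]

variable [IsContMDiffRiemannianBundle (𝓡 2) ∞ (EuclideanSpace ℝ (Fin 2))
  (fun x : S => TangentSpace (𝓡 2) x)]

theorem contMDiffOn_extend (v₀ : TangentBundle (𝓡 2) S) :
    ContMDiffOn (𝓡 2) (𝓡 2).tangent ∞
      (fun x : S => (⟨x, FiberBundle.extend (EuclideanSpace ℝ (Fin 2)) v₀.2 x⟩ :
        TangentBundle (𝓡 2) S)) (chartAt (EuclideanSpace ℝ (Fin 2)) v₀.1).source := by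
  set t := trivializationAt (EuclideanSpace ℝ (Fin 2)) (fun x : S => TangentSpace (𝓡 2) x) v₀.1
    with ht
  intro x hx
  have hxt : x ∈ t.baseSet := by simpa [ht] using hx
  rw [t.contMDiffWithinAt_section _ hxt]
  have hc : ContMDiffOn (𝓡 2) 𝓘(ℝ, EuclideanSpace ℝ (Fin 2)) ∞ (fun _ : S => (t ⟨v₀.1, v₀.2⟩).2)
    (chartAt (EuclideanSpace ℝ (Fin 2)) v₀.1).source := contMDiffOn_const
  refine hc.congr (fun y hy => ?_) x hx
  have hyt : y ∈ t.baseSet := by simpa [ht] using hy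
  simp [FiberBundle.extend, ← ht, hyt]

theorem contMDiffOn_frame {v₀ : TangentBundle (𝓡 2) S} (h₀ : ‖v₀.2‖ = 1) :
    ContMDiffOn (𝓡 2) (𝓡 2).tangent ∞
      (fun x : S => (⟨x, frame v₀ x⟩ : TangentBundle (𝓡 2) S))
      (chartAt (EuclideanSpace ℝ (Fin 2)) v₀.1).source := by
  have he := contMDiffOn_extend v₀
  have hin : ContMDiffOn (𝓡 2) 𝓘(ℝ) ∞ (fun x : S =>
      (inner ℝ (FiberBundle.extend (EuclideanSpace ℝ (Fin 2)) v₀.2 x)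
        (FiberBundle.extend (EuclideanSpace ℝ (Fin 2)) v₀.2 x) : ℝ))
      (chartAt (EuclideanSpace ℝ (Fin 2)) v₀.1).source :=
    ContMDiffOn.inner_bundle (E := fun x : S => TangentSpace (𝓡 2) x) (b := fun x => x) he he
  have hn : ContMDiffOn (𝓡 2) 𝓘(ℝ) ∞ (fun x : S =>
      (‖FiberBundle.extend (EuclideanSpace ℝ (Fin 2)) v₀.2 x‖⁻¹ : ℝ))
      (chartAt (EuclideanSpace ℝ (Fin 2)) v₀.1).source := by
    intro x hx
    have hne := extend_ne_zero h₀ hx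
    have h1 : ContDiffAt ℝ ∞ (fun r : ℝ => (Real.sqrt r)⁻¹)
        (inner ℝ (FiberBundle.extend (EuclideanSpace ℝ (Fin 2)) v₀.2 x)
        (FiberBundle.extend (EuclideanSpace ℝ (Fin 2)) v₀.2 x)) := by
      have hpos := real_inner_self_pos.2 hne
      exact (Real.contDiffAt_sqrt hpos.ne').inv (Real.sqrt_pos.2 hpos).ne'
    refine (h1.contMDiffAt.comp_contMDiffWithinAt x (hin x hx)).congr (fun y hy => ?_) ?_ <;>
    exact congrArg Inv.inv (norm_eq_sqrt_real_inner _)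
  have := contMDiffOn_combination he he hn (contMDiffOn_const (c := (0 : ℝ)))
  refine this.congr fun x hx => ?_
  simp [frame]

theorem contMDiffOn_J_frame (o : SurfaceOrientation S) {v₀ : TangentBundle (𝓡 2) S}
    (h₀ : ‖v₀.2‖ = 1) :
    ContMDiffOn (𝓡 2) (𝓡 2).tangent ∞
      (fun x : S => (⟨x, o.J x (frame v₀ x)⟩ : TangentBundle (𝓡 2) S))
      (chartAt (EuclideanSpace ℝ (Fin 2)) v₀.1).source :=
  o.contMDiff_J.comp_contMDiffOn (contMDiffOn_frame h₀)

/-- The coordinates of the unit vector `v` in the chart centred at `v₀`. -/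
def fwd (o : SurfaceOrientation S) (v₀ v : TangentBundle (𝓡 2) S) : EuclideanSpace ℝ (Fin 2) × ℝ :=
  (chartAt (EuclideanSpace ℝ (Fin 2)) v₀.1 v.1,
    inner ℝ (o.J v.1 (frame v₀ v.1)) v.2 / (1 + inner ℝ (frame v₀ v.1) v.2))

/-- The unit vector with given coordinates in the chart centred at `v₀`. -/
def bwd (o : SurfaceOrientation S) (v₀ : TangentBundle (𝓡 2) S)
    (p : EuclideanSpace ℝ (Fin 2) × ℝ) : TangentBundle (𝓡 2) S :=
  ⟨(chartAt (EuclideanSpace ℝ (Fin 2)) v₀.1).symm p.1,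
    ((1 - p.2 ^ 2) / (1 + p.2 ^ 2)) • frame v₀ ((chartAt (EuclideanSpace ℝ (Fin 2)) v₀.1).symm p.1)
    + (2 * p.2 / (1 + p.2 ^ 2)) •
      o.J _ (frame v₀ ((chartAt (EuclideanSpace ℝ (Fin 2)) v₀.1).symm p.1))⟩

/-- The domain of the chart centred at `v₀`. -/
def dom (v₀ : TangentBundle (𝓡 2) S) : Set (TangentBundle (𝓡 2) S) :=
  {v | v.1 ∈ (chartAt (EuclideanSpace ℝ (Fin 2)) v₀.1).source ∧ 1 + inner ℝ (frame v₀ v.1) v.2 ≠ 0}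

theorem contMDiffOn_inner_frame {v₀ : TangentBundle (𝓡 2) S} (h₀ : ‖v₀.2‖ = 1) :
    ContMDiffOn (𝓡 2).tangent 𝓘(ℝ) ∞
      (fun v : TangentBundle (𝓡 2) S => (inner ℝ (frame v₀ v.1) v.2 : ℝ))
      {v | v.1 ∈ (chartAt (EuclideanSpace ℝ (Fin 2)) v₀.1).source} := by
  have hp : ContMDiffOn (𝓡 2).tangent (𝓡 2) ∞ (fun v : TangentBundle (𝓡 2) S => v.1)
    {v | v.1 ∈ (chartAt (EuclideanSpace ℝ (Fin 2)) v₀.1).source} :=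
    (contMDiff_proj (fun x : S => TangentSpace (𝓡 2) x)).contMDiffOn
  have h1 := (contMDiffOn_frame h₀).comp hp (fun v hv => hv)
  exact ContMDiffOn.inner_bundle (E := fun x : S => TangentSpace (𝓡 2) x)
    (b := fun v : TangentBundle (𝓡 2) S => v.1) h1 contMDiffOn_id

theorem contMDiffOn_inner_J_frame (o : SurfaceOrientation S) {v₀ : TangentBundle (𝓡 2) S}
    (h₀ : ‖v₀.2‖ = 1) :
    ContMDiffOn (𝓡 2).tangent 𝓘(ℝ) ∞
      (fun v : TangentBundle (𝓡 2) S => (inner ℝ (o.J v.1 (frame v₀ v.1)) v.2 : ℝ))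
      {v | v.1 ∈ (chartAt (EuclideanSpace ℝ (Fin 2)) v₀.1).source} := by
  have hp : ContMDiffOn (𝓡 2).tangent (𝓡 2) ∞ (fun v : TangentBundle (𝓡 2) S => v.1)
    {v | v.1 ∈ (chartAt (EuclideanSpace ℝ (Fin 2)) v₀.1).source} :=
    (contMDiff_proj (fun x : S => TangentSpace (𝓡 2) x)).contMDiffOn
  have h1 := (contMDiffOn_J_frame o h₀).comp hp (fun v hv => hv)
  exact ContMDiffOn.inner_bundle (E := fun x : S => TangentSpace (𝓡 2) x)
    (b := fun v : TangentBundle (𝓡 2) S => v.1) h1 contMDiffOn_id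

theorem isOpen_dom {v₀ : TangentBundle (𝓡 2) S} (h₀ : ‖v₀.2‖ = 1) : IsOpen (dom v₀) := by
  have hU : IsOpen {v : TangentBundle (𝓡 2) S |
      v.1 ∈ (chartAt (EuclideanSpace ℝ (Fin 2)) v₀.1).source} :=
    (chartAt (EuclideanSpace ℝ (Fin 2)) v₀.1).open_source.preimage
      (contMDiff_proj (IB := 𝓡 2) (n := ∞) (fun x : S => TangentSpace (𝓡 2) x)).continuous
  have := (continuousOn_const.add (contMDiffOn_inner_frame h₀).continuousOn).isOpen_inter_preimage
    (f := fun v : TangentBundle (𝓡 2) S => (1 : ℝ) + inner ℝ (frame v₀ v.1) v.2) hU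
    (isOpen_compl_singleton (x := (0 : ℝ)))
  exact this

theorem contMDiffOn_fwd (o : SurfaceOrientation S) {v₀ : TangentBundle (𝓡 2) S} (h₀ : ‖v₀.2‖ = 1) :
    ContMDiffOn (𝓡 2).tangent 𝓘(ℝ, EuclideanSpace ℝ (Fin 2) × ℝ) ∞ (fwd o v₀) (dom v₀) := by
  have hp : ContMDiffOn (𝓡 2).tangent (𝓡 2) ∞ (fun v : TangentBundle (𝓡 2) S => v.1) (dom v₀) :=
    (contMDiff_proj (fun x : S => TangentSpace (𝓡 2) x)).contMDiffOn
  have h1 : ContMDiffOn (𝓡 2).tangent 𝓘(ℝ, EuclideanSpace ℝ (Fin 2)) ∞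
      (fun v : TangentBundle (𝓡 2) S => chartAt (EuclideanSpace ℝ (Fin 2)) v₀.1 v.1) (dom v₀) :=
    (contMDiffOn_chart (I := 𝓡 2) (n := ∞) (x := v₀.1)).comp hp (fun v hv => hv.1)
  have h2 := (contMDiffOn_inner_frame h₀).mono (fun v (hv : v ∈ dom v₀) => hv.1)
  have h3 := (contMDiffOn_inner_J_frame o h₀).mono (fun v (hv : v ∈ dom v₀) => hv.1)
  exact h1.prodMk_space (h3.div₀ (contMDiffOn_const.add h2) (fun v hv => hv.2))

theorem contMDiffOn_bwd (o : SurfaceOrientation S) {v₀ : TangentBundle (𝓡 2) S} (h₀ : ‖v₀.2‖ = 1) :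
    ContMDiffOn 𝓘(ℝ, EuclideanSpace ℝ (Fin 2) × ℝ) (𝓡 2).tangent ∞ (bwd o v₀)
      ((chartAt (EuclideanSpace ℝ (Fin 2)) v₀.1).target ×ˢ univ) := by
  have hb : ContMDiffOn 𝓘(ℝ, EuclideanSpace ℝ (Fin 2) × ℝ) (𝓡 2) ∞
      (fun p : EuclideanSpace ℝ (Fin 2) × ℝ =>
        (chartAt (EuclideanSpace ℝ (Fin 2)) v₀.1).symm p.1)
      ((chartAt (EuclideanSpace ℝ (Fin 2)) v₀.1).target ×ˢ univ) :=
    (contMDiffOn_chart_symm (I := 𝓡 2) (n := ∞) (x := v₀.1)).comp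
      (contDiff_fst.contMDiff.contMDiffOn) (fun p hp => hp.1)
  have hm : MapsTo (fun p : EuclideanSpace ℝ (Fin 2) × ℝ =>
        (chartAt (EuclideanSpace ℝ (Fin 2)) v₀.1).symm p.1)
      ((chartAt (EuclideanSpace ℝ (Fin 2)) v₀.1).target ×ˢ univ)
      (chartAt (EuclideanSpace ℝ (Fin 2)) v₀.1).source :=
    fun p hp => (chartAt (EuclideanSpace ℝ (Fin 2)) v₀.1).map_target hp.1
  have hpos : ∀ p : EuclideanSpace ℝ (Fin 2) × ℝ, 1 + p.2 ^ 2 ≠ 0 := fun p => by positivity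
  have hf : ContMDiff 𝓘(ℝ, EuclideanSpace ℝ (Fin 2) × ℝ) 𝓘(ℝ) ∞
      (fun p : EuclideanSpace ℝ (Fin 2) × ℝ => (1 - p.2 ^ 2) / (1 + p.2 ^ 2)) :=
    ContDiff.contMDiff (by fun_prop (disch := exact hpos _))
  have hg : ContMDiff 𝓘(ℝ, EuclideanSpace ℝ (Fin 2) × ℝ) 𝓘(ℝ) ∞
      (fun p : EuclideanSpace ℝ (Fin 2) × ℝ => (2 * p.2) / (1 + p.2 ^ 2)) :=
    ContDiff.contMDiff (by fun_prop (disch := exact hpos _))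
  exact contMDiffOn_combination ((contMDiffOn_frame h₀).comp hb hm)
    ((contMDiffOn_J_frame o h₀).comp hb hm) hf.contMDiffOn hg.contMDiffOn

theorem bwd_norm (o : SurfaceOrientation S) {v₀ : TangentBundle (𝓡 2) S} (h₀ : ‖v₀.2‖ = 1)
    {p : EuclideanSpace ℝ (Fin 2) × ℝ}
    (hp : p.1 ∈ (chartAt (EuclideanSpace ℝ (Fin 2)) v₀.1).target) : ‖(bwd o v₀ p).2‖ = 1 := by
  have he := norm_frame h₀ ((chartAt (EuclideanSpace ℝ (Fin 2)) v₀.1).map_target hp)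
  refine o.norm_combination he _ _ ?_
  have : 1 + p.2 ^ 2 ≠ 0 := by positivity
  field_simp
  ring

theorem inner_frame_bwd (o : SurfaceOrientation S) {v₀ : TangentBundle (𝓡 2) S} (h₀ : ‖v₀.2‖ = 1)
    {p : EuclideanSpace ℝ (Fin 2) × ℝ}
    (hp : p.1 ∈ (chartAt (EuclideanSpace ℝ (Fin 2)) v₀.1).target) :
    inner ℝ (frame v₀ (bwd o v₀ p).1) (bwd o v₀ p).2 = (1 - p.2 ^ 2) / (1 + p.2 ^ 2) := by
  have he := norm_frame h₀ ((chartAt (EuclideanSpace ℝ (Fin 2)) v₀.1).map_target hp)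
  exact o.inner_combination he _ _

theorem inner_J_frame_bwd (o : SurfaceOrientation S) {v₀ : TangentBundle (𝓡 2) S}
    (h₀ : ‖v₀.2‖ = 1) {p : EuclideanSpace ℝ (Fin 2) × ℝ}
    (hp : p.1 ∈ (chartAt (EuclideanSpace ℝ (Fin 2)) v₀.1).target) :
    inner ℝ (o.J _ (frame v₀ (bwd o v₀ p).1)) (bwd o v₀ p).2 = 2 * p.2 / (1 + p.2 ^ 2) := by
  have he := norm_frame h₀ ((chartAt (EuclideanSpace ℝ (Fin 2)) v₀.1).map_target hp)
  exact o.inner_J_combination he _ _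

theorem bwd_mem_dom (o : SurfaceOrientation S) {v₀ : TangentBundle (𝓡 2) S} (h₀ : ‖v₀.2‖ = 1)
    {p : EuclideanSpace ℝ (Fin 2) × ℝ}
    (hp : p.1 ∈ (chartAt (EuclideanSpace ℝ (Fin 2)) v₀.1).target) : bwd o v₀ p ∈ dom v₀ := by
  refine ⟨(chartAt (EuclideanSpace ℝ (Fin 2)) v₀.1).map_target hp, ?_⟩
  rw [inner_frame_bwd o h₀ hp]
  have : 1 + p.2 ^ 2 ≠ 0 := by positivity
  have h : 1 + (1 - p.2 ^ 2) / (1 + p.2 ^ 2) = 2 / (1 + p.2 ^ 2) := by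
    field_simp
    ring
  rw [h]
  positivity

theorem fwd_bwd (o : SurfaceOrientation S) {v₀ : TangentBundle (𝓡 2) S} (h₀ : ‖v₀.2‖ = 1)
    {p : EuclideanSpace ℝ (Fin 2) × ℝ}
    (hp : p.1 ∈ (chartAt (EuclideanSpace ℝ (Fin 2)) v₀.1).target) :
    fwd o v₀ (bwd o v₀ p) = p := by
  refine Prod.ext ((chartAt (EuclideanSpace ℝ (Fin 2)) v₀.1).right_inv hp) ?_
  change _ / (1 + _) = p.2
  rw [inner_frame_bwd o h₀ hp, inner_J_frame_bwd o h₀ hp]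
  have : 1 + p.2 ^ 2 ≠ 0 := by positivity
  have h : 1 + (1 - p.2 ^ 2) / (1 + p.2 ^ 2) = 2 / (1 + p.2 ^ 2) := by
    field_simp
    ring
  rw [h]
  field_simp

theorem bwd_fwd (o : SurfaceOrientation S) {v₀ v : TangentBundle (𝓡 2) S} (h₀ : ‖v₀.2‖ = 1)
    (hv : ‖v.2‖ = 1) (hd : v ∈ dom v₀) : bwd o v₀ (fwd o v₀ v) = v := by
  obtain ⟨x, w⟩ := v
  obtain ⟨hx, hne⟩ := hd
  change x ∈ _ at hx
  have he : ‖frame v₀ x‖ = 1 := norm_frame h₀ hx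
  have hw := o.expand he w
  have hsum : inner ℝ (frame v₀ x) w ^ 2 + inner ℝ (o.J x (frame v₀ x)) w ^ 2 = 1 := by
    have h1 : inner ℝ w w = (1 : ℝ) := by
      rw [real_inner_self_eq_norm_sq]
      simp only at hv
      rw [hv, one_pow]
    conv_lhs at h1 => enter [2]; rw [hw]
    rw [inner_add_left, real_inner_smul_left, real_inner_smul_left] at h1
    linear_combination h1
  simp only at hne hx
  have hb : (chartAt (EuclideanSpace ℝ (Fin 2)) v₀.1).symm
      (chartAt (EuclideanSpace ℝ (Fin 2)) v₀.1 x) = x :=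
    (chartAt (EuclideanSpace ℝ (Fin 2)) v₀.1).left_inv hx
  simp only [bwd, fwd]
  rw [hb]
  congr 1
  conv_rhs => rw [hw]
  set a : ℝ := inner ℝ (frame v₀ x) w
  set b : ℝ := inner ℝ (o.J x (frame v₀ x)) w
  have h2 : 1 + (b / (1 + a)) ^ 2 = 2 / (1 + a) := by
    field_simp
    linear_combination hsum
  have h3 : (1 - (b / (1 + a)) ^ 2) / (1 + (b / (1 + a)) ^ 2) = a := by
    rw [h2]
    field_simp
    linear_combination -hsum
  have h4 : 2 * (b / (1 + a)) / (1 + (b / (1 + a)) ^ 2) = b := by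
    rw [h2]
    field_simp
  rw [h3, h4]
  rfl

open Classical in
/-- `bwd`, with values in the unit tangent bundle. -/
def unitInv (v₀ : UnitTangent o) (p : EuclideanSpace ℝ (Fin 2) × ℝ) : UnitTangent o :=
  if hp : p.1 ∈ (chartAt (EuclideanSpace ℝ (Fin 2)) v₀.val.1).target then
    ⟨bwd o v₀.val p, bwd_norm o v₀.norm_val hp⟩ else v₀

theorem unitInv_val (v₀ : UnitTangent o) {p : EuclideanSpace ℝ (Fin 2) × ℝ}
    (hp : p.1 ∈ (chartAt (EuclideanSpace ℝ (Fin 2)) v₀.val.1).target) :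
    (unitInv v₀ p).val = bwd o v₀.val p := by
  rw [unitInv, dif_pos hp]

/-- The chart of the unit tangent bundle centred at a unit vector `v₀` based at `x₀`: a unit vector
`v = cos α • e + sin α • J e` based at `x` (with `e` the local unit field `frame v₀`, and `v ≠ -e`)
is sent to the coordinates of `x` in the preferred chart at `x₀` and to `tan (α / 2)`. -/
def unitChart (v₀ : UnitTangent o) :
    OpenPartialHomeomorph (UnitTangent o) (EuclideanSpace ℝ (Fin 2) × ℝ) where
  toFun v := fwd o v₀.val v.val
  invFun := unitInv v₀
  source := {v | v.val ∈ dom v₀.val}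
  target := (chartAt (EuclideanSpace ℝ (Fin 2)) v₀.val.1).target ×ˢ univ
  map_source' v hv := ⟨(chartAt (EuclideanSpace ℝ (Fin 2)) v₀.val.1).map_source hv.1, mem_univ _⟩
  map_target' p hp := by
    change (unitInv v₀ p).val ∈ dom v₀.val
    rw [unitInv_val v₀ hp.1]
    exact bwd_mem_dom o v₀.norm_val hp.1
  left_inv' v hv := by
    apply UnitTangent.ext
    rw [unitInv_val v₀ ((chartAt (EuclideanSpace ℝ (Fin 2)) v₀.val.1).map_source hv.1)]
    exact bwd_fwd o v₀.norm_val v.norm_val hv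
  right_inv' p hp := by
    rw [unitInv_val v₀ hp.1]
    exact fwd_bwd o v₀.norm_val hp.1
  open_source := (isOpen_dom v₀.norm_val).preimage isInducing_val.continuous
  open_target := (chartAt (EuclideanSpace ℝ (Fin 2)) v₀.val.1).open_target.prod isOpen_univ
  continuousOn_toFun :=
    (contMDiffOn_fwd o v₀.norm_val).continuousOn.comp isInducing_val.continuous.continuousOn
      (fun _ hv => hv)
  continuousOn_invFun := by
    refine isInducing_val.continuousOn_iff.2
      ((contMDiffOn_bwd o v₀.norm_val).continuousOn.congr fun p hp => ?_)
    exact unitInv_val v₀ hp.1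

instance : ChartedSpace (EuclideanSpace ℝ (Fin 2) × ℝ) (UnitTangent o) where
  atlas := range unitChart
  chartAt := unitChart
  mem_chart_source v := ⟨mem_chart_source _ _, by
    change 1 + inner ℝ (frame v.val v.val.1) v.val.2 ≠ 0
    rw [frame_self v.norm_val, real_inner_self_eq_norm_sq, v.norm_val]
    norm_num⟩
  chart_mem_atlas v := ⟨v, rfl⟩

instance : IsManifold 𝓘(ℝ, EuclideanSpace ℝ (Fin 2) × ℝ) ∞ (UnitTangent o) := by
  refine isManifold_of_contDiffOn _ _ _ ?_
  rintro _ _ ⟨v, rfl⟩ ⟨w, rfl⟩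
  have hs : ∀ p ∈ ((unitChart v).symm.trans (unitChart w)).source,
      p.1 ∈ (chartAt (EuclideanSpace ℝ (Fin 2)) v.val.1).target ∧ bwd o v.val p ∈ dom w.val := by
    intro p hp
    have h1 : p.1 ∈ (chartAt (EuclideanSpace ℝ (Fin 2)) v.val.1).target := hp.1.1
    have h2 : (unitInv v p).val ∈ dom w.val := hp.2
    rw [unitInv_val v h1] at h2
    exact ⟨h1, h2⟩
  have h := (contMDiffOn_fwd o w.norm_val).comp
    ((contMDiffOn_bwd o v.norm_val).mono (t := ((unitChart v).symm.trans (unitChart w)).source)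
      (fun p hp => ⟨(hs p hp).1, mem_univ _⟩)) (fun p hp => (hs p hp).2)
  simp only [modelWithCornersSelf_coe, modelWithCornersSelf_coe_symm, range_id, inter_univ,
    preimage_id, Function.id_comp, Function.comp_id]
  refine (contMDiffOn_iff_contDiffOn.1 h).congr fun p hp => ?_
  change fwd o w.val (unitInv v p).val = _
  rw [unitInv_val v (hs p hp).1]
  rfl

theorem contMDiff_val : ContMDiff 𝓘(ℝ, EuclideanSpace ℝ (Fin 2) × ℝ) (𝓡 2).tangent ∞
    (UnitTangent.val : UnitTangent o → TangentBundle (𝓡 2) S) := by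
  intro v
  have hv : v.val ∈ dom v.val := mem_chart_source (EuclideanSpace ℝ (Fin 2) × ℝ) v
  have h1 : ContMDiffAt 𝓘(ℝ, EuclideanSpace ℝ (Fin 2) × ℝ) 𝓘(ℝ, EuclideanSpace ℝ (Fin 2) × ℝ) ∞
    (fun w : UnitTangent o => fwd o v.val w.val) v := contMDiffAt_extChartAt (x := v)
  have h2 : ContMDiffAt 𝓘(ℝ, EuclideanSpace ℝ (Fin 2) × ℝ) (𝓡 2).tangent ∞ (bwd o v.val)
      (fwd o v.val v.val) :=
    (contMDiffOn_bwd o v.norm_val).contMDiffAt (prod_mem_nhds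
      ((chartAt (EuclideanSpace ℝ (Fin 2)) v.val.1).open_target.mem_nhds
        ((chartAt (EuclideanSpace ℝ (Fin 2)) v.val.1).map_source hv.1)) univ_mem)
  refine (h2.comp v h1).congr_of_eventuallyEq ?_
  filter_upwards [chart_source_mem_nhds (EuclideanSpace ℝ (Fin 2) × ℝ) v] with w hw
  exact (bwd_fwd o v.norm_val w.norm_val hw).symm

end UnitTangent

end UnitTangent

section EngelStructures

variable {E : Type*} [NormedAddCommGroup E] [NormedSpace ℝ E]
  {H : Type*} [TopologicalSpace H] (I : ModelWithCorners ℝ E H)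
  {M : Type*} [TopologicalSpace M] [ChartedSpace H M] [IsManifold I ∞ M]

/-- `A` is, near the point `p`, a smooth vector field with values in the distribution `D`. -/
def IsLocalSection (D : ∀ p : M, Submodule ℝ (TangentSpace I p)) (p : M)
    (A : ∀ q : M, TangentSpace I q) : Prop :=
  ∀ᶠ q in 𝓝 p, A q ∈ D q ∧
    ContMDiffAt I I.tangent ∞ (fun r : M => (⟨r, A r⟩ : TangentBundle I M)) q

/-- `D` is a smooth distribution of rank `k`. -/
def IsSmoothDistribution (D : ∀ p : M, Submodule ℝ (TangentSpace I p)) (k : ℕ) : Prop :=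
  ∀ p : M, Module.finrank ℝ (D p) = k ∧ ∀ w ∈ D p, ∃ A, IsLocalSection I D p A ∧ A p = w

/-- The derived distribution `[D, D]`: the values at `p` of local sections of `D` and of their Lie
brackets. -/
def derivedDistribution (D : ∀ p : M, Submodule ℝ (TangentSpace I p)) (p : M) :
    Submodule ℝ (TangentSpace I p) :=
  D p ⊔ Submodule.span ℝ
    {w | ∃ A B, IsLocalSection I D p A ∧ IsLocalSection I D p B ∧ mlieBracket I A B p = w}

/-- `D` is an Engel structure: a smooth plane field on a four-manifold such that `[D, D]` is a
smooth distribution of rank three and `[[D, D], [D, D]]` is the whole tangent bundle. -/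
def IsEngel (D : ∀ p : M, Submodule ℝ (TangentSpace I p)) : Prop :=
  Module.finrank ℝ E = 4 ∧ IsSmoothDistribution I D 2 ∧
    IsSmoothDistribution I (derivedDistribution I D) 3 ∧
      ∀ p, derivedDistribution I (derivedDistribution I D) p = ⊤

/-- The Cauchy characteristic of a distribution `D`: the vectors `w ∈ D p` such that
`[A, B] p ∈ D p` for all local sections `A`, `B` of `D` with `A p = w`. -/
def cauchyCharacteristic (D : ∀ p : M, Submodule ℝ (TangentSpace I p)) (p : M) :
    Submodule ℝ (TangentSpace I p) :=
  Submodule.span ℝ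
    {w | w ∈ D p ∧ ∀ A B, IsLocalSection I D p A → IsLocalSection I D p B → A p = w →
      mlieBracket I A B p ∈ D p}

/-- A continuous fibrewise metric on the quotient bundle `D / W`, given as a positive semidefinite
form on `D` whose kernel is `W`. -/
structure QuotientMetric (D W : ∀ p : M, Submodule ℝ (TangentSpace I p)) where
  /-- the form at the point `p` (its values outside of `D p` are irrelevant) -/
  form : ∀ p : M, TangentSpace I p →ₗ[ℝ] TangentSpace I p →ₗ[ℝ] ℝ
  symm : ∀ p, ∀ u ∈ D p, ∀ v ∈ D p, form p u v = form p v u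
  kernel : ∀ p, ∀ u ∈ W p, ∀ v ∈ D p, form p u v = 0
  pos : ∀ p, ∀ u ∈ D p, u ∉ W p → 0 < form p u u
  continuousAt : ∀ (p : M) (A B : ∀ q : M, TangentSpace I q),
    IsLocalSection I D p A → IsLocalSection I D p B →
      ContinuousAt (fun q => form q (A q) (B q)) p

/-- `X` is a smooth vector field spanning the line field `W`. -/
def IsGenerator (W : ∀ p : M, Submodule ℝ (TangentSpace I p)) (X : ∀ p : M, TangentSpace I p) :
    Prop :=
  ContMDiff I I.tangent ∞ (fun p : M => (⟨p, X p⟩ : TangentBundle I M)) ∧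
    ∀ p, X p ≠ 0 ∧ W p = Submodule.span ℝ {X p}

/-- `φ` is the (complete) flow of the vector field `X`. -/
structure IsFlow (X : ∀ p : M, TangentSpace I p) (φ : ℝ → M → M) : Prop where
  zero : ∀ p, φ 0 p = p
  isMIntegralCurve : ∀ p, IsMIntegralCurve (I := I) (fun t => φ t p) X
  mdifferentiable : ∀ t, MDifferentiable I I (φ t)

variable {I}
variable {D W : ∀ p : M, Submodule ℝ (TangentSpace I p)}

/-- Elliptic type: the maps induced by the flow `φ` between the fibres of `D / W` have uniformly
bounded conformal distortion. -/
def IsElliptic (b : QuotientMetric I D W) (φ : ℝ → M → M) : Prop :=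
  ∃ C : ℝ, ∀ (t : ℝ) (p : M), ∀ u ∈ D p, ∀ v ∈ D p, b.form p u u = b.form p v v →
    b.form (φ t p) (mfderiv I I (φ t) p u) (mfderiv I I (φ t) p u)
      ≤ C * b.form (φ t p) (mfderiv I I (φ t) p v) (mfderiv I I (φ t) p v)

/-- A global continuous section of `D`. -/
def IsContinuousSection (D : ∀ p : M, Submodule ℝ (TangentSpace I p))
    (A : ∀ p : M, TangentSpace I p) : Prop :=
  Continuous (fun p : M => (⟨p, A p⟩ : TangentBundle I M)) ∧ ∀ p, A p ∈ D p

/-- Parabolic type of `D`, together with the condition that the plane field `P` (with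
`W ⊆ P ⊆ D`) is such that the line `P / W` is nowhere equal to the parabolic line
`lʰ = ⟨ℓ₁⟩`. Here `ℓ₁`, `ℓ₂` represents a continuous orthonormal frame of `D / W`. -/
def IsGenuineParabolic (P : ∀ p : M, Submodule ℝ (TangentSpace I p)) (b : QuotientMetric I D W)
    (φ : ℝ → M → M) : Prop :=
  ∃ ℓ₁ ℓ₂ : ∀ p : M, TangentSpace I p,
    IsContinuousSection D ℓ₁ ∧ IsContinuousSection D ℓ₂ ∧
    (∀ p, b.form p (ℓ₁ p) (ℓ₁ p) = 1 ∧ b.form p (ℓ₂ p) (ℓ₂ p) = 1 ∧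
      b.form p (ℓ₁ p) (ℓ₂ p) = 0) ∧
    (∃ c > 0, ∃ T₀ > 0, ∀ (p : M) (t : ℝ), T₀ ≤ t →
      c * t ≤ b.form (φ t p) (mfderiv I I (φ t) p (ℓ₁ p)) (mfderiv I I (φ t) p (ℓ₂ p))
          / b.form (φ t p) (mfderiv I I (φ t) p (ℓ₁ p)) (mfderiv I I (φ t) p (ℓ₁ p)) ∧
      c * t ≤ -(b.form (φ (-t) p) (mfderiv I I (φ (-t)) p (ℓ₁ p)) (mfderiv I I (φ (-t)) p (ℓ₂ p))
          / b.form (φ (-t) p) (mfderiv I I (φ (-t)) p (ℓ₁ p))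
              (mfderiv I I (φ (-t)) p (ℓ₁ p)))) ∧
    ∀ p, ℓ₁ p ∉ P p

/-- A continuous line subbundle of `D / W`, given as a field `L` of subspaces with
`W ⊆ L ⊆ D`. -/
def IsQuotientLine (D W L : ∀ p : M, Submodule ℝ (TangentSpace I p)) : Prop :=
  ∀ p : M, ∃ A : ∀ q : M, TangentSpace I q, ∀ᶠ q in 𝓝 p,
    ContinuousAt (fun r : M => (⟨r, A r⟩ : TangentBundle I M)) q ∧
      A q ∈ D q ∧ A q ∉ W q ∧ L q = W q ⊔ Submodule.span ℝ {A q}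

/-- Hyperbolic type of `D`, together with the condition that the plane field `P` (with
`W ⊆ P ⊆ D`) is such that the line `P / W` is nowhere equal to one of the two invariant lines
`lᵘ`, `lˢ` of `D / W`. -/
def IsGenuineHyperbolic (P : ∀ p : M, Submodule ℝ (TangentSpace I p)) (b : QuotientMetric I D W)
    (φ : ℝ → M → M) : Prop :=
  ∃ Lu Ls : ∀ p : M, Submodule ℝ (TangentSpace I p),
    IsQuotientLine D W Lu ∧ IsQuotientLine D W Ls ∧ (∀ p, Lu p ⊓ Ls p = W p) ∧
    (∀ (t : ℝ) (p : M), ∀ v ∈ Lu p, mfderiv I I (φ t) p v ∈ Lu (φ t p)) ∧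
    (∀ (t : ℝ) (p : M), ∀ v ∈ Ls p, mfderiv I I (φ t) p v ∈ Ls (φ t p)) ∧
    (∃ c > 0, ∃ c' > 0, ∃ T₀ > 0, ∀ (p : M) (t : ℝ), T₀ ≤ t →
      ∀ u ∈ Lu p, ∀ s ∈ Ls p, s ∉ W p →
        c' * Real.exp (c * t) * (√(b.form p u u) / √(b.form p s s))
          ≤ √(b.form (φ t p) (mfderiv I I (φ t) p u) (mfderiv I I (φ t) p u))
            / √(b.form (φ t p) (mfderiv I I (φ t) p s) (mfderiv I I (φ t) p s))) ∧
    ∀ p, P p ⊓ Lu p = W p ∧ P p ⊓ Ls p = W p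

end EngelStructures

section MagneticExtension

variable {S : Type*} [TopologicalSpace S] [ChartedSpace (EuclideanSpace ℝ (Fin 2)) S]
  [IsManifold (𝓡 2) ∞ S] [RiemannianBundle (fun x : S => TangentSpace (𝓡 2) x)]
  [IsContMDiffRiemannianBundle (𝓡 2) ∞ (EuclideanSpace ℝ (Fin 2))
    (fun x : S => TangentSpace (𝓡 2) x)]

variable (S) in
/-- The surface `S` has constant Gauss curvature `κ`:
`R(X, Y) Z = κ (⟨Y, Z⟩ X - ⟨X, Z⟩ Y)` for all vector fields. -/
def HasConstantCurvature (κ : ℝ) : Prop :=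
  ∀ (x : S) (X Y Z : ∀ y : S, TangentSpace (𝓡 2) y),
    ContMDiffAt (𝓡 2) (𝓡 2).tangent ∞ (fun y : S => (⟨y, X y⟩ : TangentBundle (𝓡 2) S)) x →
    ContMDiffAt (𝓡 2) (𝓡 2).tangent ∞ (fun y : S => (⟨y, Y y⟩ : TangentBundle (𝓡 2) S)) x →
    ContMDiffAt (𝓡 2) (𝓡 2).tangent ∞ (fun y : S => (⟨y, Z y⟩ : TangentBundle (𝓡 2) S)) x →
    leviCivita (I := 𝓡 2) (fun y => leviCivita (I := 𝓡 2) Z y (Y y)) x (X x)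
      - leviCivita (I := 𝓡 2) (fun y => leviCivita (I := 𝓡 2) Z y (X y)) x (Y x)
      - leviCivita (I := 𝓡 2) Z x (mlieBracket (𝓡 2) X Y x)
      = κ • (inner ℝ (Y x) (Z x) • X x - inner ℝ (X x) (Z x) • Y x)

variable {o : SurfaceOrientation S}

/-- The model with corners of the unit tangent bundle. -/
abbrev unitModel : ModelWithCorners ℝ (EuclideanSpace ℝ (Fin 2) × ℝ)
    (EuclideanSpace ℝ (Fin 2) × ℝ) := 𝓘(ℝ, EuclideanSpace ℝ (Fin 2) × ℝ)

/-- The differential at `v` of the projection of the unit tangent bundle to the surface. -/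
def footDeriv (v : UnitTangent o) :
    TangentSpace unitModel v →L[ℝ] TangentSpace (𝓡 2) v.val.1 :=
  mfderiv unitModel (𝓡 2) (fun w : UnitTangent o => w.val.1) v

/-- The Levi-Civita connection form `ω` of the unit tangent bundle. If `e` is a local unit vector
field with `e = v` at the base point of `v`, and unit vectors are written as
`w = cos α • e + sin α • J e`, then `ω = dα + ⟨∇ e, J e⟩` at `v`, where `dα = d (sin α)` since
`α = 0` there. The horizontal plane is the kernel of `ω`, and `ω = 1` on the generator of the
rotation of the fibre in the direction of `J`. -/
def connectionForm (v : UnitTangent o) (ξ : TangentSpace unitModel v) : ℝ :=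
  mvfderiv unitModel (fun w : UnitTangent o =>
      (inner ℝ (o.J w.val.1 (UnitTangent.frame v.val w.val.1)) w.val.2 : ℝ)) v ξ
    + inner ℝ (o.J v.val.1 v.val.2)
        (leviCivita (I := 𝓡 2) (UnitTangent.frame v.val) v.val.1 (footDeriv v ξ))

/-- The Lorentzian metric `dg = dh ⊕ (-dθ²)` of the magnetic extension. -/
def magneticMetric (v : UnitTangent o) (ξ η : TangentSpace unitModel v) : ℝ :=
  inner ℝ (footDeriv v ξ) (footDeriv v η) - connectionForm v ξ * connectionForm v η

/-- The null cone at `v`: the set of all null lines of the magnetic extension. -/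
def nullCone (v : UnitTangent o) : Set (Submodule ℝ (TangentSpace unitModel v)) :=
  {ℓ | Module.finrank ℝ ℓ = 1 ∧ ∀ ξ ∈ ℓ, magneticMetric v ξ ξ = 0}

/-- The unit tangent vector `v` rotated by the unit complex number `z`. -/
def rotated (v : UnitTangent o) (z : Circle) : TangentSpace (𝓡 2) v.val.1 :=
  (z : ℂ).re • v.val.2 + (z : ℂ).im • o.J v.val.1 v.val.2

/-- The null line at `v` spanned by the sum of the horizontal lift of the rotated vector `z v` and
the vertical unit vector. -/
def nullLine (v : UnitTangent o) (z : Circle) : Submodule ℝ (TangentSpace unitModel v) :=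
  Submodule.span ℝ {ξ | footDeriv v ξ = rotated v z ∧ connectionForm v ξ = 1}

/-- The model with corners of the prolongation. -/
abbrev prolongModel : ModelWithCorners ℝ
    ((EuclideanSpace ℝ (Fin 2) × ℝ) × EuclideanSpace ℝ (Fin 1))
    (ModelProd (EuclideanSpace ℝ (Fin 2) × ℝ) (EuclideanSpace ℝ (Fin 1))) :=
  unitModel.prod (𝓡 1)

/-- The bundle of null lines of the magnetic extension, where the pair `(v, z)` stands for the null
line `nullLine v z` at `v`. -/
abbrev Prolongation (o : SurfaceOrientation S) : Type _ := UnitTangent o × Circle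

/-- The differential of the projection of the prolongation to the magnetic extension. -/
def prolongProj (p : Prolongation o) :
    TangentSpace prolongModel p →L[ℝ] TangentSpace unitModel p.1 :=
  mfderiv prolongModel unitModel (fun q : Prolongation o => q.1) p

/-- The tautological plane field of the prolongation: the vectors which the projection to the
magnetic extension maps into the null line. -/
def prolongation (p : Prolongation o) : Submodule ℝ (TangentSpace prolongModel p) :=
  (nullLine p.1 p.2).comap (prolongProj p).toLinearMap

/-- `[D, D]` for the tautological plane field `D`. -/
def evenContact (p : Prolongation o) : Submodule ℝ (TangentSpace prolongModel p) :=
  derivedDistribution prolongModel prolongation p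

/-- The Cauchy characteristic of `[D, D]` for the tautological plane field `D`. -/
def charLine (p : Prolongation o) : Submodule ℝ (TangentSpace prolongModel p) :=
  cauchyCharacteristic prolongModel evenContact p

/-- `ξ` is the value at `p` of the vertical vector field `Θ = ∂/∂θ`, where `z = exp (i θ)`. -/
def IsTheta (p : Prolongation o) (ξ : TangentSpace prolongModel p) : Prop :=
  prolongProj p ξ = 0 ∧
    mvfderiv prolongModel (fun q : Prolongation o => (q.2 : ℂ)) p ξ = Complex.I * (p.2 : ℂ)

/-- `η` is the value at `p = (v, z)` of the vector field `Ỹ`: the horizontal lift of the vector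
`J (z v)`, tangent to the slice on which `z` is constant. -/
def IsTildeY (p : Prolongation o) (η : TangentSpace prolongModel p) : Prop :=
  footDeriv p.1 (prolongProj p η) = o.J p.1.val.1 (rotated p.1 p.2) ∧
    connectionForm p.1 (prolongProj p η) = 0 ∧
    mvfderiv prolongModel (fun q : Prolongation o => (q.2 : ℂ)) p η = 0

/-- The vector field `X` moves points of the surface with speed bounded above and away from
zero. -/
def HasBoundedSpeed (X : ∀ p : Prolongation o, TangentSpace prolongModel p) : Prop :=
  ∃ C > 0, ∀ p, C⁻¹ ≤ ‖footDeriv p.1 (prolongProj p (X p))‖ ∧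
    ‖footDeriv p.1 (prolongProj p (X p))‖ ≤ C

/-- The fibrewise metric is uniformly comparable with the one for which `Θ`, `Ỹ` is an orthonormal
frame. -/
def IsUniform (b : QuotientMetric prolongModel (evenContact (o := o)) charLine) : Prop :=
  ∃ C > 0, ∀ (p : Prolongation o) (ξ η : TangentSpace prolongModel p),
    IsTheta p ξ → IsTildeY p η → ∀ a c : ℝ,
      C⁻¹ * (a ^ 2 + c ^ 2) ≤ b.form p (a • ξ + c • η) (a • ξ + c • η) ∧
      b.form p (a • ξ + c • η) (a • ξ + c • η) ≤ C * (a ^ 2 + c ^ 2)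

end MagneticExtension

end

/-! Everything is read off from one global frame on `M`. Let X be the horizontal lift of zv, and let
Z be the rotation of the fibres of `V`, both tangent to the slices z = const. If α is the angle of v
from a local unit field, then zv has the angle α + θ, so turning v and turning z act alike on
horizontal lifts: [Θ, X] = [Z, X] = Ỹ and [Θ, Ỹ] = [Z, Ỹ] = -X. The structure equations of the
Levi-Civita connection give [X, Ỹ] = κ Z.

The plane field is spanned by Θ and X + Z, and one bracket adds Ỹ. Since [X + Z + λΘ, Ỹ] = κ Z - (1
+ λ) X, this bracket stays in the span of Θ, X + Z, Ỹ exactly for λ = -(1 + κ). Hence W = X + Z - (1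
+ κ)Θ, and the frame Θ, W, Ỹ, X satisfies [Θ, W] = Ỹ, [Θ, Ỹ] = -X and [W, Ỹ] = κ W + κ(κ + 1)Θ
(`isMagneticFrame`). The Engel property and the identification of the characteristic line are
algebra in these relations (`IsMagneticFrame.isEngel`,
`IsMagneticFrame.cauchyCharacteristic_three`).

A generator of the characteristic line is h W with h nowhere zero. Modulo W the derivatives of h
disappear, so the coefficients of a transported vector xΘ + yỸ solve x' = -κ(κ + 1) h y, y' = h x.
This is a constant linear system run at the time τ = ∫ h (`IsMagneticFrame.exists_flow_apply`,
resting on `mfderiv_flow_sum` and the differentiability of flows). For h = 1 it is the matrix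
exponential of part (a).

Bounds on |h| make τ comparable with t, up to a sign. With K = κ(κ + 1) there are three cases. If K
> 0, the form x² + K y² is invariant, so the distortion is bounded. If K = 0, the holonomy is the
shear (x, y) ↦ (x, y + τx), which fixes Ỹ. If K < 0, there are two eigenlines x = ±√(-K) y with
opposite exponential rates. The line of `D`, which is y = 0, differs from all these special lines,
so the types are genuine. The equivalences follow once the types are shown to exclude each other by
growth rates (`IsMagneticFrame.types`).

Completeness of the flow comes from the surface. Bounded speed of the foot point makes it converge
as time approaches a finite end of the interval of definition, and the fibres of `M` over the
surface are compact, so the integral curve stays near a compact set and can be continued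
(`exists_isFlow_of_norm_footDeriv_le`). The parametrization of the null lines only uses that the
differential of the projection and the connection form are together coordinates on the tangent
spaces of `V` (`bijOn_nullLine`). -/

/-! ### Local flows in a normed space and the variational equation -/

section LocalFlow

variable {E : Type*} [NormedAddCommGroup E] [NormedSpace ℝ E]

/-- Grönwall's inequality in both directions of time: negative times are reduced to positive ones by
reflecting the curve. -/
theorem norm_le_gronwallBound_abs {r r' : ℝ → E} {K δ ε : ℝ} (h0 : r 0 = 0)
    (hr : ∀ t ∈ Ioo (-ε) ε, HasDerivAt r (r' t) t)
    (hb : ∀ t ∈ Ioo (-ε) ε, ‖r' t‖ ≤ K * ‖r t‖ + δ) {t : ℝ} (ht : t ∈ Ioo (-ε) ε) :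
    ‖r t‖ ≤ gronwallBound 0 K δ |t| := by
  have pos : ∀ {s s' : ℝ → E}, s 0 = 0 → (∀ t ∈ Ioo (-ε) ε, HasDerivAt s (s' t) t) →
      (∀ t ∈ Ioo (-ε) ε, ‖s' t‖ ≤ K * ‖s t‖ + δ) → ∀ t ∈ Ico 0 ε,
      ‖s t‖ ≤ gronwallBound 0 K δ t := by
    intro s s' hs0 hs hsb t ht
    have hsub : ∀ u ∈ Icc 0 t, u ∈ Ioo (-ε) ε := fun u hu =>
      ⟨by linarith [hu.1, ht.1, ht.2], hu.2.trans_lt ht.2⟩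
    have := norm_le_gronwallBound_of_norm_deriv_right_le (f := s) (f' := s') (a := 0) (b := t)
      (δ := 0) (K := K) (ε := δ)
      (fun u hu => (hs u (hsub u hu)).continuousAt.continuousWithinAt)
      (fun u hu => (hs u (hsub u (Ico_subset_Icc_self hu))).hasDerivWithinAt) (by simp [hs0])
      (fun u hu => hsb u (hsub u (Ico_subset_Icc_self hu))) t ⟨ht.1, le_rfl⟩
    simpa using this
  rcases le_total 0 t with h | h
  · rw [abs_of_nonneg h]
    exact pos h0 hr hb t ⟨h, ht.2⟩
  · rw [abs_of_nonpos h]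
    have hneg : ∀ u ∈ Ioo (-ε) ε, -u ∈ Ioo (-ε) ε := fun u hu =>
      ⟨by linarith [hu.2], by linarith [hu.1]⟩
    have := pos (s := fun u => r (-u)) (s' := fun u => -r' (-u)) (by simpa using h0)
      (fun u hu => by
        simpa [Function.comp_def] using (hr (-u) (hneg u hu)).scomp u (hasDerivAt_neg u))
      (fun u hu => by simpa using hb (-u) (hneg u hu)) (-t) ⟨by linarith, by linarith [ht.1]⟩
    simpa using this

/-- The solutions of an autonomous ODE depend differentiably on the initial value, and the
derivative solves the variational equation. -/
theorem hasFDerivAt_of_variational {f : E → E} {α : E → ℝ → E} {J : ℝ → E →L[ℝ] E} {x : E}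
    {B : Set E} (hB : Convex ℝ B) {K L L' ε : ℝ}
    (hf : ∀ z ∈ B, DifferentiableAt ℝ f z) (hK : ∀ z ∈ B, ‖fderiv ℝ f z‖ ≤ K)
    (hL : ∀ z ∈ B, ∀ w ∈ B, ‖fderiv ℝ f z - fderiv ℝ f w‖ ≤ L * ‖z - w‖) (hL0 : 0 ≤ L)
    (hα : ∀ᶠ y in 𝓝 x, α y 0 = y ∧ ∀ t ∈ Ioo (-ε) ε, α y t ∈ B ∧
      HasDerivAt (α y) (f (α y t)) t ∧ ‖α y t - α x t‖ ≤ L' * ‖y - x‖)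
    (hJ0 : J 0 = ContinuousLinearMap.id ℝ E)
    (hJ : ∀ t ∈ Ioo (-ε) ε, HasDerivAt J ((fderiv ℝ f (α x t)).comp (J t)) t)
    {t : ℝ} (ht : t ∈ Ioo (-ε) ε) : HasFDerivAt (fun y => α y t) (J t) x := by
  have hx := hα.self_of_nhds
  have hK0 : 0 ≤ K := (norm_nonneg _).trans (hK _ (hx.2 t ht).1)
  -- The shift by 1 makes the Grönwall constant nonzero, so that the closed formula with the
  -- exponential applies.
  set K' := K + 1 with hK'
  have hK'0 : K' ≠ 0 := by positivity
  -- The remainder of the linearization satisfies the variational equation up to an error quadratic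
  -- in y - x, so by Grönwall it is itself quadratic in y - x.
  have key : ∀ᶠ y in 𝓝 x, ‖α y t - α x t - J t (y - x)‖ ≤
      (L * L' ^ 2 / K' * (Real.exp (K' * |t|) - 1)) * ‖y - x‖ ^ 2 := by
    filter_upwards [hα] with y hy
    have := norm_le_gronwallBound_abs (ε := ε) (K := K') (δ := L * L' ^ 2 * ‖y - x‖ ^ 2)
      (r := fun s => α y s - α x s - J s (y - x))
      (r' := fun s => f (α y s) - f (α x s) - (fderiv ℝ f (α x s)) (J s (y - x)))
      (by simp [hy.1, hx.1, hJ0])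
      (fun s hs => ((hy.2 s hs).2.1.sub (hx.2 s hs).2.1).sub
        (by simpa using (hJ s hs).clm_apply (hasDerivAt_const s (y - x)))) (fun s hs => ?_) ht
    · rw [gronwallBound_of_K_ne_0 hK'0] at this
      refine this.trans (le_of_eq ?_)
      ring
    · obtain ⟨hyB, -, hyL⟩ := hy.2 s hs
      obtain ⟨hxB, -, -⟩ := hx.2 s hs
      have hseg : segment ℝ (α x s) (α y s) ⊆ B := hB.segment_subset hxB hyB
      -- Second-order Taylor estimate: on the segment the derivative of `f` differs from its value
      -- at the end point by at most `L` times the length of the segment.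
      have h1 : ‖f (α y s) - f (α x s) - (fderiv ℝ f (α x s)) (α y s - α x s)‖
          ≤ (L * ‖α y s - α x s‖) * ‖α y s - α x s‖ := by
        refine (convex_segment (α x s) (α y s)).norm_image_sub_le_of_norm_hasFDerivWithin_le'
          (f' := fderiv ℝ f) (fun z hz => (hf z (hseg hz)).hasFDerivAt.hasFDerivWithinAt)
          (fun z hz => ?_) (left_mem_segment ..) (right_mem_segment ..)
        refine (hL z (hseg hz) _ hxB).trans ?_
        gcongr
        exact norm_sub_le_of_mem_segment hz
      have h2 : ‖(fderiv ℝ f (α x s)) (α y s - α x s - J s (y - x))‖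
          ≤ K * ‖α y s - α x s - J s (y - x)‖ :=
        (ContinuousLinearMap.le_opNorm _ _).trans (by gcongr; exact hK _ hxB)
      calc ‖f (α y s) - f (α x s) - (fderiv ℝ f (α x s)) (J s (y - x))‖
          = ‖(f (α y s) - f (α x s) - (fderiv ℝ f (α x s)) (α y s - α x s))
            + (fderiv ℝ f (α x s)) (α y s - α x s - J s (y - x))‖ := by
              congr 1
              simp only [map_sub]
              abel
        _ ≤ (L * ‖α y s - α x s‖) * ‖α y s - α x s‖ + K * ‖α y s - α x s - J s (y - x)‖ :=
            (norm_add_le _ _).trans (add_le_add h1 h2)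
        _ ≤ L * (L' * ‖y - x‖) * (L' * ‖y - x‖) + K' * ‖α y s - α x s - J s (y - x)‖ := by
            have := (norm_nonneg _).trans hyL
            gcongr
            linarith
        _ = _ := by ring
  have hO : (fun y => α y t - α x t - J t (y - x)) =O[𝓝 x] fun y => ‖y - x‖ ^ 2 :=
    Asymptotics.IsBigO.of_bound _ (key.mono fun y hy => by simpa using hy)
  rw [hasFDerivAt_iff_isLittleO]
  refine hO.trans_isLittleO ?_
  have h2 : (fun y => ‖y - x‖ ^ 2) =o[𝓝 x] fun y => ‖y - x‖ := by
    have h0 : Tendsto (fun y => ‖y - x‖) (𝓝 x) (𝓝 0) := by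
      have : Continuous fun y => ‖y - x‖ := by fun_prop
      simpa using this.tendsto x
    have := (Asymptotics.isLittleO_pow_id (𝕜 := ℝ) one_lt_two).comp_tendsto h0
    simpa [Function.comp_def] using this
  exact Asymptotics.isLittleO_norm_right.1 h2

variable [CompleteSpace E]

/-- The local flow of a vector field, together with its derivative with respect to the initial
value. -/
theorem exists_localFlow {f : E → E} {x₀ : E} (hf : ContDiffAt ℝ 2 f x₀) {U : Set E}
    (hU : U ∈ 𝓝 x₀) :
    ∃ ε > 0, ∃ (α : E → ℝ → E) (J : E → ℝ → E →L[ℝ] E), ∀ᶠ x in 𝓝 x₀,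
      α x 0 = x ∧ J x 0 = ContinuousLinearMap.id ℝ E ∧ ∀ t ∈ Ioo (-ε) ε, α x t ∈ U ∧
        HasDerivAt (α x) (f (α x t)) t ∧
        HasDerivAt (J x) ((fderiv ℝ f (α x t)).comp (J x t)) t ∧
        HasFDerivAt (fun y => α y t) (J x t) x := by
  have hdf : ContDiffAt ℝ 1 (fderiv ℝ f) x₀ := hf.fderiv_right (by norm_num)
  obtain ⟨L, s, hs, hL⟩ := hdf.exists_lipschitzOnWith
  have hd : ∀ᶠ z in 𝓝 x₀, DifferentiableAt ℝ f z :=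
    (hf.eventually (by simp)).mono fun z hz => hz.differentiableAt (by simp)
  have hK : ∀ᶠ z in 𝓝 x₀, ‖fderiv ℝ f z‖ < ‖fderiv ℝ f x₀‖ + 1 :=
    hdf.continuousAt.norm.eventually_lt_const (by linarith)
  obtain ⟨ρ, hρ, hB⟩ := Metric.eventually_nhds_iff_ball.1 
    ((hd.and hK).and ((eventually_mem_set.2 hs).and (eventually_mem_set.2 hU)))
  set I₀ := ContinuousLinearMap.id ℝ E with hI
  -- The equation and its linearization are solved as one system, with initial value (x, id). Its
  -- right-hand side has one derivative less than `f`, hence the hypothesis that `f` is twice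
  -- differentiable.
  have hF : ContDiffAt ℝ 1 (fun p : E × (E →L[ℝ] E) => (f p.1, (fderiv ℝ f p.1).comp p.2))
      (x₀, I₀) := by
    have h1 : ContDiffAt ℝ 1 (fun p : E × (E →L[ℝ] E) => f p.1) (x₀, I₀) :=
      (hf.of_le (by norm_num)).comp (x₀, I₀) contDiffAt_fst
    have h2 : ContDiffAt ℝ 1 (fun p : E × (E →L[ℝ] E) => fderiv ℝ f p.1) (x₀, I₀) :=
      hdf.comp (x₀, I₀) contDiffAt_fst
    exact h1.prodMk (h2.clm_comp contDiffAt_snd)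
  obtain ⟨ε, hε, a, r, L₁, K₁, hr, hpl⟩ := IsPicardLindelof.of_contDiffAt_one hF
  obtain ⟨A, hA, L', hAL⟩ :=
    (hpl 0).exists_forall_mem_closedBall_eq_hasDerivWithinAt_lipschitzOnWith
  simp only [zero_sub, zero_add] at hA hAL
  have hmem0 : (x₀, I₀) ∈ Metric.closedBall (x₀, I₀) (r : ℝ) :=
    Metric.mem_closedBall_self r.2
  have hcont : ContinuousAt (fun t => (A (x₀, I₀) t).1) 0 :=
    (((hA _ hmem0).2 0 ⟨by linarith, hε.le⟩).hasDerivAt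
      (Icc_mem_nhds (by linarith) hε)).continuousAt.fst
  have hA0 : (A (x₀, I₀) 0).1 = x₀ := by rw [(hA _ hmem0).1]
  obtain ⟨ε₁, hε₁, hnear⟩ := Metric.eventually_nhds_iff.1
    (hcont.eventually (Metric.ball_mem_nhds _ (half_pos hρ)))
  beta_reduce at hnear
  rw [hA0] at hnear
  have hballs : ∀ᶠ x in 𝓝 x₀, (x, I₀) ∈ Metric.closedBall (x₀, I₀) (r : ℝ) ∧
      L' * ‖x - x₀‖ < ρ / 2 := by
    have c1 : ContinuousAt (fun x : E => (x, I₀)) x₀ := by fun_prop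
    have c2 : ContinuousAt (fun x : E => L' * ‖x - x₀‖) x₀ := by fun_prop
    refine (c1.eventually (Metric.closedBall_mem_nhds _ hr)).and
      (c2.eventually_lt_const ?_)
    simpa using half_pos hρ
  -- The initial values (x, id) and (y, id) differ only in the first component, so the Lipschitz
  -- bound of the coupled flow is one in terms of x - y.
  have hlip : ∀ x y : E, (x, I₀) ∈ Metric.closedBall (x₀, I₀) (r : ℝ) →
      (y, I₀) ∈ Metric.closedBall (x₀, I₀) (r : ℝ) → ∀ t ∈ Icc (-ε) ε,
      ‖(A (y, I₀) t).1 - (A (x, I₀) t).1‖ ≤ L' * ‖y - x‖ := by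
    intro x y hx hy t ht
    have h := (hAL t ht).norm_sub_le hy hx
    refine (norm_fst_le (A (y, I₀) t - A (x, I₀) t)).trans (h.trans (le_of_eq ?_))
    simp [Prod.norm_def]
  set ε' := min ε ε₁ with hε'
  have hsub : ∀ t ∈ Ioo (-ε') ε', t ∈ Icc (-ε) ε ∧ t ∈ Ioo (-ε) ε ∧ dist t 0 < ε₁ := by
    intro t ht
    have h1 : t ∈ Ioo (-ε) ε := ⟨by linarith [ht.1, min_le_left ε ε₁],
      ht.2.trans_le (min_le_left _ _)⟩
    refine ⟨Ioo_subset_Icc_self h1, h1, ?_⟩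
    rw [Real.dist_0_eq_abs, abs_lt]
    exact ⟨by linarith [ht.1, min_le_right ε ε₁], ht.2.trans_le (min_le_right _ _)⟩
  have hder : ∀ x, (x, I₀) ∈ Metric.closedBall (x₀, I₀) (r : ℝ) → ∀ t ∈ Ioo (-ε') ε',
      HasDerivAt (fun t => A (x, I₀) t) (f (A (x, I₀) t).1,
        (fderiv ℝ f (A (x, I₀) t).1).comp (A (x, I₀) t).2) t := fun x hx t ht =>
    ((hA _ hx).2 t (hsub t ht).1).hasDerivAt
      (Icc_mem_nhds (hsub t ht).2.1.1 (hsub t ht).2.1.2)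
  refine ⟨ε', lt_min hε hε₁, fun x t => (A (x, I₀) t).1, fun x t => (A (x, I₀) t).2, ?_⟩
  have hgood : ∀ x, ((x, I₀) ∈ Metric.closedBall (x₀, I₀) (r : ℝ) ∧
      L' * ‖x - x₀‖ < ρ / 2) → ∀ t ∈ Ioo (-ε') ε', (A (x, I₀) t).1 ∈ Metric.ball x₀ ρ := by
    intro x hx t ht
    have h1 := hnear (hsub t ht).2.2
    have h2 := hlip x₀ x hmem0 hx.1 t (hsub t ht).1
    rw [Metric.mem_ball]
    rw [← dist_eq_norm] at h2
    linarith [dist_triangle (A (x, I₀) t).1 (A (x₀, I₀) t).1 x₀, hx.2]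
  filter_upwards [hballs.eventually_nhds] with x hxx
  have hx := hxx.self_of_nhds
  refine ⟨by simp [(hA _ hx.1).1], by rw [(hA _ hx.1).1], fun t ht =>
    ⟨(hB _ (hgood x hx t ht)).2.2, (hder x hx.1 t ht).fst, (hder x hx.1 t ht).snd, ?_⟩⟩
  refine hasFDerivAt_of_variational (B := Metric.ball x₀ ρ) (convex_ball _ _) (ε := ε')
    (K := ‖fderiv ℝ f x₀‖ + 1) (L := L) (L' := L') (α := fun x t => (A (x, I₀) t).1) (f := f)
    (fun z hz => (hB z hz).1.1) (fun z hz => (hB z hz).1.2.le)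
    (fun z hz w hw => hL.norm_sub_le (hB z hz).2.1 (hB w hw).2.1) L.2 ?_
    (by rw [(hA _ hx.1).1]) (fun s hs => (hder x hx.1 s hs).snd) ht
  filter_upwards [hxx] with y hy
  exact ⟨by simp [(hA _ hy.1).1], fun s hs => ⟨hgood y hy s hs, (hder y hy.1 s hs).fst,
    hlip x y hx.1 hy.1 s (hsub s hs).1⟩⟩

end LocalFlow

/-! ### Vector fields related by a local diffeomorphism to a normed space -/

section RelatedFields

variable {E : Type*} [NormedAddCommGroup E] [NormedSpace ℝ E]
  {H : Type*} [TopologicalSpace H] {I : ModelWithCorners ℝ E H}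
  {M : Type*} [TopologicalSpace M] [ChartedSpace H M]
  {E' : Type*} [NormedAddCommGroup E'] [NormedSpace ℝ E']
  {H' : Type*} [TopologicalSpace H'] {I' : ModelWithCorners ℝ E' H'}
  {N : Type*} [TopologicalSpace N] [ChartedSpace H' N]
  {F : Type*} [NormedAddCommGroup F] [NormedSpace ℝ F]
  {G : Type*} [NormedAddCommGroup G] [NormedSpace ℝ G]

theorem mvfderiv_comp_mfderiv_apply {g : M → F} {f : N → M} (x : N)
    (hg : MDifferentiableAt I 𝓘(ℝ, F) g (f x)) (hf : MDifferentiableAt I' I f x)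
    (v : TangentSpace I' x) :
    mvfderiv I' (g ∘ f) x v = mvfderiv I g (f x) (mfderiv I' I f x v) :=
  mfderiv_comp_apply x hg hf v

theorem mvfderiv_eq_fderiv_apply {g : F → G} (x : F) (v : F) :
    mvfderiv 𝓘(ℝ, F) g x v = fderiv ℝ g x v := by
  change mfderiv 𝓘(ℝ, F) 𝓘(ℝ, G) g x v = _
  rw [mfderiv_eq_fderiv]
  rfl

theorem mvfderiv_comp_fderiv_apply {g : F → G} {f : M → F} (x : M)
    (hg : DifferentiableAt ℝ g (f x)) (hf : MDifferentiableAt I 𝓘(ℝ, F) f x)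
    (v : TangentSpace I x) :
    mvfderiv I (g ∘ f) x v = fderiv ℝ g (f x) (mvfderiv I f x v) := by
  rw [← mvfderiv_eq_fderiv_apply]
  exact mfderiv_comp_apply x hg.mdifferentiableAt hf v

theorem mvfderiv_congr_of_eventuallyEq {g g' : M → F} {x : M} (h : g =ᶠ[𝓝 x] g') :
    mvfderiv I g x = mvfderiv I g' x := by
  have h1 : mfderiv I 𝓘(ℝ, F) g x = mfderiv I 𝓘(ℝ, F) g' x := h.mfderiv_eq
  have h2 := h.self_of_nhds
  ext v
  exact congrArg (fun L : E →L[ℝ] F => L v) h1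

theorem two_le_infty : (2 : WithTop ℕ∞) ≤ ∞ := ENat.LEInfty.out

theorem mlieBracket_eq_fderiv (A B : ∀ x : F, TangentSpace 𝓘(ℝ, F) x) (x : F) :
    mlieBracket 𝓘(ℝ, F) A B x =
      fderiv ℝ (B : F → F) x (A x) - fderiv ℝ (A : F → F) x (B x) := by
  have h := congrFun (mlieBracketWithin_eq_lieBracketWithin (V := A) (W := B) (s := univ)) x
  rw [mlieBracketWithin_univ] at h
  have key : ∀ C D : F → F, lieBracketWithin ℝ C D univ x =
      fderiv ℝ D x (C x) - fderiv ℝ C x (D x) := fun C D => by rw [lieBracketWithin_univ]; rfl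
  exact h.trans (key A B)

theorem eq_mpullback_of_related {g : M → F} {A : ∀ q : M, TangentSpace I q} {A' : F → F} {q : M}
    (hinv : (mfderiv I 𝓘(ℝ, F) g q).IsInvertible) (h : mvfderiv I g q (A q) = A' (g q)) :
    A q = mpullback I 𝓘(ℝ, F) g A' q :=
  (hinv.inverse_apply_eq.2 h.symm).symm

variable [IsManifold I ∞ M]

theorem contMDiffOn_mvfderiv_apply {g : M → F} {U : Set M} (hU : IsOpen U)
    (hg : ContMDiffOn I 𝓘(ℝ, F) ∞ g U) {X : ∀ q : M, TangentSpace I q}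
    (hX : ContMDiffOn I I.tangent ∞ (fun q => (⟨q, X q⟩ : TangentBundle I M)) U) :
    ContMDiffOn I 𝓘(ℝ, F) ∞ (fun q => mvfderiv I g q (X q)) U := by
  have h1 := hg.contMDiffOn_tangentMapWithin (m := ∞) (by simp) hU.uniqueMDiffOn
  have h2 := (contMDiff_snd_tangentBundle_modelSpace F 𝓘(ℝ, F) (n := ∞)).comp_contMDiffOn
    (h1.comp hX (fun q hq => hq))
  refine h2.congr fun q hq => ?_
  simp only [Function.comp, tangentMapWithin, mfderivWithin_of_isOpen hU hq]
  rfl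

variable [CompleteSpace E]

/-- As `g` has invertible derivative near `p`, relatedness makes `A` and `B` the pullbacks of `A'`
and `B'`, and pullbacks commute with brackets. Since `A'` and `B'` need only be differentiable at
the single point `g p`, brackets can be computed in coordinates centred at the point in question. -/
theorem mvfderiv_mlieBracket_of_related {g : M → F} {p : M} (hg : ContMDiffAt I 𝓘(ℝ, F) ∞ g p)
    (hinv : ∀ᶠ q in 𝓝 p, (mfderiv I 𝓘(ℝ, F) g q).IsInvertible)
    {A B : ∀ q : M, TangentSpace I q} {A' B' : F → F}
    (hA : ∀ᶠ q in 𝓝 p, mvfderiv I g q (A q) = A' (g q))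
    (hB : ∀ᶠ q in 𝓝 p, mvfderiv I g q (B q) = B' (g q))
    (hA' : DifferentiableAt ℝ A' (g p)) (hB' : DifferentiableAt ℝ B' (g p)) :
    mvfderiv I g p (mlieBracket I A B p) =
      fderiv ℝ B' (g p) (A' (g p)) - fderiv ℝ A' (g p) (B' (g p)) := by
  have hAp : A =ᶠ[𝓝 p] mpullback I 𝓘(ℝ, F) g A' := by
    filter_upwards [hinv, hA] with q h1 h2 using eq_mpullback_of_related h1 h2
  have hBp : B =ᶠ[𝓝 p] mpullback I 𝓘(ℝ, F) g B' := by
    filter_upwards [hinv, hB] with q h1 h2 using eq_mpullback_of_related h1 h2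
  rw [hAp.mlieBracket_vectorField_eq hBp]
  have hm : ∀ V : F → F, DifferentiableAt ℝ V (g p) →
      MDifferentiableAt 𝓘(ℝ, F) 𝓘(ℝ, F).tangent
        (fun y => (⟨y, V y⟩ : TangentBundle 𝓘(ℝ, F) F)) (g p) := by
    intro V hV
    rw [mdifferentiableAt_totalSpace]
    refine ⟨mdifferentiableAt_id, ?_⟩
    simpa using hV.mdifferentiableAt
  have : IsManifold I (minSmoothness ℝ 2) M := by
    rw [minSmoothness_of_isRCLikeNormedField]
    exact IsManifold.of_le (n := ∞) two_le_infty
  rw [← mpullback_mlieBracket (n := ∞) (hm A' hA') (hm B' hB') hg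
    (by rw [minSmoothness_of_isRCLikeNormedField]; exact two_le_infty)]
  have h := hinv.self_of_nhds.self_apply_inverse (mlieBracket 𝓘(ℝ, F) A' B' (g p))
  change mfderiv I 𝓘(ℝ, F) g p (mpullback I 𝓘(ℝ, F) g (mlieBracket 𝓘(ℝ, F) A' B') p) = _
  rw [mpullback_apply]
  refine h.trans ?_
  exact mlieBracket_eq_fderiv A' B' (g p)

theorem contMDiffAt_of_related {g : M → F} {p : M} (hg : ContMDiffAt I 𝓘(ℝ, F) ∞ g p)
    (hinv : ∀ᶠ q in 𝓝 p, (mfderiv I 𝓘(ℝ, F) g q).IsInvertible)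
    {A : ∀ q : M, TangentSpace I q} {A' : F → F}
    (hA : ∀ᶠ q in 𝓝 p, mvfderiv I g q (A q) = A' (g q)) (hA' : ContDiffAt ℝ ∞ A' (g p)) :
    ContMDiffAt I I.tangent ∞ (fun q => (⟨q, A q⟩ : TangentBundle I M)) p := by
  have hAp : A =ᶠ[𝓝 p] mpullback I 𝓘(ℝ, F) g A' := by
    filter_upwards [hinv, hA] with q h1 h2 using eq_mpullback_of_related h1 h2
  have h : ContMDiffAt I I.tangent ∞
      (fun q => (⟨q, mpullback I 𝓘(ℝ, F) g A' q⟩ : TangentBundle I M)) p :=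
    ContMDiffAt.mpullback_vectorField_preimage (m := ∞) (n := ∞)
      (contMDiffAt_vectorSpace_iff_contDiffAt.2 hA') hg hinv.self_of_nhds (by simp)
  refine h.congr_of_eventuallyEq ?_
  filter_upwards [hAp] with q hq
  rw [hq]

end RelatedFields

/-! ### Vector fields and integral curves in charts -/

section Flows

variable {E : Type*} [NormedAddCommGroup E] [NormedSpace ℝ E]
  {H : Type*} [TopologicalSpace H] {I : ModelWithCorners ℝ E H}
  {M : Type*} [TopologicalSpace M] [ChartedSpace H M]

/-- The vector field `X` in the chart at `p`. -/
noncomputable def chartField (p : M) (X : ∀ q : M, TangentSpace I q) (y : E) : E :=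
  mvfderiv I (extChartAt I p) ((extChartAt I p).symm y) (X ((extChartAt I p).symm y))

theorem chartField_extChartAt {p q : M} (X : ∀ q : M, TangentSpace I q)
    (hq : q ∈ (extChartAt I p).source) :
    mvfderiv I (extChartAt I p) q (X q) = chartField p X (extChartAt I p q) := by
  rw [chartField, (extChartAt I p).left_inv hq]

variable [IsManifold I ∞ M] [I.Boundaryless]

theorem contDiffAt_chartField {p : M} {X : ∀ q : M, TangentSpace I q}
    (hX : ∀ᶠ q in 𝓝 p, ContMDiffAt I I.tangent ∞ (fun q => (⟨q, X q⟩ : TangentBundle I M)) q) :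
    ContDiffAt ℝ ∞ (chartField p X) (extChartAt I p p) := by
  obtain ⟨U, hXU, hU, hpU⟩ := eventually_nhds_iff.1 hX
  have hV : IsOpen (U ∩ (extChartAt I p).source) := hU.inter (isOpen_extChartAt_source p)
  have h1 := contMDiffOn_mvfderiv_apply (I := I) hV
    ((contMDiffOn_extChartAt (n := ∞) (x := p)).mono fun q hq => by
      simpa [extChartAt_source] using hq.2)
    (fun q hq => (hXU q hq.1).contMDiffWithinAt)
  have h2 := (h1.contMDiffAt (hV.mem_nhds ⟨hpU, mem_extChartAt_source p⟩))
  have h3 : ContMDiffAt 𝓘(ℝ, E) I ∞ (extChartAt I p).symm (extChartAt I p p) :=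
    (contMDiffOn_extChartAt_symm (n := ∞) p).contMDiffAt (extChartAt_target_mem_nhds p)
  have h4 := ContMDiffAt.comp_of_eq h2 h3 (extChartAt_to_inv (I := I) p)
  exact contMDiffAt_iff_contDiffAt.1 h4

/-- A curve is an integral curve when its image in a chart is. -/
theorem hasMFDerivAt_symm_comp {p : M} {X : ∀ q : M, TangentSpace I q} {α : ℝ → E} {t : ℝ}
    (ht : α t ∈ (extChartAt I p).target) (hα : HasDerivAt α (chartField p X (α t)) t) :
    HasMFDerivAt 𝓘(ℝ, ℝ) I (fun s => (extChartAt I p).symm (α s)) t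
      ((1 : ℝ →L[ℝ] ℝ).smulRight (X ((extChartAt I p).symm (α t)))) := by
  set q := (extChartAt I p).symm (α t) with hq
  have hqs : q ∈ (extChartAt I p).source := (extChartAt I p).map_target ht
  have hs : MDifferentiableAt 𝓘(ℝ, E) I (extChartAt I p).symm (α t) :=
    ((contMDiffOn_extChartAt_symm (n := ∞) p).contMDiffAt
      ((isOpen_extChartAt_target p).mem_nhds ht)).mdifferentiableAt (by simp)
  have h1 := hs.hasMFDerivAt.comp t hα.hasFDerivAt.hasMFDerivAt
  refine h1.congr_mfderiv ?_
  ext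
  have h2 := mfderivWithin_extChartAt_symm_comp_mfderiv_extChartAt' (I := I) (x := p) hqs
  rw [I.range_eq_univ, mfderivWithin_univ, hq, (extChartAt I p).right_inv ht] at h2
  have h3 := congrArg (fun L : TangentSpace I q →L[ℝ] TangentSpace I q => L (X q)) h2
  change mfderiv 𝓘(ℝ, E) I (extChartAt I p).symm (α t) ((1:ℝ) • chartField p X (α t)) = (1:ℝ) • X q
  rw [one_smul, one_smul]
  exact h3

end Flows

/-! ### Differentiability of global flows and pullback of vector fields -/

section FlowDerivative

variable {E : Type*} [NormedAddCommGroup E] [NormedSpace ℝ E]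
  {H : Type*} [TopologicalSpace H] {I : ModelWithCorners ℝ E H} [I.Boundaryless]
  {M : Type*} [TopologicalSpace M] [ChartedSpace H M] [IsManifold I ∞ M] [T2Space M]
  {X : ∀ q : M, TangentSpace I q} {φ : ℝ → M → M}

theorem flow_add (hX : ContMDiff I I.tangent ∞ (fun q => (⟨q, X q⟩ : TangentBundle I M)))
    (h0 : ∀ p, φ 0 p = p) (hφ : ∀ p, IsMIntegralCurve (I := I) (fun t => φ t p) X)
    (s t : ℝ) (p : M) : φ (s + t) p = φ s (φ t p) := by
  have h1 := (hφ p).comp_add t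
  have := isMIntegralCurve_Ioo_eq_of_contMDiff_boundaryless (t₀ := 0) (hX.of_le ENat.LEInfty.out)
    h1 (hφ (φ t p)) (by simp [h0])
  exact congrFun this s

/-- The inverse is the derivative of the flow at time `-t`, by the group law and the chain rule. -/
theorem isInvertible_mfderiv_flow
    (hX : ContMDiff I I.tangent ∞ (fun q => (⟨q, X q⟩ : TangentBundle I M))) (hφ : IsFlow I X φ)
    (t : ℝ) (p : M) : (mfderiv I I (φ t) p).IsInvertible := by
  have key : ∀ (s : ℝ) (q : M) , (mfderiv I I (φ (-s)) (φ s q)).comp (mfderiv I I (φ s) q) =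
      ContinuousLinearMap.id ℝ (TangentSpace I q) := by
    intro s q
    have h := mfderiv_comp q (hφ.mdifferentiable (-s) (φ s q)) (hφ.mdifferentiable s q)
    have e : φ (-s) ∘ φ s = id := by
      funext r
      rw [Function.comp, ← flow_add hX hφ.zero hφ.isMIntegralCurve, neg_add_cancel, hφ.zero]
      rfl
    rw [e, mfderiv_id] at h
    exact h.symm
  have h1 := key t p
  have h2 := key (-t) (φ t p)
  have e : φ (-t) (φ t p) = p := by
    rw [← flow_add hX hφ.zero hφ.isMIntegralCurve, neg_add_cancel, hφ.zero]
  rw [neg_neg, e] at h2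
  have h1' := key t p
  rw [e] at h1'
  exact ContinuousLinearMap.IsInvertible.of_inverse h2 h1'

variable [CompleteSpace E]

/-- Near a point, a global flow is the local flow in a chart. -/
theorem exists_flow_eq_localFlow
    (hX : ContMDiff I I.tangent ∞ (fun q => (⟨q, X q⟩ : TangentBundle I M)))
    (h0 : ∀ p, φ 0 p = p) (hφ : ∀ p, IsMIntegralCurve (I := I) (fun t => φ t p) X) (p : M) :
    ∃ ε > 0, ∃ (α : E → ℝ → E) (J : E → ℝ → E →L[ℝ] E), ∀ᶠ q in 𝓝 p,
      q ∈ (extChartAt I p).source ∧ α (extChartAt I p q) 0 = extChartAt I p q ∧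
      J (extChartAt I p q) 0 = ContinuousLinearMap.id ℝ E ∧ ∀ t ∈ Ioo (-ε) ε,
        α (extChartAt I p q) t ∈ (extChartAt I p).target ∧
        φ t q = (extChartAt I p).symm (α (extChartAt I p q) t) ∧
        HasDerivAt (α (extChartAt I p q)) (chartField p X (α (extChartAt I p q) t)) t ∧
        HasDerivAt (J (extChartAt I p q))
          ((fderiv ℝ (chartField p X) (α (extChartAt I p q) t)).comp (J (extChartAt I p q) t)) t ∧
        HasFDerivAt (fun y => α y t) (J (extChartAt I p q) t) (extChartAt I p q) := by
  obtain ⟨ε, hε, α, J, h⟩ := exists_localFlow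
    ((contDiffAt_chartField (p := p) (X := X) (Eventually.of_forall fun q => hX q)).of_le
      two_le_infty) (extChartAt_target_mem_nhds (I := I) p)
  refine ⟨ε, hε, α, J, ?_⟩
  filter_upwards [(continuousAt_extChartAt (I := I) p).eventually h,
    extChartAt_source_mem_nhds (I := I) p] with q hq hqs
  obtain ⟨h1, h2, h3⟩ := hq
  refine ⟨hqs, h1, h2, fun t ht => ⟨(h3 t ht).1, ?_, (h3 t ht).2⟩⟩
  have hc : IsMIntegralCurveOn (fun s => (extChartAt I p).symm (α (extChartAt I p q) s)) X
      (Ioo (-ε) ε) := fun s hs =>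
    (hasMFDerivAt_symm_comp (h3 s hs).1 (h3 s hs).2.1).hasMFDerivWithinAt
  refine isMIntegralCurveOn_Ioo_eqOn_of_contMDiff_boundaryless (t₀ := 0) ⟨by linarith, hε⟩
    (hX.of_le ENat.LEInfty.out) ((hφ q).isMIntegralCurveOn _) hc ?_ ht
  rw [h0, h1, (extChartAt I p).left_inv hqs]

theorem eventually_mdifferentiableAt_flow
    (hX : ContMDiff I I.tangent ∞ (fun q => (⟨q, X q⟩ : TangentBundle I M)))
    (h0 : ∀ p, φ 0 p = p) (hφ : ∀ p, IsMIntegralCurve (I := I) (fun t => φ t p) X) (p : M) :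
    ∃ ε > 0, ∀ᶠ q in 𝓝 p, ∀ t ∈ Ioo (-ε) ε, MDifferentiableAt I I (φ t) q := by
  obtain ⟨ε, hε, α, J, h⟩ := exists_flow_eq_localFlow hX h0 hφ p
  refine ⟨ε, hε, ?_⟩
  filter_upwards [h.eventually_nhds] with q hq t ht
  have hq' := hq.self_of_nhds
  have hs : MDifferentiableAt 𝓘(ℝ, E) I (extChartAt I p).symm (α (extChartAt I p q) t) :=
    ((contMDiffOn_extChartAt_symm (n := ∞) p).contMDiffAt
      ((isOpen_extChartAt_target p).mem_nhds (hq'.2.2.2 t ht).1)).mdifferentiableAt (by simp)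
  have h1 := (hq'.2.2.2 t ht).2.2.2.2.differentiableAt.mdifferentiableAt
  have h2 : MDifferentiableAt I 𝓘(ℝ, E) (extChartAt I p) q :=
    mdifferentiableAt_extChartAt (by simpa [extChartAt_source] using hq'.1)
  refine ((hs.comp (extChartAt I p q) h1).comp q h2).congr_of_eventuallyEq ?_
  filter_upwards [hq] with r hr
  exact (hr.2.2.2 t ht).2.1

/-- The local theory gives differentiability for short times only. The orbit segment up to time `t`
is compact, so one short time δ serves near all of its points, and the map at time `t` is a
composition of n maps at time t / n with |t| / n < δ. -/
theorem mdifferentiable_flow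
    (hX : ContMDiff I I.tangent ∞ (fun q => (⟨q, X q⟩ : TangentBundle I M)))
    (h0 : ∀ p, φ 0 p = p) (hφ : ∀ p, IsMIntegralCurve (I := I) (fun t => φ t p) X) (t : ℝ) :
    MDifferentiable I I (φ t) := by
  intro p
  have hK : IsCompact ((fun s => φ s p) '' Icc (-|t|) |t|) :=
    isCompact_Icc.image (hφ p).continuous
  choose ε hε hdiff using eventually_mdifferentiableAt_flow hX h0 hφ
  obtain ⟨T, -, hT⟩ := hK.elim_nhds_subcover
    (fun q => {r | ∀ t ∈ Ioo (-ε q) (ε q), MDifferentiableAt I I (φ t) r}) (fun q _ => hdiff q)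
  obtain ⟨δ, hδ, hδT⟩ : ∃ δ > 0, ∀ q ∈ T, δ ≤ ε q := by
    rcases T.eq_empty_or_nonempty with h | h
    · exact ⟨1, one_pos, by simp [h]⟩
    · obtain ⟨q, hq, hmin⟩ := T.exists_min_image ε h
      exact ⟨ε q, hε q, hmin⟩
  obtain ⟨n, hn⟩ := exists_nat_gt (|t| / δ)
  have hn0 : (0 : ℝ) < n := (by positivity : 0 ≤ |t| / δ).trans_lt hn
  have hsmall : t / n ∈ Ioo (-δ) δ := by
    refine abs_lt.1 ?_
    rw [abs_div, abs_of_pos hn0, div_lt_iff₀ hn0]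
    rw [div_lt_iff₀ hδ] at hn
    linarith
  have hstep : ∀ k : ℕ, k ≤ n → MDifferentiableAt I I (φ (k * (t / n))) p := by
    intro k
    induction k with
    | zero =>
      intro _
      have : φ ((0 : ℕ) * (t / n)) = id := by
        funext q
        simp [h0]
      rw [this]
      exact mdifferentiableAt_id
    | succ k ih =>
      intro hk
      have hk' : k ≤ n := by omega
      have e : φ ((k + 1 : ℕ) * (t / n)) = φ (t / n) ∘ φ (k * (t / n)) := by
        funext q
        rw [Function.comp, ← flow_add hX h0 hφ]
        congr 1
        push_cast
        ring
      rw [e]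
      refine MDifferentiableAt.comp p ?_ (ih hk')
      have hmem : φ (k * (t / n)) p ∈ (fun s => φ s p) '' Icc (-|t|) |t| := by
        refine ⟨_, ?_, rfl⟩
        rw [mem_Icc, ← abs_le, abs_mul, abs_div, Nat.abs_cast, Nat.abs_cast]
        rw [mul_div_assoc', div_le_iff₀ hn0, mul_comm]
        gcongr
      obtain ⟨q, hq, hr⟩ := mem_iUnion₂.1 (hT hmem)
      exact hr _ ⟨by linarith [hsmall.1, hδT q hq], by linarith [hsmall.2, hδT q hq]⟩
  have := hstep n le_rfl
  rwa [mul_div_cancel₀ _ hn0.ne'] at this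

theorem exists_isFlow (hX : ContMDiff I I.tangent ∞ (fun q => (⟨q, X q⟩ : TangentBundle I M)))
    (hc : ∀ p, ∃ γ : ℝ → M, γ 0 = p ∧ IsMIntegralCurve (I := I) γ X) :
    ∃ φ : ℝ → M → M, IsFlow I X φ := by
  choose γ h0 hγ using hc
  exact ⟨fun t p => γ p t, h0, hγ, mdifferentiable_flow hX h0 hγ⟩

/-- In a chart the pullback is J(s)⁻¹ A(α(s)). The variational equation gives J'(0) = DX, so the
product rule yields DA·X - DX·A, the bracket in coordinates. The functional `L` turns the assertion
into one about a real function. -/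
theorem hasDerivAt_flow_pullback_zero
    (hX : ContMDiff I I.tangent ∞ (fun q => (⟨q, X q⟩ : TangentBundle I M))) (hφ : IsFlow I X φ)
    {A : ∀ q : M, TangentSpace I q}
    (hA : ContMDiff I I.tangent ∞ (fun q => (⟨q, A q⟩ : TangentBundle I M)))
    (p : M) (L : TangentSpace I p →L[ℝ] ℝ) :
    HasDerivAt (fun s => L ((mfderiv I I (φ s) p).inverse (A (φ s p))))
      (L (mlieBracket I X A p)) 0 := by
  obtain ⟨ε, hε, α, J, h⟩ := exists_flow_eq_localFlow hX hφ.zero hφ.isMIntegralCurve p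
  set g := extChartAt I p with hg
  set x := g p with hx
  have hp := h.self_of_nhds
  obtain ⟨hps, ha0, hJ0, hp⟩ := hp
  have hI0 : (0 : ℝ) ∈ Ioo (-ε) ε := ⟨by linarith, hε⟩
  have hsrc : ∀ q ∈ g.source, MDifferentiableAt I 𝓘(ℝ, E) g q := fun q hq =>
    mdifferentiableAt_extChartAt (by simpa [hg, extChartAt_source] using hq)
  have hinv : ∀ q ∈ g.source, (mfderiv I 𝓘(ℝ, E) g q).IsInvertible := fun q hq =>
    isInvertible_mfderiv_extChartAt hq
  have hpush : ∀ s ∈ Ioo (-ε) ε, ∀ w : TangentSpace I p,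
      mvfderiv I g (φ s p) (mfderiv I I (φ s) p w) = J x s (mvfderiv I g p w) := by
    intro s hs w
    have hφs : φ s p ∈ g.source := by
      rw [(hp s hs).2.1]
      exact g.map_target (hp s hs).1
    rw [← mvfderiv_comp_mfderiv_apply p (hsrc _ hφs) (hφ.mdifferentiable s p)]
    have hev : g ∘ φ s =ᶠ[𝓝 p] (fun y => α y s) ∘ g := by
      filter_upwards [h] with q hq
      change g (φ s q) = α (g q) s
      rw [(hq.2.2.2 s hs).2.1, g.right_inv (hq.2.2.2 s hs).1]
    rw [mvfderiv_congr_of_eventuallyEq hev,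
      mvfderiv_comp_fderiv_apply p (hp s hs).2.2.2.2.differentiableAt (hsrc _ hps),
      (hp s hs).2.2.2.2.fderiv]
  let D' : E →L[ℝ] TangentSpace I p := (mfderiv I 𝓘(ℝ, E) g p).inverse
  have hD' : ∀ y : E, mvfderiv I g p (D' y) = y := fun y => (hinv p hps).self_apply_inverse y
  have hJd := (hp 0 hI0).2.2.2.1
  rw [ha0, hJ0, ContinuousLinearMap.comp_id] at hJd
  have had := (hp 0 hI0).2.2.1
  rw [ha0] at had
  -- Invertibility is an open condition and `J x 0` is the identity.
  have hJinv : ∀ᶠ s in 𝓝 (0 : ℝ), (J x s).IsInvertible := by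
    have : ContinuousAt (J x) 0 := hJd.continuousAt
    have hu : J x 0 ∈ {u : E →L[ℝ] E | IsUnit u} := by
      rw [hJ0]
      exact isUnit_one
    filter_upwards [this.preimage_mem_nhds (Units.isOpen.mem_nhds hu)] with s hs
    obtain ⟨u, hu⟩ := hs
    exact ⟨ContinuousLinearEquiv.unitsEquiv ℝ E u, hu⟩
  have hev : (fun s => L ((mfderiv I I (φ s) p).inverse (A (φ s p)))) =ᶠ[𝓝 0]
      fun s => (L.comp D') ((J x s).inverse (chartField p A (α x s))) := by
    filter_upwards [hJinv, Ioo_mem_nhds hI0.1 hI0.2] with s hJs hs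
    change _ = L (D' ((J x s).inverse (chartField p A (α x s))))
    congr 1
    rw [(isInvertible_mfderiv_flow hX hφ s p).inverse_apply_eq]
    have hφs : φ s p ∈ g.source := by
      rw [(hp s hs).2.1]
      exact g.map_target (hp s hs).1
    have h1 := hpush s hs (D' ((J x s).inverse (chartField p A (α x s))))
    rw [hD', hJs.self_apply_inverse] at h1
    have h2 : mvfderiv I g (φ s p) (A (φ s p)) = chartField p A (α x s) := by
      rw [chartField_extChartAt A hφs, (hp s hs).2.1, g.right_inv (hp s hs).1]
    exact (hinv _ hφs).injective (h2.trans h1.symm)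
  refine HasDerivAt.congr_of_eventuallyEq ?_ hev
  have hcX := contDiffAt_chartField (p := p) (X := X) (Eventually.of_forall fun q => hX q)
  have hcA := contDiffAt_chartField (p := p) (X := A) (Eventually.of_forall fun q => hA q)
  have hbr := mvfderiv_mlieBracket_of_related (contMDiffAt_extChartAt (n := ∞) (x := p))
    (by filter_upwards [extChartAt_source_mem_nhds (I := I) p] with q hq using hinv q hq)
    (by filter_upwards [extChartAt_source_mem_nhds (I := I) p] with q hq using
      chartField_extChartAt X hq)
    (by filter_upwards [extChartAt_source_mem_nhds (I := I) p] with q hq using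
      chartField_extChartAt A hq)
    (hcX.differentiableAt (by simp)) (hcA.differentiableAt (by simp))
  -- The derivative of inversion at the identity is minus the identity.
  have hinvd : HasDerivAt (fun s => (J x s).inverse) (-fderiv ℝ (chartField p X) x) 0 := by
    have h1 := hasFDerivAt_ringInverse (𝕜 := ℝ) (1 : (E →L[ℝ] E)ˣ)
    have h2 : HasFDerivAt Ring.inverse (-ContinuousLinearMap.mulLeftRight ℝ (E →L[ℝ] E)
        ((1 : (E →L[ℝ] E)ˣ)⁻¹ : (E →L[ℝ] E)ˣ) ((1 : (E →L[ℝ] E)ˣ)⁻¹ : (E →L[ℝ] E)ˣ)) (J x 0) := by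
      rw [hJ0]
      exact h1
    have h3 := h2.comp_hasDerivAt (0 : ℝ) hJd
    rw [ContinuousLinearMap.ringInverse_eq_inverse] at h3
    convert! h3 using 1
  have hval : HasDerivAt (fun s => chartField p A (α x s))
      (fderiv ℝ (chartField p A) x (chartField p X x)) 0 := by
    have h2 : HasFDerivAt (chartField p A) (fderiv ℝ (chartField p A) x) (α x 0) := by
      rw [ha0]
      exact (hcA.differentiableAt (by simp)).hasFDerivAt
    exact h2.comp_hasDerivAt (0 : ℝ) had
  have hfin := (L.comp D').hasFDerivAt.comp_hasDerivAt (0 : ℝ) (hinvd.clm_apply hval)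
  convert! hfin using 1
  rw [ha0, hJ0, ContinuousLinearMap.inverse_id]
  change _ = L (D' _)
  congr 1
  refine (hinv p hps).injective (hbr.trans ?_)
  refine Eq.trans ?_ (hD' _).symm
  rw [sub_eq_neg_add]
  rfl

/-- The derivative of the pullback of a vector field under a flow is the pullback of the Lie
bracket. -/
theorem hasDerivAt_flow_pullback
    (hX : ContMDiff I I.tangent ∞ (fun q => (⟨q, X q⟩ : TangentBundle I M))) (hφ : IsFlow I X φ)
    {A : ∀ q : M, TangentSpace I q}
    (hA : ContMDiff I I.tangent ∞ (fun q => (⟨q, A q⟩ : TangentBundle I M)))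
    (p : M) (L : TangentSpace I p →L[ℝ] ℝ) (t : ℝ) :
    HasDerivAt (fun s => L ((mfderiv I I (φ s) p).inverse (A (φ s p))))
      (L ((mfderiv I I (φ t) p).inverse (mlieBracket I X A (φ t p)))) t := by
  -- By the group law the derivative at time `t` is the one at time 0 from the base point `φ t p`,
  -- with the functional pulled back by the derivative of the flow.
  have h := hasDerivAt_flow_pullback_zero hX hφ hA (φ t p)
    (L.comp (mfderiv I I (φ t) p).inverse)
  have h' : HasDerivAt (fun s => (L.comp (mfderiv I I (φ t) p).inverse)
      ((mfderiv I I (φ s) (φ t p)).inverse (A (φ s (φ t p)))))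
      ((L.comp (mfderiv I I (φ t) p).inverse) (mlieBracket I X A (φ t p))) (t - t) := by
    rwa [sub_self]
  have h2 := HasDerivAt.scomp (h := fun s => s - t) t h' ((hasDerivAt_id t).sub_const t)
  simp only [one_smul] at h2
  refine h2.congr_of_eventuallyEq (Eventually.of_forall fun s => ?_)
  have hadd := flow_add hX hφ.zero hφ.isMIntegralCurve (s - t) t
  have e : φ s = φ (s - t) ∘ φ t := by
    funext q
    rw [Function.comp, ← hadd, sub_add_cancel]
  change L _ = L ((mfderiv I I (φ t) p).inverse
    ((mfderiv I I (φ (s - t)) (φ t p)).inverse (A (φ (s - t) (φ t p)))))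
  congr 1
  have hc : mfderiv I I (φ s) p =
      (mfderiv I I (φ (s - t)) (φ t p)).comp (mfderiv I I (φ t) p) := by
    rw [← mfderiv_comp p (hφ.mdifferentiable _ _) (hφ.mdifferentiable _ _), ← e]
  have hq : φ s p = φ (s - t) (φ t p) := congrFun e p
  rw [(isInvertible_mfderiv_flow hX hφ s p).inverse_apply_eq, hc]
  have i1 := isInvertible_mfderiv_flow hX hφ t p
  have i2 := isInvertible_mfderiv_flow hX hφ (s - t) (φ t p)
  change A (φ s p) = mfderiv I I (φ (s - t)) (φ t p) (mfderiv I I (φ t) p _)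
  rw [i1.self_apply_inverse, i2.self_apply_inverse, hq]

/-- The flow transports `∑ aᵢ(0) Aᵢ` to `∑ aᵢ(t) Aᵢ` if the coefficients solve the linear equation
given by the brackets of the `Aᵢ` with the vector field. -/
theorem mfderiv_flow_sum {ι : Type*} [Fintype ι]
    (hX : ContMDiff I I.tangent ∞ (fun q => (⟨q, X q⟩ : TangentBundle I M))) (hφ : IsFlow I X φ)
    {A : ι → ∀ q : M, TangentSpace I q}
    (hA : ∀ i, ContMDiff I I.tangent ∞ (fun q => (⟨q, A i q⟩ : TangentBundle I M)))
    (p : M) {a a' : ι → ℝ → ℝ} (ha : ∀ i t, HasDerivAt (a i) (a' i t) t)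
    (hode : ∀ t, ∑ i, (a' i t • A i (φ t p) + a i t • mlieBracket I X (A i) (φ t p)) = 0) (t : ℝ) :
    mfderiv I I (φ t) p (∑ i, a i 0 • A i p) = ∑ i, a i t • A i (φ t p) := by
  -- Pulled back to `p`, the combination ∑ aᵢ(t) Aᵢ has derivative zero by the hypothesis `hode`,
  -- hence is constant. Linear functionals separate points, so it suffices to test against each `L`.
  have hder : ∀ (L : TangentSpace I p →L[ℝ] ℝ) (t : ℝ),
      HasDerivAt (fun s => L ((mfderiv I I (φ s) p).inverse (∑ i, a i s • A i (φ s p)))) 0 t := by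
    intro L t
    have h1 := HasDerivAt.fun_sum (u := Finset.univ) fun i _ =>
      (ha i t).mul (hasDerivAt_flow_pullback hX hφ (hA i) p L t)
    have h2 : ∑ i, (a' i t * L ((mfderiv I I (φ t) p).inverse (A i (φ t p))) +
        a i t * L ((mfderiv I I (φ t) p).inverse (mlieBracket I X (A i) (φ t p)))) = 0 := by
      have := congrArg (fun v => L ((mfderiv I I (φ t) p).inverse v)) (hode t)
      simpa [map_sum, map_add, map_smul] using this
    rw [h2] at h1
    refine h1.congr_of_eventuallyEq (Eventually.of_forall fun s => ?_)
    simp [map_sum, map_smul]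
  have hconst : ∀ (L : TangentSpace I p →L[ℝ] ℝ),
      L ((mfderiv I I (φ t) p).inverse (∑ i, a i t • A i (φ t p))) =
      L (∑ i, a i 0 • A i p) := by
    intro L
    have := is_const_of_deriv_eq_zero (fun s => (hder L s).differentiableAt)
      (fun s => (hder L s).deriv) t 0
    rw [this]
    have e : φ 0 = id := funext hφ.zero
    congr 1
    rw [(isInvertible_mfderiv_flow hX hφ 0 p).inverse_apply_eq, e, mfderiv_id]
    rfl
  have hsep : ∀ v w : E, (∀ L : E →L[ℝ] ℝ, L v = L w) → v = w := fun v w h => by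
    by_contra hne
    obtain ⟨L, hL⟩ := SeparatingDual.exists_separating_of_ne (R := ℝ) hne
    exact hL (h L)
  have h1 : (mfderiv I I (φ t) p).inverse (∑ i, a i t • A i (φ t p)) = ∑ i, a i 0 • A i p :=
    hsep _ _ hconst
  rw [← h1, (isInvertible_mfderiv_flow hX hφ t p).self_apply_inverse]

end FlowDerivative

/-! ### Distributions spanned by part of a global frame -/

section FrameDistributions

variable {E : Type*} [NormedAddCommGroup E] [NormedSpace ℝ E] [FiniteDimensional ℝ E]
  {H : Type*} [TopologicalSpace H] {I : ModelWithCorners ℝ E H} [I.Boundaryless]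
  {M : Type*} [TopologicalSpace M] [ChartedSpace H M] [IsManifold I ∞ M]
  {ι : Type*} {F : ι → ∀ p : M, TangentSpace I p}

theorem contMDiffAt_frame (hF : IsLocalFrameOn I E ∞ F univ) (i : ι) (p : M) :
    ContMDiffAt I I.tangent ∞ (fun q => (⟨q, F i q⟩ : TangentBundle I M)) p :=
  hF.contMDiffAt isOpen_univ (mem_univ p) i

theorem mdifferentiableAt_frame (hF : IsLocalFrameOn I E ∞ F univ) (i : ι) (p : M) :
    MDifferentiableAt I I.tangent (fun q => (⟨q, F i q⟩ : TangentBundle I M)) p :=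
  (contMDiffAt_frame hF i p).mdifferentiableAt (by simp)

theorem coeff_frame [DecidableEq ι] (hF : IsLocalFrameOn I E ∞ F univ) (p : M) (i j : ι) :
    hF.coeff i p (F j p) = if i = j then 1 else 0 := by
  rw [hF.coeff_apply_of_mem (mem_univ p), ← hF.toBasisAt_coe (mem_univ p) j, Module.Basis.repr_self,
    Finsupp.single_apply]
  simp [eq_comm]

theorem sum_coeff_frame [Fintype ι] (hF : IsLocalFrameOn I E ∞ F univ) {p : M}
    (ξ : TangentSpace I p) : ∑ i, hF.coeff i p ξ • F i p = ξ := by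
  classical
  have := hF.coeff_sum_eq (fun q => if h : q = p then h ▸ ξ else 0) (mem_univ p)
  simpa using this.symm

/-- The coefficients of a smooth vector field with respect to a smooth frame are smooth. -/
theorem contMDiffAt_coeff [Fintype ι] (hF : IsLocalFrameOn I E ∞ F univ) {p : M}
    {A : ∀ q : M, TangentSpace I q}
    (hA : ∀ᶠ q in 𝓝 p, ContMDiffAt I I.tangent ∞ (fun q => (⟨q, A q⟩ : TangentBundle I M)) q)
    (i : ι) : ContMDiffAt I 𝓘(ℝ) ∞ (fun q => hF.coeff i q (A q)) p := by
  obtain ⟨U, hAU, hU, hpU⟩ := eventually_nhds_iff.1 hA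
  set g := extChartAt I p with hg
  have hV : IsOpen (U ∩ g.source) := hU.inter (isOpen_extChartAt_source p)
  have hpV : U ∩ g.source ∈ 𝓝 p := hV.mem_nhds ⟨hpU, mem_extChartAt_source p⟩
  have hgV : ContMDiffOn I 𝓘(ℝ, E) ∞ g (U ∩ g.source) :=
    (contMDiffOn_extChartAt (n := ∞) (x := p)).mono fun q hq => by
      simpa [hg, extChartAt_source] using hq.2
  have hA1 : ContMDiffAt I 𝓘(ℝ, E) ∞ (fun q => mvfderiv I g q (A q)) p :=
    (contMDiffOn_mvfderiv_apply hV hgV fun q hq => (hAU q hq.1).contMDiffWithinAt).contMDiffAt hpV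
  have hF1 : ContMDiffAt I 𝓘(ℝ, ι → E) ∞ (fun q j => mvfderiv I g q (F j q)) p :=
    contMDiffAt_pi_space.2 fun j => (contMDiffOn_mvfderiv_apply hV hgV
      fun q hq => (contMDiffAt_frame hF j q).contMDiffWithinAt).contMDiffAt hpV
  -- `C v` is the map c ↦ ∑ cⱼ vⱼ. For the frame read in the chart it is invertible, and the
  -- coefficients of a vector are its image under the inverse; smoothness follows since inversion of
  -- operators is smooth.
  let C : (ι → E) →L[ℝ] ((ι → ℝ) →L[ℝ] E) := ∑ j,
    (ContinuousLinearMap.smulRightL ℝ (ι → ℝ) E (ContinuousLinearMap.proj j)).comp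
      (ContinuousLinearMap.proj j)
  have hC : ∀ (v : ι → E) (c : ι → ℝ), C v c = ∑ j, c j • v j := by
    intro v c
    simp [C, ContinuousLinearMap.sum_apply]
  have hinv : ∀ q ∈ g.source, (C fun j => mvfderiv I g q (F j q)).IsInvertible := by
    intro q hq
    obtain ⟨e, he⟩ := isInvertible_mfderiv_extChartAt (I := I) (x := p) hq
    let e' : (ι → ℝ) ≃ₗ[ℝ] E :=
      (hF.toBasisAt (mem_univ q)).equivFun.symm.trans e.toLinearEquiv
    refine ⟨e'.toContinuousLinearEquiv, ?_⟩
    ext1 c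
    rw [hC]
    change e ((hF.toBasisAt (mem_univ q)).equivFun.symm c) = _
    rw [Module.Basis.equivFun_symm_apply, map_sum]
    refine Finset.sum_congr rfl fun j _ => ?_
    rw [map_smul, hF.toBasisAt_coe]
    congr 1
    exact congrArg (fun L : TangentSpace I q →L[ℝ] E => L (F j q)) he
  have hps : p ∈ g.source := mem_extChartAt_source p
  have h1 : ContMDiffAt I 𝓘(ℝ, E →L[ℝ] (ι → ℝ)) ∞
      (fun q => (C fun j => mvfderiv I g q (F j q)).inverse) p := by
    have h2 : ContMDiffAt I 𝓘(ℝ, (ι → ℝ) →L[ℝ] E) ∞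
        (fun q => C fun j => mvfderiv I g q (F j q)) p :=
      C.contDiff.contDiffAt.contMDiffAt.comp p hF1
    obtain ⟨e, he⟩ := hinv p hps
    have h3 := contDiffAt_map_inverse (𝕜 := ℝ) (n := ∞) e
    rw [he] at h3
    exact h3.contMDiffAt.comp p h2
  have h4 := contMDiffAt_pi_space.1 (h1.clm_apply hA1) i
  refine h4.congr_of_eventuallyEq ?_
  filter_upwards [(isOpen_extChartAt_source (I := I) p).mem_nhds hps] with q hq
  have h5 : (C fun j => mvfderiv I g q (F j q)).inverse (mvfderiv I g q (A q)) =
      fun j => hF.coeff j q (A q) := by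
    rw [(hinv q hq).inverse_apply_eq, hC]
    conv_lhs => rw [← sum_coeff_frame hF (A q)]
    simp
  rw [h5]

theorem mlieBracket_sum_left (hF : IsLocalFrameOn I E ∞ F univ) (s : Finset ι) {p : M}
    {a : ι → M → ℝ} (ha : ∀ i, MDifferentiableAt I 𝓘(ℝ) (a i) p)
    (B : ∀ q : M, TangentSpace I q) :
    mlieBracket I (fun q => ∑ i ∈ s, a i q • F i q) B p =
      ∑ i ∈ s, (- mvfderiv I (a i) p (B p) • F i p + a i p • mlieBracket I (F i) B p) := by
  classical
  induction s using Finset.induction_on with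
  | empty =>
    simp only [Finset.sum_empty]
    exact congrFun (mlieBracket_zero_left (I := I) (W := B)) p
  | insert i s hi ih =>
    have hm : ∀ j, MDifferentiableAt I I.tangent
        (fun q => (⟨q, (a j • F j) q⟩ : TangentBundle I M)) p := fun j =>
      (ha j).smul_section (mdifferentiableAt_frame hF j p)
    have hsum : MDifferentiableAt I I.tangent
        (fun q => (⟨q, ∑ j ∈ s, a j q • F j q⟩ : TangentBundle I M)) p :=
      MDifferentiableAt.sum_section fun j _ => hm j
    have e : (fun q => ∑ j ∈ insert i s, a j q • F j q) =
        (a i • F i) + fun q => ∑ j ∈ s, a j q • F j q := by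
      funext q
      simp [Finset.sum_insert hi]
    rw [e, mlieBracket_add_left (hm i) hsum, ih, Finset.sum_insert hi,
      mlieBracket_smul_left (ha i) (mdifferentiableAt_frame hF i p)]

/-- The Leibniz rule produces derivatives of the coefficients only as multiples of the frame vectors
themselves, and these lie in `Q`. -/
theorem mlieBracket_sub_sum_mem (hF : IsLocalFrameOn I E ∞ F univ) (s : Finset ι) {p : M}
    {a : ι → M → ℝ} (ha : ∀ i, MDifferentiableAt I 𝓘(ℝ) (a i) p)
    {A B : ∀ q : M, TangentSpace I q} (hA : ∀ᶠ q in 𝓝 p, A q = ∑ i ∈ s, a i q • F i q)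
    {Q : Submodule ℝ (TangentSpace I p)} (hQ : ∀ i ∈ s, F i p ∈ Q) :
    mlieBracket I A B p - ∑ i ∈ s, a i p • mlieBracket I (F i) B p ∈ Q := by
  rw [Filter.EventuallyEq.mlieBracket_vectorField_eq hA (EventuallyEq.refl _ B),
    mlieBracket_sum_left hF s ha, ← Finset.sum_sub_distrib]
  refine Q.sum_mem fun i hi => ?_
  rw [add_sub_cancel_right]
  exact Q.smul_mem _ (hQ i hi)

/-- The bracket of two combinations of frame fields, modulo these frame fields. -/
theorem mlieBracket_sub_sum_sum_mem (hF : IsLocalFrameOn I E ∞ F univ) (s : Finset ι) {p : M}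
    {a b : ι → M → ℝ} (ha : ∀ i, MDifferentiableAt I 𝓘(ℝ) (a i) p)
    (hb : ∀ i, MDifferentiableAt I 𝓘(ℝ) (b i) p)
    {A B : ∀ q : M, TangentSpace I q} (hA : ∀ᶠ q in 𝓝 p, A q = ∑ i ∈ s, a i q • F i q)
    (hB : ∀ᶠ q in 𝓝 p, B q = ∑ i ∈ s, b i q • F i q)
    {Q : Submodule ℝ (TangentSpace I p)} (hQ : ∀ i ∈ s, F i p ∈ Q) :
    mlieBracket I A B p -
      ∑ i ∈ s, ∑ j ∈ s, (a i p * b j p) • mlieBracket I (F i) (F j) p ∈ Q := by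
  have h1 := mlieBracket_sub_sum_mem hF s ha (B := B) hA hQ
  have h2 : ∀ i, mlieBracket I (F i) B p - ∑ j ∈ s, b j p • mlieBracket I (F i) (F j) p ∈ Q := by
    intro i
    have := Q.neg_mem (mlieBracket_sub_sum_mem hF s hb (B := F i) hB hQ)
    rw [mlieBracket_swap_apply]
    simp_rw [mlieBracket_swap_apply (V := F i)]
    simpa [sub_eq_add_neg, add_comm] using this
  have h3 := Q.add_mem h1 (Q.sum_mem (t := s) fun i _ => Q.smul_mem (a i p) (h2 i))
  convert h3 using 1
  simp only [smul_sub, Finset.smul_sum, smul_smul, Finset.sum_sub_distrib]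
  abel

/-- The distribution spanned by a part of a frame. -/
noncomputable def frameSpan (F : ι → ∀ p : M, TangentSpace I p) (s : Finset ι) (p : M) :
    Submodule ℝ (TangentSpace I p) :=
  Submodule.span ℝ ((fun i => F i p) '' s)

theorem frame_mem_frameSpan {s : Finset ι} {i : ι} (hi : i ∈ s) (p : M) :
    F i p ∈ frameSpan F s p :=
  Submodule.subset_span ⟨i, hi, rfl⟩

theorem mem_frameSpan_iff [Fintype ι] (hF : IsLocalFrameOn I E ∞ F univ) {s : Finset ι} {p : M}
    {ξ : TangentSpace I p} : ξ ∈ frameSpan F s p ↔ ∀ i ∉ s, hF.coeff i p ξ = 0 := by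
  classical
  constructor
  · intro h i hi
    have : frameSpan F s p ≤ LinearMap.ker (hF.coeff i p) := by
      rw [frameSpan, Submodule.span_le]
      rintro _ ⟨j, hj, rfl⟩
      rw [SetLike.mem_coe, LinearMap.mem_ker, coeff_frame, if_neg]
      rintro rfl
      exact hi hj
    exact this h
  · intro h
    rw [← sum_coeff_frame hF ξ]
    refine Submodule.sum_mem _ fun i _ => ?_
    by_cases hi : i ∈ s
    · exact Submodule.smul_mem _ _ (frame_mem_frameSpan hi p)
    · rw [h i hi, zero_smul]
      exact Submodule.zero_mem _

theorem eq_sum_of_mem_frameSpan [Fintype ι] (hF : IsLocalFrameOn I E ∞ F univ) {s : Finset ι}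
    {p : M} {ξ : TangentSpace I p} (h : ξ ∈ frameSpan F s p) :
    ξ = ∑ i ∈ s, hF.coeff i p ξ • F i p := by
  conv_lhs => rw [← sum_coeff_frame hF ξ]
  refine (Finset.sum_subset (Finset.subset_univ s) fun i _ hi => ?_).symm
  rw [(mem_frameSpan_iff hF).1 h i hi, zero_smul]

theorem isLocalSection_const_combination [Fintype ι] (hF : IsLocalFrameOn I E ∞ F univ)
    (s : Finset ι) (c : ι → ℝ) (p : M) :
    IsLocalSection I (frameSpan F s) p (fun q => ∑ i ∈ s, c i • F i q) :=
  Eventually.of_forall fun q => ⟨Submodule.sum_mem _ fun _ hi =>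
    Submodule.smul_mem _ _ (frame_mem_frameSpan hi q),
    ContMDiffAt.sum_section fun i _ => contMDiffAt_const.smul_section (contMDiffAt_frame hF i q)⟩

theorem isLocalSection_frame [Fintype ι] (hF : IsLocalFrameOn I E ∞ F univ) {s : Finset ι} {i : ι}
    (hi : i ∈ s) (p : M) : IsLocalSection I (frameSpan F s) p (F i) :=
  Eventually.of_forall fun q => ⟨frame_mem_frameSpan hi q, contMDiffAt_frame hF i q⟩

theorem isSmoothDistribution_frameSpan [Fintype ι] (hF : IsLocalFrameOn I E ∞ F univ)
    (s : Finset ι) : IsSmoothDistribution I (frameSpan F s) s.card := by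
  refine fun p => ⟨?_, fun w hw => ⟨_, isLocalSection_const_combination hF s
    (fun i => hF.coeff i p w) p, (eq_sum_of_mem_frameSpan hF hw).symm⟩⟩
  have hli : LinearIndependent ℝ fun i : s => F i p :=
    (hF.linearIndependent (mem_univ p)).comp _ Subtype.val_injective
  have := finrank_span_eq_card hli
  rw [Fintype.card_coe] at this
  rw [← this, frameSpan, image_eq_range]
  rfl

/-- Reduces a definition quantified over all local sections to finitely many brackets: modulo the
frame vectors, the bracket of two sections is a combination of brackets of frame fields. The
hypothesis `hQ` says that `Q` is the smallest subspace containing the vectors and their brackets. -/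
theorem derivedDistribution_frameSpan [Fintype ι] (hF : IsLocalFrameOn I E ∞ F univ)
    (s : Finset ι) {p : M} {Q : Submodule ℝ (TangentSpace I p)} (hsQ : frameSpan F s p ≤ Q)
    (hbQ : ∀ i ∈ s, ∀ j ∈ s, mlieBracket I (F i) (F j) p ∈ Q)
    (hQ : ∀ R : Submodule ℝ (TangentSpace I p), frameSpan F s p ≤ R →
      (∀ i ∈ s, ∀ j ∈ s, mlieBracket I (F i) (F j) p ∈ R) → Q ≤ R) :
    derivedDistribution I (frameSpan F s) p = Q := by
  refine le_antisymm (sup_le hsQ (Submodule.span_le.2 ?_)) (hQ _ le_sup_left fun i hi j hj => ?_)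
  · rintro w ⟨A, B, hA, hB, rfl⟩
    have h := mlieBracket_sub_sum_sum_mem hF s (p := p) (A := A) (B := B)
      (a := fun i q => hF.coeff i q (A q)) (b := fun i q => hF.coeff i q (B q))
      (fun i => (contMDiffAt_coeff hF (hA.mono fun q h => h.2) i).mdifferentiableAt (by simp))
      (fun i => (contMDiffAt_coeff hF (hB.mono fun q h => h.2) i).mdifferentiableAt (by simp))
      (hA.mono fun q h => eq_sum_of_mem_frameSpan hF h.1)
      (hB.mono fun q h => eq_sum_of_mem_frameSpan hF h.1)
      (Q := Q) (fun i hi => hsQ (frame_mem_frameSpan hi p))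
    have h2 := Q.add_mem h (Q.sum_mem (t := s) fun i hi => Q.sum_mem (t := s) fun j hj =>
      Q.smul_mem (hF.coeff i p (A p) * hF.coeff j p (B p)) (hbQ i hi j hj))
    rwa [sub_add_cancel] at h2
  · exact Submodule.mem_sup_right (Submodule.subset_span
      ⟨F i, F j, isLocalSection_frame hF hi p, isLocalSection_frame hF hj p, rfl⟩)

end FrameDistributions

/-! ### Engel structure and characteristic line of a magnetic frame -/

section EngelFrames

variable {E : Type*} [NormedAddCommGroup E] [NormedSpace ℝ E] [FiniteDimensional ℝ E]
  {H : Type*} [TopologicalSpace H] {I : ModelWithCorners ℝ E H} [I.Boundaryless]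
  {M : Type*} [TopologicalSpace M] [ChartedSpace H M] [IsManifold I ∞ M]

variable (I) in
/-- A global frame `T, W, Y, X` with the bracket relations of the prolongation of a magnetic
extension. -/
structure IsMagneticFrame (F : Fin 4 → ∀ p : M, TangentSpace I p) (κ : ℝ) : Prop where
  isLocalFrameOn : IsLocalFrameOn I E ∞ F univ
  bracket_zero_one : ∀ p, mlieBracket I (F 0) (F 1) p = F 2 p
  bracket_zero_two : ∀ p, mlieBracket I (F 0) (F 2) p = -F 3 p
  bracket_one_two : ∀ p, mlieBracket I (F 1) (F 2) p = κ • F 1 p + (κ * (κ + 1)) • F 0 p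

namespace IsMagneticFrame

variable {F : Fin 4 → ∀ p : M, TangentSpace I p} {κ : ℝ}

theorem coeff_apply (hF : IsMagneticFrame I F κ) (p : M) (i j : Fin 4) :
    hF.isLocalFrameOn.coeff i p (F j p) = if i = j then 1 else 0 :=
  coeff_frame hF.isLocalFrameOn p i j

theorem expand (hF : IsMagneticFrame I F κ) {p : M} {u : TangentSpace I p}
    (hu : u ∈ frameSpan F {0, 1, 2} p) :
    u = hF.isLocalFrameOn.coeff 0 p u • F 0 p + hF.isLocalFrameOn.coeff 1 p u • F 1 p +
      hF.isLocalFrameOn.coeff 2 p u • F 2 p := by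
  have h := eq_sum_of_mem_frameSpan hF.isLocalFrameOn hu
  rw [Finset.sum_insert (by decide), Finset.sum_insert (by decide), Finset.sum_singleton,
    ← add_assoc] at h
  exact h

theorem mem_three_iff (hF : IsMagneticFrame I F κ) {p : M} {u : TangentSpace I p} :
    u ∈ frameSpan F {0, 1, 2} p ↔ hF.isLocalFrameOn.coeff 3 p u = 0 := by
  rw [mem_frameSpan_iff hF.isLocalFrameOn]
  constructor
  · exact fun h => h 3 (by decide)
  · intro h i hi
    fin_cases i <;> simp_all

theorem mem_two_iff (hF : IsMagneticFrame I F κ) {p : M} {u : TangentSpace I p}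
    (hu : u ∈ frameSpan F {0, 1, 2} p) :
    u ∈ frameSpan F {0, 1} p ↔ hF.isLocalFrameOn.coeff 2 p u = 0 := by
  have h3 := hF.mem_three_iff.1 hu
  rw [mem_frameSpan_iff hF.isLocalFrameOn]
  constructor
  · exact fun h => h 2 (by decide)
  · intro h i hi
    fin_cases i <;> simp_all

theorem two_le_three (p : M) : frameSpan F {0, 1} p ≤ frameSpan F {0, 1, 2} p := by
  refine Submodule.span_mono (image_mono ?_)
  intro i hi
  simp only [Finset.coe_insert, Finset.coe_singleton, mem_insert_iff, mem_singleton_iff] at hi ⊢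
  tauto

theorem mem_span_one_iff (hF : IsMagneticFrame I F κ) {p : M} {u : TangentSpace I p}
    (hu : u ∈ frameSpan F {0, 1, 2} p) :
    u ∈ Submodule.span ℝ {F 1 p} ↔
      hF.isLocalFrameOn.coeff 0 p u = 0 ∧ hF.isLocalFrameOn.coeff 2 p u = 0 := by
  constructor
  · intro h
    obtain ⟨c, rfl⟩ := Submodule.mem_span_singleton.1 h
    simp [hF.coeff_apply]
  · rintro ⟨h0, h2⟩
    refine Submodule.mem_span_singleton.2 ⟨hF.isLocalFrameOn.coeff 1 p u, ?_⟩
    conv_rhs => rw [hF.expand hu, h0, h2]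
    simp

theorem mem_three_combination (hF : IsMagneticFrame I F κ) (p : M) (a b c : ℝ) :
    a • F 0 p + b • F 1 p + c • F 2 p ∈ frameSpan F {0, 1, 2} p := by
  rw [hF.mem_three_iff]
  simp [hF.coeff_apply]

theorem derivedDistribution_two (hF : IsMagneticFrame I F κ) :
    derivedDistribution I (frameSpan F {0, 1}) = frameSpan F {0, 1, 2} := by
  funext p
  have h01 : mlieBracket I (F 0) (F 1) p = F 2 p := hF.bracket_zero_one p
  have h10 : mlieBracket I (F 1) (F 0) p = -F 2 p := by rw [mlieBracket_swap_apply, h01]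
  have h2 : F 2 p ∈ frameSpan F {0, 1, 2} p := frame_mem_frameSpan (by decide) p
  refine derivedDistribution_frameSpan hF.isLocalFrameOn _ (two_le_three p) ?_ ?_
  · intro i hi j hj
    simp only [Finset.mem_insert, Finset.mem_singleton] at hi hj
    rcases hi with rfl | rfl <;> rcases hj with rfl | rfl
    · rw [mlieBracket_self]
      exact Submodule.zero_mem _
    · rwa [h01]
    · rw [h10]
      exact Submodule.neg_mem _ h2
    · rw [mlieBracket_self]
      exact Submodule.zero_mem _
  · intro R hR hb
    rw [frameSpan, Submodule.span_le]
    rintro _ ⟨i, hi, rfl⟩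
    have h2R : F 2 p ∈ R := h01 ▸ hb 0 (by decide) 1 (by decide)
    simp only [Finset.coe_insert, Finset.coe_singleton, mem_insert_iff, mem_singleton_iff] at hi
    rcases hi with rfl | rfl | rfl
    · exact hR (frame_mem_frameSpan (by decide) p)
    · exact hR (frame_mem_frameSpan (by decide) p)
    · exact h2R

/-- The only direction missing from the span of `F 0`, `F 1`, `F 2` is `F 3`, which is minus the
bracket of `F 0` and `F 2`. -/
theorem derivedDistribution_three (hF : IsMagneticFrame I F κ) (p : M) :
    derivedDistribution I (frameSpan F {0, 1, 2}) p = ⊤ := by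
  refine derivedDistribution_frameSpan hF.isLocalFrameOn _ le_top (fun _ _ _ _ => trivial) ?_
  intro R hR hb ξ _
  rw [← sum_coeff_frame hF.isLocalFrameOn ξ]
  refine R.sum_mem fun i _ => R.smul_mem _ ?_
  by_cases hi : i = 3
  · subst hi
    have h := R.neg_mem (hb 0 (by decide) 2 (by decide))
    rwa [hF.bracket_zero_two, neg_neg] at h
  · refine hR (frame_mem_frameSpan ?_ p)
    fin_cases i <;> simp_all

/-- The transversal component of the bracket of two sections of the even contact structure. -/
theorem coeff_three_bracket (hF : IsMagneticFrame I F κ) {p : M}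
    {A B : ∀ q : M, TangentSpace I q} (hA : IsLocalSection I (frameSpan F {0, 1, 2}) p A)
    (hB : IsLocalSection I (frameSpan F {0, 1, 2}) p B) :
    hF.isLocalFrameOn.coeff 3 p (mlieBracket I A B p) =
      hF.isLocalFrameOn.coeff 2 p (A p) * hF.isLocalFrameOn.coeff 0 p (B p) -
      hF.isLocalFrameOn.coeff 0 p (A p) * hF.isLocalFrameOn.coeff 2 p (B p) := by
  have hl := hF.isLocalFrameOn
  have h := mlieBracket_sub_sum_sum_mem hl {0, 1, 2} (p := p) (A := A) (B := B)
      (a := fun i q => hl.coeff i q (A q)) (b := fun i q => hl.coeff i q (B q))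
      (fun i => (contMDiffAt_coeff hl (hA.mono fun q h => h.2) i).mdifferentiableAt (by simp))
      (fun i => (contMDiffAt_coeff hl (hB.mono fun q h => h.2) i).mdifferentiableAt (by simp))
      (hA.mono fun q h => eq_sum_of_mem_frameSpan hl h.1)
      (hB.mono fun q h => eq_sum_of_mem_frameSpan hl h.1)
      (Q := frameSpan F {0, 1, 2} p) (fun i hi => frame_mem_frameSpan hi p)
  have h01 : mlieBracket I (F 0) (F 1) p = F 2 p := hF.bracket_zero_one p
  have h10 : mlieBracket I (F 1) (F 0) p = -F 2 p := by rw [mlieBracket_swap_apply, h01]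
  have h20 : mlieBracket I (F 2) (F 0) p = F 3 p := by
    rw [mlieBracket_swap_apply, hF.bracket_zero_two, neg_neg]
  have h21 : mlieBracket I (F 2) (F 1) p = -(κ • F 1 p + (κ * (κ + 1)) • F 0 p) := by
    rw [mlieBracket_swap_apply, hF.bracket_one_two]
  rw [hF.mem_three_iff, map_sub, sub_eq_zero] at h
  rw [h]
  have s3 : ∀ g : Fin 4 → TangentSpace I p, ∑ i ∈ {0, 1, 2}, g i = g 0 + (g 1 + g 2) := by
    intro g
    rw [Finset.sum_insert (by decide), Finset.sum_insert (by decide), Finset.sum_singleton]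
  simp only [s3, h01, h10, h20, h21, hF.bracket_zero_two, hF.bracket_one_two, mlieBracket_self,
    map_add, map_smul, map_neg, hF.coeff_apply]
  simp
  ring

/-- By `coeff_three_bracket` the obstruction to a bracket staying in the distribution is the
determinant of the coefficients along `F 0` and `F 2`. It is nondegenerate in these coefficients and
ignores the one along `F 1`, so its kernel is the line of `F 1`. -/
theorem cauchyCharacteristic_three (hF : IsMagneticFrame I F κ) (p : M) :
    cauchyCharacteristic I (frameSpan F {0, 1, 2}) p = Submodule.span ℝ {F 1 p} := by
  have hl := hF.isLocalFrameOn
  refine le_antisymm (Submodule.span_le.2 ?_) (Submodule.span_mono ?_)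
  · rintro w ⟨hw, h⟩
    have hA := isLocalSection_const_combination hl {0, 1, 2} (fun i => hl.coeff i p w) p
    have hAp := (eq_sum_of_mem_frameSpan hl hw).symm
    -- Testing with `F 2` and `F 0` isolates the two coefficients which have to vanish.
    have key : ∀ i, i ∈ ({0, 1, 2} : Finset (Fin 4)) →
        hl.coeff 2 p w * hl.coeff 0 p (F i p) - hl.coeff 0 p w * hl.coeff 2 p (F i p) = 0 := by
      intro i hi
      have hB := isLocalSection_frame hl hi p
      have h1 := h _ _ hA hB hAp
      rw [hF.mem_three_iff, hF.coeff_three_bracket hA hB] at h1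
      simp only [hAp] at h1
      exact h1
    refine (hF.mem_span_one_iff hw).2 ⟨?_, ?_⟩
    · simpa [hF.coeff_apply] using key 2 (by decide)
    · simpa [hF.coeff_apply] using key 0 (by decide)
  · rintro _ rfl
    refine ⟨frame_mem_frameSpan (by decide) p, fun A B hA hB hAp => ?_⟩
    rw [hF.mem_three_iff, hF.coeff_three_bracket hA hB, hAp]
    simp [hF.coeff_apply]

theorem isEngel (hF : IsMagneticFrame I F κ) [Nonempty M] : IsEngel I (frameSpan F {0, 1}) := by
  refine ⟨?_, isSmoothDistribution_frameSpan hF.isLocalFrameOn _, ?_, fun p => ?_⟩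
  · obtain ⟨p⟩ := ‹Nonempty M›
    have := Module.finrank_eq_card_basis (hF.isLocalFrameOn.toBasisAt (mem_univ p))
    exact this.trans (Fintype.card_fin 4)
  · rw [hF.derivedDistribution_two]
    exact isSmoothDistribution_frameSpan hF.isLocalFrameOn _
  · rw [hF.derivedDistribution_two]
    exact hF.derivedDistribution_three p

end IsMagneticFrame

end EngelFrames

/-! ### Linear holonomy of the characteristic foliation -/

section CharacteristicFlow

variable {E : Type*} [NormedAddCommGroup E] [NormedSpace ℝ E] [FiniteDimensional ℝ E]
  {H : Type*} [TopologicalSpace H] {I : ModelWithCorners ℝ E H} [I.Boundaryless]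
  {M : Type*} [TopologicalSpace M] [ChartedSpace H M] [IsManifold I ∞ M]
  {F : Fin 4 → ∀ p : M, TangentSpace I p} {κ : ℝ}

theorem IsMagneticFrame.contMDiff (hF : IsMagneticFrame I F κ) (i : Fin 4) :
    ContMDiff I I.tangent ∞ (fun q => (⟨q, F i q⟩ : TangentBundle I M)) :=
  fun p => contMDiffAt_frame hF.isLocalFrameOn i p

variable {X : ∀ q : M, TangentSpace I q} {h : M → ℝ}

/-- The derivative of `h` enters only along `F 1`. This is why, modulo the characteristic line,
replacing `F 1` by `h • F 1` only changes the speed. -/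
theorem IsMagneticFrame.bracket_multiple_zero (hF : IsMagneticFrame I F κ)
    (hh : ContMDiff I 𝓘(ℝ) ∞ h) (hX : ∀ p, X p = h p • F 1 p) (p : M) :
    mlieBracket I X (F 0) p = -mvfderiv I h p (F 0 p) • F 1 p - h p • F 2 p := by
  have e : X = h • F 1 := funext hX
  rw [e, mlieBracket_smul_left ((hh p).mdifferentiableAt (by simp))
    (mdifferentiableAt_frame hF.isLocalFrameOn 1 p), mlieBracket_swap_apply,
    hF.bracket_zero_one, smul_neg, sub_eq_add_neg]

theorem IsMagneticFrame.bracket_multiple_two (hF : IsMagneticFrame I F κ)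
    (hh : ContMDiff I 𝓘(ℝ) ∞ h) (hX : ∀ p, X p = h p • F 1 p) (p : M) :
    mlieBracket I X (F 2) p = -mvfderiv I h p (F 2 p) • F 1 p +
      h p • (κ • F 1 p + (κ * (κ + 1)) • F 0 p) := by
  have e : X = h • F 1 := funext hX
  rw [e, mlieBracket_smul_left ((hh p).mdifferentiableAt (by simp))
    (mdifferentiableAt_frame hF.isLocalFrameOn 1 p), hF.bracket_one_two]

variable [T2Space M] {φ : ℝ → M → M}

/-- The linear holonomy of the characteristic foliation in the frame `T, Y`, for the flow of an
arbitrary generator `h • W`. -/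
theorem IsMagneticFrame.exists_flow_apply (hF : IsMagneticFrame I F κ)
    (hh : ContMDiff I 𝓘(ℝ) ∞ h) (h0 : ∀ p, h p ≠ 0) (hX : ∀ p, X p = h p • F 1 p)
    (hφ : IsFlow I X φ) {cs sn : ℝ → ℝ} (hcs : ∀ t, HasDerivAt cs (-(κ * (κ + 1)) * sn t) t)
    (hsn : ∀ t, HasDerivAt sn (cs t) t) (cs0 : cs 0 = 1) (sn0 : sn 0 = 0) (p : M) :
    ∃ τ : ℝ → ℝ, τ 0 = 0 ∧ (∀ t, HasDerivAt τ (h (φ t p)) t) ∧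
      ∀ x y w t : ℝ, ∃ w' : ℝ, mfderiv I I (φ t) p (x • F 0 p + w • F 1 p + y • F 2 p) =
        (x * cs (τ t) - κ * (κ + 1) * (y * sn (τ t))) • F 0 (φ t p) + w' • F 1 (φ t p) +
          (x * sn (τ t) + y * cs (τ t)) • F 2 (φ t p) := by
  have hXs : ContMDiff I I.tangent ∞ (fun q => (⟨q, X q⟩ : TangentBundle I M)) := by
    have e : X = h • F 1 := funext hX
    rw [e]
    exact fun q => (hh q).smul_section (hF.contMDiff 1 q)
  have hc : Continuous fun t => φ t p := (hφ.isMIntegralCurve p).continuous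
  have hhc : Continuous fun t => h (φ t p) := hh.continuous.comp hc
  have hder : ∀ i, Continuous fun t => mvfderiv I h (φ t p) (F i (φ t p)) := fun i =>
    ((contMDiffOn_univ.1 (contMDiffOn_mvfderiv_apply isOpen_univ hh.contMDiffOn
      (hF.contMDiff i).contMDiffOn)).continuous).comp hc
  -- The time change is the parameter along the orbit measured by `F 1` instead of by `X`.
  refine ⟨fun t => ∫ s in (0 : ℝ)..t, h (φ s p), by simp,
    fun t => intervalIntegral.integral_hasDerivAt_right (hhc.intervalIntegrable _ _)
      hhc.aestronglyMeasurable.stronglyMeasurableAtFilter hhc.continuousAt, ?_⟩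
  intro x y w t
  set τ : ℝ → ℝ := fun t => ∫ s in (0 : ℝ)..t, h (φ s p) with hτ
  have hτ' : ∀ t, HasDerivAt τ (h (φ t p)) t := fun t =>
    intervalIntegral.integral_hasDerivAt_right (hhc.intervalIntegrable _ _)
      hhc.aestronglyMeasurable.stronglyMeasurableAtFilter hhc.continuousAt
  have hτ0 : τ 0 = 0 := by simp [hτ]
  have hτc : Continuous τ := continuous_iff_continuousAt.2 fun t => (hτ' t).continuousAt
  have hcsc : Continuous cs := continuous_iff_continuousAt.2 fun t => (hcs t).continuousAt
  have hsnc : Continuous sn := continuous_iff_continuousAt.2 fun t => (hsn t).continuousAt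
  let a₀ : ℝ → ℝ := fun t => x * cs (τ t) - κ * (κ + 1) * (y * sn (τ t))
  let a₁ : ℝ → ℝ := fun t => x * sn (τ t) + y * cs (τ t)
  -- The derivative of the third coefficient which cancels the components along `F 1` of the
  -- brackets with `F 0` and `F 2`. The third field is `X` rather than `F 1`, since its bracket with
  -- `X` vanishes; hence the division by `h`, here and in the initial value of `a₂`.
  let g : ℝ → ℝ := fun t => (a₀ t * mvfderiv I h (φ t p) (F 0 (φ t p)) +
    a₁ t * mvfderiv I h (φ t p) (F 2 (φ t p))) / h (φ t p) - κ * a₁ t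
  have hgc : Continuous g := by
    have := hder 0
    have := hder 2
    refine (Continuous.div (by fun_prop) hhc fun t => h0 _).sub (by fun_prop)
  let a₂ : ℝ → ℝ := fun t => w / h p + ∫ s in (0 : ℝ)..t, g s
  have ha₀ : ∀ t, HasDerivAt a₀ (-(κ * (κ + 1)) * h (φ t p) * a₁ t) t := by
    intro t
    have h1 := (((hcs (τ t)).comp t (hτ' t)).const_mul x).sub
      ((((hsn (τ t)).comp t (hτ' t)).const_mul y).const_mul (κ * (κ + 1)))
    refine h1.congr_deriv ?_
    simp only [a₁]
    ring
  have ha₁ : ∀ t, HasDerivAt a₁ (h (φ t p) * a₀ t) t := by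
    intro t
    have h1 := (((hsn (τ t)).comp t (hτ' t)).const_mul x).add
      (((hcs (τ t)).comp t (hτ' t)).const_mul y)
    refine h1.congr_deriv ?_
    simp only [a₀]
    ring
  have ha₂ : ∀ t, HasDerivAt a₂ (g t) t := fun t =>
    (intervalIntegral.integral_hasDerivAt_right (hgc.intervalIntegrable _ _)
      hgc.aestronglyMeasurable.stronglyMeasurableAtFilter hgc.continuousAt).const_add _
  have key := mfderiv_flow_sum hXs hφ (A := ![F 0, F 2, X])
    (by
      intro i
      fin_cases i
      · exact hF.contMDiff 0
      · exact hF.contMDiff 2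
      · exact hXs) p (a := ![a₀, a₁, a₂])
    (a' := ![fun t => -(κ * (κ + 1)) * h (φ t p) * a₁ t, fun t => h (φ t p) * a₀ t, g])
    (by
      intro i
      fin_cases i
      · exact ha₀
      · exact ha₁
      · exact ha₂)
    (by
      intro t
      simp only [Fin.sum_univ_three, Matrix.cons_val_zero, Matrix.cons_val_one, Matrix.cons_val]
      rw [hF.bracket_multiple_zero hh hX, hF.bracket_multiple_two hh hX, mlieBracket_self, hX, Pi.zero_apply]
      have := h0 (φ t p)
      simp only [g]
      match_scalars
      · ring
      · field_simp
        ring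
      · ring) t
  refine ⟨a₂ t * h (φ t p), ?_⟩
  simp only [Fin.sum_univ_three, Matrix.cons_val_zero, Matrix.cons_val_one, Matrix.cons_val] at key
  have e1 : x • F 0 p + w • F 1 p + y • F 2 p = a₀ 0 • F 0 p + a₁ 0 • F 2 p + a₂ 0 • X p := by
    have := h0 p
    simp only [a₀, a₁, a₂, hτ0, cs0, sn0, hX, intervalIntegral.integral_same]
    match_scalars <;> field_simp <;> simp
  rw [e1, key, hX]
  match_scalars <;> simp [a₀, a₁]

end CharacteristicFlow

/-! ### Mutual exclusion of the types -/

section Types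

variable {E : Type*} [NormedAddCommGroup E] [NormedSpace ℝ E] [FiniteDimensional ℝ E]
  {H : Type*} [TopologicalSpace H] {I : ModelWithCorners ℝ E H}
  {M : Type*} [TopologicalSpace M] [ChartedSpace H M] [IsManifold I ∞ M]

namespace QuotientMetric

variable {D W : ∀ p : M, Submodule ℝ (TangentSpace I p)} (b : QuotientMetric I D W)

theorem form_self_nonneg {p : M} {u : TangentSpace I p} (hu : u ∈ D p) : 0 ≤ b.form p u u := by
  by_cases h : u ∈ W p
  · exact (b.kernel p u h u hu).ge
  · exact (b.pos p u hu h).le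

theorem two_mul_form_le {p : M} {u v : TangentSpace I p} (hu : u ∈ D p) (hv : v ∈ D p) :
    2 * b.form p u v ≤ b.form p u u + b.form p v v := by
  have h := b.form_self_nonneg (sub_mem hu hv)
  simp only [map_sub, LinearMap.sub_apply] at h
  linarith [b.symm p u hu v hv]

theorem neg_two_mul_form_le {p : M} {u v : TangentSpace I p} (hu : u ∈ D p) (hv : v ∈ D p) :
    -(2 * b.form p u v) ≤ b.form p u u + b.form p v v := by
  have h := b.form_self_nonneg (add_mem hu hv)
  simp only [map_add, LinearMap.add_apply] at h
  linarith [b.symm p u hu v hv]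

end QuotientMetric

variable {D W P : ∀ p : M, Submodule ℝ (TangentSpace I p)} {b : QuotientMetric I D W}
  {φ : ℝ → M → M}

/-- Bounded distortion makes the image of `ℓ₂` at most a constant times as long as that of `ℓ₁`, so
the parabolic quotient is bounded by the inequality between inner product and squares and cannot
grow linearly. -/
theorem not_isGenuineParabolic_of_isElliptic [Nonempty M]
    (hm : ∀ t p, ∀ u ∈ D p, mfderiv I I (φ t) p u ∈ D (φ t p)) (hE : IsElliptic b φ) :
    ¬ IsGenuineParabolic P b φ := by
  rintro ⟨ℓ₁, ℓ₂, h1, h2, hon, ⟨c, hc, T₀, hT, hb⟩, -⟩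
  obtain ⟨C, hC⟩ := hE
  obtain ⟨p⟩ := ‹Nonempty M›
  -- At this time the lower bound c t is at least 1 + |C|, whereas the quotient is at most (1 + |C|)
  -- / 2.
  set t : ℝ := max T₀ ((1 + |C|) / c) with ht
  have h := (hb p t (le_max_left _ _)).1
  have hct : 1 + |C| ≤ c * t := by
    have := le_max_right T₀ ((1 + |C|) / c)
    rw [div_le_iff₀ hc] at this
    linarith
  have e := hC t p _ (h2.2 p) _ (h1.2 p) ((hon p).2.1.trans (hon p).1.symm)
  have n1 := b.form_self_nonneg (hm t p _ (h1.2 p))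
  have h12 := b.two_mul_form_le (hm t p _ (h1.2 p)) (hm t p _ (h2.2 p))
  have hle : b.form (φ t p) (mfderiv I I (φ t) p (ℓ₁ p)) (mfderiv I I (φ t) p (ℓ₂ p)) /
      b.form (φ t p) (mfderiv I I (φ t) p (ℓ₁ p)) (mfderiv I I (φ t) p (ℓ₁ p)) ≤
      (1 + |C|) / 2 := by
    refine div_le_of_le_mul₀ n1 (by positivity) ?_
    have := mul_le_mul_of_nonneg_right (le_abs_self C) n1
    linarith
  linarith [abs_nonneg C]

theorem exists_mem_quotientLine {L : ∀ p : M, Submodule ℝ (TangentSpace I p)}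
    (hL : IsQuotientLine D W L) (p : M) : ∃ u ∈ L p, u ∈ D p ∧ u ∉ W p := by
  obtain ⟨A, hA⟩ := hL p
  obtain ⟨-, h1, h2, h3⟩ := hA.self_of_nhds
  refine ⟨A p, ?_, h1, h2⟩
  rw [h3]
  exact Submodule.mem_sup_right (Submodule.mem_span_singleton_self _)

/-- Exponential growth beats quadratic growth. The quadratic factor serves the shear of the
parabolic case; in the elliptic case it is harmless. -/
theorem exists_lt_mul_exp (A c c' T₀ : ℝ) (hc : 0 < c) (hc' : 0 < c') :
    ∃ t, T₀ ≤ t ∧ 0 ≤ t ∧ A * (1 + t) ^ 2 < c' * Real.exp (c * t) := by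
  have h : Tendsto (fun t : ℝ => (1 + t) ^ 2 / Real.exp (c * t)) atTop (𝓝 0) := by
    have h2 := ((Real.tendsto_pow_mul_exp_neg_atTop_nhds_zero 2).comp
      (tendsto_id.const_mul_atTop hc)).const_mul (c⁻¹ ^ 2)
    have h1 := ((Real.tendsto_pow_mul_exp_neg_atTop_nhds_zero 1).comp
      (tendsto_id.const_mul_atTop hc)).const_mul (2 * c⁻¹)
    have h0 := ((Real.tendsto_pow_mul_exp_neg_atTop_nhds_zero 0).comp
      (tendsto_id.const_mul_atTop hc))
    have h3 := (h2.add h1).add h0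
    simp only [mul_zero, add_zero] at h3
    refine h3.congr fun t => ?_
    simp only [Function.comp, id, Real.exp_neg]
    field_simp
    ring
  have h' := h.const_mul A
  rw [mul_zero] at h'
  obtain ⟨t, ht, h1, h2⟩ := ((h'.eventually_lt_const hc').and
    ((eventually_ge_atTop T₀).and (eventually_ge_atTop 0))).exists
  refine ⟨t, h1, h2, ?_⟩
  rw [← mul_div_assoc, div_lt_iff₀ (Real.exp_pos _)] at ht
  exact ht

theorem not_isGenuineHyperbolic_of_isElliptic [Nonempty M] (hE : IsElliptic b φ)
    (hm : ∀ t p, ∀ u ∈ D p, mfderiv I I (φ t) p u ∈ D (φ t p)) :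
    ¬ IsGenuineHyperbolic P b φ := by
  rintro ⟨Lu, Ls, hu, hs, -, -, -, ⟨c, hc, c', hc', T₀, hT, hb⟩, -⟩
  obtain ⟨C, hC⟩ := hE
  obtain ⟨p⟩ := ‹Nonempty M›
  obtain ⟨u, hu1, hu2, hu3⟩ := exists_mem_quotientLine hu p
  obtain ⟨s, hs1, hs2, hs3⟩ := exists_mem_quotientLine hs p
  have pu := b.pos p u hu2 hu3
  have ps := b.pos p s hs2 hs3
  -- The stable vector is rescaled to the length of the unstable one, since ellipticity compares
  -- vectors of equal length.
  set r := √(b.form p u u / b.form p s s) with hr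
  have hr0 : r ≠ 0 := (Real.sqrt_pos.2 (div_pos pu ps)).ne'
  have hrs : b.form p (r • s) (r • s) = b.form p u u := by
    simp only [map_smul, LinearMap.smul_apply, smul_eq_mul]
    rw [← mul_assoc, hr, Real.mul_self_sqrt (div_pos pu ps).le]
    field_simp
  obtain ⟨t, ht1, ht0, ht2⟩ := exists_lt_mul_exp (√|C|) c c' T₀ hc hc'
  have h := hb p t ht1 u hu1 (r • s) (Submodule.smul_mem _ _ hs1)
    (fun h => hs3 ((Submodule.smul_mem_iff _ hr0).1 h))
  rw [hrs, div_self (Real.sqrt_pos.2 pu).ne', mul_one] at h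
  have e := hC t p u hu2 (r • s) (Submodule.smul_mem _ _ hs2) hrs.symm
  have n1 := b.form_self_nonneg (hm t p _ (Submodule.smul_mem _ r hs2))
  have h2 : √(b.form (φ t p) (mfderiv I I (φ t) p u) (mfderiv I I (φ t) p u)) /
      √(b.form (φ t p) (mfderiv I I (φ t) p (r • s)) (mfderiv I I (φ t) p (r • s))) ≤ √|C| := by
    refine div_le_of_le_mul₀ (Real.sqrt_nonneg _) (Real.sqrt_nonneg _) ?_
    rw [← Real.sqrt_mul (abs_nonneg C)]
    exact Real.sqrt_le_sqrt (e.trans (mul_le_mul_of_nonneg_right (le_abs_self C) n1))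
  have h3 : √|C| * 1 ≤ √|C| * (1 + t) ^ 2 :=
    mul_le_mul_of_nonneg_left (by nlinarith) (Real.sqrt_nonneg _)
  linarith

/-- If lengths change by at most a factor of linear growth, both up and down, then the quotient of
two lengths changes by at most a quadratic factor, which is less than the exponential demanded by
hyperbolicity. -/
theorem not_isGenuineHyperbolic_of_le [Nonempty M] {A : ℝ} (hA : 0 < A)
    (h : ∀ t, 0 ≤ t → ∀ p, ∀ u ∈ D p,
      b.form (φ t p) (mfderiv I I (φ t) p u) (mfderiv I I (φ t) p u) ≤
          A * (1 + t) ^ 2 * b.form p u u ∧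
        b.form p u u ≤ A * (1 + t) ^ 2 *
          b.form (φ t p) (mfderiv I I (φ t) p u) (mfderiv I I (φ t) p u)) :
    ¬ IsGenuineHyperbolic P b φ := by
  rintro ⟨Lu, Ls, hu, hs, -, -, -, ⟨c, hc, c', hc', T₀, hT, hb⟩, -⟩
  obtain ⟨p⟩ := ‹Nonempty M›
  obtain ⟨u, hu1, hu2, hu3⟩ := exists_mem_quotientLine hu p
  obtain ⟨s, hs1, hs2, hs3⟩ := exists_mem_quotientLine hs p
  have pu := b.pos p u hu2 hu3
  have ps := b.pos p s hs2 hs3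
  obtain ⟨t, ht1, ht0, ht2⟩ := exists_lt_mul_exp A c c' T₀ hc hc'
  have h1 := hb p t ht1 u hu1 s hs1 hs3
  have hB : 0 < A * (1 + t) ^ 2 := by positivity
  have e1 := (h t ht0 p u hu2).1
  have e2 := (h t ht0 p s hs2).2
  set B := A * (1 + t) ^ 2
  set bu := b.form (φ t p) (mfderiv I I (φ t) p u) (mfderiv I I (φ t) p u)
  set bs := b.form (φ t p) (mfderiv I I (φ t) p s) (mfderiv I I (φ t) p s)
  have hbs : 0 < bs := by
    by_contra hn
    nlinarith
  have h2 : √bu / √bs ≤ B * (√(b.form p u u) / √(b.form p s s)) := by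
    rw [← mul_div_assoc, div_le_div_iff₀ (Real.sqrt_pos.2 hbs) (Real.sqrt_pos.2 ps)]
    have i1 := Real.sqrt_le_sqrt e1
    have i2 := Real.sqrt_le_sqrt e2
    rw [Real.sqrt_mul hB.le] at i1 i2
    calc √bu * √(b.form p s s) ≤ (√B * √(b.form p u u)) * (√B * √bs) :=
          mul_le_mul i1 i2 (Real.sqrt_nonneg _) (by positivity)
      _ = (√B * √B) * √(b.form p u u) * √bs := by ring
      _ = _ := by rw [Real.mul_self_sqrt hB.le]
  have hpos : 0 < √(b.form p u u) / √(b.form p s s) :=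
    div_pos (Real.sqrt_pos.2 pu) (Real.sqrt_pos.2 ps)
  exact absurd (le_of_mul_le_mul_right (h1.trans h2) hpos) (not_le.2 ht2)

theorem isContinuousSection_combination {F G : ∀ p : M, TangentSpace I p} {f g : M → ℝ}
    (hF : Continuous fun p => (⟨p, F p⟩ : TangentBundle I M))
    (hG : Continuous fun p => (⟨p, G p⟩ : TangentBundle I M))
    (hf : Continuous f) (hg : Continuous g) :
    Continuous fun p => (⟨p, f p • F p + g p • G p⟩ : TangentBundle I M) := by
  refine (contMDiff_zero_iff (I := I) (I' := I.tangent)).1 fun p => ?_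
  exact ContMDiffAt.add_section
    (((contMDiff_zero_iff (I := I) (I' := 𝓘(ℝ))).2 hf p).smul_section
      ((contMDiff_zero_iff (I := I) (I' := I.tangent)).2 hF p))
    (((contMDiff_zero_iff (I := I) (I' := 𝓘(ℝ))).2 hg p).smul_section
      ((contMDiff_zero_iff (I := I) (I' := I.tangent)).2 hG p))

end Types

/-! ### Generators as time changes of the linear flow -/

section TypesOfMagneticFrames

variable {E : Type*} [NormedAddCommGroup E] [NormedSpace ℝ E] [FiniteDimensional ℝ E]
  {H : Type*} [TopologicalSpace H] {I : ModelWithCorners ℝ E H} [I.Boundaryless]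
  {M : Type*} [TopologicalSpace M] [ChartedSpace H M] [IsManifold I ∞ M]
  {F : Fin 4 → ∀ p : M, TangentSpace I p} {κ : ℝ}

/-- The linear holonomy of a flow along the characteristic foliation is the linear flow with
coefficients `cs`, `sn`, up to a change of time `τ` whose speed is bounded and bounded away from
zero, and whose direction is given by the sign `σ`. -/
structure IsReparametrizedFlow (hF : IsMagneticFrame I F κ) (φ : ℝ → M → M) (cs sn : ℝ → ℝ)
    (C : ℝ) (σ : M → ℝ) (τ : M → ℝ → ℝ) : Prop where
  continuous_sign : Continuous σ
  sign_sq : ∀ p, σ p = 1 ∨ σ p = -1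
  sign_flow : ∀ t p, σ (φ t p) = σ p
  bounds : ∀ p t, 0 ≤ t → (C⁻¹ * t ≤ σ p * τ p t ∧ σ p * τ p t ≤ C * t) ∧
    (C⁻¹ * t ≤ -(σ p * τ p (-t)) ∧ -(σ p * τ p (-t)) ≤ C * t)
  mem : ∀ t p, ∀ u ∈ frameSpan F {0, 1, 2} p,
    mfderiv I I (φ t) p u ∈ frameSpan F {0, 1, 2} (φ t p)
  coeff_zero : ∀ t p, ∀ u ∈ frameSpan F {0, 1, 2} p,
    hF.isLocalFrameOn.coeff 0 (φ t p) (mfderiv I I (φ t) p u) =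
      hF.isLocalFrameOn.coeff 0 p u * cs (τ p t) -
        κ * (κ + 1) * (hF.isLocalFrameOn.coeff 2 p u * sn (τ p t))
  coeff_two : ∀ t p, ∀ u ∈ frameSpan F {0, 1, 2} p,
    hF.isLocalFrameOn.coeff 2 (φ t p) (mfderiv I I (φ t) p u) =
      hF.isLocalFrameOn.coeff 0 p u * sn (τ p t) + hF.isLocalFrameOn.coeff 2 p u * cs (τ p t)

/-- The product of τ with the sign of `h` has derivative |h| along an orbit, so the mean value
inequality gives linear bounds in both directions of time. The sign is kept as a function σ because
`M` is not assumed connected here. -/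
theorem exists_isReparametrizedFlow [T2Space M] {X : ∀ q : M, TangentSpace I q} {h : M → ℝ}
    {φ : ℝ → M → M} (hF : IsMagneticFrame I F κ)
    (hh : ContMDiff I 𝓘(ℝ) ∞ h) (h0 : ∀ p, h p ≠ 0) (hX : ∀ p, X p = h p • F 1 p)
    (hφ : IsFlow I X φ) {cs sn : ℝ → ℝ} (hcs : ∀ t, HasDerivAt cs (-(κ * (κ + 1)) * sn t) t)
    (hsn : ∀ t, HasDerivAt sn (cs t) t) (cs0 : cs 0 = 1) (sn0 : sn 0 = 0) {C : ℝ}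
    (hC : ∀ p, C⁻¹ ≤ |h p| ∧ |h p| ≤ C) :
    ∃ σ τ, IsReparametrizedFlow hF φ cs sn C σ τ := by
  choose τ hτ0 hτ hflow using hF.exists_flow_apply hh h0 hX hφ hcs hsn cs0 sn0
  have hσ : ∀ p, h p / |h p| = 1 ∨ h p / |h p| = -1 := by
    intro p
    rcases lt_or_gt_of_ne (h0 p) with hp | hp
    · right
      rw [abs_of_neg hp, div_neg, div_self (h0 p)]
    · left
      rw [abs_of_pos hp, div_self (h0 p)]
  have hσc : Continuous fun p => h p / |h p| :=
    hh.continuous.div hh.continuous.abs fun p => abs_ne_zero.2 (h0 p)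
  -- A continuous function with values ±1 is constant along an orbit, as the real line is connected.
  have hσφ : ∀ t p, h (φ t p) / |h (φ t p)| = h p / |h p| := by
    intro t p
    have hc : Continuous fun s => h (φ s p) / |h (φ s p)| :=
      hσc.comp (hφ.isMIntegralCurve p).continuous
    have hz := hφ.zero p
    rcases isPreconnected_univ.eq_one_or_eq_neg_one_of_sq_eq hc.continuousOn (fun s _ => by
      rcases hσ (φ s p) with e | e <;> simp [e]) with e | e
    · have e1 := e (mem_univ t)
      have e2 := e (mem_univ 0)
      simp only [hz, Pi.one_apply] at e1 e2
      rw [e1, e2]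
    · have e1 := e (mem_univ t)
      have e2 := e (mem_univ 0)
      simp only [hz, Pi.neg_apply, Pi.one_apply] at e1 e2
      rw [e1, e2]
  refine ⟨fun p => h p / |h p|, τ, hσc, hσ, hσφ, ?_, ?_, ?_, ?_⟩
  · intro p t ht
    have hd : ∀ s, HasDerivAt (fun s => h p / |h p| * τ p s) |h (φ s p)| s := by
      intro s
      refine ((hτ p s).const_mul _).congr_deriv ?_
      rw [← hσφ s p]
      have := h0 (φ s p)
      rw [div_mul_eq_mul_div, div_eq_iff (abs_ne_zero.2 this), abs_mul_abs_self]
    have hdf : Differentiable ℝ fun s => h p / |h p| * τ p s :=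
      fun s => (hd s).differentiableAt
    have lo : ∀ x y, x ≤ y → C⁻¹ * (y - x) ≤ h p / |h p| * τ p y - h p / |h p| * τ p x :=
      fun x y hxy => mul_sub_le_image_sub_of_le_deriv hdf
        (fun s => by rw [(hd s).deriv]; exact (hC _).1) hxy
    have hi : ∀ x y, x ≤ y → h p / |h p| * τ p y - h p / |h p| * τ p x ≤ C * (y - x) :=
      fun x y hxy => image_sub_le_mul_sub_of_deriv_le hdf
        (fun s => by rw [(hd s).deriv]; exact (hC _).2) hxy
    have l1 := lo 0 t ht
    have l2 := hi 0 t ht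
    have l3 := lo (-t) 0 (by linarith)
    have l4 := hi (-t) 0 (by linarith)
    simp only [hτ0, mul_zero, sub_zero, zero_sub, neg_neg] at l1 l2 l3 l4
    exact ⟨⟨l1, l2⟩, l3, l4⟩
  · intro t p u hu
    obtain ⟨w, hw⟩ := hflow p (hF.isLocalFrameOn.coeff 0 p u) (hF.isLocalFrameOn.coeff 2 p u)
      (hF.isLocalFrameOn.coeff 1 p u) t
    rw [← hF.expand hu] at hw
    rw [hw]
    exact hF.mem_three_combination _ _ _ _
  · intro t p u hu
    obtain ⟨w, hw⟩ := hflow p (hF.isLocalFrameOn.coeff 0 p u) (hF.isLocalFrameOn.coeff 2 p u)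
      (hF.isLocalFrameOn.coeff 1 p u) t
    rw [← hF.expand hu] at hw
    rw [hw]
    simp [hF.coeff_apply]
  · intro t p u hu
    obtain ⟨w, hw⟩ := hflow p (hF.isLocalFrameOn.coeff 0 p u) (hF.isLocalFrameOn.coeff 2 p u)
      (hF.isLocalFrameOn.coeff 1 p u) t
    rw [← hF.expand hu] at hw
    rw [hw]
    simp [hF.coeff_apply]

variable {b : QuotientMetric I (frameSpan F {0, 1, 2}) fun p => Submodule.span ℝ {F 1 p}}

/-- As `F 1` spans the kernel, the metric is determined by its Gram matrix in `F 0`, `F 2`. All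
later estimates therefore take place in these two coefficients. -/
theorem IsMagneticFrame.form_eq (hF : IsMagneticFrame I F κ) {p : M} {u v : TangentSpace I p}
    (hu : u ∈ frameSpan F {0, 1, 2} p) (hv : v ∈ frameSpan F {0, 1, 2} p) :
    b.form p u v =
      hF.isLocalFrameOn.coeff 0 p u * hF.isLocalFrameOn.coeff 0 p v * b.form p (F 0 p) (F 0 p) +
      (hF.isLocalFrameOn.coeff 0 p u * hF.isLocalFrameOn.coeff 2 p v +
        hF.isLocalFrameOn.coeff 2 p u * hF.isLocalFrameOn.coeff 0 p v) *
          b.form p (F 0 p) (F 2 p) +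
      hF.isLocalFrameOn.coeff 2 p u * hF.isLocalFrameOn.coeff 2 p v *
        b.form p (F 2 p) (F 2 p) := by
  have m : ∀ i, i ∈ ({0, 1, 2} : Finset (Fin 4)) → F i p ∈ frameSpan F {0, 1, 2} p :=
    fun i hi => frame_mem_frameSpan hi p
  have k : ∀ i, i ∈ ({0, 1, 2} : Finset (Fin 4)) → b.form p (F 1 p) (F i p) = 0 := fun i hi =>
    b.kernel p _ (Submodule.mem_span_singleton_self _) _ (m i hi)
  have k' : ∀ i, i ∈ ({0, 1, 2} : Finset (Fin 4)) → b.form p (F i p) (F 1 p) = 0 := fun i hi =>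
    (b.symm p _ (m i hi) _ (m 1 (by decide))).trans (k i hi)
  have s : b.form p (F 2 p) (F 0 p) = b.form p (F 0 p) (F 2 p) :=
    b.symm p _ (m 2 (by decide)) _ (m 0 (by decide))
  conv_lhs => rw [hF.expand hu, hF.expand hv]
  simp only [map_add, map_smul, LinearMap.add_apply, LinearMap.smul_apply, smul_eq_mul,
    k 0 (by decide), k 1 (by decide), k 2 (by decide), k' 0 (by decide), k' 2 (by decide), s]
  ring

theorem IsMagneticFrame.form_bounds (hF : IsMagneticFrame I F κ) {C : ℝ}
    (hb : ∀ p x y, C⁻¹ * (x ^ 2 + y ^ 2) ≤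
        b.form p (x • F 0 p + y • F 2 p) (x • F 0 p + y • F 2 p) ∧
      b.form p (x • F 0 p + y • F 2 p) (x • F 0 p + y • F 2 p) ≤ C * (x ^ 2 + y ^ 2))
    {p : M} {u : TangentSpace I p} (hu : u ∈ frameSpan F {0, 1, 2} p) :
    C⁻¹ * (hF.isLocalFrameOn.coeff 0 p u ^ 2 + hF.isLocalFrameOn.coeff 2 p u ^ 2) ≤
        b.form p u u ∧
      b.form p u u ≤
        C * (hF.isLocalFrameOn.coeff 0 p u ^ 2 + hF.isLocalFrameOn.coeff 2 p u ^ 2) := by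
  have h := hb p (hF.isLocalFrameOn.coeff 0 p u) (hF.isLocalFrameOn.coeff 2 p u)
  have hm : hF.isLocalFrameOn.coeff 0 p u • F 0 p + hF.isLocalFrameOn.coeff 2 p u • F 2 p ∈
      frameSpan F {0, 1, 2} p := by
    simpa using hF.mem_three_combination p (hF.isLocalFrameOn.coeff 0 p u) 0
      (hF.isLocalFrameOn.coeff 2 p u)
  rw [hF.form_eq hm hm] at h
  rw [hF.form_eq hu hu]
  simpa [hF.coeff_apply] using h

end TypesOfMagneticFrames

/-! ### The elliptic and the parabolic case -/

section TypeClassification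

variable {E : Type*} [NormedAddCommGroup E] [NormedSpace ℝ E] [FiniteDimensional ℝ E]
  {H : Type*} [TopologicalSpace H] {I : ModelWithCorners ℝ E H} [I.Boundaryless]
  {M : Type*} [TopologicalSpace M] [ChartedSpace H M] [IsManifold I ∞ M]
  {F : Fin 4 → ∀ p : M, TangentSpace I p} {κ : ℝ}
  {b : QuotientMetric I (frameSpan F {0, 1, 2}) fun p => Submodule.span ℝ {F 1 p}}
  {φ : ℝ → M → M} {C : ℝ} {σ : M → ℝ} {τ : M → ℝ → ℝ} {hF : IsMagneticFrame I F κ}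

/-- Transfers an estimate from the coefficient norm q to the given metric n. Each passage between
the two costs a factor `C`. -/
theorem le_mul_of_comparable {C n q n' q' B : ℝ} (hC : 0 < C) (hB : 0 ≤ B) (h1 : C⁻¹ * q ≤ n)
    (h2 : n' ≤ C * q') (h : q' ≤ B * q) : n' ≤ C ^ 2 * B * n := by
  have h3 : q ≤ C * n := by rwa [inv_mul_le_iff₀ hC] at h1
  calc n' ≤ C * q' := h2
    _ ≤ C * (B * (C * n)) := by gcongr; exact h.trans (by gcongr)
    _ = C ^ 2 * B * n := by ring

/-- The holonomy preserves x² + K y², whatever the time change. This form is comparable with x² +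
y², hence with the given metric, so all maps have bounded distortion. -/
theorem IsReparametrizedFlow.isElliptic
    (hr : IsReparametrizedFlow hF φ (fun t => Real.cos (√(κ * (κ + 1)) * t))
      (fun t => Real.sin (√(κ * (κ + 1)) * t) / √(κ * (κ + 1))) C σ τ)
    (hC : 0 < C) (hK : 0 < κ * (κ + 1))
    (hb : ∀ p x y, C⁻¹ * (x ^ 2 + y ^ 2) ≤
        b.form p (x • F 0 p + y • F 2 p) (x • F 0 p + y • F 2 p) ∧
      b.form p (x • F 0 p + y • F 2 p) (x • F 0 p + y • F 2 p) ≤ C * (x ^ 2 + y ^ 2)) :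
    IsElliptic b φ := by
  set K := κ * (κ + 1) with hKdef
  have hs : √K * √K = K := Real.mul_self_sqrt hK.le
  have hs0 : √K ≠ 0 := (Real.sqrt_pos.2 hK).ne'
  set N : ∀ p : M, TangentSpace I p → ℝ := fun p u =>
    hF.isLocalFrameOn.coeff 0 p u ^ 2 + K * hF.isLocalFrameOn.coeff 2 p u ^ 2 with hN
  set q : ∀ p : M, TangentSpace I p → ℝ := fun p u =>
    hF.isLocalFrameOn.coeff 0 p u ^ 2 + hF.isLocalFrameOn.coeff 2 p u ^ 2 with hq
  have hNinv : ∀ t p, ∀ u ∈ frameSpan F {0, 1, 2} p,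
      N (φ t p) (mfderiv I I (φ t) p u) = N p u := by
    intro t p u hu
    simp only [hN]
    rw [hr.coeff_zero t p u hu, hr.coeff_two t p u hu]
    have h1 := Real.sin_sq_add_cos_sq (√K * τ p t)
    rw [← hKdef]
    field_simp
    have h2 : √K ^ 2 = K := by rw [sq, hs]
    set x := hF.isLocalFrameOn.coeff 0 p u
    set y := hF.isLocalFrameOn.coeff 2 p u
    linear_combination (x ^ 2 * Real.cos (√K * τ p t) ^ 2 + K * Real.cos (√K * τ p t) ^ 2 * y ^ 2 -
      x ^ 2 - K * y ^ 2) * h2 + (K * x ^ 2 + K ^ 2 * y ^ 2) * h1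
  -- The cost of passing from x² + y² to the invariant form and back.
  set B := (1 + K) * (1 + K⁻¹) with hB
  have hB0 : 0 ≤ B := by positivity
  have hqN : ∀ p u, q p u ≤ (1 + K⁻¹) * N p u ∧ N p u ≤ (1 + K) * q p u := by
    intro p u
    simp only [hN, hq]
    set x := hF.isLocalFrameOn.coeff 0 p u
    set y := hF.isLocalFrameOn.coeff 2 p u
    constructor
    · have : (1 + K⁻¹) * (x ^ 2 + K * y ^ 2) = x ^ 2 + y ^ 2 + (K⁻¹ * x ^ 2 + K * y ^ 2) := by
        field_simp
        ring
      have : 0 ≤ K⁻¹ * x ^ 2 + K * y ^ 2 := by positivity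
      linarith
    · have : 0 ≤ K * x ^ 2 + y ^ 2 := by positivity
      linarith
  have hle : ∀ t p, ∀ u ∈ frameSpan F {0, 1, 2} p,
      q (φ t p) (mfderiv I I (φ t) p u) ≤ B * q p u ∧
        q p u ≤ B * q (φ t p) (mfderiv I I (φ t) p u) := by
    intro t p u hu
    have h1 := hqN p u
    have h2 := hqN (φ t p) (mfderiv I I (φ t) p u)
    rw [hNinv t p u hu] at h2
    have hK' : 0 < 1 + K⁻¹ := by positivity
    have i1 := mul_le_mul_of_nonneg_left h1.2 hK'.le
    have i2 := mul_le_mul_of_nonneg_left h2.2 hK'.le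
    constructor
    · linarith
    · linarith
  -- One factor compares the image of `u` with `u`, the other one compares `v` with its image; in
  -- between the two lengths are equal.
  refine ⟨C ^ 2 * B * (C ^ 2 * B), fun t p u hu v hv huv => ?_⟩
  have m1 := hr.mem t p u hu
  have m2 := hr.mem t p v hv
  have e1 := le_mul_of_comparable hC hB0 (hF.form_bounds hb hu).1 (hF.form_bounds hb m1).2
    (hle t p u hu).1
  have e2 := le_mul_of_comparable hC hB0 (hF.form_bounds hb m2).1 (hF.form_bounds hb hv).2
    (hle t p v hv).2
  rw [huv] at e1
  have hp : 0 ≤ C ^ 2 * B := by positivity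
  calc _ ≤ _ := e1
    _ ≤ C ^ 2 * B * (C ^ 2 * B * _) := mul_le_mul_of_nonneg_left e2 hp
    _ = _ := by ring

/-- The holonomy is the shear (x, y) ↦ (x, y + τx) with |τ| ≤ C t, so it stretches lengths at most
linearly in time. The inverse is the shear by -τ and obeys the same bound. -/
theorem IsReparametrizedFlow.not_isGenuineHyperbolic_of_eq_zero [Nonempty M]
    {P : ∀ p : M, Submodule ℝ (TangentSpace I p)}
    (hr : IsReparametrizedFlow hF φ (fun _ => 1) (fun t => t) C σ τ)
    (hC : 0 < C) (hK : κ * (κ + 1) = 0)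
    (hb : ∀ p x y, C⁻¹ * (x ^ 2 + y ^ 2) ≤
        b.form p (x • F 0 p + y • F 2 p) (x • F 0 p + y • F 2 p) ∧
      b.form p (x • F 0 p + y • F 2 p) (x • F 0 p + y • F 2 p) ≤ C * (x ^ 2 + y ^ 2)) :
    ¬ IsGenuineHyperbolic P b φ := by
  refine not_isGenuineHyperbolic_of_le (A := C ^ 2 * (2 * (1 + C) ^ 2)) (by positivity) ?_
  intro t ht p u hu
  have m := hr.mem t p u hu
  have b0 := hF.form_bounds hb hu
  have b1 := hF.form_bounds hb m
  rw [hr.coeff_zero t p u hu, hr.coeff_two t p u hu, hK] at b1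
  simp only [mul_one, zero_mul, sub_zero] at b1
  set x := hF.isLocalFrameOn.coeff 0 p u
  set y := hF.isLocalFrameOn.coeff 2 p u
  have hτ : τ p t ^ 2 ≤ (C * t) ^ 2 := by
    have h := (hr.bounds p t ht).1
    have h0 : 0 ≤ σ p * τ p t := le_trans (by positivity) h.1
    have : (σ p * τ p t) ^ 2 ≤ (C * t) ^ 2 := pow_le_pow_left₀ h0 h.2 2
    rcases hr.sign_sq p with e | e <;> rw [e] at this <;> linarith
  set s := τ p t
  have hB0 : 0 ≤ 2 * (1 + C) ^ 2 * (1 + t) ^ 2 := by positivity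
  have hs : 1 + s ^ 2 ≤ (1 + C) ^ 2 * (1 + t) ^ 2 := by
    have : 0 ≤ (1 + C) ^ 2 * (1 + t) ^ 2 - (1 + (C * t) ^ 2) := by
      have : (1 + C) ^ 2 * (1 + t) ^ 2 - (1 + (C * t) ^ 2) = C ^ 2 * (1 + 2 * t) +
        2 * C * (1 + t) ^ 2 + t ^ 2 + 2 * t := by ring
      rw [this]
      positivity
    linarith
  have hxy : ∀ a c r : ℝ, a ^ 2 + (a * r + c) ^ 2 ≤ 2 * (1 + r ^ 2) * (a ^ 2 + c ^ 2) := by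
    intro a c r
    nlinarith [sq_nonneg (a * r - c), sq_nonneg (r * c), sq_nonneg a, sq_nonneg c]
  have hq0 : 0 ≤ x ^ 2 + y ^ 2 := by positivity
  have hq1 : 0 ≤ x ^ 2 + (x * s + y) ^ 2 := by positivity
  have key : C ^ 2 * (2 * (1 + C) ^ 2) * (1 + t) ^ 2 = C ^ 2 * (2 * (1 + C) ^ 2 * (1 + t) ^ 2) := by
    ring
  rw [key]
  refine ⟨le_mul_of_comparable hC hB0 b0.1 b1.2 ?_, le_mul_of_comparable hC hB0 b1.1 b0.2 ?_⟩
  · have := mul_le_mul_of_nonneg_right hs hq0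
    linarith [hxy x y s]
  · have h1 := mul_le_mul_of_nonneg_right hs hq1
    have h2 := hxy x (x * s + y) (-s)
    rw [show x * -s + (x * s + y) = y by ring, neg_sq] at h2
    linarith

/-- The shear fixes `F 2` modulo the characteristic line and adds τ times it to `F 0`. Gram–Schmidt
applied to `F 2`, `F 0` yields the required frame, up to bounded corrections when the metric varies
along the orbit. -/
theorem IsReparametrizedFlow.isGenuineParabolic
    (hr : IsReparametrizedFlow hF φ (fun _ => 1) (fun t => t) C σ τ)
    (hC : 0 < C) (hK : κ * (κ + 1) = 0)
    (hb : ∀ p x y, C⁻¹ * (x ^ 2 + y ^ 2) ≤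
        b.form p (x • F 0 p + y • F 2 p) (x • F 0 p + y • F 2 p) ∧
      b.form p (x • F 0 p + y • F 2 p) (x • F 0 p + y • F 2 p) ≤ C * (x ^ 2 + y ^ 2)) :
    IsGenuineParabolic (frameSpan F {0, 1}) b φ := by
  have m0 : ∀ p, F 0 p ∈ frameSpan F {0, 1, 2} p := fun p => frame_mem_frameSpan (by decide) p
  have m2 : ∀ p, F 2 p ∈ frameSpan F {0, 1, 2} p := fun p => frame_mem_frameSpan (by decide) p
  have l0 := fun p => isLocalSection_frame hF.isLocalFrameOn (s := {0, 1, 2}) (i := 0) (by decide) p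
  have l2 := fun p => isLocalSection_frame hF.isLocalFrameOn (s := {0, 1, 2}) (i := 2) (by decide) p
  set A : M → ℝ := fun p => b.form p (F 0 p) (F 0 p) with hA
  set G : M → ℝ := fun p => b.form p (F 0 p) (F 2 p) with hG
  set N : M → ℝ := fun p => b.form p (F 2 p) (F 2 p) with hN
  have cA : Continuous A := continuous_iff_continuousAt.2 fun p =>
    b.continuousAt p _ _ (l0 p) (l0 p)
  have cG : Continuous G := continuous_iff_continuousAt.2 fun p =>
    b.continuousAt p _ _ (l0 p) (l2 p)
  have cN : Continuous N := continuous_iff_continuousAt.2 fun p =>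
    b.continuousAt p _ _ (l2 p) (l2 p)
  have hAb : ∀ p, A p ≤ C := fun p => by simpa using (hb p 1 0).2
  have hNb : ∀ p, C⁻¹ ≤ N p ∧ N p ≤ C := fun p => by simpa using hb p 0 1
  have hNpos : ∀ p, 0 < N p := fun p => (inv_pos.2 hC).trans_le (hNb p).1
  -- The Gram–Schmidt coefficient: `F 0 - m • F 2` is orthogonal to `F 2`, and `Q` is its squared
  -- length.
  set m : M → ℝ := fun p => G p / N p with hm
  have cm : Continuous m := cG.div cN fun p => (hNpos p).ne'
  have hmN : ∀ p, m p * N p = G p := fun p => div_mul_cancel₀ _ (hNpos p).ne'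
  have hmb : ∀ p, |m p| ≤ C ^ 2 := by
    intro p
    have h1 := b.two_mul_form_le (m0 p) (m2 p)
    have h2 := b.neg_two_mul_form_le (m0 p) (m2 p)
    have hGC : |G p| ≤ C := abs_le.2
      ⟨by linarith [hAb p, (hNb p).2], by linarith [hAb p, (hNb p).2]⟩
    rw [hm, abs_div, abs_of_pos (hNpos p), div_le_iff₀ (hNpos p)]
    have : C ^ 2 * C⁻¹ = C := by field_simp
    nlinarith [(hNb p).1, sq_nonneg C]
  set Q : M → ℝ := fun p => A p - m p * G p with hQ
  have cQ : Continuous Q := cA.sub (cm.mul cG)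
  have hform : ∀ p (x y x' y' : ℝ), b.form p (x • F 0 p + y • F 2 p) (x' • F 0 p + y' • F 2 p) =
      x * x' * A p + (x * y' + y * x') * G p + y * y' * N p := by
    intro p x y x' y'
    have hh : ∀ x y : ℝ, x • F 0 p + y • F 2 p ∈ frameSpan F {0, 1, 2} p := fun x y => by
      simpa using hF.mem_three_combination p x 0 y
    rw [hF.form_eq (hh x y) (hh x' y')]
    simp [hF.coeff_apply, hA, hG, hN]
  have hQe : ∀ p, Q p = b.form p ((1 : ℝ) • F 0 p + (-m p) • F 2 p)
      ((1 : ℝ) • F 0 p + (-m p) • F 2 p) := by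
    intro p
    rw [hform, hQ]
    linear_combination -m p * hmN p
  have hQpos : ∀ p, 0 < Q p := by
    intro p
    rw [hQe]
    refine lt_of_lt_of_le ?_ (hb p 1 (-m p)).1
    have := inv_pos.2 hC
    positivity
  have hQC : ∀ p, Q p ≤ C := by
    intro p
    have : 0 ≤ m p * G p := by
      rw [← hmN, ← mul_assoc]
      exact mul_nonneg (mul_self_nonneg _) (hNpos p).le
    simp only [hQ]
    linarith [hAb p]
  have hsN : ∀ p, √(N p) * √(N p) = N p := fun p => Real.mul_self_sqrt (hNpos p).le
  have hsQ : ∀ p, √(Q p) * √(Q p) = Q p := fun p => Real.mul_self_sqrt (hQpos p).le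
  have nN : ∀ p, √(N p) ≠ 0 := fun p => (Real.sqrt_pos.2 (hNpos p)).ne'
  have nQ : ∀ p, √(Q p) ≠ 0 := fun p => (Real.sqrt_pos.2 (hQpos p)).ne'
  have hσ2 : ∀ p, σ p * σ p = 1 := fun p => by rcases hr.sign_sq p with e | e <;> simp [e]
  have c0 := (hF.contMDiff 0).continuous
  have c2 := (hF.contMDiff 2).continuous
  have iN : ∀ p, (√(N p))⁻¹ * (√(N p))⁻¹ * N p = 1 := fun p => by
    rw [← mul_inv, hsN, inv_mul_cancel₀ (hNpos p).ne']
  have iQ : ∀ p, (√(Q p))⁻¹ * (√(Q p))⁻¹ * Q p = 1 := fun p => by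
    rw [← mul_inv, hsQ, inv_mul_cancel₀ (hQpos p).ne']
  -- The second vector carries the sign σ, so that the shear is positive in forward time also where
  -- the generator points against `F 1`.
  let ℓ₁ : ∀ p : M, TangentSpace I p := fun p => (0 : ℝ) • F 0 p + (√(N p))⁻¹ • F 2 p
  let ℓ₂ : ∀ p : M, TangentSpace I p := fun p =>
    (σ p * (√(Q p))⁻¹) • F 0 p + (-(σ p * (√(Q p))⁻¹ * m p)) • F 2 p
  have hmem : ∀ p (x y : ℝ), x • F 0 p + y • F 2 p ∈ frameSpan F {0, 1, 2} p := fun p x y => by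
    simpa using hF.mem_three_combination p x 0 y
  have cQi : Continuous fun p => (√(Q p))⁻¹ := (Real.continuous_sqrt.comp cQ).inv₀ nQ
  have cNi : Continuous fun p => (√(N p))⁻¹ := (Real.continuous_sqrt.comp cN).inv₀ nN
  have cσ := hr.continuous_sign
  have key : ∀ t p,
      b.form (φ t p) (mfderiv I I (φ t) p (ℓ₁ p)) (mfderiv I I (φ t) p (ℓ₂ p)) /
        b.form (φ t p) (mfderiv I I (φ t) p (ℓ₁ p)) (mfderiv I I (φ t) p (ℓ₁ p)) =
      √(N p) / √(Q p) * (σ p * (m (φ t p) + τ p t - m p)) := by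
    intro t p
    have k1 := hmem p 0 (√(N p))⁻¹
    have k2 := hmem p (σ p * (√(Q p))⁻¹) (-(σ p * (√(Q p))⁻¹ * m p))
    rw [hF.form_eq (hr.mem t p _ k1) (hr.mem t p _ k2),
      hF.form_eq (hr.mem t p _ k1) (hr.mem t p _ k1), hr.coeff_zero t p _ k1,
      hr.coeff_zero t p _ k2, hr.coeff_two t p _ k1, hr.coeff_two t p _ k2, hK]
    simp only [map_add, map_smul, hF.coeff_apply, smul_eq_mul]
    have e := hmN (φ t p)
    simp only [hG, hN] at e
    have n1 : b.form (φ t p) (F 2 (φ t p)) (F 2 (φ t p)) ≠ 0 := (hNpos (φ t p)).ne'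
    have n2 := nN p
    have n3 := nQ p
    simp only [← e]
    simp
    field_simp
    ring
  -- The quotient in `key` has a prefactor at least 1 / C, and its bracket is at least t / C - 2C²,
  -- since |m| ≤ C². The product is at least t / (2C²) as soon as t ≥ 4C³.
  refine ⟨ℓ₁, ℓ₂,
    ⟨isContinuousSection_combination c0 c2 continuous_const cNi, fun p => hmem p _ _⟩,
    ⟨isContinuousSection_combination c0 c2 (cσ.mul cQi) ((cσ.mul cQi).mul cm).neg,
      fun p => hmem p _ _⟩, ?_, ⟨(2 * C ^ 2)⁻¹, by positivity, 4 * C ^ 3, by positivity, ?_⟩, ?_⟩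
  · intro p
    refine ⟨?_, ?_, ?_⟩
    · simp only [ℓ₁]
      rw [hform]
      linear_combination iN p
    · simp only [ℓ₂]
      rw [hform]
      have e1 := hmN p
      have e2 := iQ p
      have e3 := hσ2 p
      simp only [hQ] at e2 ⊢
      linear_combination e2 + (√(A p - m p * G p))⁻¹ * (√(A p - m p * G p))⁻¹ *
        (A p - 2 * m p * G p + m p * m p * N p) * e3 +
        (√(A p - m p * G p))⁻¹ * (√(A p - m p * G p))⁻¹ * m p * e1
    · simp only [ℓ₁, ℓ₂]
      rw [hform]
      linear_combination -(√(N p))⁻¹ * (σ p * (√(Q p))⁻¹) * hmN p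
  · intro p t ht
    have ht0 : 0 ≤ t := le_trans (by positivity) ht
    have hbd := hr.bounds p t ht0
    rw [key, key]
    have hratio : C⁻¹ ≤ √(N p) / √(Q p) := by
      rw [← Real.sqrt_div (hNpos p).le]
      refine Real.le_sqrt_of_sq_le ?_
      rw [le_div_iff₀ (hQpos p), sq, mul_assoc]
      refine le_trans ?_ (hNb p).1
      have : C⁻¹ * Q p ≤ 1 := by
        rw [inv_mul_le_iff₀ hC, mul_one]
        exact hQC p
      have hi := inv_pos.2 hC
      nlinarith
    have habs : ∀ r s : ℝ, |r| ≤ C ^ 2 → |s| ≤ C ^ 2 → -(2 * C ^ 2) ≤ σ p * (r - s) ∧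
        σ p * (r - s) ≤ 2 * C ^ 2 := by
      intro r s hr' hs
      have := abs_le.1 hr'
      have := abs_le.1 hs
      rcases hr.sign_sq p with e | e <;> rw [e] <;> constructor <;> linarith
    have hhalf : (2 * C ^ 2)⁻¹ * t ≤ C⁻¹ * (C⁻¹ * t - 2 * C ^ 2) := by
      have e : C⁻¹ * (C⁻¹ * t - 2 * C ^ 2) = (2 * C ^ 2)⁻¹ * t + (2 * C ^ 2)⁻¹ * (t - 4 * C ^ 3) := by
        field_simp
        ring
      have : 0 ≤ (2 * C ^ 2)⁻¹ * (t - 4 * C ^ 3) := mul_nonneg (by positivity) (by linarith)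
      linarith
    have hnn : 0 ≤ C⁻¹ * t - 2 * C ^ 2 := by
      have h1 : C⁻¹ * (4 * C ^ 3) ≤ C⁻¹ * t := by gcongr
      have h2 : C⁻¹ * (4 * C ^ 3) = 4 * C ^ 2 := by field_simp
      nlinarith [sq_nonneg C]
    have hCi := (inv_pos.2 hC).le
    constructor
    · refine hhalf.trans (mul_le_mul hratio ?_ hnn (hCi.trans hratio))
      have := (habs _ _ (hmb (φ t p)) (hmb p)).1
      linarith [hbd.1.1]
    · rw [← mul_neg]
      refine hhalf.trans (mul_le_mul hratio ?_ hnn (hCi.trans hratio))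
      have := (habs _ _ (hmb (φ (-t) p)) (hmb p)).2
      linarith [hbd.2.1]
  · intro p hp
    rw [hF.mem_two_iff (hmem p _ _)] at hp
    simp [hF.coeff_apply, nN p] at hp

end TypeClassification

/-! ### The hyperbolic case and the classification -/

section HyperbolicType

variable {E : Type*} [NormedAddCommGroup E] [NormedSpace ℝ E] [FiniteDimensional ℝ E]
  {H : Type*} [TopologicalSpace H] {I : ModelWithCorners ℝ E H} [I.Boundaryless]
  {M : Type*} [TopologicalSpace M] [ChartedSpace H M] [IsManifold I ∞ M]
  {F : Fin 4 → ∀ p : M, TangentSpace I p} {κ : ℝ}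
  {b : QuotientMetric I (frameSpan F {0, 1, 2}) fun p => Submodule.span ℝ {F 1 p}}
  {φ : ℝ → M → M} {C : ℝ} {σ : M → ℝ} {τ : M → ℝ → ℝ} {hF : IsMagneticFrame I F κ}

/-- The plane field spanned by `W` and `r T + Y`. -/
noncomputable def slopePlane (F : Fin 4 → ∀ p : M, TangentSpace I p) (r : M → ℝ) (p : M) :
    Submodule ℝ (TangentSpace I p) :=
  Submodule.span ℝ {F 1 p} ⊔ Submodule.span ℝ {r p • F 0 p + F 2 p}

theorem IsMagneticFrame.mem_slopePlane_iff (hF : IsMagneticFrame I F κ) {r : M → ℝ} {p : M}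
    {u : TangentSpace I p} : u ∈ slopePlane F r p ↔ u ∈ frameSpan F {0, 1, 2} p ∧
      hF.isLocalFrameOn.coeff 0 p u = r p * hF.isLocalFrameOn.coeff 2 p u := by
  constructor
  · intro h
    obtain ⟨v, hv, w, hw, rfl⟩ := Submodule.mem_sup.1 h
    obtain ⟨c, rfl⟩ := Submodule.mem_span_singleton.1 hv
    obtain ⟨d, rfl⟩ := Submodule.mem_span_singleton.1 hw
    constructor
    · rw [hF.mem_three_iff]
      simp [hF.coeff_apply]
    · simp [hF.coeff_apply]
      ring
  · rintro ⟨hu, h⟩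
    rw [hF.expand hu, h]
    refine Submodule.mem_sup.2 ⟨hF.isLocalFrameOn.coeff 1 p u • F 1 p,
      Submodule.smul_mem _ _ (Submodule.mem_span_singleton_self _),
      hF.isLocalFrameOn.coeff 2 p u • (r p • F 0 p + F 2 p),
      Submodule.smul_mem _ _ (Submodule.mem_span_singleton_self _), ?_⟩
    module

theorem IsMagneticFrame.isQuotientLine_slopePlane (hF : IsMagneticFrame I F κ) {r : M → ℝ}
    (hr : Continuous r) : IsQuotientLine (frameSpan F {0, 1, 2})
      (fun p => Submodule.span ℝ {F 1 p}) (slopePlane F r) := by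
  refine fun p => ⟨fun q => r q • F 0 q + F 2 q, Eventually.of_forall fun q => ?_⟩
  have hm : r q • F 0 q + F 2 q ∈ frameSpan F {0, 1, 2} q := by
    rw [hF.mem_three_iff]
    simp [hF.coeff_apply]
  refine ⟨?_, hm, ?_, rfl⟩
  · have := isContinuousSection_combination (hF.contMDiff 0).continuous
      (hF.contMDiff 2).continuous hr (continuous_const (y := (1 : ℝ)))
    simp only [one_smul] at this
    exact this.continuousAt
  · rw [hF.mem_span_one_iff hm]
    simp [hF.coeff_apply]

theorem cosh_add_mul_sinh {ρ : ℝ} (hρ : ρ = 1 ∨ ρ = -1) (z : ℝ) :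
    Real.cosh z + ρ * Real.sinh z = Real.exp (ρ * z) := by
  rcases hρ with rfl | rfl
  · rw [one_mul, one_mul, Real.cosh_add_sinh]
  · rw [neg_one_mul, neg_one_mul, ← sub_eq_add_neg, Real.cosh_sub_sinh]

/-- The two linear forms `x ± μ y` are eigenvectors of the linear holonomy. -/
theorem IsReparametrizedFlow.eigenform {μ : ℝ} (hμ : 0 < μ) (hK : κ * (κ + 1) = -μ ^ 2)
    (hr : IsReparametrizedFlow hF φ (fun t => Real.cosh (μ * t)) (fun t => Real.sinh (μ * t) / μ)
      C σ τ) {ρ : ℝ} (hρ : ρ = 1 ∨ ρ = -1) (t : ℝ) {p : M} {u : TangentSpace I p}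
    (hu : u ∈ frameSpan F {0, 1, 2} p) :
    hF.isLocalFrameOn.coeff 0 (φ t p) (mfderiv I I (φ t) p u) +
        ρ * μ * hF.isLocalFrameOn.coeff 2 (φ t p) (mfderiv I I (φ t) p u) =
      Real.exp (ρ * (μ * τ p t)) *
        (hF.isLocalFrameOn.coeff 0 p u + ρ * μ * hF.isLocalFrameOn.coeff 2 p u) := by
  have hρ2 : ρ * ρ = 1 := by rcases hρ with rfl | rfl <;> norm_num
  rw [hr.coeff_zero t p u hu, hr.coeff_two t p u hu, hK, ← cosh_add_mul_sinh hρ]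
  field_simp
  linear_combination (-hF.isLocalFrameOn.coeff 2 p u * Real.sinh (μ * τ p t) * μ) * hρ2

/-- On the line x = ρμy one eigenform vanishes. It still vanishes on the image, which therefore lies
on the same line, and the other eigenform fixes the scaling factor. -/
theorem eq_of_eigenforms {x y ρ μ e : ℝ} (h : x = ρ * μ * y) (hμ : 0 < μ) (hρ : ρ = 1 ∨ ρ = -1)
    {x' y' : ℝ} (h1 : x' + ρ * μ * y' = e * (x + ρ * μ * y))
    (h2 : x' + -ρ * μ * y' = 0) : x' = ρ * μ * y' ∧ x' ^ 2 + y' ^ 2 = e ^ 2 * (x ^ 2 + y ^ 2) := by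
  have hx : x' = ρ * μ * y' := by linarith
  refine ⟨hx, ?_⟩
  subst hx h
  have hρ0 : ρ * μ ≠ 0 := by
    refine mul_ne_zero ?_ hμ.ne'
    rcases hρ with rfl | rfl <;> norm_num
  have hy : y' = e * y := by
    refine mul_left_cancel₀ hρ0 ?_
    linarith
  rw [hy]
  ring

/-- The slope contains σ so that s = 1 is the line expanded in forward time, even where the
generator runs against `F 1`; the plane field is invariant because σ is constant along orbits. -/
theorem IsReparametrizedFlow.slopePlane_flow {μ : ℝ} (hμ : 0 < μ) (hK : κ * (κ + 1) = -μ ^ 2)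
    (hr : IsReparametrizedFlow hF φ (fun t => Real.cosh (μ * t)) (fun t => Real.sinh (μ * t) / μ)
      C σ τ) {s : ℝ} (hs : s = 1 ∨ s = -1) (t : ℝ) {p : M} {u : TangentSpace I p}
    (hu : u ∈ slopePlane F (fun q => s * σ q * μ) p) :
    mfderiv I I (φ t) p u ∈ slopePlane F (fun q => s * σ q * μ) (φ t p) ∧
      hF.isLocalFrameOn.coeff 0 (φ t p) (mfderiv I I (φ t) p u) ^ 2 +
        hF.isLocalFrameOn.coeff 2 (φ t p) (mfderiv I I (φ t) p u) ^ 2 =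
      Real.exp (s * (μ * (σ p * τ p t))) ^ 2 *
        (hF.isLocalFrameOn.coeff 0 p u ^ 2 + hF.isLocalFrameOn.coeff 2 p u ^ 2) := by
  obtain ⟨hu, h⟩ := hF.mem_slopePlane_iff.1 hu
  have hρ : s * σ p = 1 ∨ s * σ p = -1 := by
    rcases hs with rfl | rfl <;> rcases hr.sign_sq p with e | e <;> simp [e]
  have hρ' : -(s * σ p) = 1 ∨ -(s * σ p) = -1 := by
    rcases hρ with e | e <;> simp [e]
  have e1 := hr.eigenform hμ hK hρ t hu
  have e2 := hr.eigenform hμ hK hρ' t hu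
  rw [show hF.isLocalFrameOn.coeff 0 p u + -(s * σ p) * μ * hF.isLocalFrameOn.coeff 2 p u = 0 by
    rw [h]; ring, mul_zero] at e2
  obtain ⟨i1, i2⟩ := eq_of_eigenforms h hμ hρ e1 e2
  refine ⟨hF.mem_slopePlane_iff.2 ⟨hr.mem t p u hu, ?_⟩, ?_⟩
  · rw [i1, hr.sign_flow]
  · rw [i2]
    congr 3
    ring

theorem IsReparametrizedFlow.isGenuineHyperbolic {μ : ℝ} (hμ : 0 < μ)
    (hK : κ * (κ + 1) = -μ ^ 2)
    (hr : IsReparametrizedFlow hF φ (fun t => Real.cosh (μ * t)) (fun t => Real.sinh (μ * t) / μ)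
      C σ τ) (hC : 0 < C)
    (hb : ∀ p x y, C⁻¹ * (x ^ 2 + y ^ 2) ≤
        b.form p (x • F 0 p + y • F 2 p) (x • F 0 p + y • F 2 p) ∧
      b.form p (x • F 0 p + y • F 2 p) (x • F 0 p + y • F 2 p) ≤ C * (x ^ 2 + y ^ 2)) :
    IsGenuineHyperbolic (frameSpan F {0, 1}) b φ := by
  have hσ0 : ∀ p, σ p ≠ 0 := fun p => by rcases hr.sign_sq p with e | e <;> rw [e] <;> norm_num
  have line : ∀ s : ℝ, IsQuotientLine (frameSpan F {0, 1, 2})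
      (fun p => Submodule.span ℝ {F 1 p}) (slopePlane F fun q => s * σ q * μ) := fun s =>
    hF.isQuotientLine_slopePlane ((continuous_const.mul hr.continuous_sign).mul continuous_const)
  have hinf : ∀ s : ℝ, s ≠ 0 → ∀ p, frameSpan F {0, 1} p ⊓ slopePlane F (fun q => s * σ q * μ) p =
      Submodule.span ℝ {F 1 p} := by
    intro s hs p
    refine le_antisymm ?_ (le_inf ?_ le_sup_left)
    · rintro u ⟨h1, h2⟩
      obtain ⟨hu, h⟩ := hF.mem_slopePlane_iff.1 h2
      have h3 := (hF.mem_two_iff hu).1 h1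
      rw [h3, mul_zero] at h
      exact (hF.mem_span_one_iff hu).2 ⟨h, h3⟩
    · rw [Submodule.span_singleton_le_iff_mem]
      exact frame_mem_frameSpan (by decide) p
  -- In the coefficient norm the quotient of lengths is multiplied by the square of exp(μστ), and στ
  -- ≥ t / C gives the rate 2μ / C. Comparing the metric with the coefficient norm costs C² for the
  -- quotient. The starting time 1 is arbitrary.
  refine ⟨slopePlane F fun q => 1 * σ q * μ, slopePlane F fun q => -1 * σ q * μ, line 1, line (-1),
    fun p => ?_, fun t p v hv => (hr.slopePlane_flow hμ hK (Or.inl rfl) t hv).1,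
    fun t p v hv => (hr.slopePlane_flow hμ hK (Or.inr rfl) t hv).1,
    ⟨2 * μ * C⁻¹, by positivity, (C ^ 2)⁻¹, by positivity, 1, one_pos, ?_⟩,
    fun p => ⟨hinf 1 one_ne_zero p, hinf (-1) (by norm_num) p⟩⟩
  · refine le_antisymm ?_ (le_inf le_sup_left le_sup_left)
    rintro u ⟨h1, h2⟩
    obtain ⟨hu, e1⟩ := hF.mem_slopePlane_iff.1 h1
    obtain ⟨-, e2⟩ := hF.mem_slopePlane_iff.1 h2
    have h3 : 2 * (σ p * μ) * hF.isLocalFrameOn.coeff 2 p u = 0 := by linarith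
    have h4 : hF.isLocalFrameOn.coeff 2 p u = 0 := by
      simpa [hσ0 p, hμ.ne'] using h3
    exact (hF.mem_span_one_iff hu).2 ⟨by rw [e1, h4, mul_zero], h4⟩
  · intro p t ht u hu s hs hsW
    have ht0 : 0 ≤ t := by linarith
    obtain ⟨hu', eu⟩ := hr.slopePlane_flow hμ hK (Or.inl rfl) t hu
    obtain ⟨hs', es⟩ := hr.slopePlane_flow hμ hK (Or.inr rfl) t hs
    have hsD := (hF.mem_slopePlane_iff.1 hs).1
    have bu := hF.form_bounds hb (hF.mem_slopePlane_iff.1 hu).1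
    have bs := hF.form_bounds hb hsD
    have bu' := hF.form_bounds hb (hF.mem_slopePlane_iff.1 hu').1
    have bs' := hF.form_bounds hb (hF.mem_slopePlane_iff.1 hs').1
    have ps := b.pos p s hsD hsW
    rw [eu] at bu'
    rw [es] at bs'
    set qu := hF.isLocalFrameOn.coeff 0 p u ^ 2 + hF.isLocalFrameOn.coeff 2 p u ^ 2
    set qs := hF.isLocalFrameOn.coeff 0 p s ^ 2 + hF.isLocalFrameOn.coeff 2 p s ^ 2
    set z := μ * (σ p * τ p t) with hz
    have hz1 : μ * (C⁻¹ * t) ≤ z := mul_le_mul_of_nonneg_left (hr.bounds p t ht0).1.1 hμ.le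
    rw [one_mul] at bu'
    rw [neg_one_mul, Real.exp_neg] at bs'
    set e := Real.exp z with he
    have he0 : 0 < e := Real.exp_pos z
    have hqs : 0 < qs := by
      by_contra hn
      have : qs ≤ 0 := not_lt.1 hn
      nlinarith [bs.2]
    have hqu : 0 ≤ qu := by positivity
    have ps' : 0 < b.form (φ t p) (mfderiv I I (φ t) p s) (mfderiv I I (φ t) p s) := by
      refine lt_of_lt_of_le ?_ bs'.1
      positivity
    set nu := b.form p u u
    set ns := b.form p s s
    set nu' := b.form (φ t p) (mfderiv I I (φ t) p u) (mfderiv I I (φ t) p u)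
    set ns' := b.form (φ t p) (mfderiv I I (φ t) p s) (mfderiv I I (φ t) p s)
    have hnu0 : 0 ≤ nu := le_trans (by positivity) bu.1
    have i1 : e ^ 2 * nu ≤ C ^ 2 * nu' := by
      have h2 : e ^ 2 * qu ≤ C * nu' := (inv_mul_le_iff₀ hC).1 bu'.1
      calc e ^ 2 * nu ≤ e ^ 2 * (C * qu) := by gcongr; exact bu.2
        _ = C * (e ^ 2 * qu) := by ring
        _ ≤ C * (C * nu') := by gcongr
        _ = C ^ 2 * nu' := by ring
    have i2 : e ^ 2 * ns' ≤ C ^ 2 * ns := by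
      have h2 : qs ≤ C * ns := (inv_mul_le_iff₀ hC).1 bs.1
      calc e ^ 2 * ns' ≤ e ^ 2 * (C * (e⁻¹ ^ 2 * qs)) := by gcongr; exact bs'.2
        _ = C * qs := by field_simp
        _ ≤ C * (C * ns) := by gcongr
        _ = C ^ 2 * ns := by ring
    have j1 := Real.sqrt_le_sqrt i1
    have j2 := Real.sqrt_le_sqrt i2
    rw [Real.sqrt_mul (by positivity), Real.sqrt_mul (by positivity), Real.sqrt_sq he0.le,
      Real.sqrt_sq hC.le] at j1 j2
    have hexp : Real.exp (2 * μ * C⁻¹ * t) ≤ e * e := by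
      rw [he, ← Real.exp_add]
      refine Real.exp_le_exp.2 ?_
      linarith
    have s1 := Real.sqrt_pos.2 ps
    have s2 := Real.sqrt_pos.2 ps'
    have s3 := Real.sqrt_nonneg nu
    rw [← mul_div_assoc, div_le_div_iff₀ s1 s2]
    calc (C ^ 2)⁻¹ * Real.exp (2 * μ * C⁻¹ * t) * √nu * √ns'
        ≤ (C ^ 2)⁻¹ * (e * e) * √nu * √ns' := by gcongr
      _ = (C ^ 2)⁻¹ * ((e * √nu) * (e * √ns')) := by ring
      _ ≤ (C ^ 2)⁻¹ * ((C * √nu') * (C * √ns)) := by gcongr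
      _ = √nu' * √ns := by field_simp

theorem exists_lt_mul_mul (a c T₀ A : ℝ) (ha : 0 < a) (hc : 0 < c) :
    ∃ t, T₀ ≤ t ∧ 0 ≤ t ∧ A < (2 * (c * t) - 1) * a := by
  refine ⟨max (max T₀ 0) ((|A| / a + 2) / c), (le_max_left _ _).trans (le_max_left _ _),
    (le_max_right _ _).trans (le_max_left _ _), ?_⟩
  have h1 := le_max_right (max T₀ 0) ((|A| / a + 2) / c)
  set t := max (max T₀ 0) ((|A| / a + 2) / c)
  rw [div_le_iff₀ hc] at h1
  have h2 : 0 ≤ |A| / a := by positivity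
  have h3 : |A| / a * a = |A| := div_mul_cancel₀ _ ha.ne'
  have h4 : |A| / a + 3 ≤ 2 * (c * t) - 1 := by linarith
  have h5 := mul_le_mul_of_nonneg_right h4 ha.le
  linarith [le_abs_self A]

/-- If `ℓ₁` has a component along the line expanded in one direction of time, its image grows at the
maximal rate there, so the image of `ℓ₂` is at most a constant times as long and the parabolic
quotient is bounded. Growth in both directions of time thus forces both components of `ℓ₁` to
vanish, contradicting its length 1. -/
theorem IsReparametrizedFlow.not_isGenuineParabolic_of_neg {μ : ℝ} (hμ : 0 < μ)
    (hK : κ * (κ + 1) = -μ ^ 2) [Nonempty M] {P : ∀ p : M, Submodule ℝ (TangentSpace I p)}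
    (hr : IsReparametrizedFlow hF φ (fun t => Real.cosh (μ * t)) (fun t => Real.sinh (μ * t) / μ)
      C σ τ) (hC : 0 < C)
    (hb : ∀ p x y, C⁻¹ * (x ^ 2 + y ^ 2) ≤
        b.form p (x • F 0 p + y • F 2 p) (x • F 0 p + y • F 2 p) ∧
      b.form p (x • F 0 p + y • F 2 p) (x • F 0 p + y • F 2 p) ≤ C * (x ^ 2 + y ^ 2)) :
    ¬ IsGenuineParabolic P b φ := by
  rintro ⟨ℓ₁, ℓ₂, h1, h2, hon, ⟨c, hc, T₀, hT, h⟩, -⟩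
  obtain ⟨p⟩ := ‹Nonempty M›
  set u := ℓ₁ p
  set v := ℓ₂ p
  have hu : u ∈ frameSpan F {0, 1, 2} p := h1.2 p
  have hv : v ∈ frameSpan F {0, 1, 2} p := h2.2 p
  -- Both directions of time at once: s is the direction, and x + sσμy is the eigenform which grows
  -- in it.
  have key : ∀ s : ℝ, s = 1 ∨ s = -1 → (∀ t, T₀ ≤ t → ∀ r, r = s * t → c * t ≤ s *
        (b.form (φ r p) (mfderiv I I (φ r) p u) (mfderiv I I (φ r) p v) /
        b.form (φ r p) (mfderiv I I (φ r) p u) (mfderiv I I (φ r) p u))) →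
      hF.isLocalFrameOn.coeff 0 p u + s * σ p * μ * hF.isLocalFrameOn.coeff 2 p u = 0 := by
    intro s hs h
    have hρ : s * σ p = 1 ∨ s * σ p = -1 := by
      rcases hs with rfl | rfl <;> rcases hr.sign_sq p with e | e <;> simp [e]
    have hρ' : -(s * σ p) = 1 ∨ -(s * σ p) = -1 := by
      rcases hρ with e | e <;> simp [e]
    by_contra hne
    set a := hF.isLocalFrameOn.coeff 0 p u + s * σ p * μ * hF.isLocalFrameOn.coeff 2 p u with ha
    set d := hF.isLocalFrameOn.coeff 0 p v + s * σ p * μ * hF.isLocalFrameOn.coeff 2 p v with hd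
    set d' := hF.isLocalFrameOn.coeff 0 p v + -(s * σ p) * μ * hF.isLocalFrameOn.coeff 2 p v
      with hd'
    have ha2 : 0 < a ^ 2 := by positivity
    have lower : ∀ x y : ℝ, (x + s * σ p * μ * y) ^ 2 ≤ 2 * (1 + μ ^ 2) * (x ^ 2 + y ^ 2) := by
      intro x y
      have e : (s * σ p) ^ 2 = 1 := by rcases hρ with e | e <;> rw [e] <;> norm_num
      have e2 : (x + s * σ p * μ * y) ^ 2 + (x - s * σ p * μ * y) ^ 2 =
          2 * x ^ 2 + 2 * ((s * σ p) ^ 2 * (μ ^ 2 * y ^ 2)) := by ring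
      rw [e] at e2
      nlinarith [sq_nonneg (x - s * σ p * μ * y), sq_nonneg x, sq_nonneg y,
        mul_nonneg (sq_nonneg μ) (sq_nonneg x)]
    have upper : ∀ x y : ℝ, x ^ 2 + y ^ 2 ≤ (1 + μ⁻¹ ^ 2) *
        ((x + s * σ p * μ * y) ^ 2 + (x + -(s * σ p) * μ * y) ^ 2) := by
      intro x y
      have e : (s * σ p) ^ 2 = 1 := by rcases hρ with e | e <;> rw [e] <;> norm_num
      have e2 : (x + s * σ p * μ * y) ^ 2 + (x + -(s * σ p) * μ * y) ^ 2 =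
          2 * x ^ 2 + 2 * ((s * σ p) ^ 2 * (μ ^ 2 * y ^ 2)) := by ring
      rw [e2, e]
      have e3 : (1 + μ⁻¹ ^ 2) * (2 * x ^ 2 + 2 * (1 * (μ ^ 2 * y ^ 2))) =
          x ^ 2 + y ^ 2 + (x ^ 2 + 2 * (μ⁻¹ * x) ^ 2 + 2 * (μ * y) ^ 2 + y ^ 2) := by
        field_simp
        ring
      rw [e3]
      have : 0 ≤ x ^ 2 + 2 * (μ⁻¹ * x) ^ 2 + 2 * (μ * y) ^ 2 + y ^ 2 := by positivity
      linarith
    -- The constant is the bound for (2ct - 1) a² derived in `i4` after cancelling the common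
    -- exponential. Taking t ≥ 1 / c keeps the factor 2ct - 1 nonnegative.
    obtain ⟨t, ht, ht0, htA⟩ := exists_lt_mul_mul (a ^ 2) c (max T₀ c⁻¹)
      (C * (2 * (1 + μ ^ 2)) * (C * ((1 + μ⁻¹ ^ 2) * (d ^ 2 + d' ^ 2)))) ha2 hc
    have hT₀ := (le_max_left _ _).trans ht
    have h' := h t hT₀ _ rfl
    have hct : 1 ≤ c * t := by
      have := (le_max_right T₀ c⁻¹).trans ht
      rwa [inv_le_iff_one_le_mul₀' hc] at this
    have hz : 0 ≤ s * σ p * (μ * τ p (s * t)) := by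
      have hbd := hr.bounds p t ht0
      have hCt : 0 ≤ C⁻¹ * t := by positivity
      have e : s * σ p * (μ * τ p (s * t)) = μ * (s * (σ p * τ p (s * t))) := by ring
      rw [e]
      refine mul_nonneg hμ.le ?_
      rcases hs with rfl | rfl
      · rw [one_mul, one_mul]
        linarith [hbd.1.1]
      · rw [neg_one_mul, neg_one_mul]
        linarith [hbd.2.1]
    have mu := hr.mem (s * t) p u hu
    have mv := hr.mem (s * t) p v hv
    have fu := hr.eigenform hμ hK hρ (s * t) hu
    have fv := hr.eigenform hμ hK hρ (s * t) hv
    have fv' := hr.eigenform hμ hK hρ' (s * t) hv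
    rw [neg_mul (s * σ p) (μ * τ p (s * t)), Real.exp_neg] at fv'
    set e := Real.exp (s * σ p * (μ * τ p (s * t))) with he
    have he1 : 1 ≤ e := Real.one_le_exp hz
    have he0 : 0 < e := by linarith
    have bu := (hF.form_bounds hb mu).1
    have bv := (hF.form_bounds hb mv).2
    have lu := lower (hF.isLocalFrameOn.coeff 0 (φ (s * t) p) (mfderiv I I (φ (s * t)) p u))
      (hF.isLocalFrameOn.coeff 2 (φ (s * t) p) (mfderiv I I (φ (s * t)) p u))
    have uv := upper (hF.isLocalFrameOn.coeff 0 (φ (s * t) p) (mfderiv I I (φ (s * t)) p v))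
      (hF.isLocalFrameOn.coeff 2 (φ (s * t) p) (mfderiv I I (φ (s * t)) p v))
    rw [fu, ← ha] at lu
    rw [fv, fv', ← hd, ← hd'] at uv
    have nu0 := b.form_self_nonneg mu
    have huv : s * (2 * b.form (φ (s * t) p) (mfderiv I I (φ (s * t)) p u)
        (mfderiv I I (φ (s * t)) p v)) ≤
        b.form (φ (s * t) p) (mfderiv I I (φ (s * t)) p u) (mfderiv I I (φ (s * t)) p u) +
        b.form (φ (s * t) p) (mfderiv I I (φ (s * t)) p v) (mfderiv I I (φ (s * t)) p v) := by
      rcases hs with e | e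
      · rw [e, one_mul]
        rw [e] at mu mv
        exact b.two_mul_form_le mu mv
      · rw [e, neg_one_mul]
        rw [e] at mu mv
        exact b.neg_two_mul_form_le mu mv
    set nu := b.form (φ (s * t) p) (mfderiv I I (φ (s * t)) p u) (mfderiv I I (φ (s * t)) p u)
    set nv := b.form (φ (s * t) p) (mfderiv I I (φ (s * t)) p v) (mfderiv I I (φ (s * t)) p v)
    set nuv := b.form (φ (s * t) p) (mfderiv I I (φ (s * t)) p u) (mfderiv I I (φ (s * t)) p v)
    set qu := hF.isLocalFrameOn.coeff 0 (φ (s * t) p) (mfderiv I I (φ (s * t)) p u) ^ 2 +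
      hF.isLocalFrameOn.coeff 2 (φ (s * t) p) (mfderiv I I (φ (s * t)) p u) ^ 2
    set qv := hF.isLocalFrameOn.coeff 0 (φ (s * t) p) (mfderiv I I (φ (s * t)) p v) ^ 2 +
      hF.isLocalFrameOn.coeff 2 (φ (s * t) p) (mfderiv I I (φ (s * t)) p v) ^ 2
    have hquC : qu ≤ C * nu := (inv_mul_le_iff₀ hC).1 bu
    have i1 : e ^ 2 * a ^ 2 ≤ 2 * (1 + μ ^ 2) * (C * nu) := by
      rw [← mul_pow]
      exact lu.trans (mul_le_mul_of_nonneg_left hquC (by positivity))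
    have hnu : 0 < nu := by
      rcases nu0.lt_or_eq with hlt | heq
      · exact hlt
      · rw [← heq, mul_zero, mul_zero] at i1
        have : 0 < e ^ 2 * a ^ 2 := by positivity
        linarith
    -- The parabolic lower bound for the inner product, combined with the upper bound by half the
    -- sum of the squares.
    have i2 : (2 * (c * t) - 1) * nu ≤ nv := by
      rw [mul_div_assoc', le_div_iff₀ hnu] at h'
      linarith
    have he' : e⁻¹ ^ 2 ≤ e ^ 2 := by
      have : e⁻¹ ≤ e := (inv_le_one_of_one_le₀ he1).trans he1
      gcongr
    have i3 : nv ≤ e ^ 2 * (C * ((1 + μ⁻¹ ^ 2) * (d ^ 2 + d' ^ 2))) := by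
      refine bv.trans ?_
      have : (e * d) ^ 2 + (e⁻¹ * d') ^ 2 ≤ e ^ 2 * (d ^ 2 + d' ^ 2) := by
        rw [mul_pow, mul_pow, mul_add]
        gcongr
      calc C * qv ≤ C * ((1 + μ⁻¹ ^ 2) * (e ^ 2 * (d ^ 2 + d' ^ 2))) := by
            gcongr
            exact uv.trans (by gcongr)
        _ = _ := by ring
    have i4 : e ^ 2 * ((2 * (c * t) - 1) * a ^ 2) ≤
        e ^ 2 * (C * (2 * (1 + μ ^ 2)) * (C * ((1 + μ⁻¹ ^ 2) * (d ^ 2 + d' ^ 2)))) := by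
      have hpos : 0 ≤ 2 * (c * t) - 1 := by linarith
      calc e ^ 2 * ((2 * (c * t) - 1) * a ^ 2) = (2 * (c * t) - 1) * (e ^ 2 * a ^ 2) := by ring
        _ ≤ (2 * (c * t) - 1) * (2 * (1 + μ ^ 2) * (C * nu)) := by gcongr
        _ = C * (2 * (1 + μ ^ 2)) * ((2 * (c * t) - 1) * nu) := by ring
        _ ≤ C * (2 * (1 + μ ^ 2)) * nv := by gcongr
        _ ≤ C * (2 * (1 + μ ^ 2)) * (e ^ 2 * (C * ((1 + μ⁻¹ ^ 2) * (d ^ 2 + d' ^ 2)))) := by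
            gcongr
        _ = _ := by ring
    have := le_of_mul_le_mul_left i4 (by positivity)
    linarith
  have k1 := key 1 (Or.inl rfl) fun t ht r hr => by
    rw [one_mul] at hr ⊢
    subst hr
    exact (h p r ht).1
  have k2 := key (-1) (Or.inr rfl) fun t ht r hr => by
    rw [neg_one_mul] at hr ⊢
    subst hr
    exact (h p t ht).2
  have hy : 2 * (σ p * μ) * hF.isLocalFrameOn.coeff 2 p u = 0 := by linarith
  have hσ0 : σ p ≠ 0 := by rcases hr.sign_sq p with e | e <;> rw [e] <;> norm_num
  have hy0 : hF.isLocalFrameOn.coeff 2 p u = 0 := by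
    simpa [hσ0, hμ.ne'] using hy
  rw [hy0, mul_zero, add_zero] at k1
  have := (hF.form_bounds hb hu).2
  rw [hy0, k1, (hon p).1] at this
  norm_num at this

/-- For each sign of κ(κ + 1) the system cs' = -κ(κ + 1) sn, sn' = cs has an elementary solution.
The corresponding type is established and the other two are excluded, which gives all equivalences
together. -/
theorem IsMagneticFrame.types (hF : IsMagneticFrame I F κ) [T2Space M] [Nonempty M]
    {X : ∀ q : M, TangentSpace I q} {h : M → ℝ}
    (hh : ContMDiff I 𝓘(ℝ) ∞ h) (h0 : ∀ p, h p ≠ 0) (hX : ∀ p, X p = h p • F 1 p)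
    (hφ : IsFlow I X φ) (hC : 0 < C) (hhC : ∀ p, C⁻¹ ≤ |h p| ∧ |h p| ≤ C)
    (hb : ∀ p x y, C⁻¹ * (x ^ 2 + y ^ 2) ≤
        b.form p (x • F 0 p + y • F 2 p) (x • F 0 p + y • F 2 p) ∧
      b.form p (x • F 0 p + y • F 2 p) (x • F 0 p + y • F 2 p) ≤ C * (x ^ 2 + y ^ 2)) :
    (IsElliptic b φ ↔ 0 < κ * (κ + 1)) ∧
    (IsGenuineParabolic (frameSpan F {0, 1}) b φ ↔ κ * (κ + 1) = 0) ∧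
    (IsGenuineHyperbolic (frameSpan F {0, 1}) b φ ↔ κ * (κ + 1) < 0) := by
  rcases lt_trichotomy (κ * (κ + 1)) 0 with hK | hK | hK
  · set μ := √(-(κ * (κ + 1))) with hμ
    have hμ0 : 0 < μ := Real.sqrt_pos.2 (by linarith)
    have hμ2 : κ * (κ + 1) = -μ ^ 2 := by rw [hμ, Real.sq_sqrt (by linarith), neg_neg]
    have hd : ∀ t, HasDerivAt (fun t => μ * t) μ t := fun t => by
      simpa using (hasDerivAt_id t).const_mul μ
    obtain ⟨σ, τ, hr⟩ := exists_isReparametrizedFlow hF hh h0 hX hφ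
      (cs := fun t => Real.cosh (μ * t)) (sn := fun t => Real.sinh (μ * t) / μ)
      (fun t => (hd t).cosh.congr_deriv (by rw [hμ2]; field_simp))
      (fun t => ((hd t).sinh.div_const μ).congr_deriv (by field_simp)) (by simp) (by simp) hhC
    have hH := hr.isGenuineHyperbolic hμ0 hμ2 hC hb
    exact ⟨iff_of_false (fun hE => not_isGenuineHyperbolic_of_isElliptic hE hr.mem hH) hK.not_gt,
      iff_of_false (hr.not_isGenuineParabolic_of_neg hμ0 hμ2 hC hb) hK.ne, iff_of_true hH hK⟩
  · obtain ⟨σ, τ, hr⟩ := exists_isReparametrizedFlow hF hh h0 hX hφ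
      (cs := fun _ => 1) (sn := fun t => t)
      (fun t => (hasDerivAt_const t 1).congr_deriv (by rw [hK]; ring))
      (fun t => hasDerivAt_id t) rfl rfl hhC
    have hP := hr.isGenuineParabolic hC hK hb
    exact ⟨iff_of_false (fun hE => not_isGenuineParabolic_of_isElliptic hr.mem hE hP) hK.not_gt,
      iff_of_true hP hK, iff_of_false (hr.not_isGenuineHyperbolic_of_eq_zero hC hK hb) hK.not_lt⟩
  · set μ := √(κ * (κ + 1)) with hμ
    have hμ0 : 0 < μ := Real.sqrt_pos.2 hK
    have hμ2 : κ * (κ + 1) = μ ^ 2 := by rw [hμ, Real.sq_sqrt hK.le]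
    have hd : ∀ t, HasDerivAt (fun t => μ * t) μ t := fun t => by
      simpa using (hasDerivAt_id t).const_mul μ
    obtain ⟨σ, τ, hr⟩ := exists_isReparametrizedFlow hF hh h0 hX hφ
      (cs := fun t => Real.cos (μ * t)) (sn := fun t => Real.sin (μ * t) / μ)
      (fun t => (hd t).cos.congr_deriv (by rw [hμ2]; field_simp))
      (fun t => ((hd t).sin.div_const μ).congr_deriv (by field_simp)) (by simp) (by simp) hhC
    have hE := hr.isElliptic hC hK hb
    exact ⟨iff_of_true hE hK, iff_of_false (not_isGenuineParabolic_of_isElliptic hr.mem hE) hK.ne',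
      iff_of_false (not_isGenuineHyperbolic_of_isElliptic hE hr.mem) hK.not_gt⟩

end HyperbolicType

/-! ### Structure equations of an orthonormal frame on the surface -/

section SurfaceGeometry

variable {S : Type*} [TopologicalSpace S] [ChartedSpace (EuclideanSpace ℝ (Fin 2)) S]
  [IsManifold (𝓡 2) ∞ S] [RiemannianBundle (fun x : S => TangentSpace (𝓡 2) x)]
  {o : SurfaceOrientation S} {e : ∀ x : S, TangentSpace (𝓡 2) x} {x : S} {κ : ℝ}

/-- `e` is a smooth unit vector field near `x`. -/
def IsLocalUnitField (e : ∀ x : S, TangentSpace (𝓡 2) x) (x : S) : Prop :=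
  ∀ᶠ y in 𝓝 x, ContMDiffAt (𝓡 2) (𝓡 2).tangent ∞
    (fun y : S => (⟨y, e y⟩ : TangentBundle (𝓡 2) S)) y ∧ ‖e y‖ = 1

theorem SurfaceOrientation.inner_J_left (o : SurfaceOrientation S) {x : S}
    (u : TangentSpace (𝓡 2) x) : inner ℝ (o.J x u) u = 0 := by
  rw [real_inner_comm, o.inner_J_self]

namespace IsLocalUnitField

theorem contMDiffAt (he : IsLocalUnitField e x) : ContMDiffAt (𝓡 2) (𝓡 2).tangent ∞
    (fun y : S => (⟨y, e y⟩ : TangentBundle (𝓡 2) S)) x :=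
  he.self_of_nhds.1

theorem norm_eq (he : IsLocalUnitField e x) : ‖e x‖ = 1 := he.self_of_nhds.2

theorem inner_self (he : IsLocalUnitField e x) : (inner ℝ (e x) (e x) : ℝ) = 1 := by
  rw [real_inner_self_eq_norm_sq, he.norm_eq, one_pow]

theorem eventually (he : IsLocalUnitField e x) : ∀ᶠ y in 𝓝 x, IsLocalUnitField e y :=
  Filter.Eventually.eventually_nhds he

theorem rotate (o : SurfaceOrientation S) (he : IsLocalUnitField e x) :
    IsLocalUnitField (fun y => o.J y (e y)) x := by
  filter_upwards [he] with y hy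
  exact ⟨o.contMDiff_J.contMDiffAt.comp y hy.1, by rw [o.norm_J, hy.2]⟩

theorem mdifferentiableAt (he : IsLocalUnitField e x) : MDifferentiableAt (𝓡 2) (𝓡 2).tangent
    (fun y : S => (⟨y, e y⟩ : TangentBundle (𝓡 2) S)) x :=
  he.contMDiffAt.mdifferentiableAt (by simp)

end IsLocalUnitField

variable [IsContMDiffRiemannianBundle (𝓡 2) ∞ (EuclideanSpace ℝ (Fin 2))
  (fun x : S => TangentSpace (𝓡 2) x)]

/-- The connection form of the orthonormal frame `e`, `J e`. -/
noncomputable def frameForm (o : SurfaceOrientation S) (e : ∀ x : S, TangentSpace (𝓡 2) x) (x : S)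
    (u : TangentSpace (𝓡 2) x) : ℝ :=
  inner ℝ (o.J x (e x)) (leviCivita (I := 𝓡 2) e x u)

theorem mvfderiv_const_apply {g : S → ℝ} {c : ℝ} (h : ∀ᶠ y in 𝓝 x, g y = c)
    (u : TangentSpace (𝓡 2) x) : mvfderiv (𝓡 2) g x u = 0 := by
  have : mvfderiv (𝓡 2) g x = mvfderiv (𝓡 2) (fun _ => c) x := mvfderiv_congr_of_eventuallyEq h
  rw [this, mvfderiv_const]
  rfl

theorem frameForm_add (o : SurfaceOrientation S) (e : ∀ x : S, TangentSpace (𝓡 2) x) (x : S)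
    (u v : TangentSpace (𝓡 2) x) : frameForm o e x (u + v) = frameForm o e x u + frameForm o e x v := by
  rw [frameForm, map_add, inner_add_right]
  rfl

theorem frameForm_smul (o : SurfaceOrientation S) (e : ∀ x : S, TangentSpace (𝓡 2) x) (x : S)
    (c : ℝ) (u : TangentSpace (𝓡 2) x) : frameForm o e x (c • u) = c * frameForm o e x u := by
  rw [frameForm, map_smul, real_inner_smul_right]
  rfl

namespace IsLocalUnitField

/-- Differentiating ⟨e, e⟩ = 1 leaves only the component along J e. -/
theorem leviCivita_eq (he : IsLocalUnitField e x) (u : TangentSpace (𝓡 2) x) :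
    leviCivita (I := 𝓡 2) e x u = frameForm o e x u • o.J x (e x) := by
  have h := leviCivita_metric he.mdifferentiableAt he.mdifferentiableAt u
  have h0 : mvfderiv (𝓡 2) (fun y => (inner ℝ (e y) (e y) : ℝ)) x u = 0 :=
    mvfderiv_const_apply (he.eventually.mono fun y hy => hy.inner_self) u
  rw [h0, real_inner_comm (e x)] at h
  have h1 : (inner ℝ (e x) (leviCivita (I := 𝓡 2) e x u) : ℝ) = 0 := by linarith
  conv_lhs => rw [o.expand he.norm_eq (leviCivita (I := 𝓡 2) e x u), h1, zero_smul, zero_add]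
  rfl

theorem leviCivita_rotate (he : IsLocalUnitField e x) (u : TangentSpace (𝓡 2) x) :
    leviCivita (I := 𝓡 2) (fun y => o.J y (e y)) x u = -(frameForm o e x u • e x) := by
  have hJ := he.rotate o
  have h := leviCivita_metric he.mdifferentiableAt hJ.mdifferentiableAt u
  have h0 : mvfderiv (𝓡 2) (fun y => (inner ℝ (e y) (o.J y (e y)) : ℝ)) x u = 0 :=
    mvfderiv_const_apply (Eventually.of_forall fun y => o.inner_J_self (e y)) u
  rw [h0, real_inner_comm (o.J x (e x))] at h
  rw [hJ.leviCivita_eq (o := o), o.J_J, smul_neg]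
  congr 2
  rw [frameForm, o.J_J, inner_neg_left, frameForm]
  linarith

theorem bracket_rotate (he : IsLocalUnitField e x) :
    mlieBracket (𝓡 2) e (fun y => o.J y (e y)) x =
      -(frameForm o e x (e x) • e x) - frameForm o e x (o.J x (e x)) • o.J x (e x) := by
  have hJ := he.rotate o
  have h := (CovariantDerivative.torsion_eq_zero_iff _).1 (leviCivita_torsion (I := 𝓡 2) (S := S))
    he.mdifferentiableAt hJ.mdifferentiableAt
  rw [← h, he.leviCivita_rotate, he.leviCivita_eq (o := o)]

theorem contMDiffAt_inner {e' : ∀ x : S, TangentSpace (𝓡 2) x}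
    (h : ContMDiffAt (𝓡 2) (𝓡 2).tangent ∞ (fun y : S => (⟨y, e y⟩ : TangentBundle (𝓡 2) S)) x)
    (h' : ContMDiffAt (𝓡 2) (𝓡 2).tangent ∞ (fun y : S => (⟨y, e' y⟩ : TangentBundle (𝓡 2) S)) x) :
    ContMDiffAt (𝓡 2) 𝓘(ℝ) ∞ (fun y => (inner ℝ (e y) (e' y) : ℝ)) x :=
  ContMDiffAt.inner_bundle (E := fun x : S => TangentSpace (𝓡 2) x) (b := fun y => y) h h'

theorem contMDiffAt_bracket (o : SurfaceOrientation S) (he : IsLocalUnitField e x) :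
    ContMDiffAt (𝓡 2) (𝓡 2).tangent ∞
      (fun y : S => (⟨y, mlieBracket (𝓡 2) e (fun y => o.J y (e y)) y⟩ : TangentBundle (𝓡 2) S)) x :=
  haveI : IsManifold (𝓡 2) (minSmoothness ℝ 2) S :=
    IsManifold.of_le (n := ∞) (by simpa using two_le_infty)
  haveI : IsManifold (𝓡 2) (((⊤ : ℕ∞) : WithTop ℕ∞) + 1) S := by
    simpa using ‹IsManifold (𝓡 2) ∞ S›
  ContMDiffAt.mlieBracket_vectorField (m := ⊤) (n := ⊤) he.contMDiffAt (he.rotate o).contMDiffAt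
    (by simp)

/-- By torsion-freeness the connection coefficient is minus the inner product of [e, J e] with e, so
its smoothness is that of a bracket of smooth fields. -/
theorem contMDiffAt_frameForm (he : IsLocalUnitField e x) :
    ContMDiffAt (𝓡 2) 𝓘(ℝ) ∞ (fun y => frameForm o e y (e y)) x := by
  refine (contMDiffAt_inner (he.contMDiffAt_bracket o) he.contMDiffAt).neg.congr_of_eventuallyEq ?_
  filter_upwards [he.eventually] with y hy
  rw [hy.bracket_rotate, inner_sub_left, inner_neg_left, real_inner_smul_left,
    real_inner_smul_left, hy.inner_self, o.inner_J_left]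
  ring

theorem contMDiffAt_frameForm_rotate (he : IsLocalUnitField e x) :
    ContMDiffAt (𝓡 2) 𝓘(ℝ) ∞ (fun y => frameForm o e y (o.J y (e y))) x := by
  refine (contMDiffAt_inner (he.contMDiffAt_bracket o)
    (he.rotate o).contMDiffAt).neg.congr_of_eventuallyEq ?_
  filter_upwards [he.eventually] with y hy
  rw [hy.bracket_rotate, inner_sub_left, inner_neg_left, real_inner_smul_left,
    real_inner_smul_left, o.inner_J_self, o.inner_J, hy.inner_self]
  ring

theorem leviCivita_congr {s s' : ∀ x : S, TangentSpace (𝓡 2) x} (h : ∀ᶠ y in 𝓝 x, s y = s' y)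
    (hs : MDifferentiableAt (𝓡 2) (𝓡 2).tangent
      (fun y : S => (⟨y, s y⟩ : TangentBundle (𝓡 2) S)) x) :
    leviCivita (I := 𝓡 2) s x = leviCivita (I := 𝓡 2) s' x := by
  refine IsCovariantDerivativeOn.congr_of_eventuallyEq
    ((leviCivita (I := 𝓡 2) (S := S)).isCovariantDerivativeOn (s := univ)) hs ?_ univ_mem h
  refine hs.congr_of_eventuallyEq ?_
  filter_upwards [h] with y hy
  rw [hy]

/-- The J e-component of R(e, J e) e = -κ J e: the iterated derivatives contribute the derivatives
of the two connection coefficients, and the derivative along [e, J e] contributes their squares. -/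
theorem curvature (hκ : HasConstantCurvature S κ) (he : IsLocalUnitField e x) :
    mvfderiv (𝓡 2) (fun y => frameForm o e y (e y)) x (o.J x (e x)) -
      mvfderiv (𝓡 2) (fun y => frameForm o e y (o.J y (e y))) x (e x) =
    κ + frameForm o e x (e x) ^ 2 + frameForm o e x (o.J x (e x)) ^ 2 := by
  have hJ := he.rotate o
  have h := hκ x e (fun y => o.J y (e y)) e he.contMDiffAt hJ.contMDiffAt he.contMDiffAt
  have d1 := he.contMDiffAt_frameForm (o := o) |>.mdifferentiableAt (by simp)
  have d2 := he.contMDiffAt_frameForm_rotate (o := o) |>.mdifferentiableAt (by simp)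
  have key : ∀ {f : S → ℝ} (_ : MDifferentiableAt (𝓡 2) 𝓘(ℝ) f x)
      {s : ∀ x : S, TangentSpace (𝓡 2) x} (_ : ∀ᶠ y in 𝓝 x, s y = f y • o.J y (e y))
      (u : TangentSpace (𝓡 2) x), leviCivita (I := 𝓡 2) s x u =
        -(f x * frameForm o e x u) • e x + mvfderiv (𝓡 2) f x u • o.J x (e x) := by
    intro f hf s hs u
    have hfs := hf.smul_section hJ.mdifferentiableAt
    have e1 : leviCivita (I := 𝓡 2) s x = leviCivita (I := 𝓡 2) (f • fun y => o.J y (e y)) x :=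
      (leviCivita_congr (hs.mono fun y h => h.symm) hfs).symm
    have e2 : leviCivita (I := 𝓡 2) (f • fun y => o.J y (e y)) x =
      f x • leviCivita (I := 𝓡 2) (fun y => o.J y (e y)) x +
        (mvfderiv (𝓡 2) f x).smulRight (o.J x (e x)) :=
      leviCivitaFun_leibniz hJ.mdifferentiableAt hf
    rw [e1, e2]
    change f x • leviCivita (I := 𝓡 2) (fun y => o.J y (e y)) x u +
      mvfderiv (𝓡 2) f x u • o.J x (e x) = _
    rw [he.leviCivita_rotate]
    module
  rw [key d2 (he.eventually.mono fun y hy => hy.leviCivita_eq _),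
    key d1 (he.eventually.mono fun y hy => hy.leviCivita_eq _),
    he.leviCivita_eq (o := o) (mlieBracket (𝓡 2) e (fun y => o.J y (e y)) x), he.bracket_rotate,
    o.inner_J_left, he.inner_self] at h
  have h' := congrArg (fun v => (inner ℝ (o.J x (e x)) v : ℝ)) h
  have n1 : (inner ℝ (o.J x (e x)) (e x) : ℝ) = 0 := o.inner_J_left _
  have n2 : (inner ℝ (o.J x (e x)) (o.J x (e x)) : ℝ) = 1 := by rw [o.inner_J, he.inner_self]
  have e3 : ∀ a b : ℝ, frameForm o e x (-(a • e x) - b • o.J x (e x)) =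
      -a * frameForm o e x (e x) - b * frameForm o e x (o.J x (e x)) := by
    intro a b
    rw [sub_eq_add_neg, ← neg_smul, ← neg_smul, frameForm_add, frameForm_smul, frameForm_smul]
    ring
  simp only [e3, inner_sub_right, inner_add_right, real_inner_smul_right, n1, n2] at h'
  linear_combination -h'

end IsLocalUnitField

theorem UnitTangent.isLocalUnitField_frame {v₀ : TangentBundle (𝓡 2) S} (h₀ : ‖v₀.2‖ = 1)
    {x : S} (hx : x ∈ (chartAt (EuclideanSpace ℝ (Fin 2)) v₀.1).source) :
    IsLocalUnitField (UnitTangent.frame v₀) x := by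
  have ho := (chartAt (EuclideanSpace ℝ (Fin 2)) v₀.1).open_source
  filter_upwards [ho.mem_nhds hx] with y hy
  exact ⟨(UnitTangent.contMDiffOn_frame h₀).contMDiffAt (ho.mem_nhds hy),
    UnitTangent.norm_frame h₀ hy⟩

end SurfaceGeometry

/-! ### Product coordinates and invertibility by dimension -/

section CoordinateMaps

variable {E : Type*} [NormedAddCommGroup E] [NormedSpace ℝ E]
  {H : Type*} [TopologicalSpace H] {I : ModelWithCorners ℝ E H}
  {M : Type*} [TopologicalSpace M] [ChartedSpace H M]
  {F : Type*} [NormedAddCommGroup F] [NormedSpace ℝ F]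
  {G : Type*} [NormedAddCommGroup G] [NormedSpace ℝ G]

theorem mvfderiv_prodMk_space_apply {f : M → F} {g : M → G} {x : M}
    (hf : ContMDiffAt I 𝓘(ℝ, F) ∞ f x) (hg : ContMDiffAt I 𝓘(ℝ, G) ∞ g x)
    (ξ : TangentSpace I x) :
    mvfderiv I (fun y => (f y, g y)) x ξ = (mvfderiv I f x ξ, mvfderiv I g x ξ) := by
  have h : MDifferentiableAt I 𝓘(ℝ, F × G) (fun y => (f y, g y)) x :=
    (hf.prodMk_space hg).mdifferentiableAt (by simp)
  refine Prod.ext ?_ ?_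
  · have := mvfderiv_comp_fderiv_apply (g := (Prod.fst : F × G → F)) x differentiableAt_fst h ξ
    rw [fderiv_fst] at this
    exact this.symm
  · have := mvfderiv_comp_fderiv_apply (g := (Prod.snd : F × G → G)) x differentiableAt_snd h ξ
    rw [fderiv_snd] at this
    exact this.symm

theorem isInvertible_of_ker_eq_bot {V W : Type*} [AddCommGroup V] [Module ℝ V] [TopologicalSpace V]
    [IsTopologicalAddGroup V] [ContinuousSMul ℝ V] [T2Space V] [FiniteDimensional ℝ V]
    [AddCommGroup W] [Module ℝ W] [TopologicalSpace W]
    [IsTopologicalAddGroup W] [ContinuousSMul ℝ W] [T2Space W] [FiniteDimensional ℝ W]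
    (hd : Module.finrank ℝ V = Module.finrank ℝ W) {L : V →L[ℝ] W} (h : ∀ ξ, L ξ = 0 → ξ = 0) :
    L.IsInvertible := by
  have hinj : Function.Injective L.toLinearMap := (injective_iff_map_eq_zero _).2 h
  refine ⟨(LinearMap.linearEquivOfInjective L.toLinearMap hinj hd).toContinuousLinearEquiv, ?_⟩
  ext ξ
  rfl

end CoordinateMaps

/-! ### Angle coordinate and connection form on the unit tangent bundle -/

section UnitTangentGeometry

variable {S : Type*} [TopologicalSpace S] [ChartedSpace (EuclideanSpace ℝ (Fin 2)) S]
  [IsManifold (𝓡 2) ∞ S] [RiemannianBundle (fun x : S => TangentSpace (𝓡 2) x)]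
  [IsContMDiffRiemannianBundle (𝓡 2) ∞ (EuclideanSpace ℝ (Fin 2))
    (fun x : S => TangentSpace (𝓡 2) x)] {o : SurfaceOrientation S}

namespace UnitTangent

variable {v w : UnitTangent o}

theorem contMDiff_foot : ContMDiff unitModel (𝓡 2) ∞ fun w : UnitTangent o => w.val.1 :=
  (contMDiff_proj (fun x : S => TangentSpace (𝓡 2) x)).comp contMDiff_val

/-- The cosine of the angle from the local unit field at `v`. -/
noncomputable def cosAngle (v w : UnitTangent o) : ℝ := inner ℝ (frame v.val w.val.1) w.val.2

/-- The sine of the angle from the local unit field at `v`. -/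
noncomputable def sinAngle (v w : UnitTangent o) : ℝ :=
  inner ℝ (o.J w.val.1 (frame v.val w.val.1)) w.val.2

/-- The angle from the local unit field at `v`. -/
noncomputable def angle (v w : UnitTangent o) : ℝ :=
  2 * Real.arctan (sinAngle v w / (1 + cosAngle v w))

theorem mem_source_iff : w ∈ (unitChart v).source ↔
    w.val.1 ∈ (chartAt (EuclideanSpace ℝ (Fin 2)) v.val.1).source ∧ 1 + cosAngle v w ≠ 0 :=
  Iff.rfl

theorem mem_source_self (v : UnitTangent o) : v ∈ (unitChart v).source :=
  mem_chart_source (EuclideanSpace ℝ (Fin 2) × ℝ) v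

theorem eq_combination (hw : w.val.1 ∈ (chartAt (EuclideanSpace ℝ (Fin 2)) v.val.1).source) :
    w.val.2 = cosAngle v w • frame v.val w.val.1 +
      sinAngle v w • o.J w.val.1 (frame v.val w.val.1) :=
  o.expand (norm_frame v.norm_val hw) w.val.2

theorem cosAngle_sq_add (hw : w.val.1 ∈ (chartAt (EuclideanSpace ℝ (Fin 2)) v.val.1).source) :
    cosAngle v w ^ 2 + sinAngle v w ^ 2 = 1 := by
  have hn : (inner ℝ w.val.2 w.val.2 : ℝ) = 1 := by
    rw [real_inner_self_eq_norm_sq, w.norm_val, one_pow]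
  have he : (inner ℝ (frame v.val w.val.1) (frame v.val w.val.1) : ℝ) = 1 := by
    rw [real_inner_self_eq_norm_sq, norm_frame v.norm_val hw, one_pow]
  rw [eq_combination (v := v) hw] at hn
  simp only [inner_add_left, inner_add_right, real_inner_smul_left, real_inner_smul_right,
    o.inner_J, o.inner_J_self, o.inner_J_left, he] at hn
  linear_combination hn

theorem one_add_sq_div {c s : ℝ} (h : c ^ 2 + s ^ 2 = 1) (hc : 1 + c ≠ 0) :
    1 + (s / (1 + c)) ^ 2 = 2 / (1 + c) := by
  field_simp
  linear_combination h

/-- The half-angle formula: sin / (1 + cos), the fibre coordinate of the charts, is the tangent of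
half the angle. -/
theorem cos_angle (hw : w ∈ (unitChart v).source) : Real.cos (angle v w) = cosAngle v w := by
  obtain ⟨h1, h2⟩ := mem_source_iff.1 hw
  have h := cosAngle_sq_add h1
  rw [angle, Real.cos_two_mul, Real.cos_sq_arctan, one_add_sq_div h h2]
  field_simp
  ring

theorem sin_angle (hw : w ∈ (unitChart v).source) : Real.sin (angle v w) = sinAngle v w := by
  obtain ⟨h1, h2⟩ := mem_source_iff.1 hw
  have h := cosAngle_sq_add h1
  have e : Real.sin (Real.arctan (sinAngle v w / (1 + cosAngle v w))) =
      sinAngle v w / (1 + cosAngle v w) *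
        Real.cos (Real.arctan (sinAngle v w / (1 + cosAngle v w))) := by
    rw [← Real.tan_mul_cos (Real.cos_arctan_pos _).ne', Real.tan_arctan]
  rw [angle, Real.sin_two_mul, e, mul_assoc, mul_assoc, ← sq, Real.cos_sq_arctan,
    one_add_sq_div h h2]
  field_simp

theorem source_mem_nhds (hw : w ∈ (unitChart v).source) : (unitChart v).source ∈ 𝓝 w :=
  (unitChart v).open_source.mem_nhds hw

theorem contMDiffAt_cosAngle (hw : w ∈ (unitChart v).source) :
    ContMDiffAt unitModel 𝓘(ℝ) ∞ (cosAngle v) w := by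
  have hU : IsOpen {v' : TangentBundle (𝓡 2) S |
      v'.1 ∈ (chartAt (EuclideanSpace ℝ (Fin 2)) v.val.1).source} :=
    (chartAt (EuclideanSpace ℝ (Fin 2)) v.val.1).open_source.preimage
      (contMDiff_proj (IB := 𝓡 2) (n := ∞) (fun x : S => TangentSpace (𝓡 2) x)).continuous
  exact ((contMDiffOn_inner_frame v.norm_val).contMDiffAt (hU.mem_nhds hw.1)).comp w
    contMDiff_val.contMDiffAt

theorem contMDiffAt_sinAngle (hw : w ∈ (unitChart v).source) :
    ContMDiffAt unitModel 𝓘(ℝ) ∞ (sinAngle v) w := by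
  have hU : IsOpen {v' : TangentBundle (𝓡 2) S |
      v'.1 ∈ (chartAt (EuclideanSpace ℝ (Fin 2)) v.val.1).source} :=
    (chartAt (EuclideanSpace ℝ (Fin 2)) v.val.1).open_source.preimage
      (contMDiff_proj (IB := 𝓡 2) (n := ∞) (fun x : S => TangentSpace (𝓡 2) x)).continuous
  exact ((contMDiffOn_inner_J_frame o v.norm_val).contMDiffAt (hU.mem_nhds hw.1)).comp w
    contMDiff_val.contMDiffAt

theorem contMDiffAt_quotient (hw : w ∈ (unitChart v).source) :
    ContMDiffAt unitModel 𝓘(ℝ) ∞ (fun w => sinAngle v w / (1 + cosAngle v w)) w :=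
  (contMDiffAt_sinAngle hw).div₀ (contMDiffAt_const.add (contMDiffAt_cosAngle hw))
    (mem_source_iff.1 hw).2

theorem contMDiffAt_angle (hw : w ∈ (unitChart v).source) :
    ContMDiffAt unitModel 𝓘(ℝ) ∞ (angle v) w :=
  contMDiffAt_const.mul
    (Real.contDiff_arctan.contMDiff.contMDiffAt.comp w (contMDiffAt_quotient hw))

theorem contMDiffAt_chart_foot (hw : w ∈ (unitChart v).source) :
    ContMDiffAt unitModel 𝓘(ℝ, EuclideanSpace ℝ (Fin 2)) ∞
      (fun w : UnitTangent o => chartAt (EuclideanSpace ℝ (Fin 2)) v.val.1 w.val.1) w :=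
  ((contMDiffOn_chart (I := 𝓡 2) (n := ∞) (x := v.val.1)).contMDiffAt
    ((chartAt (EuclideanSpace ℝ (Fin 2)) v.val.1).open_source.mem_nhds hw.1)).comp w
    contMDiff_foot.contMDiffAt

theorem mvfderiv_comp_foot {F : Type*} [NormedAddCommGroup F] [NormedSpace ℝ F] {h : S → F}
    (hh : MDifferentiableAt (𝓡 2) 𝓘(ℝ, F) h w.val.1) (ξ : TangentSpace unitModel w) :
    mvfderiv unitModel (fun w : UnitTangent o => h w.val.1) w ξ =
      mvfderiv (𝓡 2) h w.val.1 (footDeriv w ξ) :=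
  mvfderiv_comp_mfderiv_apply (g := h) w hh (contMDiff_foot.contMDiffAt.mdifferentiableAt (by simp))
    ξ

theorem mdifferentiableAt_comp_foot {F : Type*} [NormedAddCommGroup F] [NormedSpace ℝ F]
    {h : S → F} (hh : MDifferentiableAt (𝓡 2) 𝓘(ℝ, F) h w.val.1) :
    MDifferentiableAt unitModel 𝓘(ℝ, F) (fun w : UnitTangent o => h w.val.1) w :=
  MDifferentiableAt.comp (g := h) w hh (contMDiff_foot.contMDiffAt.mdifferentiableAt (by simp))

theorem mvfderiv_chart_foot (hw : w ∈ (unitChart v).source) (ξ : TangentSpace unitModel w) :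
    mvfderiv unitModel
      (fun w : UnitTangent o => chartAt (EuclideanSpace ℝ (Fin 2)) v.val.1 w.val.1) w ξ =
    mvfderiv (𝓡 2) (chartAt (EuclideanSpace ℝ (Fin 2)) v.val.1) w.val.1 (footDeriv w ξ) :=
  mvfderiv_comp_foot (((contMDiffOn_chart (I := 𝓡 2) (n := ∞) (x := v.val.1)).contMDiffAt
      ((chartAt (EuclideanSpace ℝ (Fin 2)) v.val.1).open_source.mem_nhds hw.1)).mdifferentiableAt
      (by simp)) ξ

theorem mvfderiv_sinAngle (hw : w ∈ (unitChart v).source) (ξ : TangentSpace unitModel w) :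
    mvfderiv unitModel (sinAngle v) w ξ = cosAngle v w * mvfderiv unitModel (angle v) w ξ := by
  have h : sinAngle v =ᶠ[𝓝 w] Real.sin ∘ angle v := by
    filter_upwards [source_mem_nhds hw] with w' hw' using (sin_angle hw').symm
  rw [mvfderiv_congr_of_eventuallyEq h, mvfderiv_comp_fderiv_apply w Real.differentiableAt_sin
    ((contMDiffAt_angle hw).mdifferentiableAt (by simp)), fderiv_eq_smul_deriv, Real.deriv_sin,
    cos_angle hw, smul_eq_mul, mul_comm]

theorem mvfderiv_cosAngle (hw : w ∈ (unitChart v).source) (ξ : TangentSpace unitModel w) :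
    mvfderiv unitModel (cosAngle v) w ξ = -(sinAngle v w * mvfderiv unitModel (angle v) w ξ) := by
  have h : cosAngle v =ᶠ[𝓝 w] Real.cos ∘ angle v := by
    filter_upwards [source_mem_nhds hw] with w' hw' using (cos_angle hw').symm
  rw [mvfderiv_congr_of_eventuallyEq h, mvfderiv_comp_fderiv_apply w Real.differentiableAt_cos
    ((contMDiffAt_angle hw).mdifferentiableAt (by simp)), fderiv_eq_smul_deriv, Real.deriv_cos,
    sin_angle hw, smul_eq_mul, mul_neg, mul_comm]

/-- The angle is a function with nowhere vanishing derivative of the fibre coordinate of the chart,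
so foot point and angle together determine a tangent vector just as the chart does. -/
theorem eq_zero_of_mvfderiv_angleCoord (hw : w ∈ (unitChart v).source)
    {ξ : TangentSpace unitModel w} (h1 : footDeriv w ξ = 0)
    (h2 : mvfderiv unitModel (angle v) w ξ = 0) : ξ = 0 := by
  have hd := (contMDiffAt_quotient hw).mdifferentiableAt (n := ∞) (by simp)
  have e2 : mvfderiv unitModel (fun w => sinAngle v w / (1 + cosAngle v w)) w ξ = 0 := by
    have e := mvfderiv_comp_fderiv_apply (g := fun u : ℝ => 2 * Real.arctan u) w
      ((Real.differentiableAt_arctan _).const_mul 2) hd ξ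
    have e' : mvfderiv unitModel ((fun u : ℝ => 2 * Real.arctan u) ∘
        fun w => sinAngle v w / (1 + cosAngle v w)) w ξ = 0 := h2
    rw [e', fderiv_eq_smul_deriv, deriv_const_mul _ (Real.differentiableAt_arctan _),
      Real.deriv_arctan] at e
    have hpos : 2 * (1 / (1 + (sinAngle v w / (1 + cosAngle v w)) ^ 2)) ≠ 0 := by positivity
    exact (mul_eq_zero.1 e.symm).resolve_right hpos
  have e1 := mvfderiv_chart_foot hw ξ
  rw [h1, map_zero] at e1
  have e := mvfderiv_prodMk_space_apply (contMDiffAt_chart_foot hw) (contMDiffAt_quotient hw) ξ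
  rw [e1, e2] at e
  obtain ⟨L, hL⟩ := isInvertible_mfderiv_extChartAt (I := unitModel) (x := v) (y := w)
    (by rw [extChartAt_source]; exact hw)
  have e' : L ξ = 0 := (congrArg (fun T : TangentSpace unitModel w →L[ℝ] _ => T ξ) hL).trans e
  exact (map_eq_zero_iff L L.injective).1 e'

theorem frame_self_apply (w : UnitTangent o) : frame w.val w.val.1 = w.val.2 :=
  frame_self w.norm_val

theorem _root_.IsLocalUnitField.leviCivita_combination {e f : ∀ x : S, TangentSpace (𝓡 2) x}
    {x : S} {a b : S → ℝ} (he : IsLocalUnitField e x) (hf : IsLocalUnitField f x)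
    (ma : MDifferentiableAt (𝓡 2) 𝓘(ℝ) a x) (mb : MDifferentiableAt (𝓡 2) 𝓘(ℝ) b x)
    (hfe : ∀ᶠ y in 𝓝 x, f y = a y • e y + b y • o.J y (e y)) (u : TangentSpace (𝓡 2) x) :
    leviCivita (I := 𝓡 2) f x u =
      (mvfderiv (𝓡 2) a x u - b x * frameForm o e x u) • e x +
      (mvfderiv (𝓡 2) b x u + a x * frameForm o e x u) • o.J x (e x) := by
  have hJe := he.rotate o
  have e1 : leviCivita (I := 𝓡 2) f x =
      leviCivita (I := 𝓡 2) (a • e + b • fun y => o.J y (e y)) x :=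
    IsLocalUnitField.leviCivita_congr hfe hf.mdifferentiableAt
  have e2 : leviCivita (I := 𝓡 2) (a • e + b • fun y => o.J y (e y)) x =
      leviCivita (I := 𝓡 2) (a • e) x + leviCivita (I := 𝓡 2) (b • fun y => o.J y (e y)) x :=
    leviCivitaFun_add (ma.smul_section he.mdifferentiableAt)
      (mb.smul_section hJe.mdifferentiableAt)
  have e3 : leviCivita (I := 𝓡 2) (a • e) x = a x • leviCivita (I := 𝓡 2) e x +
      (mvfderiv (𝓡 2) a x).smulRight (e x) := leviCivitaFun_leibniz he.mdifferentiableAt ma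
  have e4 : leviCivita (I := 𝓡 2) (b • fun y => o.J y (e y)) x =
      b x • leviCivita (I := 𝓡 2) (fun y => o.J y (e y)) x +
      (mvfderiv (𝓡 2) b x).smulRight (o.J x (e x)) :=
    leviCivitaFun_leibniz hJe.mdifferentiableAt mb
  rw [e1, e2, e3, e4]
  change (a x • leviCivita (I := 𝓡 2) e x u + mvfderiv (𝓡 2) a x u • e x) +
    (b x • leviCivita (I := 𝓡 2) (fun y => o.J y (e y)) x u +
    mvfderiv (𝓡 2) b x u • o.J x (e x)) = _
  rw [he.leviCivita_eq (o := o), he.leviCivita_rotate (o := o)]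
  module

/-- The derivative of the first summand of the connection form. -/
theorem mvfderiv_inner_rotate {e f : ∀ x : S, TangentSpace (𝓡 2) x} {a b : S → ℝ}
    (he : e = frame v.val) (hw : w ∈ (unitChart v).source)
    (ma : MDifferentiableAt (𝓡 2) 𝓘(ℝ) a w.val.1) (mb : MDifferentiableAt (𝓡 2) 𝓘(ℝ) b w.val.1)
    (hfe : ∀ᶠ y in 𝓝 w.val.1, f y = a y • e y + b y • o.J y (e y)) (ξ : TangentSpace unitModel w) :
    mvfderiv unitModel
      (fun u : UnitTangent o => (inner ℝ (o.J u.val.1 (f u.val.1)) u.val.2 : ℝ)) w ξ =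
      (a w.val.1 * mvfderiv unitModel (sinAngle v) w ξ +
        sinAngle v w * mvfderiv (𝓡 2) a w.val.1 (footDeriv w ξ)) -
      (b w.val.1 * mvfderiv unitModel (cosAngle v) w ξ +
        cosAngle v w * mvfderiv (𝓡 2) b w.val.1 (footDeriv w ξ)) := by
  have ms := (contMDiffAt_sinAngle hw).mdifferentiableAt (n := ∞) (by simp)
  have mc := (contMDiffAt_cosAngle hw).mdifferentiableAt (n := ∞) (by simp)
  have mfa := mdifferentiableAt_comp_foot ma
  have mfb := mdifferentiableAt_comp_foot mb
  have hfun : (fun u : UnitTangent o => (inner ℝ (o.J u.val.1 (f u.val.1)) u.val.2 : ℝ)) =ᶠ[𝓝 w]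
      fun u => a u.val.1 * sinAngle v u - b u.val.1 * cosAngle v u := by
    filter_upwards [(contMDiff_foot (o := o)).continuous.continuousAt.eventually hfe] with u hu
    rw [hu, map_add, map_smul, map_smul, o.J_J, inner_add_left, real_inner_smul_left,
      real_inner_smul_left, inner_neg_left, he]
    change a u.val.1 * sinAngle v u + b u.val.1 * -cosAngle v u = _
    ring
  have mfs : MDifferentiableAt unitModel 𝓘(ℝ) (fun u => a u.val.1 * sinAngle v u) w := mfa.mul ms
  have mfc : MDifferentiableAt unitModel 𝓘(ℝ) (fun u => b u.val.1 * cosAngle v u) w := mfb.mul mc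
  rw [mvfderiv_congr_of_eventuallyEq hfun, mvfderiv_fun_sub mfs mfc, mvfderiv_fun_mul mfa ms,
    mvfderiv_fun_mul mfb mc, ← mvfderiv_comp_foot ma ξ, ← mvfderiv_comp_foot mb ξ]
  rfl

/-- The connection form in terms of the angle from a local unit field. -/
theorem connectionForm_eq (hw : w ∈ (unitChart v).source) (ξ : TangentSpace unitModel w) :
    connectionForm w ξ = mvfderiv unitModel (angle v) w ξ +
      frameForm o (frame v.val) w.val.1 (footDeriv w ξ) := by
  have hx := (mem_source_iff.1 hw).1
  have he : IsLocalUnitField (frame v.val) w.val.1 := isLocalUnitField_frame v.norm_val hx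
  have hf : IsLocalUnitField (frame w.val) w.val.1 :=
    isLocalUnitField_frame w.norm_val (mem_chart_source _ _)
  have hJe := he.rotate o
  set e := frame v.val with he_def
  set f := frame w.val with hf_def
  set x := w.val.1 with hx_def
  let a : S → ℝ := fun y => inner ℝ (e y) (f y)
  let b : S → ℝ := fun y => inner ℝ (o.J y (e y)) (f y)
  have ha : ContMDiffAt (𝓡 2) 𝓘(ℝ) ∞ a x :=
    IsLocalUnitField.contMDiffAt_inner he.contMDiffAt hf.contMDiffAt
  have hb : ContMDiffAt (𝓡 2) 𝓘(ℝ) ∞ b x :=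
    IsLocalUnitField.contMDiffAt_inner hJe.contMDiffAt hf.contMDiffAt
  have hax : a x = cosAngle v w := by
    change inner ℝ (e x) (f x) = inner ℝ (e x) w.val.2
    rw [hf_def, hx_def, frame_self_apply]
  have hbx : b x = sinAngle v w := by
    change inner ℝ (o.J x (e x)) (f x) = inner ℝ (o.J x (e x)) w.val.2
    rw [hf_def, hx_def, frame_self_apply]
  have hfe : ∀ᶠ y in 𝓝 x, f y = a y • e y + b y • o.J y (e y) :=
    he.eventually.mono fun y hy => o.expand hy.norm_eq (f y)
  have ma := ha.mdifferentiableAt (n := ∞) (by simp)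
  have mb := hb.mdifferentiableAt (n := ∞) (by simp)
  -- The connection form at `w` is defined by the field f adapted to `w`, whereas the angle refers
  -- to e. At the base point the coefficients of f are the cosine and sine of the angle of `w`, and
  -- the terms with their derivatives in `d1` and `d2` cancel.
  have d1 := mvfderiv_inner_rotate he_def hw ma mb hfe ξ
  have d2 := he.leviCivita_combination hf ma mb hfe (footDeriv w ξ)
  have hw2 : o.J x w.val.2 = cosAngle v w • o.J x (e x) - sinAngle v w • e x := by
    rw [eq_combination (v := v) hx, map_add, map_smul, map_smul, o.J_J, smul_neg, ← sub_eq_add_neg]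
  have hcs := cosAngle_sq_add hx
  have n1 : (inner ℝ (o.J x (e x)) (e x) : ℝ) = 0 := o.inner_J_left _
  have n2 : (inner ℝ (e x) (o.J x (e x)) : ℝ) = 0 := o.inner_J_self _
  have n3 : (inner ℝ (o.J x (e x)) (o.J x (e x)) : ℝ) = 1 := by rw [o.inner_J, he.inner_self]
  have n4 := he.inner_self
  rw [connectionForm, d1, d2, hw2, mvfderiv_sinAngle hw, mvfderiv_cosAngle hw, hax, hbx]
  simp only [inner_sub_left, inner_add_right, real_inner_smul_left, real_inner_smul_right, n1, n2,
    n3, n4]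
  linear_combination (mvfderiv unitModel (angle v) w ξ +
    frameForm o e x (footDeriv w ξ)) * hcs

end UnitTangent

end UnitTangentGeometry

/-! ### Local angle on the circle -/

section CircleAngle

theorem contMDiff_circle_coe : ContMDiff (𝓡 1) 𝓘(ℝ, ℂ) ∞ fun z : Circle => (z : ℂ) :=
  haveI := finrank_real_complex_fact'
  contMDiff_coe_sphere (E := ℂ)

/-- The points which are not opposite to `z₀`. -/
def circleArc (z₀ : Circle) : Set Circle := {z | ((z * z₀⁻¹ : Circle) : ℂ) ∈ Complex.slitPlane}

/-- A smooth determination of the argument near `z₀`. -/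
noncomputable def circleAngle (z₀ z : Circle) : ℝ :=
  Complex.arg z₀ + Complex.arg ((z * z₀⁻¹ : Circle) : ℂ)

theorem isOpen_circleArc (z₀ : Circle) : IsOpen (circleArc z₀) :=
  Complex.isOpen_slitPlane.preimage
    (contMDiff_circle_coe.continuous.comp (continuous_id.mul continuous_const))

theorem self_mem_circleArc (z₀ : Circle) : z₀ ∈ circleArc z₀ := by
  simp [circleArc]

theorem exp_circleAngle (z₀ z : Circle) : Complex.exp (circleAngle z₀ z * Complex.I) = z := by
  have h : ∀ u : Circle, Complex.exp (Complex.arg u * Complex.I) = u := fun u => by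
    have := Complex.norm_mul_exp_arg_mul_I (u : ℂ)
    rwa [Circle.norm_coe, Complex.ofReal_one, one_mul] at this
  rw [circleAngle, Complex.ofReal_add, add_mul, Complex.exp_add, h, h, Circle.coe_mul, Circle.coe_inv]
  have := Circle.coe_ne_zero z₀
  field_simp

/-- The argument is the imaginary part of the logarithm, which is smooth off the negative real axis;
dividing by `z₀` moves the cut to the point opposite to `z₀`. -/
theorem contMDiffAt_circleAngle {z₀ z : Circle} (hz : z ∈ circleArc z₀) :
    ContMDiffAt (𝓡 1) 𝓘(ℝ) ∞ (circleAngle z₀) z := by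
  have h1 : ContDiffAt ℝ ∞ (fun u : ℂ => Complex.arg z₀ + (Complex.log (u * (z₀⁻¹ : Circle))).im)
      z := by
    have h2 : ContDiffAt ℝ ∞ Complex.log ((z : ℂ) * (z₀⁻¹ : Circle)) :=
      (Complex.contDiffAt_log (by rw [← Circle.coe_mul]; exact hz)).restrict_scalars ℝ
    have h3 : ContDiffAt ℝ ∞ (fun u : ℂ => u * (z₀⁻¹ : Circle)) (z : ℂ) :=
      contDiffAt_id.mul contDiffAt_const
    have h4 : ContDiffAt ℝ ∞ (fun u : ℂ => Complex.imCLM (Complex.log (u * (z₀⁻¹ : Circle))))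
        (z : ℂ) :=
      Complex.imCLM.contDiff.contDiffAt.comp (z : ℂ)
        (ContDiffAt.comp (g := Complex.log) (z : ℂ) h2 h3)
    exact contDiffAt_const.add h4
  refine (h1.contMDiffAt.comp z contMDiff_circle_coe.contMDiffAt).congr_of_eventuallyEq
    (Eventually.of_forall fun u => ?_)
  change circleAngle z₀ u = Complex.arg z₀ + (Complex.log ((u : ℂ) * (z₀⁻¹ : Circle))).im
  rw [Complex.log_im, circleAngle, Circle.coe_mul]

theorem mvfderiv_circle_coe {z₀ z : Circle} (hz : z ∈ circleArc z₀) (ξ : TangentSpace (𝓡 1) z) :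
    mvfderiv (𝓡 1) (fun z : Circle => (z : ℂ)) z ξ =
      (mvfderiv (𝓡 1) (circleAngle z₀) z ξ : ℂ) * (Complex.I * z) := by
  have h : (fun z : Circle => (z : ℂ)) =
      (fun t : ℝ => Complex.exp (t * Complex.I)) ∘ circleAngle z₀ :=
    funext fun z => (exp_circleAngle z₀ z).symm
  have hd : HasDerivAt (fun t : ℝ => Complex.exp (t * Complex.I)) (Complex.I * z)
      (circleAngle z₀ z) := by
    have h1 := ((Complex.ofRealCLM.hasDerivAt (x := circleAngle z₀ z)).mul_const Complex.I).cexp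
    refine h1.congr_deriv ?_
    rw [Complex.ofRealCLM_apply, exp_circleAngle]
    simp [mul_comm]
  rw [h, mvfderiv_comp_fderiv_apply z hd.differentiableAt
    ((contMDiffAt_circleAngle hz).mdifferentiableAt (by simp)), hd.hasFDerivAt.fderiv]
  simp

theorem circle_eq_zero_of_mvfderiv_coe {z : Circle} {ξ : TangentSpace (𝓡 1) z}
    (h : mvfderiv (𝓡 1) (fun z : Circle => (z : ℂ)) z ξ = 0) : ξ = 0 :=
  haveI := finrank_real_complex_fact'
  injective_mvfderiv_subtypeVal_sphere (n := 1) (E := ℂ) z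
    (h.trans (map_zero (mvfderiv (𝓡 1) (fun z : Circle => (z : ℂ)) z)).symm)

end CircleAngle

/-! ### Null lines of the magnetic extension -/

section NullCone

variable {S : Type*} [TopologicalSpace S] [ChartedSpace (EuclideanSpace ℝ (Fin 2)) S]
  [IsManifold (𝓡 2) ∞ S] [RiemannianBundle (fun x : S => TangentSpace (𝓡 2) x)]
  [IsContMDiffRiemannianBundle (𝓡 2) ∞ (EuclideanSpace ℝ (Fin 2))
    (fun x : S => TangentSpace (𝓡 2) x)] {o : SurfaceOrientation S}

/-- The connection form, as a linear form. -/
noncomputable def connectionLinear (v : UnitTangent o) : TangentSpace unitModel v →ₗ[ℝ] ℝ where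
  toFun := connectionForm v
  map_add' ξ η := by
    simp only [connectionForm, map_add, inner_add_right]
    ring
  map_smul' c ξ := by
    simp only [connectionForm, map_smul, real_inner_smul_right, RingHom.id_apply, smul_eq_mul]
    ring

theorem connectionForm_smul (v : UnitTangent o) (c : ℝ) (ξ : TangentSpace unitModel v) :
    connectionForm v (c • ξ) = c * connectionForm v ξ :=
  (connectionLinear v).map_smul c ξ

theorem connectionForm_zero (v : UnitTangent o) : connectionForm v 0 = 0 :=
  (connectionLinear v).map_zero

/-- On vertical vectors the connection form is the differential of the angle. With
`exists_footDeriv` this makes the differential of the projection and the connection form linear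
coordinates on the tangent space. -/
theorem eq_zero_of_footDeriv {v : UnitTangent o} {ξ : TangentSpace unitModel v}
    (h1 : footDeriv v ξ = 0) (h2 : connectionForm v ξ = 0) : ξ = 0 := by
  have hv := UnitTangent.mem_source_self v
  refine UnitTangent.eq_zero_of_mvfderiv_angleCoord hv h1 ?_
  have h := UnitTangent.connectionForm_eq hv ξ
  rw [h2, h1, frameForm, map_zero, inner_zero_right, add_zero] at h
  exact h.symm

theorem eq_of_footDeriv {v : UnitTangent o} {ξ η : TangentSpace unitModel v}
    (h1 : footDeriv v ξ = footDeriv v η) (h2 : connectionForm v ξ = connectionForm v η) :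
    ξ = η := by
  refine sub_eq_zero.1 (eq_zero_of_footDeriv ?_ ?_)
  · rw [map_sub, h1, sub_self]
  · exact ((connectionLinear v).map_sub ξ η).trans (sub_eq_zero.2 h2)

theorem exists_footDeriv (v : UnitTangent o) (a : TangentSpace (𝓡 2) v.val.1) (r : ℝ) :
    ∃ ξ, footDeriv v ξ = a ∧ connectionForm v ξ = r := by
  let L : TangentSpace unitModel v →ₗ[ℝ] TangentSpace (𝓡 2) v.val.1 × ℝ :=
    (footDeriv v).toLinearMap.prod (connectionLinear v)
  have hinj : Function.Injective L := by
    intro ξ η h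
    exact eq_of_footDeriv (congrArg Prod.fst h) (congrArg Prod.snd h)
  have hfin : FiniteDimensional ℝ (TangentSpace (𝓡 2) v.val.1) :=
    inferInstanceAs (FiniteDimensional ℝ (EuclideanSpace ℝ (Fin 2)))
  have hdim : Module.finrank ℝ (TangentSpace unitModel v) =
      Module.finrank ℝ (TangentSpace (𝓡 2) v.val.1 × ℝ) := by
    change Module.finrank ℝ (EuclideanSpace ℝ (Fin 2) × ℝ) =
      Module.finrank ℝ (EuclideanSpace ℝ (Fin 2) × ℝ)
    rfl
  have hfin' : FiniteDimensional ℝ (TangentSpace unitModel v) :=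
    inferInstanceAs (FiniteDimensional ℝ (EuclideanSpace ℝ (Fin 2) × ℝ))
  obtain ⟨ξ, hξ⟩ := (LinearMap.injective_iff_surjective_of_finrank_eq_finrank hdim).1 hinj (a, r)
  exact ⟨ξ, congrArg Prod.fst hξ, congrArg Prod.snd hξ⟩

theorem nullLine_eq_span {v : UnitTangent o} {z : Circle} {ξ : TangentSpace unitModel v}
    (h1 : footDeriv v ξ = rotated v z) (h2 : connectionForm v ξ = 1) :
    nullLine v z = Submodule.span ℝ {ξ} := by
  refine congrArg (Submodule.span ℝ) (Subset.antisymm ?_ (singleton_subset_iff.2 ⟨h1, h2⟩))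
  rintro η ⟨e1, e2⟩
  exact eq_of_footDeriv (e1.trans h1.symm) (e2.trans h2.symm)

theorem mem_nullLine_iff {v : UnitTangent o} {z : Circle} {ξ : TangentSpace unitModel v} :
    ξ ∈ nullLine v z ↔ footDeriv v ξ = connectionForm v ξ • rotated v z := by
  obtain ⟨ξ₀, h1, h2⟩ := exists_footDeriv v (rotated v z) 1
  rw [nullLine_eq_span h1 h2, Submodule.mem_span_singleton]
  constructor
  · rintro ⟨c, rfl⟩
    rw [map_smul, h1, connectionForm_smul, h2, mul_one]
  · intro h
    refine ⟨connectionForm v ξ, eq_of_footDeriv ?_ ?_⟩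
    · rw [map_smul, h1, h]
    · rw [connectionForm_smul, h2, mul_one]

theorem circle_re_sq_add_im_sq (z : Circle) : (z : ℂ).re ^ 2 + (z : ℂ).im ^ 2 = 1 := by
  have h := Circle.normSq_coe z
  rw [Complex.normSq_apply] at h
  linarith

theorem norm_rotated (v : UnitTangent o) (z : Circle) : ‖rotated v z‖ = 1 :=
  o.norm_combination v.norm_val _ _ (circle_re_sq_add_im_sq z)

theorem inner_rotated (v : UnitTangent o) (z : Circle) :
    (inner ℝ (rotated v z) (rotated v z) : ℝ) = 1 := by
  rw [real_inner_self_eq_norm_sq, norm_rotated, one_pow]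

theorem rotated_injective (v : UnitTangent o) : Function.Injective (rotated v) := by
  intro z z' h
  have h1 := congrArg (fun u => (inner ℝ v.val.2 u : ℝ)) h
  have h2 := congrArg (fun u => (inner ℝ (o.J v.val.1 v.val.2) u : ℝ)) h
  simp only [rotated, o.inner_combination v.norm_val, o.inner_J_combination v.norm_val] at h1 h2
  exact Circle.ext (Complex.ext h1 h2)

theorem exists_rotated {v : UnitTangent o} {u : TangentSpace (𝓡 2) v.val.1}
    (hu : (inner ℝ u u : ℝ) = 1) : ∃ z, rotated v z = u := by
  set a : ℝ := inner ℝ v.val.2 u with ha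
  set b : ℝ := inner ℝ (o.J v.val.1 v.val.2) u with hb
  have hex : u = a • v.val.2 + b • o.J v.val.1 v.val.2 := o.expand v.norm_val u
  have hv : (inner ℝ v.val.2 v.val.2 : ℝ) = 1 := by
    rw [real_inner_self_eq_norm_sq, v.norm_val, one_pow]
  have hab : a ^ 2 + b ^ 2 = 1 := by
    rw [hex] at hu
    simp only [inner_add_left, inner_add_right, real_inner_smul_left, real_inner_smul_right,
      o.inner_J, o.inner_J_self, o.inner_J_left, hv] at hu
    linear_combination hu
  have hz : (⟨a, b⟩ : ℂ) ∈ Submonoid.unitSphere ℂ := by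
    refine mem_sphere_zero_iff_norm.2 ?_
    rw [← pow_eq_one_iff_of_nonneg (norm_nonneg _) two_ne_zero, ← Complex.normSq_eq_norm_sq,
      Complex.normSq_apply]
    linear_combination hab
  exact ⟨⟨⟨a, b⟩, hz⟩, hex.symm⟩

/-- A nonzero null vector is not horizontal, since the metric is positive definite on horizontal
vectors. Scaled to have value 1 under the connection form, it projects to a unit vector, which is
the rotated `v` for exactly one z. -/
theorem bijOn_nullLine (v : UnitTangent o) : BijOn (nullLine v) univ (nullCone v) := by
  refine ⟨?_, ?_, ?_⟩
  · intro z _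
    obtain ⟨ξ, h1, h2⟩ := exists_footDeriv v (rotated v z) 1
    have hξ : ξ ≠ 0 := by
      rintro rfl
      rw [connectionForm_zero] at h2
      exact zero_ne_one h2
    refine ⟨by rw [nullLine_eq_span h1 h2, finrank_span_singleton hξ], fun η hη => ?_⟩
    rw [mem_nullLine_iff] at hη
    rw [magneticMetric, hη, real_inner_smul_left, real_inner_smul_right, inner_rotated]
    ring
  · intro z _ z' _ h
    obtain ⟨ξ, h1, h2⟩ := exists_footDeriv v (rotated v z) 1
    have hm : ξ ∈ nullLine v z := mem_nullLine_iff.2 (by rw [h1, h2, one_smul])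
    rw [h, mem_nullLine_iff, h1, h2, one_smul] at hm
    exact rotated_injective v hm
  · rintro ℓ ⟨hfin, hnull⟩
    obtain ⟨⟨ξ, hξ⟩, hξ0, hspan⟩ := finrank_eq_one_iff'.1 hfin
    have hn := hnull ξ hξ
    have hξ0' : ξ ≠ 0 := fun h => hξ0 (Subtype.ext h)
    have hω : connectionForm v ξ ≠ 0 := by
      intro h0
      rw [magneticMetric, h0, mul_zero, sub_zero] at hn
      exact hξ0' (eq_zero_of_footDeriv (inner_self_eq_zero.1 hn) h0)
    set r := connectionForm v ξ with hr
    obtain ⟨z, hz⟩ := exists_rotated (v := v) (u := r⁻¹ • footDeriv v ξ) (by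
      rw [magneticMetric] at hn
      rw [real_inner_smul_left, real_inner_smul_right]
      field_simp
      rw [← hr] at hn
      linear_combination hn)
    refine ⟨z, mem_univ _, ?_⟩
    have h1 : footDeriv v (r⁻¹ • ξ) = rotated v z := by rw [map_smul, hz]
    have h2 : connectionForm v (r⁻¹ • ξ) = 1 := by
      rw [connectionForm_smul, ← hr, inv_mul_cancel₀ hω]
    rw [nullLine_eq_span h1 h2]
    refine le_antisymm ?_ ?_
    · rw [Submodule.span_singleton_le_iff_mem]
      exact ℓ.smul_mem _ hξ
    · intro η hη
      obtain ⟨c, hc⟩ := hspan ⟨η, hη⟩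
      have hc' : c • ξ = η := congrArg Subtype.val hc
      refine Submodule.mem_span_singleton.2 ⟨c * r, ?_⟩
      rw [smul_smul, mul_assoc, mul_inv_cancel₀ hω, mul_one, hc']

end NullCone

/-! ### Brackets of horizontal lifts in coordinates -/

section HorizontalModel

variable {F : Type*} [NormedAddCommGroup F] [NormedSpace ℝ F]

/-- The horizontal lift, in coordinates, of the unit vector at the angle `α + θ` from the field `A`
of an orthonormal frame `A`, `B` with connection coefficients `h₁`, `h₂`. -/
noncomputable def horizontalModel (A B : F → F) (h₁ h₂ : F → ℝ) (p : F × ℝ × ℝ) : F × ℝ × ℝ :=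
  (Real.cos (p.2.1 + p.2.2) • A p.1 + Real.sin (p.2.1 + p.2.2) • B p.1,
    -(Real.cos (p.2.1 + p.2.2) * h₁ p.1 + Real.sin (p.2.1 + p.2.2) * h₂ p.1), 0)

variable {A B : F → F} {h₁ h₂ : F → ℝ} {p : F × ℝ × ℝ}

theorem contDiffAt_horizontalModel (hA : ContDiffAt ℝ ∞ A p.1) (hB : ContDiffAt ℝ ∞ B p.1)
    (k₁ : ContDiffAt ℝ ∞ h₁ p.1) (k₂ : ContDiffAt ℝ ∞ h₂ p.1) :
    ContDiffAt ℝ ∞ (horizontalModel A B h₁ h₂) p := by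
  have hA' : ContDiffAt ℝ ∞ (fun p : F × ℝ × ℝ => A p.1) p := hA.comp p contDiffAt_fst
  have hB' : ContDiffAt ℝ ∞ (fun p : F × ℝ × ℝ => B p.1) p := hB.comp p contDiffAt_fst
  have k₁' : ContDiffAt ℝ ∞ (fun p : F × ℝ × ℝ => h₁ p.1) p := k₁.comp p contDiffAt_fst
  have k₂' : ContDiffAt ℝ ∞ (fun p : F × ℝ × ℝ => h₂ p.1) p := k₂.comp p contDiffAt_fst
  have hs : ContDiffAt ℝ ∞ (fun p : F × ℝ × ℝ => p.2.1 + p.2.2) p := by fun_prop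
  have hc' := hs.cos
  have hs' := hs.sin
  exact ((hc'.smul hA').add (hs'.smul hB')).prodMk
    ((((hc'.mul k₁').add (hs'.mul k₂')).neg).prodMk contDiffAt_const)

/-- The lift depends on the two angles through their sum only. Differentiating in either of them
turns the frame A, B into B, -A, which is again a horizontal lift, rotated by a right angle. -/
theorem fderiv_horizontalModel (hA : DifferentiableAt ℝ A p.1) (hB : DifferentiableAt ℝ B p.1)
    (k₁ : DifferentiableAt ℝ h₁ p.1) (k₂ : DifferentiableAt ℝ h₂ p.1) (ξ : F × ℝ × ℝ) :
    fderiv ℝ (horizontalModel A B h₁ h₂) p ξ =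
      (ξ.2.1 + ξ.2.2) • horizontalModel B (-A) h₂ (-h₁) p +
        (Real.cos (p.2.1 + p.2.2) • fderiv ℝ A p.1 ξ.1 +
            Real.sin (p.2.1 + p.2.2) • fderiv ℝ B p.1 ξ.1,
          -(Real.cos (p.2.1 + p.2.2) * fderiv ℝ h₁ p.1 ξ.1 +
            Real.sin (p.2.1 + p.2.2) * fderiv ℝ h₂ p.1 ξ.1), 0) := by
  have hfst : HasFDerivAt (fun p : F × ℝ × ℝ => p.1) (ContinuousLinearMap.fst ℝ F (ℝ × ℝ)) p :=
    hasFDerivAt_fst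
  have hA' := hA.hasFDerivAt.comp p hfst
  have hB' := hB.hasFDerivAt.comp p hfst
  have k₁' := k₁.hasFDerivAt.comp p hfst
  have k₂' := k₂.hasFDerivAt.comp p hfst
  have hs : HasFDerivAt (fun p : F × ℝ × ℝ => p.2.1 + p.2.2)
      (((ContinuousLinearMap.fst ℝ ℝ ℝ).comp (ContinuousLinearMap.snd ℝ F (ℝ × ℝ))) +
        ((ContinuousLinearMap.snd ℝ ℝ ℝ).comp (ContinuousLinearMap.snd ℝ F (ℝ × ℝ)))) p :=
    (hasFDerivAt_fst.comp p hasFDerivAt_snd).add (hasFDerivAt_snd.comp p hasFDerivAt_snd)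
  have hc' := hs.cos
  have hs' := hs.sin
  have h := ((hc'.smul hA').add (hs'.smul hB')).prodMk
    ((((hc'.mul k₁').add (hs'.mul k₂')).neg).prodMk (hasFDerivAt_const (0 : ℝ) p))
  have e : fderiv ℝ (horizontalModel A B h₁ h₂) p = _ := HasFDerivAt.fderiv h
  rw [e]
  refine Prod.ext ?_ (Prod.ext ?_ ?_)
  · simp [horizontalModel]
    module
  · simp [horizontalModel]
    ring
  · simp [horizontalModel]

/-- The bracket relations in coordinates. -/
theorem bracket_horizontalModel {κ : ℝ} (hA : DifferentiableAt ℝ A p.1)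
    (hB : DifferentiableAt ℝ B p.1) (k₁ : DifferentiableAt ℝ h₁ p.1)
    (k₂ : DifferentiableAt ℝ h₂ p.1)
    (torsion : fderiv ℝ B p.1 (A p.1) - fderiv ℝ A p.1 (B p.1) =
      -(h₁ p.1 • A p.1) - h₂ p.1 • B p.1)
    (curvature : fderiv ℝ h₁ p.1 (B p.1) - fderiv ℝ h₂ p.1 (A p.1) =
      κ + h₁ p.1 ^ 2 + h₂ p.1 ^ 2) :
    fderiv ℝ (horizontalModel B (-A) h₂ (-h₁)) p
        (horizontalModel A B h₁ h₂ p + (0, 1, -(1 + κ))) -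
      fderiv ℝ (horizontalModel A B h₁ h₂) p (horizontalModel B (-A) h₂ (-h₁) p) =
    κ • (horizontalModel A B h₁ h₂ p + (0, 1, 0)) := by
  -- The vector (0, 1, -(1 + κ)) changes the sum of the angles at the rate -κ and so contributes κ
  -- times the horizontal lift. What remains is the bracket of the two lifts: its base component
  -- vanishes by `torsion`, and its angular component is κ by `curvature`.
  rw [fderiv_horizontalModel hA hB k₁ k₂, fderiv_horizontalModel hB hA.neg k₂ k₁.neg]
  have hcs := Real.sin_sq_add_cos_sq (p.2.1 + p.2.2)
  have eA : fderiv ℝ (-A) p.1 = -fderiv ℝ A p.1 := fderiv_neg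
  have e₁ : fderiv ℝ (-h₁) p.1 = -fderiv ℝ h₁ p.1 := fderiv_neg
  rw [eA, e₁]
  simp only [horizontalModel, Pi.neg_apply, smul_neg, map_add, map_smul, map_neg]
  set C := Real.cos (p.2.1 + p.2.2)
  set D := Real.sin (p.2.1 + p.2.2)
  set DA := fderiv ℝ A p.1
  set DB := fderiv ℝ B p.1
  set D₁ := fderiv ℝ h₁ p.1
  set D₂ := fderiv ℝ h₂ p.1
  set a := A p.1
  set b := B p.1
  set m₁ := h₁ p.1
  set m₂ := h₂ p.1
  refine Prod.ext ?_ (Prod.ext ?_ ?_)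
  · have hb : DB a = DA b + (-(m₁ • a) - m₂ • b) := by rw [← torsion]; abel
    simp only [Prod.fst_add, Prod.fst_sub, Prod.snd_add, Prod.smul_fst, map_add, map_smul,
      _root_.neg_apply, add_zero, smul_neg]
    rw [hb]
    module
  · simp only [Prod.fst_add, Prod.fst_sub, Prod.snd_add, Prod.snd_sub, Prod.smul_fst,
      Prod.smul_snd, map_add, map_smul, _root_.neg_apply, add_zero,
      smul_eq_mul]
    linear_combination curvature + (D₁ b - D₂ a - m₁ ^ 2 - m₂ ^ 2) * hcs
  · simp

end HorizontalModel

/-! ### Linear coordinates and the magnetic frame on the prolongation -/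

section ProlongationForms

variable {S : Type*} [TopologicalSpace S] [ChartedSpace (EuclideanSpace ℝ (Fin 2)) S]
  [IsManifold (𝓡 2) ∞ S] [RiemannianBundle (fun x : S => TangentSpace (𝓡 2) x)]
  [IsContMDiffRiemannianBundle (𝓡 2) ∞ (EuclideanSpace ℝ (Fin 2))
    (fun x : S => TangentSpace (𝓡 2) x)] {o : SurfaceOrientation S}

/-- The differential of the projection of the prolongation to the circle. -/
noncomputable def circleProj (p : Prolongation o) :
    TangentSpace prolongModel p →L[ℝ] TangentSpace (𝓡 1) p.2 :=
  mfderiv prolongModel (𝓡 1) (fun q : Prolongation o => q.2) p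

theorem prolongProj_apply (p : Prolongation o)
    (ξ : (EuclideanSpace ℝ (Fin 2) × ℝ) × EuclideanSpace ℝ (Fin 1)) :
    prolongProj p ξ = ξ.1 :=
  congrArg (fun L : TangentSpace prolongModel p →L[ℝ] TangentSpace unitModel p.1 => L ξ)
    (mfderiv_fst (I := unitModel) (I' := 𝓡 1) (x := p))

theorem circleProj_apply (p : Prolongation o)
    (ξ : (EuclideanSpace ℝ (Fin 2) × ℝ) × EuclideanSpace ℝ (Fin 1)) :
    circleProj p ξ = ξ.2 :=
  congrArg (fun L : TangentSpace prolongModel p →L[ℝ] TangentSpace (𝓡 1) p.2 => L ξ)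
    (mfderiv_snd (I := unitModel) (I' := 𝓡 1) (x := p))

/-- The angular form of the circle factor of the prolongation. -/
noncomputable def thetaForm (p : Prolongation o) : TangentSpace prolongModel p →L[ℝ] ℝ :=
  (mvfderiv (𝓡 1) (circleAngle p.2) p.2).comp (circleProj p)

theorem mvfderiv_comp_snd {G : Type*} [NormedAddCommGroup G] [NormedSpace ℝ G] {h : Circle → G}
    {p : Prolongation o} (hh : MDifferentiableAt (𝓡 1) 𝓘(ℝ, G) h p.2)
    (ξ : TangentSpace prolongModel p) :
    mvfderiv prolongModel (fun q : Prolongation o => h q.2) p ξ =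
      mvfderiv (𝓡 1) h p.2 (circleProj p ξ) :=
  mvfderiv_comp_mfderiv_apply (g := h) (f := fun q : Prolongation o => q.2) p hh
    mdifferentiableAt_snd ξ

theorem mvfderiv_comp_fst {G : Type*} [NormedAddCommGroup G] [NormedSpace ℝ G]
    {h : UnitTangent o → G} {p : Prolongation o} (hh : MDifferentiableAt unitModel 𝓘(ℝ, G) h p.1)
    (ξ : TangentSpace prolongModel p) :
    mvfderiv prolongModel (fun q : Prolongation o => h q.1) p ξ =
      mvfderiv unitModel h p.1 (prolongProj p ξ) :=
  mvfderiv_comp_mfderiv_apply (g := h) (f := fun q : Prolongation o => q.1) p hh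
    mdifferentiableAt_fst ξ

theorem mvfderiv_coe_snd (p : Prolongation o) (ξ : TangentSpace prolongModel p) :
    mvfderiv prolongModel (fun q : Prolongation o => (q.2 : ℂ)) p ξ =
      (thetaForm p ξ : ℂ) * (Complex.I * p.2) :=
  (mvfderiv_comp_snd (contMDiff_circle_coe.contMDiffAt.mdifferentiableAt (by simp)) ξ).trans
    (mvfderiv_circle_coe (self_mem_circleArc p.2) _)

theorem I_mul_coe_ne_zero (z : Circle) : Complex.I * (z : ℂ) ≠ 0 :=
  mul_ne_zero Complex.I_ne_zero (Circle.coe_ne_zero z)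

theorem mvfderiv_circleAngle_snd {z₀ : Circle} {p : Prolongation o} (hp : p.2 ∈ circleArc z₀)
    (ξ : TangentSpace prolongModel p) :
    mvfderiv prolongModel (fun q : Prolongation o => circleAngle z₀ q.2) p ξ = thetaForm p ξ := by
  rw [mvfderiv_comp_snd ((contMDiffAt_circleAngle hp).mdifferentiableAt (by simp)) ξ]
  have h1 := mvfderiv_circle_coe hp (circleProj p ξ)
  rw [mvfderiv_circle_coe (self_mem_circleArc p.2) (circleProj p ξ)] at h1
  exact (Complex.ofReal_injective (mul_right_cancel₀ (I_mul_coe_ne_zero p.2) h1)).symm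

theorem isTheta_iff {p : Prolongation o} {ξ : TangentSpace prolongModel p} :
    IsTheta p ξ ↔ prolongProj p ξ = 0 ∧ thetaForm p ξ = 1 := by
  rw [IsTheta, mvfderiv_coe_snd]
  refine and_congr_right fun _ => ⟨fun h => ?_, fun h => by rw [h, Complex.ofReal_one, one_mul]⟩
  exact Complex.ofReal_injective (mul_right_cancel₀ (I_mul_coe_ne_zero p.2)
    (h.trans (by rw [Complex.ofReal_one, one_mul])))

theorem isTildeY_iff {p : Prolongation o} {ξ : TangentSpace prolongModel p} :
    IsTildeY p ξ ↔ footDeriv p.1 (prolongProj p ξ) = o.J p.1.val.1 (rotated p.1 p.2) ∧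
      connectionForm p.1 (prolongProj p ξ) = 0 ∧ thetaForm p ξ = 0 := by
  rw [IsTildeY, mvfderiv_coe_snd, mul_eq_zero, or_iff_left (I_mul_coe_ne_zero p.2),
    Complex.ofReal_eq_zero]

/-- The differential of the foot point, the connection form and the angular form. -/
noncomputable def prolongForms (p : Prolongation o) :
    TangentSpace prolongModel p →ₗ[ℝ] TangentSpace (𝓡 2) p.1.val.1 × ℝ × ℝ :=
  ((footDeriv p.1).toLinearMap ∘ₗ (prolongProj p).toLinearMap).prod
    ((connectionLinear p.1 ∘ₗ (prolongProj p).toLinearMap).prod (thetaForm p).toLinearMap)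

/-- The first two forms detect the component along `V`, the third one the component along the
circle. As the dimensions agree, the three forms can be prescribed at will, which is how the
magnetic frame is defined. -/
theorem eq_zero_of_prolongForms {p : Prolongation o} {ξ : TangentSpace prolongModel p}
    (h1 : footDeriv p.1 (prolongProj p ξ) = 0) (h2 : connectionForm p.1 (prolongProj p ξ) = 0)
    (h3 : thetaForm p ξ = 0) : ξ = 0 := by
  have e1 := eq_zero_of_footDeriv h1 h2
  have e2 : circleProj p ξ = 0 := circle_eq_zero_of_mvfderiv_coe (by
    rw [mvfderiv_circle_coe (self_mem_circleArc p.2)]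
    refine mul_eq_zero_of_left ?_ _
    exact Complex.ofReal_eq_zero.2 h3)
  exact Prod.ext ((prolongProj_apply p ξ).symm.trans e1) ((circleProj_apply p ξ).symm.trans e2)

instance finiteDimensional_prolongation (p : Prolongation o) :
    FiniteDimensional ℝ (TangentSpace prolongModel p) :=
  inferInstanceAs (FiniteDimensional ℝ
    ((EuclideanSpace ℝ (Fin 2) × ℝ) × EuclideanSpace ℝ (Fin 1)))

theorem finrank_prolongation (p : Prolongation o) :
    Module.finrank ℝ (TangentSpace prolongModel p) = 4 := by
  change Module.finrank ℝ ((EuclideanSpace ℝ (Fin 2) × ℝ) × EuclideanSpace ℝ (Fin 1)) = 4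
  simp

/-- The differential of the foot point, the connection form and the angular form, as coordinates on
the tangent space of the prolongation. -/
noncomputable def prolongEquiv (p : Prolongation o) :
    TangentSpace prolongModel p ≃ₗ[ℝ] TangentSpace (𝓡 2) p.1.val.1 × ℝ × ℝ :=
  LinearEquiv.ofInjectiveOfFinrankEq (prolongForms p)
    ((injective_iff_map_eq_zero _).2 fun _ h => eq_zero_of_prolongForms (congrArg Prod.fst h)
      (congrArg (fun u => u.2.1) h) (congrArg (fun u => u.2.2) h))
    ((finrank_prolongation p).trans (by
      change 4 = Module.finrank ℝ (EuclideanSpace ℝ (Fin 2) × ℝ × ℝ)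
      simp))

theorem prolongEquiv_apply (p : Prolongation o) (ξ : TangentSpace prolongModel p) :
    prolongEquiv p ξ =
      (footDeriv p.1 (prolongProj p ξ), connectionForm p.1 (prolongProj p ξ), thetaForm p ξ) := rfl

variable (κ : ℝ)

/-- The values of the magnetic frame `Θ`, `X + Z - (1 + κ) Θ`, `Ỹ`, `X` in the coordinates
`prolongEquiv`. -/
noncomputable def magneticVector (p : Prolongation o) :
    Fin 4 → TangentSpace (𝓡 2) p.1.val.1 × ℝ × ℝ :=
  ![(0, 0, 1), (rotated p.1 p.2, 1, -(1 + κ)), (o.J p.1.val.1 (rotated p.1 p.2), 0, 0),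
    (rotated p.1 p.2, 0, 0)]

/-- The magnetic frame of the prolongation. -/
noncomputable def magneticFrame (i : Fin 4) (p : Prolongation o) : TangentSpace prolongModel p :=
  (prolongEquiv p).symm (magneticVector κ p i)

theorem prolongEquiv_magneticFrame (i : Fin 4) (p : Prolongation o) :
    prolongEquiv p (magneticFrame κ i p) = magneticVector κ p i :=
  (prolongEquiv p).apply_symm_apply _

theorem linearIndependent_magneticVector (p : Prolongation o) :
    LinearIndependent ℝ (magneticVector κ p) := by
  rw [Fintype.linearIndependent_iff]
  intro c hc
  rw [Fin.sum_univ_four] at hc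
  have n1 : (inner ℝ (o.J p.1.val.1 (rotated p.1 p.2)) (rotated p.1 p.2) : ℝ) = 0 :=
    o.inner_J_left _
  have n2 : (inner ℝ (rotated p.1 p.2) (o.J p.1.val.1 (rotated p.1 p.2)) : ℝ) = 0 :=
    o.inner_J_self _
  have n3 : (inner ℝ (o.J p.1.val.1 (rotated p.1 p.2)) (o.J p.1.val.1 (rotated p.1 p.2)) : ℝ) = 1 :=
    by rw [o.inner_J, inner_rotated]
  have h1 : c 0 • (0 : TangentSpace (𝓡 2) p.1.val.1) + c 1 • rotated p.1 p.2 +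
      c 2 • o.J p.1.val.1 (rotated p.1 p.2) + c 3 • rotated p.1 p.2 = 0 := congrArg Prod.fst hc
  have h2 : c 0 * 0 + c 1 * 1 + c 2 * 0 + c 3 * 0 = 0 := congrArg (fun u => u.2.1) hc
  have h3 : c 0 * 1 + c 1 * -(1 + κ) + c 2 * 0 + c 3 * 0 = 0 := congrArg (fun u => u.2.2) hc
  have h4 := congrArg (fun u => (inner ℝ (rotated p.1 p.2) u : ℝ)) h1
  have h5 := congrArg (fun u => (inner ℝ (o.J p.1.val.1 (rotated p.1 p.2)) u : ℝ)) h1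
  simp only [inner_add_right, real_inner_smul_right, n1, n2, n3, inner_rotated,
    inner_zero_right] at h4 h5
  have c1 : c 1 = 0 := by linarith
  rw [c1] at h3 h4 h5
  intro i
  fin_cases i
  · change c 0 = 0
    linarith
  · exact c1
  · change c 2 = 0
    linarith
  · change c 3 = 0
    linarith

theorem linearIndependent_magneticFrame (p : Prolongation o) :
    LinearIndependent ℝ (fun i => magneticFrame κ i p) :=
  (linearIndependent_magneticVector κ p).map' (prolongEquiv p).symm.toLinearMap
    (LinearEquiv.ker _)

theorem span_magneticFrame (p : Prolongation o) :
    Submodule.span ℝ (range fun i => magneticFrame κ i p) = ⊤ :=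
  (linearIndependent_magneticFrame κ p).span_eq_top_of_card_eq_finrank'
    (by rw [finrank_prolongation, Fintype.card_fin])

theorem isTheta_magneticFrame (p : Prolongation o) : IsTheta p (magneticFrame κ 0 p) := by
  have h := prolongEquiv_magneticFrame κ 0 p
  rw [prolongEquiv_apply] at h
  exact isTheta_iff.2 ⟨eq_zero_of_footDeriv (congrArg Prod.fst h) (congrArg (fun u => u.2.1) h),
    congrArg (fun u => u.2.2) h⟩

theorem isTildeY_magneticFrame (p : Prolongation o) : IsTildeY p (magneticFrame κ 2 p) := by
  have h := prolongEquiv_magneticFrame κ 2 p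
  rw [prolongEquiv_apply] at h
  exact isTildeY_iff.2 ⟨congrArg Prod.fst h, congrArg (fun u => u.2.1) h,
    congrArg (fun u => u.2.2) h⟩

theorem footDeriv_magneticFrame (p : Prolongation o) :
    footDeriv p.1 (prolongProj p (magneticFrame κ 1 p)) = rotated p.1 p.2 :=
  congrArg Prod.fst (prolongEquiv_magneticFrame κ 1 p)

theorem eq_magneticFrame_of_isTheta {p : Prolongation o} {ξ : TangentSpace prolongModel p}
    (h : IsTheta p ξ) : ξ = magneticFrame κ 0 p := by
  obtain ⟨h1, h2⟩ := isTheta_iff.1 h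
  obtain ⟨h3, h4⟩ := isTheta_iff.1 (isTheta_magneticFrame κ p)
  refine (prolongEquiv p).injective ?_
  rw [prolongEquiv_apply, prolongEquiv_apply, h1, h2, h3, h4]

theorem eq_magneticFrame_of_isTildeY {p : Prolongation o} {ξ : TangentSpace prolongModel p}
    (h : IsTildeY p ξ) : ξ = magneticFrame κ 2 p := by
  obtain ⟨h1, h2, h3⟩ := isTildeY_iff.1 h
  obtain ⟨h4, h5, h6⟩ := isTildeY_iff.1 (isTildeY_magneticFrame κ p)
  refine (prolongEquiv p).injective ?_
  rw [prolongEquiv_apply, prolongEquiv_apply, h1, h2, h3, h4, h5, h6]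

/-- Being a preimage, the plane field contains the circle direction Θ, so the correction -(1 + κ)Θ
in the second frame field does not affect the span; κ is arbitrary here. -/
theorem prolongation_eq_frameSpan :
    prolongation (o := o) = frameSpan (magneticFrame κ) {0, 1} := by
  funext p
  have hmem : ∀ ξ : TangentSpace prolongModel p, ξ ∈ prolongation p ↔
      footDeriv p.1 (prolongProj p ξ) =
        connectionForm p.1 (prolongProj p ξ) • rotated p.1 p.2 := fun ξ => mem_nullLine_iff
  have e0 := prolongEquiv_magneticFrame κ 0 p
  have e1 := prolongEquiv_magneticFrame κ 1 p
  refine le_antisymm ?_ (Submodule.span_le.2 ?_)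
  · intro ξ hξ
    rw [hmem] at hξ
    have h : ξ = (thetaForm p ξ + (1 + κ) * connectionForm p.1 (prolongProj p ξ)) •
        magneticFrame κ 0 p + connectionForm p.1 (prolongProj p ξ) • magneticFrame κ 1 p := by
      refine (prolongEquiv p).injective ?_
      rw [map_add, map_smul, map_smul, e0, e1, prolongEquiv_apply]
      refine Prod.ext ?_ (Prod.ext ?_ ?_)
      · change _ = _ • (0 : TangentSpace (𝓡 2) p.1.val.1) + _ • rotated p.1 p.2
        rw [smul_zero, zero_add]
        exact hξ
      · change connectionForm p.1 (prolongProj p ξ) =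
          (thetaForm p ξ + (1 + κ) * connectionForm p.1 (prolongProj p ξ)) * (0 : ℝ) +
            connectionForm p.1 (prolongProj p ξ) * (1 : ℝ)
        ring
      · change thetaForm p ξ =
          (thetaForm p ξ + (1 + κ) * connectionForm p.1 (prolongProj p ξ)) * (1 : ℝ) +
            connectionForm p.1 (prolongProj p ξ) * -(1 + κ)
        ring
    rw [h]
    exact add_mem (Submodule.smul_mem _ _ (frame_mem_frameSpan (by decide) p))
      (Submodule.smul_mem _ _ (frame_mem_frameSpan (by decide) p))
  · rintro _ ⟨i, hi, rfl⟩
    have hi' : i = 0 ∨ i = 1 := by simpa using hi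
    rcases hi' with rfl | rfl
    · refine (hmem _).2 ?_
      rw [show footDeriv p.1 (prolongProj p (magneticFrame κ 0 p)) = 0 from congrArg Prod.fst e0,
        show connectionForm p.1 (prolongProj p (magneticFrame κ 0 p)) = 0 from
          congrArg (fun u => u.2.1) e0, zero_smul]
    · refine (hmem _).2 ?_
      rw [footDeriv_magneticFrame,
        show connectionForm p.1 (prolongProj p (magneticFrame κ 1 p)) = 1 from
          congrArg (fun u => u.2.1) e1, one_smul]

end ProlongationForms

/-! ### Coordinates given by the foot point and the two angles -/

section ProlongationCoordinates

variable {S : Type*} [TopologicalSpace S] [ChartedSpace (EuclideanSpace ℝ (Fin 2)) S]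
  [IsManifold (𝓡 2) ∞ S] [RiemannianBundle (fun x : S => TangentSpace (𝓡 2) x)]
  [IsContMDiffRiemannianBundle (𝓡 2) ∞ (EuclideanSpace ℝ (Fin 2))
    (fun x : S => TangentSpace (𝓡 2) x)] {o : SurfaceOrientation S}

open UnitTangent

/-- The coordinates on the prolongation given by the foot point, the angle of the unit vector and
the angle on the circle. -/
noncomputable def prolongCoord (p₀ q : Prolongation o) : EuclideanSpace ℝ (Fin 2) × ℝ × ℝ :=
  (extChartAt (𝓡 2) p₀.1.val.1 q.1.val.1, angle p₀.1 q.1, circleAngle p₀.2 q.2)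

/-- The domain of `prolongCoord p₀`. -/
def prolongDomain (p₀ : Prolongation o) : Set (Prolongation o) :=
  {q | q.1 ∈ (unitChart p₀.1).source ∧ q.2 ∈ circleArc p₀.2}

variable {p₀ q : Prolongation o}

theorem isOpen_prolongDomain (p₀ : Prolongation o) : IsOpen (prolongDomain p₀) :=
  (unitChart p₀.1).open_source.prod (isOpen_circleArc p₀.2)

theorem self_mem_prolongDomain (p₀ : Prolongation o) : p₀ ∈ prolongDomain p₀ :=
  ⟨mem_source_self p₀.1, self_mem_circleArc p₀.2⟩

theorem foot_mem_source (hq : q ∈ prolongDomain p₀) :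
    q.1.val.1 ∈ (extChartAt (𝓡 2) p₀.1.val.1).source := by
  rw [extChartAt_source]
  exact (mem_source_iff.1 hq.1).1

theorem contMDiffAt_prolongCoord (hq : q ∈ prolongDomain p₀) :
    ContMDiffAt prolongModel 𝓘(ℝ, EuclideanSpace ℝ (Fin 2) × ℝ × ℝ) ∞ (prolongCoord p₀) q :=
  ((contMDiffAt_chart_foot hq.1).comp q contMDiffAt_fst).prodMk_space
    (((contMDiffAt_angle hq.1).comp q contMDiffAt_fst).prodMk_space
      ((contMDiffAt_circleAngle hq.2).comp q contMDiffAt_snd))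

/-- By `connectionForm_eq` the differential of the angle is the connection form minus the connection
form of the local frame at the projected vector; hence the horizontal lifts acquire the angular
component of `horizontalModel`. -/
theorem mvfderiv_prolongCoord (hq : q ∈ prolongDomain p₀) (ξ : TangentSpace prolongModel q) :
    mvfderiv prolongModel (prolongCoord p₀) q ξ =
      (mvfderiv (𝓡 2) (extChartAt (𝓡 2) p₀.1.val.1) q.1.val.1 (footDeriv q.1 (prolongProj q ξ)),
        connectionForm q.1 (prolongProj q ξ) -
          frameForm o (frame p₀.1.val) q.1.val.1 (footDeriv q.1 (prolongProj q ξ)),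
        thetaForm q ξ) := by
  have c1 : ContMDiffAt prolongModel 𝓘(ℝ, EuclideanSpace ℝ (Fin 2)) ∞ (fun q : Prolongation o =>
      extChartAt (𝓡 2) p₀.1.val.1 q.1.val.1) q :=
    (contMDiffAt_chart_foot hq.1).comp q contMDiffAt_fst
  have c2 : ContMDiffAt prolongModel 𝓘(ℝ) ∞ (fun q : Prolongation o => angle p₀.1 q.1) q :=
    (contMDiffAt_angle hq.1).comp q contMDiffAt_fst
  have c3 : ContMDiffAt prolongModel 𝓘(ℝ) ∞ (fun q : Prolongation o => circleAngle p₀.2 q.2) q :=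
    (contMDiffAt_circleAngle hq.2).comp q contMDiffAt_snd
  have e := mvfderiv_prodMk_space_apply c1 (c2.prodMk_space c3) ξ
  refine e.trans (Prod.ext ?_ ?_)
  · exact (mvfderiv_comp_fst ((contMDiffAt_chart_foot hq.1).mdifferentiableAt (by simp)) ξ).trans
      (mvfderiv_chart_foot hq.1 _)
  · refine (mvfderiv_prodMk_space_apply c2 c3 ξ).trans (Prod.ext ?_ ?_)
    · refine (mvfderiv_comp_fst ((contMDiffAt_angle hq.1).mdifferentiableAt (by simp)) ξ).trans ?_
      rw [connectionForm_eq hq.1, add_sub_cancel_right]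
    · exact mvfderiv_circleAngle_snd hq.2 ξ

theorem isInvertible_mfderiv_prolongCoord (hq : q ∈ prolongDomain p₀) :
    (mfderiv prolongModel 𝓘(ℝ, EuclideanSpace ℝ (Fin 2) × ℝ × ℝ) (prolongCoord p₀) q).IsInvertible
    := by
  have hk : ∀ ξ : TangentSpace prolongModel q, mvfderiv prolongModel (prolongCoord p₀) q ξ = 0 →
      ξ = 0 := by
    intro ξ h
    rw [mvfderiv_prolongCoord hq] at h
    have h1 := congrArg Prod.fst h
    have h2 := congrArg (fun u => u.2.1) h
    have h3 := congrArg (fun u => u.2.2) h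
    obtain ⟨L, hL⟩ := isInvertible_mfderiv_extChartAt (I := 𝓡 2) (foot_mem_source hq)
    have h4 : L (footDeriv q.1 (prolongProj q ξ)) = 0 :=
      (congrArg (fun T : TangentSpace (𝓡 2) q.1.val.1 →L[ℝ] _ =>
        T (footDeriv q.1 (prolongProj q ξ))) hL).trans h1
    have h5 : footDeriv q.1 (prolongProj q ξ) = 0 := (map_eq_zero_iff L L.injective).1 h4
    have h6 : frameForm o (frame p₀.1.val) q.1.val.1 (footDeriv q.1 (prolongProj q ξ)) = 0 := by
      rw [h5, frameForm, map_zero, inner_zero_right]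
    simp only [h6, sub_zero] at h2
    exact eq_zero_of_prolongForms h5 h2 h3
  refine isInvertible_of_ker_eq_bot (V := (EuclideanSpace ℝ (Fin 2) × ℝ) × EuclideanSpace ℝ (Fin 1))
    (W := EuclideanSpace ℝ (Fin 2) × ℝ × ℝ) (by simp) hk

/-- Rotations add their angles. Thus only the sum of the angle of the vector and that of the circle
enters the frame. -/
theorem rotated_eq_angle (hq : q ∈ prolongDomain p₀) :
    rotated q.1 q.2 =
      Real.cos (angle p₀.1 q.1 + circleAngle p₀.2 q.2) • frame p₀.1.val q.1.val.1 +
        Real.sin (angle p₀.1 q.1 + circleAngle p₀.2 q.2) •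
          o.J q.1.val.1 (frame p₀.1.val q.1.val.1) := by
  have h := exp_circleAngle p₀.2 q.2
  have hre : (q.2 : ℂ).re = Real.cos (circleAngle p₀.2 q.2) := by
    rw [← h, Complex.exp_ofReal_mul_I_re]
  have him : (q.2 : ℂ).im = Real.sin (circleAngle p₀.2 q.2) := by
    rw [← h, Complex.exp_ofReal_mul_I_im]
  rw [rotated, hre, him, eq_combination (v := p₀.1) (mem_source_iff.1 hq.1).1, ← cos_angle hq.1,
    ← sin_angle hq.1, map_add, map_smul, map_smul, o.J_J, Real.cos_add, Real.sin_add]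
  module

theorem rotate_rotated_eq_angle (hq : q ∈ prolongDomain p₀) :
    o.J q.1.val.1 (rotated q.1 q.2) =
      Real.cos (angle p₀.1 q.1 + circleAngle p₀.2 q.2) •
          o.J q.1.val.1 (frame p₀.1.val q.1.val.1) -
        Real.sin (angle p₀.1 q.1 + circleAngle p₀.2 q.2) • frame p₀.1.val q.1.val.1 := by
  rw [rotated_eq_angle hq, map_add, map_smul, map_smul, o.J_J]
  module

/-- The local frame at `p₀`, in coordinates. -/
noncomputable def frameCoord (p₀ : Prolongation o) : EuclideanSpace ℝ (Fin 2) →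
    EuclideanSpace ℝ (Fin 2) :=
  chartField (I := 𝓡 2) p₀.1.val.1 (frame p₀.1.val)

/-- The rotated local frame at `p₀`, in coordinates. -/
noncomputable def frameCoordRotate (p₀ : Prolongation o) : EuclideanSpace ℝ (Fin 2) →
    EuclideanSpace ℝ (Fin 2) :=
  chartField (I := 𝓡 2) p₀.1.val.1 fun x => o.J x (frame p₀.1.val x)

/-- The first connection coefficient of the local frame at `p₀`, in coordinates. -/
noncomputable def formCoord (p₀ : Prolongation o) (y : EuclideanSpace ℝ (Fin 2)) : ℝ :=
  (fun x => frameForm o (frame p₀.1.val) x (frame p₀.1.val x))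
    ((extChartAt (𝓡 2) p₀.1.val.1).symm y)

/-- The second connection coefficient of the local frame at `p₀`, in coordinates. -/
noncomputable def formCoordRotate (p₀ : Prolongation o) (y : EuclideanSpace ℝ (Fin 2)) : ℝ :=
  (fun x => frameForm o (frame p₀.1.val) x (o.J x (frame p₀.1.val x)))
    ((extChartAt (𝓡 2) p₀.1.val.1).symm y)

theorem formCoord_apply (hq : q ∈ prolongDomain p₀) :
    formCoord p₀ (prolongCoord p₀ q).1 =
      frameForm o (frame p₀.1.val) q.1.val.1 (frame p₀.1.val q.1.val.1) := by
  change (fun x => frameForm o (frame p₀.1.val) x (frame p₀.1.val x)) _ = _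
  rw [prolongCoord, (extChartAt (𝓡 2) p₀.1.val.1).left_inv (foot_mem_source hq)]

theorem formCoordRotate_apply (hq : q ∈ prolongDomain p₀) :
    formCoordRotate p₀ (prolongCoord p₀ q).1 =
      frameForm o (frame p₀.1.val) q.1.val.1 (o.J _ (frame p₀.1.val q.1.val.1)) := by
  change (fun x => frameForm o (frame p₀.1.val) x (o.J x (frame p₀.1.val x))) _ = _
  rw [prolongCoord, (extChartAt (𝓡 2) p₀.1.val.1).left_inv (foot_mem_source hq)]

theorem frameCoord_apply (hq : q ∈ prolongDomain p₀) :
    mvfderiv (𝓡 2) (extChartAt (𝓡 2) p₀.1.val.1) q.1.val.1 (frame p₀.1.val q.1.val.1) =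
      frameCoord p₀ (prolongCoord p₀ q).1 :=
  chartField_extChartAt (I := 𝓡 2) (frame p₀.1.val) (foot_mem_source hq)

theorem frameCoordRotate_apply (hq : q ∈ prolongDomain p₀) :
    mvfderiv (𝓡 2) (extChartAt (𝓡 2) p₀.1.val.1) q.1.val.1 (o.J _ (frame p₀.1.val q.1.val.1)) =
      frameCoordRotate p₀ (prolongCoord p₀ q).1 :=
  chartField_extChartAt (I := 𝓡 2) (fun x => o.J x (frame p₀.1.val x)) (foot_mem_source hq)

theorem isLocalUnitField_center (p₀ : Prolongation o) :
    IsLocalUnitField (frame p₀.1.val) p₀.1.val.1 :=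
  isLocalUnitField_frame p₀.1.norm_val (mem_chart_source _ _)

theorem contDiffAt_frameCoord (p₀ : Prolongation o) :
    ContDiffAt ℝ ∞ (frameCoord p₀) (prolongCoord p₀ p₀).1 :=
  contDiffAt_chartField ((isLocalUnitField_center p₀).mono fun _ h => h.1)

theorem contDiffAt_frameCoordRotate (p₀ : Prolongation o) :
    ContDiffAt ℝ ∞ (frameCoordRotate p₀) (prolongCoord p₀ p₀).1 :=
  contDiffAt_chartField (((isLocalUnitField_center p₀).rotate o).mono fun _ h => h.1)

theorem contDiffAt_comp_extChartAt_symm {f : S → ℝ} {x : S} (hf : ContMDiffAt (𝓡 2) 𝓘(ℝ) ∞ f x) :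
    ContDiffAt ℝ ∞ (fun y => f ((extChartAt (𝓡 2) x).symm y)) (extChartAt (𝓡 2) x x) := by
  have h : ContMDiffAt 𝓘(ℝ, EuclideanSpace ℝ (Fin 2)) (𝓡 2) ∞ (extChartAt (𝓡 2) x).symm
      (extChartAt (𝓡 2) x x) :=
    (contMDiffOn_extChartAt_symm (n := ∞) x).contMDiffAt (extChartAt_target_mem_nhds x)
  exact contMDiffAt_iff_contDiffAt.1
    (ContMDiffAt.comp_of_eq hf h (extChartAt_to_inv (I := 𝓡 2) x))

theorem contDiffAt_formCoord (p₀ : Prolongation o) :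
    ContDiffAt ℝ ∞ (formCoord p₀) (prolongCoord p₀ p₀).1 :=
  contDiffAt_comp_extChartAt_symm (isLocalUnitField_center p₀).contMDiffAt_frameForm

theorem contDiffAt_formCoordRotate (p₀ : Prolongation o) :
    ContDiffAt ℝ ∞ (formCoordRotate p₀) (prolongCoord p₀ p₀).1 :=
  contDiffAt_comp_extChartAt_symm (isLocalUnitField_center p₀).contMDiffAt_frameForm_rotate

theorem mvfderiv_eq_fderiv_extChartAt {f : S → ℝ} {x : S} (hf : ContMDiffAt (𝓡 2) 𝓘(ℝ) ∞ f x)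
    (u : TangentSpace (𝓡 2) x) :
    mvfderiv (𝓡 2) f x u =
      fderiv ℝ (fun y => f ((extChartAt (𝓡 2) x).symm y)) (extChartAt (𝓡 2) x x)
        (mvfderiv (𝓡 2) (extChartAt (𝓡 2) x) x u) := by
  have hg : ContMDiffAt (𝓡 2) 𝓘(ℝ, EuclideanSpace ℝ (Fin 2)) ∞ (extChartAt (𝓡 2) x) x :=
    contMDiffAt_extChartAt
  rw [← mvfderiv_comp_fderiv_apply x
    ((contDiffAt_comp_extChartAt_symm hf).differentiableAt (by simp))
    (hg.mdifferentiableAt (by simp))]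
  have : f =ᶠ[𝓝 x] (fun y => f ((extChartAt (𝓡 2) x).symm y)) ∘ extChartAt (𝓡 2) x := by
    filter_upwards [extChartAt_source_mem_nhds (I := 𝓡 2) x] with y hy
    rw [Function.comp, (extChartAt (𝓡 2) x).left_inv hy]
  rw [mvfderiv_congr_of_eventuallyEq this]

theorem curvature_coord {κ : ℝ} (hκ : HasConstantCurvature S κ) (p₀ : Prolongation o) :
    fderiv ℝ (formCoord p₀) (prolongCoord p₀ p₀).1 (frameCoordRotate p₀ (prolongCoord p₀ p₀).1) -
      fderiv ℝ (formCoordRotate p₀) (prolongCoord p₀ p₀).1 (frameCoord p₀ (prolongCoord p₀ p₀).1) =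
    κ + formCoord p₀ (prolongCoord p₀ p₀).1 ^ 2 + formCoordRotate p₀ (prolongCoord p₀ p₀).1 ^ 2 := by
  have he := isLocalUnitField_center p₀
  have h := he.curvature (o := o) hκ
  rw [mvfderiv_eq_fderiv_extChartAt he.contMDiffAt_frameForm,
    mvfderiv_eq_fderiv_extChartAt he.contMDiffAt_frameForm_rotate] at h
  have hs := self_mem_prolongDomain p₀
  rw [← frameCoord_apply hs, ← frameCoordRotate_apply hs, formCoord_apply hs,
    formCoordRotate_apply hs]
  exact h

theorem torsion_coord (p₀ : Prolongation o) :
    fderiv ℝ (frameCoordRotate p₀) (prolongCoord p₀ p₀).1 (frameCoord p₀ (prolongCoord p₀ p₀).1) -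
      fderiv ℝ (frameCoord p₀) (prolongCoord p₀ p₀).1 (frameCoordRotate p₀ (prolongCoord p₀ p₀).1) =
    -(formCoord p₀ (prolongCoord p₀ p₀).1 • frameCoord p₀ (prolongCoord p₀ p₀).1) -
      formCoordRotate p₀ (prolongCoord p₀ p₀).1 • frameCoordRotate p₀ (prolongCoord p₀ p₀).1 := by
  have he := isLocalUnitField_center p₀
  have hs := self_mem_prolongDomain p₀
  have hsrc := extChartAt_source_mem_nhds (I := 𝓡 2) p₀.1.val.1
  have h := mvfderiv_mlieBracket_of_related (I := 𝓡 2) (g := extChartAt (𝓡 2) p₀.1.val.1)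
    (p := p₀.1.val.1) contMDiffAt_extChartAt
    (by filter_upwards [hsrc] with y hy using isInvertible_mfderiv_extChartAt hy)
    (A := frame p₀.1.val) (B := fun x => o.J x (frame p₀.1.val x))
    (by filter_upwards [hsrc] with y hy using chartField_extChartAt _ hy)
    (by filter_upwards [hsrc] with y hy using chartField_extChartAt (fun x => o.J x (frame p₀.1.val x)) hy)
    ((contDiffAt_frameCoord p₀).differentiableAt (by simp))
    ((contDiffAt_frameCoordRotate p₀).differentiableAt (by simp))
  refine h.symm.trans ?_
  rw [he.bracket_rotate (o := o), map_sub, map_neg, map_smul, map_smul, formCoord_apply hs,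
    formCoordRotate_apply hs, ← frameCoord_apply hs, ← frameCoordRotate_apply hs]

end ProlongationCoordinates

/-! ### Bracket relations of the magnetic frame -/

section ProlongationFrame

variable {S : Type*} [TopologicalSpace S] [ChartedSpace (EuclideanSpace ℝ (Fin 2)) S]
  [IsManifold (𝓡 2) ∞ S] [RiemannianBundle (fun x : S => TangentSpace (𝓡 2) x)]
  [IsContMDiffRiemannianBundle (𝓡 2) ∞ (EuclideanSpace ℝ (Fin 2))
    (fun x : S => TangentSpace (𝓡 2) x)] {o : SurfaceOrientation S}

open UnitTangent

variable {p₀ q : Prolongation o}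

/-- The horizontal lift of the rotated vector, in coordinates. -/
noncomputable def horizontalCoord (p₀ : Prolongation o) :
    EuclideanSpace ℝ (Fin 2) × ℝ × ℝ → EuclideanSpace ℝ (Fin 2) × ℝ × ℝ :=
  horizontalModel (frameCoord p₀) (frameCoordRotate p₀) (formCoord p₀) (formCoordRotate p₀)

/-- The horizontal lift of the rotated vector, turned by a right angle, in coordinates. -/
noncomputable def horizontalCoordRotate (p₀ : Prolongation o) :
    EuclideanSpace ℝ (Fin 2) × ℝ × ℝ → EuclideanSpace ℝ (Fin 2) × ℝ × ℝ :=
  horizontalModel (frameCoordRotate p₀) (-frameCoord p₀) (formCoordRotate p₀) (-formCoord p₀)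

/-- The magnetic frame, in coordinates. -/
noncomputable def magneticModel (κ : ℝ) (p₀ : Prolongation o) (i : Fin 4)
    (y : EuclideanSpace ℝ (Fin 2) × ℝ × ℝ) : EuclideanSpace ℝ (Fin 2) × ℝ × ℝ :=
  ![(0, 0, 1), horizontalCoord p₀ y + (0, 1, -(1 + κ)), horizontalCoordRotate p₀ y,
    horizontalCoord p₀ y] i

theorem mvfderiv_prolongCoord_of_eq (hq : q ∈ prolongDomain p₀) {ξ : TangentSpace prolongModel q}
    {u : TangentSpace (𝓡 2) q.1.val.1} {r t : ℝ} (h : prolongEquiv q ξ = (u, r, t)) :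
    mvfderiv prolongModel (prolongCoord p₀) q ξ =
      (mvfderiv (𝓡 2) (extChartAt (𝓡 2) p₀.1.val.1) q.1.val.1 u,
        r - frameForm o (frame p₀.1.val) q.1.val.1 u, t) := by
  rw [prolongEquiv_apply] at h
  have h1 : footDeriv q.1 (prolongProj q ξ) = u := congrArg Prod.fst h
  have h2 : connectionForm q.1 (prolongProj q ξ) = r := congrArg (fun u => u.2.1) h
  have h3 : thetaForm q ξ = t := congrArg (fun u => u.2.2) h
  rw [mvfderiv_prolongCoord hq, h1, h2, h3]

theorem mvfderiv_rotated (hq : q ∈ prolongDomain p₀) :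
    mvfderiv (𝓡 2) (extChartAt (𝓡 2) p₀.1.val.1) q.1.val.1 (rotated q.1 q.2) =
      (horizontalCoord p₀ (prolongCoord p₀ q)).1 := by
  rw [rotated_eq_angle hq, map_add, map_smul, map_smul, frameCoord_apply hq,
    frameCoordRotate_apply hq]
  rfl

theorem frameForm_rotated (hq : q ∈ prolongDomain p₀) :
    -frameForm o (frame p₀.1.val) q.1.val.1 (rotated q.1 q.2) =
      (horizontalCoord p₀ (prolongCoord p₀ q)).2.1 := by
  rw [rotated_eq_angle hq, frameForm_add, frameForm_smul, frameForm_smul, ← formCoord_apply hq,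
    ← formCoordRotate_apply hq]
  rfl

theorem mvfderiv_rotate_rotated (hq : q ∈ prolongDomain p₀) :
    mvfderiv (𝓡 2) (extChartAt (𝓡 2) p₀.1.val.1) q.1.val.1 (o.J _ (rotated q.1 q.2)) =
      (horizontalCoordRotate p₀ (prolongCoord p₀ q)).1 := by
  rw [rotate_rotated_eq_angle hq, sub_eq_add_neg, ← smul_neg, map_add, map_smul, map_smul, map_neg,
    frameCoord_apply hq, frameCoordRotate_apply hq]
  rfl

theorem frameForm_rotate_rotated (hq : q ∈ prolongDomain p₀) :
    -frameForm o (frame p₀.1.val) q.1.val.1 (o.J _ (rotated q.1 q.2)) =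
      (horizontalCoordRotate p₀ (prolongCoord p₀ q)).2.1 := by
  rw [rotate_rotated_eq_angle hq, sub_eq_add_neg, ← neg_smul, frameForm_add, frameForm_smul,
    frameForm_smul, ← formCoord_apply hq, ← formCoordRotate_apply hq, neg_mul, ← mul_neg]
  rfl

theorem mvfderiv_magneticFrame (κ : ℝ) (hq : q ∈ prolongDomain p₀) (i : Fin 4) :
    mvfderiv prolongModel (prolongCoord p₀) q (magneticFrame κ i q) =
      magneticModel κ p₀ i (prolongCoord p₀ q) := by
  rw [mvfderiv_prolongCoord_of_eq hq (prolongEquiv_magneticFrame κ i q)]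
  have h0 : frameForm o (frame p₀.1.val) q.1.val.1 0 = 0 := by
    rw [frameForm, map_zero, inner_zero_right]
  fin_cases i
  · change (mvfderiv (𝓡 2) (extChartAt (𝓡 2) p₀.1.val.1) q.1.val.1 0,
      0 - frameForm o (frame p₀.1.val) q.1.val.1 0, (1 : ℝ)) = (0, 0, 1)
    rw [map_zero, h0, sub_zero]
  · change (mvfderiv (𝓡 2) (extChartAt (𝓡 2) p₀.1.val.1) q.1.val.1 (rotated q.1 q.2),
      1 - frameForm o (frame p₀.1.val) q.1.val.1 (rotated q.1 q.2), -(1 + κ)) =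
      horizontalCoord p₀ (prolongCoord p₀ q) + (0, 1, -(1 + κ))
    rw [mvfderiv_rotated hq, sub_eq_add_neg, frameForm_rotated hq]
    exact Prod.ext (add_zero _).symm (Prod.ext (add_comm _ _) (zero_add _).symm)
  · change (mvfderiv (𝓡 2) (extChartAt (𝓡 2) p₀.1.val.1) q.1.val.1 (o.J _ (rotated q.1 q.2)),
      0 - frameForm o (frame p₀.1.val) q.1.val.1 (o.J _ (rotated q.1 q.2)), (0 : ℝ)) =
      horizontalCoordRotate p₀ (prolongCoord p₀ q)
    rw [mvfderiv_rotate_rotated hq, zero_sub, frameForm_rotate_rotated hq]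
    rfl
  · change (mvfderiv (𝓡 2) (extChartAt (𝓡 2) p₀.1.val.1) q.1.val.1 (rotated q.1 q.2),
      0 - frameForm o (frame p₀.1.val) q.1.val.1 (rotated q.1 q.2), (0 : ℝ)) =
      horizontalCoord p₀ (prolongCoord p₀ q)
    rw [mvfderiv_rotated hq, zero_sub, frameForm_rotated hq]
    rfl

theorem contDiffAt_horizontalCoord (p₀ : Prolongation o) :
    ContDiffAt ℝ ∞ (horizontalCoord p₀) (prolongCoord p₀ p₀) :=
  contDiffAt_horizontalModel (contDiffAt_frameCoord p₀) (contDiffAt_frameCoordRotate p₀)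
    (contDiffAt_formCoord p₀) (contDiffAt_formCoordRotate p₀)

theorem contDiffAt_horizontalCoordRotate (p₀ : Prolongation o) :
    ContDiffAt ℝ ∞ (horizontalCoordRotate p₀) (prolongCoord p₀ p₀) :=
  contDiffAt_horizontalModel (contDiffAt_frameCoordRotate p₀) (contDiffAt_frameCoord p₀).neg
    (contDiffAt_formCoordRotate p₀) (contDiffAt_formCoord p₀).neg

theorem contDiffAt_magneticModel (κ : ℝ) (p₀ : Prolongation o) (i : Fin 4) :
    ContDiffAt ℝ ∞ (magneticModel κ p₀ i) (prolongCoord p₀ p₀) := by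
  fin_cases i
  · exact contDiffAt_const
  · exact (contDiffAt_horizontalCoord p₀).add contDiffAt_const
  · exact contDiffAt_horizontalCoordRotate p₀
  · exact contDiffAt_horizontalCoord p₀

theorem eventually_mem_prolongDomain (p₀ : Prolongation o) : ∀ᶠ q in 𝓝 p₀, q ∈ prolongDomain p₀ :=
  (isOpen_prolongDomain p₀).mem_nhds (self_mem_prolongDomain p₀)

theorem isLocalFrameOn_magneticFrame (κ : ℝ) :
    IsLocalFrameOn prolongModel ((EuclideanSpace ℝ (Fin 2) × ℝ) × EuclideanSpace ℝ (Fin 1)) ∞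
      (magneticFrame (o := o) κ) univ where
  linearIndependent _ := linearIndependent_magneticFrame κ _
  generating _ := (span_magneticFrame κ _).ge
  contMDiffOn i p _ := by
    have hd := eventually_mem_prolongDomain p
    exact (contMDiffAt_of_related (contMDiffAt_prolongCoord (self_mem_prolongDomain p))
      (hd.mono fun q hq => isInvertible_mfderiv_prolongCoord hq)
      (hd.mono fun q hq => mvfderiv_magneticFrame κ hq i)
      (contDiffAt_magneticModel κ p i)).contMDiffWithinAt

theorem mvfderiv_bracket_magneticFrame (κ : ℝ) (i j : Fin 4) (p : Prolongation o) :
    mvfderiv prolongModel (prolongCoord p) p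
        (mlieBracket prolongModel (magneticFrame κ i) (magneticFrame κ j) p) =
      fderiv ℝ (magneticModel κ p j) (prolongCoord p p) (magneticModel κ p i (prolongCoord p p)) -
        fderiv ℝ (magneticModel κ p i) (prolongCoord p p)
          (magneticModel κ p j (prolongCoord p p)) := by
  have hd := eventually_mem_prolongDomain p
  exact mvfderiv_mlieBracket_of_related (contMDiffAt_prolongCoord (self_mem_prolongDomain p))
      (hd.mono fun q hq => isInvertible_mfderiv_prolongCoord hq)
      (hd.mono fun q hq => mvfderiv_magneticFrame κ hq i)
      (hd.mono fun q hq => mvfderiv_magneticFrame κ hq j)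
      ((contDiffAt_magneticModel κ p i).differentiableAt (by simp))
      ((contDiffAt_magneticModel κ p j).differentiableAt (by simp))

theorem injective_mvfderiv_prolongCoord (p : Prolongation o) :
    Function.Injective (mvfderiv prolongModel (prolongCoord p) p) := by
  obtain ⟨L, hL⟩ := isInvertible_mfderiv_prolongCoord (self_mem_prolongDomain p)
  intro ξ η h
  refine L.injective ?_
  have e : ∀ ζ, L ζ = mvfderiv prolongModel (prolongCoord p) p ζ := fun ζ =>
    congrArg (fun T : TangentSpace prolongModel p →L[ℝ] _ => T ζ) hL
  rw [e, e, h]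

theorem fderiv_magneticModel_zero (κ : ℝ) (p : Prolongation o)
    (y : EuclideanSpace ℝ (Fin 2) × ℝ × ℝ) : fderiv ℝ (magneticModel κ p 0) y = 0 :=
  fderiv_const_apply (0, 0, 1)

theorem fderiv_magneticModel_one (κ : ℝ) (p : Prolongation o)
    (y : EuclideanSpace ℝ (Fin 2) × ℝ × ℝ) :
    fderiv ℝ (magneticModel κ p 1) y = fderiv ℝ (horizontalCoord p) y :=
  fderiv_add_const _

theorem fderiv_horizontalCoord_vertical (p : Prolongation o) :
    fderiv ℝ (horizontalCoord p) (prolongCoord p p) (0, 0, 1) =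
      horizontalCoordRotate p (prolongCoord p p) := by
  have h := fderiv_horizontalModel (p := prolongCoord p p)
    ((contDiffAt_frameCoord p).differentiableAt (by simp))
    ((contDiffAt_frameCoordRotate p).differentiableAt (by simp))
    ((contDiffAt_formCoord p).differentiableAt (by simp))
    ((contDiffAt_formCoordRotate p).differentiableAt (by simp)) (0, 0, 1)
  refine h.trans ?_
  simp only [map_zero, smul_zero, mul_zero, add_zero, neg_zero, zero_add, one_smul]
  exact add_zero _

theorem fderiv_horizontalCoordRotate_vertical (p : Prolongation o) :
    fderiv ℝ (horizontalCoordRotate p) (prolongCoord p p) (0, 0, 1) =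
      -horizontalCoord p (prolongCoord p p) := by
  have h := fderiv_horizontalModel (p := prolongCoord p p)
    ((contDiffAt_frameCoordRotate p).differentiableAt (by simp))
    ((contDiffAt_frameCoord p).neg.differentiableAt (by simp))
    ((contDiffAt_formCoordRotate p).differentiableAt (by simp))
    ((contDiffAt_formCoord p).neg.differentiableAt (by simp)) (0, 0, 1)
  refine h.trans ?_
  simp only [map_zero, smul_zero, mul_zero, add_zero, neg_zero, zero_add, one_smul]
  refine (add_zero _).trans ?_
  rw [horizontalCoord, horizontalModel, horizontalModel]
  simp only [Pi.neg_apply, smul_neg, mul_neg, Prod.neg_mk, neg_add, neg_neg, neg_zero]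

/-- Each relation is checked at `p` in the coordinates centred at `p`, where the torsion and
curvature identities of the local frame are available. The brackets with Θ are derivatives in the
circle angle. In the third relation κ(X + Z) is rewritten as κ W + κ(κ + 1)Θ. -/
theorem isMagneticFrame {κ : ℝ} (hκ : HasConstantCurvature S κ) :
    IsMagneticFrame prolongModel (magneticFrame (o := o) κ) κ where
  isLocalFrameOn := isLocalFrameOn_magneticFrame κ
  bracket_zero_one p := by
    refine injective_mvfderiv_prolongCoord p ?_
    rw [mvfderiv_bracket_magneticFrame, mvfderiv_magneticFrame κ (self_mem_prolongDomain p),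
      fderiv_magneticModel_zero, fderiv_magneticModel_one]
    exact (sub_zero _).trans (fderiv_horizontalCoord_vertical p)
  bracket_zero_two p := by
    refine injective_mvfderiv_prolongCoord p ?_
    rw [map_neg, mvfderiv_bracket_magneticFrame,
      mvfderiv_magneticFrame κ (self_mem_prolongDomain p), fderiv_magneticModel_zero]
    exact (sub_zero _).trans (fderiv_horizontalCoordRotate_vertical p)
  bracket_one_two p := by
    refine injective_mvfderiv_prolongCoord p ?_
    rw [map_add, map_smul, map_smul, mvfderiv_bracket_magneticFrame,
      mvfderiv_magneticFrame κ (self_mem_prolongDomain p),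
      mvfderiv_magneticFrame κ (self_mem_prolongDomain p), fderiv_magneticModel_one]
    refine (bracket_horizontalModel (p := prolongCoord p p)
      ((contDiffAt_frameCoord p).differentiableAt (by simp))
      ((contDiffAt_frameCoordRotate p).differentiableAt (by simp))
      ((contDiffAt_formCoord p).differentiableAt (by simp))
      ((contDiffAt_formCoordRotate p).differentiableAt (by simp))
      (torsion_coord p) (curvature_coord hκ p)).trans ?_
    change κ • (horizontalCoord p (prolongCoord p p) + (0, 1, 0)) =
      κ • (horizontalCoord p (prolongCoord p p) + (0, 1, -(1 + κ))) + (κ * (κ + 1)) • (0, 0, 1)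
    refine Prod.ext ?_ (Prod.ext ?_ ?_) <;>
      simp only [Prod.fst_add, Prod.snd_add, Prod.smul_fst, Prod.smul_snd, smul_zero, add_zero,
        smul_eq_mul]
    all_goals ring

end ProlongationFrame

/-! ### Separation and compactness in the unit tangent bundle -/

section UnitTangentTopology

variable {S : Type*} [TopologicalSpace S] [ChartedSpace (EuclideanSpace ℝ (Fin 2)) S]
  [IsManifold (𝓡 2) ∞ S] [RiemannianBundle (fun x : S => TangentSpace (𝓡 2) x)]
  [IsContMDiffRiemannianBundle (𝓡 2) ∞ (EuclideanSpace ℝ (Fin 2))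
    (fun x : S => TangentSpace (𝓡 2) x)] {o : SurfaceOrientation S}

namespace UnitTangent

theorem isOpen_foot_mem_source (v : UnitTangent o) :
    IsOpen {w : UnitTangent o | w.val.1 ∈ (chartAt (EuclideanSpace ℝ (Fin 2)) v.val.1).source} :=
  (chartAt (EuclideanSpace ℝ (Fin 2)) v.val.1).open_source.preimage contMDiff_foot.continuous

theorem continuousOn_cosAngle (v : UnitTangent o) : ContinuousOn (cosAngle v)
    {w : UnitTangent o | w.val.1 ∈ (chartAt (EuclideanSpace ℝ (Fin 2)) v.val.1).source} :=
  (contMDiffOn_inner_frame v.norm_val).continuousOn.comp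
    isInducing_val.continuous.continuousOn fun _ hw => hw

theorem eq_of_cosAngle_eq {v w : UnitTangent o} (h : v.val.1 = w.val.1)
    (hc : cosAngle v w = cosAngle v v) : v = w := by
  obtain ⟨⟨x, u⟩, hu⟩ := v
  obtain ⟨⟨y, u'⟩, hu'⟩ := w
  obtain rfl : x = y := h
  have hx : x ∈ (chartAt (EuclideanSpace ℝ (Fin 2)) x).source := mem_chart_source _ _
  have hv : cosAngle (o := o) ⟨⟨x, u⟩, hu⟩ ⟨⟨x, u⟩, hu⟩ = 1 := by
    change inner ℝ (frame (⟨x, u⟩ : TangentBundle (𝓡 2) S) x) u = 1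
    rw [frame_self hu]
    change inner ℝ u u = 1
    rw [real_inner_self_eq_norm_sq]
    exact (congrArg (· ^ 2) hu).trans (one_pow 2)
  have hw := cosAngle_sq_add (o := o) (v := ⟨⟨x, u⟩, hu⟩) (w := ⟨⟨x, u'⟩, hu'⟩) hx
  have he := eq_combination (o := o) (v := ⟨⟨x, u⟩, hu⟩) (w := ⟨⟨x, u'⟩, hu'⟩) hx
  rw [hc, hv] at hw
  have hs : sinAngle (o := o) ⟨⟨x, u⟩, hu⟩ ⟨⟨x, u'⟩, hu'⟩ = 0 := by
    have h2 : sinAngle (o := o) ⟨⟨x, u⟩, hu⟩ ⟨⟨x, u'⟩, hu'⟩ ^ 2 = 0 := by linarith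
    exact pow_eq_zero_iff two_ne_zero |>.1 h2
  rw [hc, hv, hs, one_smul, zero_smul, add_zero] at he
  have he' : u' = u := he.trans (frame_self (v₀ := ⟨x, u⟩) hu)
  subst he'
  rfl

/-- Vectors with different feet are separated on the surface. For a common foot the cosine of the
angle from `v` separates, since it equals 1 only at `v`. -/
instance [T2Space S] : T2Space (UnitTangent o) := by
  refine ⟨fun v w hvw => ?_⟩
  by_cases h : v.val.1 = w.val.1
  · have hc : cosAngle v v ≠ cosAngle v w := fun hc => hvw (eq_of_cosAngle_eq h hc.symm)
    obtain ⟨A, B, hA, hB, hvA, hwB, hAB⟩ := t2_separation hc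
    have hU := isOpen_foot_mem_source v
    refine ⟨_, _, (continuousOn_cosAngle v).isOpen_inter_preimage hU hA,
      (continuousOn_cosAngle v).isOpen_inter_preimage hU hB, ⟨mem_chart_source _ _, hvA⟩,
      ⟨?_, hwB⟩, ?_⟩
    · change w.val.1 ∈ (chartAt (EuclideanSpace ℝ (Fin 2)) v.val.1).source
      rw [← h]
      exact mem_chart_source _ _
    · exact (hAB.preimage (cosAngle v)).mono inter_subset_right inter_subset_right
  · obtain ⟨A, B, hA, hB, hvA, hwB, hAB⟩ := t2_separation h
    have hf := (contMDiff_foot (o := o)).continuous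
    exact ⟨_, _, hA.preimage hf, hB.preimage hf, hvA, hwB, hAB.preimage _⟩

theorem exists_foot_eq (x : S) : ∃ v : UnitTangent o, v.val.1 = x := by
  obtain ⟨u, hu⟩ : ∃ u : TangentSpace (𝓡 2) x, u ≠ 0 :=
    exists_ne (0 : EuclideanSpace ℝ (Fin 2))
  exact ⟨⟨⟨x, (‖u‖⁻¹ : ℝ) • u⟩, norm_smul_inv_norm (𝕜 := ℝ) hu⟩, rfl⟩

/-- The unit vectors over a compact subset of a chart domain form a compact set. -/
theorem isCompact_foot_mem {x : S} {K : Set S} (hK : IsCompact K)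
    (hKx : K ⊆ (chartAt (EuclideanSpace ℝ (Fin 2)) x).source) :
    IsCompact {w : UnitTangent o | w.val.1 ∈ K} := by
  obtain ⟨v, rfl⟩ := exists_foot_eq (o := o) x
  have hn : ∀ y ∈ K, ‖frame v.val y‖ = 1 := fun y hy => norm_frame v.norm_val (hKx hy)
  -- The local unit field trivializes the circle bundle over `K`, so the set in question is a
  -- continuous image of a compact product.
  let g : K × Circle → UnitTangent o := fun q =>
    ⟨⟨q.1, (q.2 : ℂ).re • frame v.val q.1 + (q.2 : ℂ).im • o.J q.1 (frame v.val q.1)⟩,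
      o.norm_combination (hn q.1 q.1.2) _ _ (circle_re_sq_add_im_sq q.2)⟩
  have hre : ContMDiff ((𝓡 2).prod (𝓡 1)) 𝓘(ℝ) ∞ fun q : S × Circle => (q.2 : ℂ).re :=
    Complex.reCLM.contDiff.contMDiff.comp (contMDiff_circle_coe.comp contMDiff_snd)
  have him : ContMDiff ((𝓡 2).prod (𝓡 1)) 𝓘(ℝ) ∞ fun q : S × Circle => (q.2 : ℂ).im :=
    Complex.imCLM.contDiff.contMDiff.comp (contMDiff_circle_coe.comp contMDiff_snd)
  have hU : ContMDiffOn ((𝓡 2).prod (𝓡 1)) (𝓡 2) ∞ (fun q : S × Circle => q.1)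
      ((chartAt (EuclideanSpace ℝ (Fin 2)) v.val.1).source ×ˢ univ) := contMDiff_fst.contMDiffOn
  have h := contMDiffOn_combination (I' := (𝓡 2).prod (𝓡 1)) (b := fun q : S × Circle => q.1)
    (U := (chartAt (EuclideanSpace ℝ (Fin 2)) v.val.1).source ×ˢ univ)
    ((contMDiffOn_frame v.norm_val).comp hU fun q hq => hq.1)
    ((contMDiffOn_J_frame o v.norm_val).comp hU fun q hq => hq.1)
    hre.contMDiffOn him.contMDiffOn
  have hg : Continuous g := by
    refine isInducing_val.continuous_iff.2 ?_
    exact h.continuousOn.comp_continuous (f := fun q : K × Circle => ((q.1 : S), q.2))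
      (by fun_prop) fun q => ⟨hKx q.1.2, mem_univ _⟩
  have : CompactSpace K := isCompact_iff_compactSpace.1 hK
  convert! isCompact_range hg
  refine Subset.antisymm (fun w hw => ?_) (range_subset_iff.2 fun q => q.1.2)
  obtain ⟨z, hz⟩ := exists_rotated (o := o)
    (v := ⟨⟨w.val.1, frame v.val w.val.1⟩, hn w.val.1 hw⟩) (u := w.val.2) (by
      rw [real_inner_self_eq_norm_sq, w.norm_val, one_pow])
  refine ⟨(⟨w.val.1, hw⟩, z), UnitTangent.ext ?_⟩
  exact congrArg (fun u => (⟨w.val.1, u⟩ : TangentBundle (𝓡 2) S)) hz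

end UnitTangent

end UnitTangentTopology

/-! ### Extension of integral curves -/

section Completeness

variable {E : Type*} [NormedAddCommGroup E] [NormedSpace ℝ E] [CompleteSpace E]
  {H : Type*} [TopologicalSpace H] {I : ModelWithCorners ℝ E H} [I.Boundaryless]
  {M : Type*} [TopologicalSpace M] [ChartedSpace H M] [IsManifold I ∞ M]
  {X : ∀ p : M, TangentSpace I p}

theorem eventually_exists_isMIntegralCurveOn
    (hX : ContMDiff I I.tangent ∞ (fun q => (⟨q, X q⟩ : TangentBundle I M))) (p : M) :
    ∃ ε > 0, ∀ᶠ q in 𝓝 p, ∃ γ : ℝ → M, γ 0 = q ∧ IsMIntegralCurveOn γ X (Ioo (-ε) ε) := by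
  have hf : ContDiffAt ℝ ∞ (chartField p X) (extChartAt I p p) :=
    contDiffAt_chartField (Eventually.of_forall fun q => hX q)
  obtain ⟨ε, hε, α, J, h⟩ := exists_localFlow (hf.of_le two_le_infty)
    (extChartAt_target_mem_nhds (I := I) p)
  refine ⟨ε, hε, ?_⟩
  filter_upwards [(continuousAt_extChartAt p).eventually h, extChartAt_source_mem_nhds (I := I) p]
    with q hq hqs
  refine ⟨fun t => (extChartAt I p).symm (α (extChartAt I p q) t), ?_, fun t ht => ?_⟩
  · change (extChartAt I p).symm (α (extChartAt I p q) 0) = q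
    rw [hq.1, (extChartAt I p).left_inv hqs]
  · obtain ⟨h1, h2, -⟩ := hq.2.2 t ht
    exact (hasMFDerivAt_symm_comp h1 h2).hasMFDerivWithinAt

/-- The existence time is bounded below near every point, hence on a compact set by a finite
subcover. This uniform time carries integral curves past a finite end. -/
theorem exists_isMIntegralCurveOn_of_isCompact
    (hX : ContMDiff I I.tangent ∞ (fun q => (⟨q, X q⟩ : TangentBundle I M))) {K : Set M}
    (hK : IsCompact K) :
    ∃ ε > 0, ∀ q ∈ K, ∃ γ : ℝ → M, γ 0 = q ∧ IsMIntegralCurveOn γ X (Ioo (-ε) ε) := by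
  choose ε hε h using eventually_exists_isMIntegralCurveOn hX
  obtain ⟨T, -, hT⟩ := hK.elim_nhds_subcover _ fun p _ => h p
  have hmin : ∃ δ > 0, ∀ p ∈ T, δ ≤ ε p := by
    rcases T.eq_empty_or_nonempty with rfl | hne
    · exact ⟨1, one_pos, by simp⟩
    · obtain ⟨p, hp, hmin⟩ := T.exists_min_image ε hne
      exact ⟨ε p, hε p, hmin⟩
  obtain ⟨δ, hδ, hmin⟩ := hmin
  refine ⟨δ, hδ, fun q hq => ?_⟩
  obtain ⟨p, hp, hqp⟩ := mem_iUnion₂.1 (hT hq)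
  obtain ⟨γ, h0, hγ⟩ := hqp
  exact ⟨γ, h0, hγ.mono (Ioo_subset_Ioo (neg_le_neg (hmin p hp)) (hmin p hp))⟩

variable [T2Space M]

/-- An integral curve can be extended beyond its end points if, near these, it meets points from
which the integral curves exist for long enough. -/
theorem exists_extension_isMIntegralCurveOn
    (hX : ContMDiff I I.tangent ∞ (fun q => (⟨q, X q⟩ : TangentBundle I M))) {γ : ℝ → M} {b : ℝ}
    (hb : 0 < b) (hγ : IsMIntegralCurveOn γ X (Ioo (-b) b)) {ε : ℝ} {t₁ t₂ : ℝ}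
    (h₁ : t₁ ∈ Ioo (max 0 (b - ε)) b) (h₂ : t₂ ∈ Ioo (-b) (min 0 (-b + ε)))
    (e₁ : ∃ β : ℝ → M, β 0 = γ t₁ ∧ IsMIntegralCurveOn β X (Ioo (-ε) ε))
    (e₂ : ∃ β : ℝ → M, β 0 = γ t₂ ∧ IsMIntegralCurveOn β X (Ioo (-ε) ε)) :
    ∃ c > b, ∃ β : ℝ → M, β 0 = γ 0 ∧ IsMIntegralCurveOn β X (Ioo (-c) c) := by
  have hX1 : ContMDiff I I.tangent 1 (fun q => (⟨q, X q⟩ : TangentBundle I M)) :=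
    hX.of_le ENat.LEInfty.out
  have : IsManifold I 1 M := IsManifold.of_le (n := ∞) ENat.LEInfty.out
  obtain ⟨β₁, i₁, d₁⟩ := e₁
  obtain ⟨β₂, i₂, d₂⟩ := e₂
  have a₁ := h₁.1
  have a₂ := h₂.2
  rw [max_lt_iff] at a₁
  rw [lt_min_iff] at a₂
  have hb₁ := h₁.2
  have hb₂ := h₂.1
  have shift : ∀ {β : ℝ → M} (s : ℝ), IsMIntegralCurveOn β X (Ioo (-ε) ε) →
      IsMIntegralCurveOn (β ∘ (· + -s)) X (Ioo (s - ε) (s + ε)) := by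
    intro β s h
    refine (h.comp_add (-s)).mono fun t ht => ?_
    change t + -s ∈ Ioo (-ε) ε
    exact ⟨by linarith [ht.1], by linarith [ht.2]⟩
  have d₁' := shift t₁ d₁
  have d₂' := shift t₂ d₂
  -- The curve is continued first to the right, by the solution from γ(t₁), and then to the left, by
  -- the one from γ(t₂). As t₁ > b - ε and t₂ < -b + ε, both continuations pass the end points.
  have q₁ := isMIntegralCurveOn_piecewise (t₀ := t₁) hX1 hγ d₁'
    ⟨⟨by linarith, by linarith⟩, ⟨by linarith, by linarith⟩⟩ (by simp [i₁])
  have q₁' := q₁.mono (Ioo_subset_Ioo_union_Ioo (a := -b) (a₁ := -b) (d := t₁ + ε)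
    (b₁ := t₁ + ε) le_rfl (by linarith) le_rfl)
  have v₁ : ∀ t ∈ Ioo (-b) b, piecewise (Ioo (-b) b) γ (β₁ ∘ (· + -t₁)) t = γ t :=
    fun t ht => piecewise_eq_of_mem _ _ _ ht
  have q₂ := isMIntegralCurveOn_piecewise (t₀ := t₂) hX1 q₁' d₂'
    ⟨⟨by linarith, by linarith⟩, ⟨by linarith, by linarith⟩⟩ (by
      rw [v₁ t₂ ⟨by linarith, by linarith⟩]
      simp [i₂])
  rw [union_comm] at q₂
  have q₂' := q₂.mono (Ioo_subset_Ioo_union_Ioo (a := t₂ - ε) (a₁ := t₂ - ε) (d := t₁ + ε)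
    (b₁ := t₁ + ε) le_rfl (by linarith) le_rfl)
  refine ⟨min (t₁ + ε) (ε - t₂), lt_min (by linarith) (by linarith), _, ?_,
    q₂'.mono (Ioo_subset_Ioo ?_ (min_le_left _ _))⟩
  · rw [piecewise_eq_of_mem _ _ _ (by constructor <;> linarith), v₁ 0 ⟨by linarith, hb⟩]
  · linarith [min_le_right (t₁ + ε) (ε - t₂)]

/-- An integral curve exists for all time if integral curves on bounded intervals can always be
extended. -/
theorem exists_isMIntegralCurve_of_extension
    (hX : ContMDiff I I.tangent ∞ (fun q => (⟨q, X q⟩ : TangentBundle I M))) (p : M)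
    (hext : ∀ (b : ℝ) (γ : ℝ → M), 0 < b → γ 0 = p → IsMIntegralCurveOn γ X (Ioo (-b) b) →
      ∃ c > b, ∃ β : ℝ → M, β 0 = γ 0 ∧ IsMIntegralCurveOn β X (Ioo (-c) c)) :
    ∃ γ : ℝ → M, γ 0 = p ∧ IsMIntegralCurve (I := I) γ X := by
  have hX1 : ContMDiff I I.tangent 1 (fun q => (⟨q, X q⟩ : TangentBundle I M)) :=
    hX.of_le ENat.LEInfty.out
  have : IsManifold I 1 M := IsManifold.of_le (n := ∞) ENat.LEInfty.out
  rw [exists_isMIntegralCurve_iff_exists_isMIntegralCurveOn_Ioo hX1]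
  by_contra! hno
  -- If there is no global curve, the half-lengths of intervals of existence have a finite supremum
  -- b. By uniqueness the curves fit together on (-b, b), and the extension of the resulting curve
  -- contradicts the supremum.
  set s := {a : ℝ | ∃ γ, γ 0 = p ∧ IsMIntegralCurveOn γ X (Ioo (-a) a)} with hs
  obtain ⟨a₀, ha₀⟩ := hno
  have hdown : ∀ {a a' : ℝ}, a ∈ s → a' ≤ a → a' ∈ s := by
    rintro a a' ⟨γ, h0, hγ⟩ h
    exact ⟨γ, h0, hγ.mono (Ioo_subset_Ioo (neg_le_neg h) h)⟩
  have hbdd : BddAbove s := ⟨a₀, fun a ⟨γ, h0, hγ⟩ => by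
    by_contra! h
    exact ha₀ γ h0 (hγ.mono (Ioo_subset_Ioo (neg_le_neg h.le) h.le))⟩
  obtain ⟨ε, hε, hloc⟩ := eventually_exists_isMIntegralCurveOn hX p
  have hεs : ε ∈ s := hloc.self_of_nhds
  set b := sSup s with hb
  have hεb : ε ≤ b := le_csSup hbdd hεs
  have hlt : ∀ a < b, a ∈ s := by
    intro a ha
    obtain ⟨a', ha', h⟩ := exists_lt_of_lt_csSup ⟨ε, hεs⟩ ha
    exact hdown ha' h.le
  have hmid : ∀ t ∈ Ioo (-b) b, (|t| + b) / 2 ∈ s := fun t ht =>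
    hlt _ (by have := abs_lt.2 ht; linarith)
  have : Nonempty M := ⟨p⟩
  choose! γ h0 hγ using hlt
  have hagree : ∀ a < b, ∀ a' < b, ∀ t, t ∈ Ioo (-a) a → t ∈ Ioo (-a') a' → γ a t = γ a' t := by
    have key : ∀ a < b, ∀ a' < b, a ≤ a' → ∀ t, t ∈ Ioo (-a) a → γ a t = γ a' t := by
      intro a ha a' ha' hle t ht
      exact isMIntegralCurveOn_Ioo_eqOn_of_contMDiff_boundaryless (t₀ := 0)
        ⟨by linarith [ht.1, ht.2], by linarith [ht.1, ht.2]⟩ hX1 (hγ a ha)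
        ((hγ a' ha').mono (Ioo_subset_Ioo (neg_le_neg hle) hle)) (by rw [h0 a ha, h0 a' ha']) ht
    intro a ha a' ha' t ht ht'
    rcases le_total a a' with h | h
    · exact key a ha a' ha' h t ht
    · exact (key a' ha' a ha h t ht').symm
  have hm : ∀ t ∈ Ioo (-b) b, (|t| + b) / 2 < b ∧ t ∈ Ioo (-((|t| + b) / 2)) ((|t| + b) / 2) := by
    intro t ht
    have := abs_lt.2 ht
    exact ⟨by linarith, abs_lt.1 (by linarith)⟩
  -- At time t the glued curve uses the solution of half-length (|t| + b) / 2, which lies strictly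
  -- between |t| and b.
  have hcurve : IsMIntegralCurveOn (fun t => γ ((|t| + b) / 2) t) X (Ioo (-b) b) := by
    intro t ht
    obtain ⟨h1, h2⟩ := hm t ht
    have h3 := (hγ _ h1 t h2).hasMFDerivAt (Ioo_mem_nhds h2.1 h2.2)
    suffices heq : (fun t => γ ((|t| + b) / 2) t) =ᶠ[𝓝 t] γ ((|t| + b) / 2) from
      (h3.congr_of_eventuallyEq heq).hasMFDerivWithinAt
    filter_upwards [Ioo_mem_nhds h2.1 h2.2, Ioo_mem_nhds ht.1 ht.2] with u hu hu'
    obtain ⟨h4, h5⟩ := hm u hu'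
    exact hagree _ h4 _ h1 u h5 hu
  have hb0 : 0 < b := hε.trans_le hεb
  obtain ⟨c, hc, β, hβ0, hβ⟩ := hext b (fun t => γ ((|t| + b) / 2) t) hb0 (h0 _ (hm 0 ⟨by linarith, hb0⟩).1) hcurve
  have hcs : c ∈ s := ⟨β, hβ0.trans (h0 _ (hm 0 ⟨by linarith, hb0⟩).1), hβ⟩
  exact absurd (le_csSup hbdd hcs) (not_le.2 hc)

end Completeness

/-! ### Regularity of integral curves -/

section CurveRegularity

variable {E : Type*} [NormedAddCommGroup E] [NormedSpace ℝ E] [CompleteSpace E]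
  {H : Type*} [TopologicalSpace H] {I : ModelWithCorners ℝ E H} [I.Boundaryless]
  {M : Type*} [TopologicalSpace M] [ChartedSpace H M] [IsManifold I ∞ M]
  {X : ∀ p : M, TangentSpace I p}

/-- The velocity is the continuous field evaluated along a continuous curve. Continuous
differentiability is what the length of the projected curve requires. -/
theorem contMDiffAt_of_isMIntegralCurveOn
    (hX : ContMDiff I I.tangent ∞ (fun q => (⟨q, X q⟩ : TangentBundle I M))) {γ : ℝ → M} {U : Set ℝ}
    (hU : IsOpen U) (hγ : IsMIntegralCurveOn γ X U) {t₀ : ℝ} (ht₀ : t₀ ∈ U) :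
    ContMDiffAt 𝓘(ℝ) I 1 γ t₀ := by
  set g := extChartAt I (γ t₀) with hg
  have hs : IsOpen g.source := isOpen_extChartAt_source (γ t₀)
  have hgs : ContMDiffOn I 𝓘(ℝ, E) ∞ g g.source := by
    rw [hg, extChartAt_source]
    exact contMDiffOn_extChartAt
  have hcγ : ∀ t ∈ U, HasMFDerivAt 𝓘(ℝ) I γ t ((1 : ℝ →L[ℝ] ℝ).smulRight (X (γ t))) :=
    fun t ht => (hγ t ht).hasMFDerivAt (hU.mem_nhds ht)
  have hcont : ContinuousOn γ U := fun t ht => (hcγ t ht).continuousAt.continuousWithinAt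
  have hV : IsOpen (U ∩ γ ⁻¹' g.source) := hcont.isOpen_inter_preimage hU hs
  have hmem : t₀ ∈ U ∩ γ ⁻¹' g.source := ⟨ht₀, mem_extChartAt_source (γ t₀)⟩
  have hd : ContinuousOn (fun t => mvfderiv I g (γ t) (X (γ t))) (U ∩ γ ⁻¹' g.source) :=
    (contMDiffOn_mvfderiv_apply hs hgs fun q _ => (hX q).contMDiffWithinAt).continuousOn.comp
      (hcont.mono inter_subset_left) fun t ht => ht.2
  have hα : ContDiffAt ℝ 1 (g ∘ γ) t₀ := by
    refine contDiffAt_one_iff.2 ⟨fun t => (1 : ℝ →L[ℝ] ℝ).smulRight (mvfderiv I g (γ t) (X (γ t))),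
      _, hV.mem_nhds hmem, ?_, fun t ht => ?_⟩
    · exact (ContinuousLinearMap.smulRightL ℝ ℝ E (1 : ℝ →L[ℝ] ℝ)).continuous.comp_continuousOn hd
    · have h1 : MDifferentiableAt I 𝓘(ℝ, E) g (γ t) :=
        (hgs.contMDiffAt (hs.mem_nhds ht.2)).mdifferentiableAt (by simp)
      have h2 := (h1.hasMFDerivAt.comp t (hcγ t ht.1)).hasFDerivAt
      refine h2.congr_fderiv ?_
      ext
      change mvfderiv I g (γ t) ((1 : ℝ) • X (γ t)) = (1 : ℝ) • mvfderiv I g (γ t) (X (γ t))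
      rw [map_smul]
  have h3 : ContMDiffAt 𝓘(ℝ, E) I 1 g.symm (g (γ t₀)) :=
    ((contMDiffOn_extChartAt_symm (n := ∞) (γ t₀)).contMDiffAt
      (extChartAt_target_mem_nhds (γ t₀))).of_le ENat.LEInfty.out
  refine (ContMDiffAt.comp (g := g.symm) t₀ h3 hα.contMDiffAt).congr_of_eventuallyEq ?_
  filter_upwards [hV.mem_nhds hmem] with t ht
  exact (g.left_inv ht.2).symm

end CurveRegularity

/-! ### Curves of bounded speed on a complete surface -/

section SpeedBounds

theorem exists_tendsto_of_lipschitzOnWith {S : Type*} [MetricSpace S] [CompleteSpace S]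
    {c : ℝ → S} {U : Set ℝ} {K : NNReal} (hc : LipschitzOnWith K c U) {x : ℝ}
    (hx : (𝓝[U] x).NeBot) : ∃ y, Tendsto c (𝓝[U] x) (𝓝 y) := by
  refine CompleteSpace.complete (f := map c (𝓝[U] x)) (Metric.cauchy_iff.2 ⟨hx.map c, ?_⟩)
  intro ε hε
  obtain ⟨δ, hδ, h⟩ := Metric.uniformContinuousOn_iff.1 hc.uniformContinuousOn ε hε
  refine ⟨c '' (U ∩ Metric.ball x (δ / 2)), image_mem_map (inter_mem self_mem_nhdsWithin
    (mem_nhdsWithin_of_mem_nhds (Metric.ball_mem_nhds x (half_pos hδ)))), ?_⟩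
  rintro _ ⟨s, hs, rfl⟩ _ ⟨t, ht, rfl⟩
  refine h s hs.1 t ht.1 ((dist_triangle_right s t x).trans_lt ?_)
  linarith [Metric.mem_ball.1 hs.2, Metric.mem_ball.1 ht.2]

variable {S : Type*} [MetricSpace S] [ChartedSpace (EuclideanSpace ℝ (Fin 2)) S]
  [IsManifold (𝓡 2) ∞ S] [RiemannianBundle (fun x : S => TangentSpace (𝓡 2) x)]
  [IsRiemannianManifold (𝓡 2) S]

open Manifold in
-- The Riemannian distance is at most the length of the curve, which is the integral of the speed.
theorem lipschitzOnWith_of_norm_mfderiv_le {c : ℝ → S} {a b : ℝ} {K : NNReal}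
    (hc : ∀ t ∈ Ioo a b, ContMDiffAt 𝓘(ℝ) (𝓡 2) 1 c t)
    (hK : ∀ t ∈ Ioo a b, ‖mfderiv 𝓘(ℝ) (𝓡 2) c t 1‖ ≤ K) : LipschitzOnWith K c (Ioo a b) := by
  have key : ∀ s ∈ Ioo a b, ∀ t ∈ Ioo a b, s ≤ t → edist (c s) (c t) ≤ K * edist s t := by
    intro s hs t ht hst
    have hsub : ∀ u ∈ Icc s t, u ∈ Ioo a b := fun u hu =>
      ⟨hs.1.trans_le hu.1, hu.2.trans_lt ht.2⟩
    rw [IsRiemannianManifold.out (I := 𝓡 2) (c s) (c t)]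
    refine (riemannianEDist_le_pathELength (fun u hu => (hc u (hsub u hu)).contMDiffWithinAt)
      rfl rfl hst).trans ?_
    rw [pathELength_eq_lintegral_mfderiv_Icc]
    have hb : ∫⁻ u in Icc s t, ‖mfderiv 𝓘(ℝ) (𝓡 2) c u 1‖ₑ ≤ ∫⁻ _ in Icc s t, (K : ENNReal) := by
      refine MeasureTheory.setLIntegral_mono measurable_const fun u hu => ?_
      rw [← ofReal_norm, ← ENNReal.ofReal_coe_nnreal]
      exact ENNReal.ofReal_le_ofReal (hK u (hsub u hu))
    refine hb.trans (le_of_eq ?_)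
    rw [MeasureTheory.setLIntegral_const, Real.volume_Icc, edist_comm, edist_dist,
      Real.dist_eq, abs_of_nonneg (sub_nonneg.2 hst)]
  intro s hs t ht
  rcases le_total s t with h | h
  · exact key s hs t ht h
  · rw [edist_comm, edist_comm s]
    exact key t ht s hs h

end SpeedBounds

/-! ### Completeness of vector fields on the prolongation -/

section ProlongationCompleteness

variable {S : Type*} [MetricSpace S] [ChartedSpace (EuclideanSpace ℝ (Fin 2)) S]
  [IsManifold (𝓡 2) ∞ S] [RiemannianBundle (fun x : S => TangentSpace (𝓡 2) x)]
  [IsContMDiffRiemannianBundle (𝓡 2) ∞ (EuclideanSpace ℝ (Fin 2))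
    (fun x : S => TangentSpace (𝓡 2) x)]
  {o : SurfaceOrientation S} {X : ∀ p : Prolongation o, TangentSpace prolongModel p}

theorem contMDiff_foot_prolongation :
    ContMDiff prolongModel (𝓡 2) ∞ fun p : Prolongation o => p.1.val.1 :=
  UnitTangent.contMDiff_foot.comp contMDiff_fst

theorem mfderiv_foot_prolongation (p : Prolongation o) (ξ : TangentSpace prolongModel p) :
    mfderiv prolongModel (𝓡 2) (fun p : Prolongation o => p.1.val.1) p ξ =
      footDeriv p.1 (prolongProj p ξ) :=
  mfderiv_comp_apply (g := fun w : UnitTangent o => w.val.1) p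
    (UnitTangent.contMDiff_foot.contMDiffAt.mdifferentiableAt (by simp)) mdifferentiableAt_fst ξ

theorem exists_isCompact_foot_nhds (y : S) : ∃ K ∈ 𝓝 y,
    IsCompact {p : Prolongation o | p.1.val.1 ∈ K} := by
  have : LocallyCompactSpace S := ChartedSpace.locallyCompactSpace (EuclideanSpace ℝ (Fin 2)) S
  obtain ⟨K, hKy, hKs, hK⟩ := local_compact_nhds
    ((chartAt (EuclideanSpace ℝ (Fin 2)) y).open_source.mem_nhds (mem_chart_source _ y))
  refine ⟨K, hKy, ?_⟩
  have h := (UnitTangent.isCompact_foot_mem (o := o) hK hKs).prod (isCompact_univ (X := Circle))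
  convert! h using 1
  ext p
  simp

theorem compactSpace_prolongation [CompactSpace S] : CompactSpace (Prolongation o) := by
  choose K hK hc using exists_isCompact_foot_nhds (o := o)
  obtain ⟨T, -, hT⟩ := (isCompact_univ (X := S)).elim_nhds_subcover K fun y _ => hK y
  refine ⟨(T.isCompact_biUnion fun y _ => hc y).of_isClosed_subset isClosed_univ fun p _ => ?_⟩
  obtain ⟨y, hy, hp⟩ := mem_iUnion₂.1 (hT (mem_univ p.1.val.1))
  exact mem_iUnion₂.2 ⟨y, hy, hp⟩

variable [IsRiemannianManifold (𝓡 2) S] [CompleteSpace S]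

/-- A vector field on the prolongation which moves the foot points at bounded speed is complete. -/
theorem exists_isFlow_of_norm_footDeriv_le
    (hX : ContMDiff prolongModel prolongModel.tangent ∞
      (fun p => (⟨p, X p⟩ : TangentBundle prolongModel (Prolongation o)))) {C : ℝ}
    (hC : ∀ p, ‖footDeriv p.1 (prolongProj p (X p))‖ ≤ C) :
    ∃ φ : ℝ → Prolongation o → Prolongation o, IsFlow prolongModel X φ := by
  refine exists_isFlow hX fun p => exists_isMIntegralCurve_of_extension hX p ?_
  intro b γ hb _ hγ
  set c : ℝ → S := fun t => (γ t).1.val.1 with hc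
  have hcd : ∀ t ∈ Ioo (-b) b, ContMDiffAt 𝓘(ℝ) (𝓡 2) 1 c t := fun t ht =>
    ((contMDiff_foot_prolongation.of_le ENat.LEInfty.out).contMDiffAt (x := γ t)).comp t
      (contMDiffAt_of_isMIntegralCurveOn hX isOpen_Ioo hγ ht)
  have hcK : ∀ t ∈ Ioo (-b) b, ‖mfderiv 𝓘(ℝ) (𝓡 2) c t 1‖ ≤ C.toNNReal := by
    intro t ht
    have h1 := (hγ t ht).hasMFDerivAt (Ioo_mem_nhds ht.1 ht.2)
    have h2 : MDifferentiableAt prolongModel (𝓡 2) (fun p : Prolongation o => p.1.val.1) (γ t) :=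
      contMDiff_foot_prolongation.contMDiffAt.mdifferentiableAt (by simp)
    have h3 : mfderiv 𝓘(ℝ) (𝓡 2) c t 1 = footDeriv (γ t).1 (prolongProj (γ t) (X (γ t))) := by
      rw [← mfderiv_foot_prolongation]
      refine (mfderiv_comp_apply (g := fun p : Prolongation o => p.1.val.1) t h2
        h1.mdifferentiableAt (1 : ℝ)).trans ?_
      rw [h1.mfderiv]
      exact congrArg _ (one_smul ℝ (X (γ t)))
    rw [h3]
    exact (hC (γ t)).trans (Real.le_coe_toNNReal C)
  -- The projected curve is Lipschitz, so by completeness of the surface it converges at both ends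
  -- of the interval. The prolongation is compact over neighbourhoods of the two limits, and the
  -- uniform existence time there lets the curve be extended.
  have hlip := lipschitzOnWith_of_norm_mfderiv_le hcd hcK
  have hlt : -b < b := by linarith
  have n₁ := right_nhdsWithin_Ioo_neBot hlt
  have n₂ := left_nhdsWithin_Ioo_neBot hlt
  obtain ⟨y₁, hy₁⟩ := exists_tendsto_of_lipschitzOnWith hlip n₁
  obtain ⟨y₂, hy₂⟩ := exists_tendsto_of_lipschitzOnWith hlip n₂
  obtain ⟨K₁, hK₁, c₁⟩ := exists_isCompact_foot_nhds (o := o) y₁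
  obtain ⟨K₂, hK₂, c₂⟩ := exists_isCompact_foot_nhds (o := o) y₂
  obtain ⟨ε, hε, hex⟩ := exists_isMIntegralCurveOn_of_isCompact hX (c₁.union c₂)
  have o₁ : ∀ᶠ t in 𝓝[Ioo (-b) b] b, max 0 (b - ε) < t :=
    mem_nhdsWithin_of_mem_nhds (Ioi_mem_nhds (max_lt hb (by linarith)))
  have o₂ : ∀ᶠ t in 𝓝[Ioo (-b) b] (-b), t < min 0 (-b + ε) :=
    mem_nhdsWithin_of_mem_nhds (Iio_mem_nhds (lt_min (by linarith) (by linarith)))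
  obtain ⟨t₁, h₁, h₁', h₁''⟩ := ((hy₁.eventually hK₁).and
    (o₁.and self_mem_nhdsWithin)).exists
  obtain ⟨t₂, h₂, h₂', h₂''⟩ := ((hy₂.eventually hK₂).and
    (o₂.and self_mem_nhdsWithin)).exists
  exact exists_extension_isMIntegralCurveOn hX hb hγ ⟨h₁', h₁''.2⟩ ⟨h₂''.1, h₂'⟩
    (hex _ (Or.inl h₁)) (hex _ (Or.inr h₂))

end ProlongationCompleteness

theorem exists_inv_le_and_le_of_compactSpace {M : Type*} [TopologicalSpace M] [CompactSpace M]
    {f : M → ℝ} (hf : Continuous f) (h0 : ∀ p, 0 < f p) : ∃ C > 0, ∀ p, C⁻¹ ≤ f p ∧ f p ≤ C := by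
  obtain ⟨a, ha⟩ := (isCompact_range hf).bddAbove
  obtain ⟨c, hc⟩ := (isCompact_range (hf.inv₀ fun p => (h0 p).ne')).bddAbove
  refine ⟨max 1 (max a c), by positivity, fun p => ⟨?_, ?_⟩⟩
  · refine inv_le_of_inv_le₀ (h0 p) ?_
    exact (hc ⟨p, rfl⟩).trans ((le_max_right a c).trans (le_max_right 1 _))
  · exact (ha ⟨p, rfl⟩).trans ((le_max_left a c).trans (le_max_right 1 _))

/-! ### Fibrewise metrics in the magnetic frame -/

section FrameMetric

variable {E : Type*} [NormedAddCommGroup E] [NormedSpace ℝ E] [FiniteDimensional ℝ E]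
  {H : Type*} [TopologicalSpace H] {I : ModelWithCorners ℝ E H} [I.Boundaryless]
  {M : Type*} [TopologicalSpace M] [ChartedSpace H M] [IsManifold I ∞ M]
  {F : Fin 4 → ∀ p : M, TangentSpace I p} {κ : ℝ}

theorem IsMagneticFrame.exists_eq_smul (hF : IsMagneticFrame I F κ) {X : ∀ p : M, TangentSpace I p}
    (hX : IsGenerator I (fun p => Submodule.span ℝ {F 1 p}) X) :
    ∃ h : M → ℝ, ContMDiff I 𝓘(ℝ) ∞ h ∧ (∀ p, h p ≠ 0) ∧ ∀ p, X p = h p • F 1 p := by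
  have hh : ∀ p, X p = hF.isLocalFrameOn.coeff 1 p (X p) • F 1 p := by
    intro p
    have hm : X p ∈ Submodule.span ℝ {F 1 p} := by
      have h : Submodule.span ℝ {F 1 p} = Submodule.span ℝ {X p} := (hX.2 p).2
      rw [h]
      exact Submodule.mem_span_singleton_self _
    obtain ⟨a, ha⟩ := Submodule.mem_span_singleton.1 hm
    rw [← ha, map_smul, hF.coeff_apply]
    simp
  refine ⟨fun p => hF.isLocalFrameOn.coeff 1 p (X p), fun p =>
    contMDiffAt_coeff hF.isLocalFrameOn (Eventually.of_forall fun q => hX.1 q) 1, fun p h => ?_, hh⟩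
  refine (hX.2 p).1 ?_
  rw [hh p]
  simp only at h
  rw [h, zero_smul]

theorem IsMagneticFrame.isGenerator (hF : IsMagneticFrame I F κ) :
    IsGenerator I (fun p => Submodule.span ℝ {F 1 p}) (F 1) := by
  refine ⟨hF.contMDiff 1, fun p => ⟨fun h => ?_, rfl⟩⟩
  have := hF.coeff_apply p 1 1
  rw [h, map_zero] at this
  simp at this

/-- The fibrewise metric for which the fields `F 0`, `F 2` are an orthonormal frame. -/
noncomputable def frameMetric (hF : IsMagneticFrame I F κ) :
    QuotientMetric I (frameSpan F {0, 1, 2}) fun p => Submodule.span ℝ {F 1 p} where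
  form p := LinearMap.mk₂ ℝ
    (fun u v => hF.isLocalFrameOn.coeff 0 p u * hF.isLocalFrameOn.coeff 0 p v +
      hF.isLocalFrameOn.coeff 2 p u * hF.isLocalFrameOn.coeff 2 p v)
    (fun u u' v => by simp only [map_add]; ring)
    (fun c u v => by simp only [map_smul, smul_eq_mul]; ring)
    (fun u v v' => by simp only [map_add]; ring)
    (fun c u v => by simp only [map_smul, smul_eq_mul]; ring)
  symm p u _ v _ := by simp only [LinearMap.mk₂_apply]; ring
  kernel p u hu v _ := by
    obtain ⟨a, rfl⟩ := Submodule.mem_span_singleton.1 hu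
    simp [LinearMap.mk₂_apply, hF.coeff_apply]
  pos p u hu hu' := by
    rw [LinearMap.mk₂_apply]
    by_contra! h
    have h0 : hF.isLocalFrameOn.coeff 0 p u = 0 := by nlinarith
    have h2 : hF.isLocalFrameOn.coeff 2 p u = 0 := by nlinarith
    refine hu' ?_
    rw [hF.expand hu, h0, h2, zero_smul, zero_smul, zero_add, add_zero]
    exact Submodule.smul_mem _ _ (Submodule.mem_span_singleton_self _)
  continuousAt p A B hA hB := by
    have h : ∀ {A : ∀ q : M, TangentSpace I q}, IsLocalSection I (frameSpan F {0, 1, 2}) p A →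
        ∀ i, ContinuousAt (fun q => hF.isLocalFrameOn.coeff i q (A q)) p := fun hA i =>
      (contMDiffAt_coeff hF.isLocalFrameOn (hA.mono fun q hq => hq.2) i).continuousAt
    exact ((h hA 0).mul (h hB 0)).add ((h hA 2).mul (h hB 2))

theorem frameMetric_apply (hF : IsMagneticFrame I F κ) (p : M) (x y x' y' : ℝ) :
    (frameMetric hF).form p (x • F 0 p + y • F 2 p) (x' • F 0 p + y' • F 2 p) =
      x * x' + y * y' := by
  change hF.isLocalFrameOn.coeff 0 p _ * hF.isLocalFrameOn.coeff 0 p _ +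
    hF.isLocalFrameOn.coeff 2 p _ * hF.isLocalFrameOn.coeff 2 p _ = _
  simp [hF.coeff_apply]

/-- The eigenvalues of the Gram matrix of `F 0`, `F 2` lie between determinant / trace and trace.
Both are continuous positive functions, hence bounded above and away from 0 on a compact space. -/
theorem IsMagneticFrame.exists_metric_bounds (hF : IsMagneticFrame I F κ) [CompactSpace M]
    (b : QuotientMetric I (frameSpan F {0, 1, 2}) fun p => Submodule.span ℝ {F 1 p}) :
    ∃ C > 0, ∀ p x y, C⁻¹ * (x ^ 2 + y ^ 2) ≤
        b.form p (x • F 0 p + y • F 2 p) (x • F 0 p + y • F 2 p) ∧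
      b.form p (x • F 0 p + y • F 2 p) (x • F 0 p + y • F 2 p) ≤ C * (x ^ 2 + y ^ 2) := by
  have hm : ∀ {i : Fin 4}, i ∈ ({0, 1, 2} : Finset (Fin 4)) → ∀ p, F i p ∈ frameSpan F {0, 1, 2} p :=
    fun hi p => frame_mem_frameSpan hi p
  have hcont : ∀ {i j : Fin 4}, i ∈ ({0, 1, 2} : Finset (Fin 4)) →
      j ∈ ({0, 1, 2} : Finset (Fin 4)) → Continuous fun p => b.form p (F i p) (F j p) :=
    fun hi hj => continuous_iff_continuousAt.2 fun p =>
      b.continuousAt p _ _ (isLocalSection_frame hF.isLocalFrameOn hi p) (isLocalSection_frame hF.isLocalFrameOn hj p)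
  set α := fun p => b.form p (F 0 p) (F 0 p) with hα
  set β := fun p => b.form p (F 0 p) (F 2 p) with hβ
  set γ := fun p => b.form p (F 2 p) (F 2 p) with hγ
  have hform : ∀ p (x y : ℝ), b.form p (x • F 0 p + y • F 2 p) (x • F 0 p + y • F 2 p) =
      α p * x ^ 2 + 2 * β p * x * y + γ p * y ^ 2 := by
    intro p x y
    have hs := b.symm p _ (hm (i := 2) (by simp) p) _ (hm (i := 0) (by simp) p)
    simp only [map_add, map_smul, LinearMap.add_apply, LinearMap.smul_apply, smul_eq_mul, hs, hα,
      hβ, hγ]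
    ring
  have hpos : ∀ p (x y : ℝ), x ≠ 0 ∨ y ≠ 0 → 0 < α p * x ^ 2 + 2 * β p * x * y + γ p * y ^ 2 := by
    intro p x y hxy
    rw [← hform]
    refine b.pos p _ (Submodule.add_mem _ (Submodule.smul_mem _ _ (hm (by simp) p))
      (Submodule.smul_mem _ _ (hm (by simp) p))) fun h => ?_
    obtain ⟨a, ha⟩ := Submodule.mem_span_singleton.1 h
    have h0 := congrArg (hF.isLocalFrameOn.coeff 0 p) ha
    have h2 := congrArg (hF.isLocalFrameOn.coeff 2 p) ha
    simp [hF.coeff_apply] at h0 h2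
    rcases hxy with hx | hy
    · exact hx h0.symm
    · exact hy h2.symm
  have hα0 : ∀ p, 0 < α p := fun p => by simpa using hpos p 1 0 (by simp)
  have hγ0 : ∀ p, 0 < γ p := fun p => by simpa using hpos p 0 1 (by simp)
  -- At (β, -α) the quadratic form takes the value α times the determinant.
  have hdet : ∀ p, 0 < α p * γ p - β p ^ 2 := fun p => by
    have h := hpos p (β p) (-α p) (Or.inr (neg_ne_zero.2 (hα0 p).ne'))
    have e : α p * β p ^ 2 + 2 * β p * β p * -α p + γ p * (-α p) ^ 2 =
      α p * (α p * γ p - β p ^ 2) := by ring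
    rw [e] at h
    exact (pos_iff_pos_of_mul_pos h).1 (hα0 p)
  have hαc : Continuous α := hcont (by simp) (by simp)
  have hβc : Continuous β := hcont (by simp) (by simp)
  have hγc : Continuous γ := hcont (by simp) (by simp)
  have ht0 : ∀ p, 0 < α p + γ p := fun p => add_pos (hα0 p) (hγ0 p)
  obtain ⟨C₁, hC₁, h₁⟩ := exists_inv_le_and_le_of_compactSpace (hαc.add hγc) ht0
  obtain ⟨C₂, hC₂, h₂⟩ := exists_inv_le_and_le_of_compactSpace
    (f := fun p => (α p * γ p - β p ^ 2) / (α p + γ p))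
    (((hαc.mul hγc).sub (hβc.pow 2)).div (hαc.add hγc) fun p => (ht0 p).ne')
    fun p => div_pos (hdet p) (ht0 p)
  refine ⟨max C₁ C₂, lt_max_of_lt_left hC₁, fun p x y => ?_⟩
  rw [hform]
  have hxy : 0 ≤ x ^ 2 + y ^ 2 := by positivity
  constructor
  · calc (max C₁ C₂)⁻¹ * (x ^ 2 + y ^ 2)
        ≤ (α p * γ p - β p ^ 2) / (α p + γ p) * (x ^ 2 + y ^ 2) := by
          refine mul_le_mul_of_nonneg_right (le_trans ?_ (h₂ p).1) hxy
          exact inv_anti₀ hC₂ (le_max_right _ _)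
      _ ≤ _ := by
          -- By Cayley–Hamilton, trace · form - det · (x² + y²) is the squared length of the Gram
          -- matrix applied to (x, y), the sum of the two squares supplied below.
          rw [div_mul_eq_mul_div, div_le_iff₀ (ht0 p)]
          nlinarith [sq_nonneg (α p * x + β p * y), sq_nonneg (β p * x + γ p * y)]
  · calc α p * x ^ 2 + 2 * β p * x * y + γ p * y ^ 2 ≤ (α p + γ p) * (x ^ 2 + y ^ 2) := by
          -- The form at (x, y) and the form at (y, -x) add up to trace · (x² + y²), so positivity
          -- of the latter is the upper bound.
          have h := hpos p y (-x)
          by_cases h0 : x = 0 ∧ y = 0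
          · simp [h0.1, h0.2]
          · have h := hpos p y (-x) (by
              by_contra! h'
              exact h0 ⟨neg_eq_zero.1 h'.2, h'.1⟩)
            nlinarith
      _ ≤ _ := mul_le_mul_of_nonneg_right ((h₁ p).2.trans (le_max_left _ _)) hxy

end FrameMetric

/-! ### The matrix exponential of the holonomy -/

section RotationExponential

open scoped Matrix.Norms.Operator in
-- The exponential commutes with its generator, which determines its second column from the first.
-- The first column then solves the scalar system, so the three signs of K need no separate
-- formulas.
theorem exists_exp_smul_eq (K : ℝ) : ∃ cs sn : ℝ → ℝ,
    (∀ t, HasDerivAt cs (-K * sn t) t) ∧ (∀ t, HasDerivAt sn (cs t) t) ∧ cs 0 = 1 ∧ sn 0 = 0 ∧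
      ∀ t : ℝ, NormedSpace.exp (t • (!![0, -K; 1, 0] : Matrix (Fin 2) (Fin 2) ℝ)) =
        !![cs t, -K * sn t; sn t, cs t] := by
  set N : Matrix (Fin 2) (Fin 2) ℝ := !![0, -K; 1, 0] with hN
  set R : ℝ → Matrix (Fin 2) (Fin 2) ℝ := fun t => NormedSpace.exp (t • N) with hR
  have h1 : ∀ t, HasDerivAt R (R t * N) t := fun t => hasDerivAt_exp_smul_const N t
  have h2 : ∀ t, HasDerivAt R (N * R t) t := fun t => hasDerivAt_exp_smul_const' N t
  have hc : ∀ t, R t * N = N * R t := fun t => (h1 t).unique (h2 t)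
  have hd : ∀ i j t, HasDerivAt (fun t => R t i j) ((N * R t) i j) t := fun i j t =>
    hasDerivAt_pi.1 (hasDerivAt_pi.1 (h2 t) i) j
  have h0 : R 0 = 1 := by simp [hR]
  have e00 : ∀ t, R t 0 1 = -K * R t 1 0 := fun t => by
    have := congrFun (congrFun (hc t) 0) 0
    simpa [Matrix.mul_apply, hN, Fin.sum_univ_two] using this
  have e10 : ∀ t, R t 1 1 = R t 0 0 := fun t => by
    have := congrFun (congrFun (hc t) 1) 0
    simpa [Matrix.mul_apply, hN, Fin.sum_univ_two] using this
  refine ⟨fun t => R t 0 0, fun t => R t 1 0, fun t => ?_, fun t => ?_, by simp [h0], by simp [h0],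
    fun t => ?_⟩
  · refine (hd 0 0 t).congr_deriv ?_
    simp [Matrix.mul_apply, hN, Fin.sum_univ_two]
  · refine (hd 1 0 t).congr_deriv ?_
    simp [Matrix.mul_apply, hN, Fin.sum_univ_two]
  · change R t = _
    rw [← e00 t]
    ext i j
    fin_cases i <;> fin_cases j <;> simp [e10 t]

end RotationExponential

/-! ### The even contact structure, its holonomy and its type -/

section MagneticTypes

variable {S : Type*} [MetricSpace S] [ChartedSpace (EuclideanSpace ℝ (Fin 2)) S]
  [IsManifold (𝓡 2) ∞ S] [RiemannianBundle (fun x : S => TangentSpace (𝓡 2) x)]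
  [IsContMDiffRiemannianBundle (𝓡 2) ∞ (EuclideanSpace ℝ (Fin 2))
    (fun x : S => TangentSpace (𝓡 2) x)] {o : SurfaceOrientation S} {κ : ℝ}

theorem nonempty_prolongation [Nonempty S] : Nonempty (Prolongation o) :=
  have ⟨v, _⟩ := UnitTangent.exists_foot_eq (o := o) (Classical.arbitrary S)
  ⟨(v, 1)⟩

theorem evenContact_eq_frameSpan (hκ : HasConstantCurvature S κ) :
    evenContact (o := o) = frameSpan (magneticFrame κ) {0, 1, 2} := by
  rw [← (isMagneticFrame (o := o) hκ).derivedDistribution_two, ← prolongation_eq_frameSpan κ]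
  rfl

theorem charLine_eq_span (hκ : HasConstantCurvature S κ) :
    charLine (o := o) = fun p => Submodule.span ℝ {magneticFrame κ 1 p} := by
  funext p
  rw [← (isMagneticFrame (o := o) hκ).cauchyCharacteristic_three p, ← evenContact_eq_frameSpan hκ]
  rfl

theorem norm_footDeriv_smul_magneticFrame (h : ℝ) (p : Prolongation o) :
    ‖footDeriv p.1 (prolongProj p (h • magneticFrame κ 1 p))‖ = |h| := by
  rw [map_smul, map_smul, footDeriv_magneticFrame, norm_smul, norm_rotated, mul_one,
    Real.norm_eq_abs]

/-- Statements about the fibrewise metrics of the even contact structure only have to be proved for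
the fibrewise metrics on the span of the magnetic frame. -/
theorem forall_quotientMetric (hκ : HasConstantCurvature S κ)
    {Q : ∀ D W P : ∀ p : Prolongation o, Submodule ℝ (TangentSpace prolongModel p),
      QuotientMetric prolongModel D W → Prop}
    (h : ∀ b, Q (frameSpan (magneticFrame κ) {0, 1, 2})
      (fun p => Submodule.span ℝ {magneticFrame κ 1 p}) (frameSpan (magneticFrame κ) {0, 1}) b) :
    ∀ b, Q evenContact charLine prolongation b := by
  rw [evenContact_eq_frameSpan hκ, charLine_eq_span hκ, prolongation_eq_frameSpan κ]
  exact h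

theorem exists_orthonormal_quotientMetric (hκ : HasConstantCurvature S κ) :
    ∃ b : QuotientMetric prolongModel (evenContact (o := o)) charLine, ∀ p (x y x' y' : ℝ),
      b.form p (x • magneticFrame κ 0 p + y • magneticFrame κ 2 p)
        (x' • magneticFrame κ 0 p + y' • magneticFrame κ 2 p) = x * x' + y * y' := by
  rw [evenContact_eq_frameSpan hκ, charLine_eq_span hκ]
  exact ⟨frameMetric (isMagneticFrame hκ), frameMetric_apply (isMagneticFrame hκ)⟩

theorem span_insert_pair_eq_sup {V : Type*} [AddCommGroup V] [Module ℝ V] {F : Fin 4 → V} :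
    Submodule.span ℝ (F '' ↑({0, 1, 2} : Finset (Fin 4))) =
      Submodule.span ℝ {F 1} ⊔ Submodule.span ℝ {F 0, F 2} := by
  rw [← Submodule.span_union]
  congr 1
  ext u
  simp
  tauto

variable [IsRiemannianManifold (𝓡 2) S] [CompleteSpace S]

/-- The witness is the second field of the magnetic frame. It projects to the unit vector zv, so it
has speed 1 and is complete, and the general holonomy formula applies with h = 1. -/
theorem exists_structure_and_flow [Nonempty S] (hκ : HasConstantCurvature S κ) :
    ∃ (X Θ Y : ∀ p : Prolongation o, TangentSpace prolongModel p)
        (b : QuotientMetric prolongModel (evenContact (o := o)) charLine)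
        (φ : ℝ → Prolongation o → Prolongation o),
      IsGenerator prolongModel charLine X ∧ HasBoundedSpeed X ∧
      ContMDiff prolongModel prolongModel.tangent ∞
        (fun p => (⟨p, Θ p⟩ : TangentBundle prolongModel (Prolongation o))) ∧
      ContMDiff prolongModel prolongModel.tangent ∞
        (fun p => (⟨p, Y p⟩ : TangentBundle prolongModel (Prolongation o))) ∧
      (∀ p, footDeriv p.1 (prolongProj p (X p)) = rotated p.1 p.2 ∧
        IsTheta p (Θ p) ∧ IsTildeY p (Y p) ∧
        evenContact p = charLine p ⊔ Submodule.span ℝ {Θ p, Y p} ∧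
        b.form p (Θ p) (Θ p) = 1 ∧ b.form p (Y p) (Y p) = 1 ∧ b.form p (Θ p) (Y p) = 0) ∧
      IsUniform b ∧
      IsFlow prolongModel X φ ∧
      ∀ (t : ℝ) (p : Prolongation o), ∀ R : Matrix (Fin 2) (Fin 2) ℝ,
        R = NormedSpace.exp (t • !![0, -(κ * (κ + 1)); 1, 0]) →
        mfderiv prolongModel prolongModel (φ t) p (Θ p)
            - (R 0 0 • Θ (φ t p) + R 1 0 • Y (φ t p)) ∈ charLine (φ t p) ∧
        mfderiv prolongModel prolongModel (φ t) p (Y p)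
            - (R 0 1 • Θ (φ t p) + R 1 1 • Y (φ t p)) ∈ charLine (φ t p) := by
  have hF := isMagneticFrame (o := o) hκ
  have : Nonempty (Prolongation o) := nonempty_prolongation
  have hfoot : ∀ p : Prolongation o,
      ‖footDeriv p.1 (prolongProj p (magneticFrame κ 1 p))‖ = 1 := fun p => by
    rw [footDeriv_magneticFrame, norm_rotated]
  obtain ⟨b, hb⟩ := exists_orthonormal_quotientMetric (o := o) hκ
  obtain ⟨φ, hφ⟩ := exists_isFlow_of_norm_footDeriv_le (X := magneticFrame (o := o) κ 1)
    (hF.contMDiff 1) fun p => (hfoot p).le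
  refine ⟨magneticFrame κ 1, magneticFrame κ 0, magneticFrame κ 2, b, φ, ?_,
    ⟨1, one_pos, fun p => by rw [hfoot]; simp⟩, hF.contMDiff 0, hF.contMDiff 2, fun p =>
    ⟨footDeriv_magneticFrame κ p, isTheta_magneticFrame κ p, isTildeY_magneticFrame κ p,
      ?_, by simpa using hb p 1 0 1 0, by simpa using hb p 0 1 0 1, by simpa using hb p 1 0 0 1⟩,
    ⟨1, one_pos, fun p ξ η hξ hη x y => ?_⟩, hφ, fun t p R hR => ?_⟩
  · rw [charLine_eq_span hκ]
    exact hF.isGenerator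
  · rw [evenContact_eq_frameSpan hκ, charLine_eq_span hκ]
    exact span_insert_pair_eq_sup (F := fun i => magneticFrame κ i p)
  · rw [eq_magneticFrame_of_isTheta κ hξ, eq_magneticFrame_of_isTildeY κ hη, hb]
    constructor <;> apply le_of_eq <;> ring
  · obtain ⟨cs, sn, hcs, hsn, cs0, sn0, hexp⟩ := exists_exp_smul_eq (κ * (κ + 1))
    have hRt : R = !![cs t, -(κ * (κ + 1)) * sn t; sn t, cs t] := hR.trans (hexp t)
    obtain ⟨τ, τ0, hτ, hd⟩ := hF.exists_flow_apply (h := fun _ => 1) contMDiff_const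
      (fun _ => one_ne_zero) (fun p => (one_smul ℝ _).symm) hφ hcs hsn cs0 sn0 p
    -- For h = 1 the time change has derivative 1 and vanishes at 0.
    have hτt : τ t = t := by
      have h : ∀ s, HasDerivAt (fun s => τ s - s) 0 s := fun s =>
        ((hτ s).sub (hasDerivAt_id s)).congr_deriv (sub_self 1)
      have h' := is_const_of_deriv_eq_zero (fun s => (h s).differentiableAt) (fun s => (h s).deriv)
        t 0
      linarith
    rw [charLine_eq_span hκ, hRt]
    constructor
    · obtain ⟨w, hw⟩ := hd 1 0 0 t
      refine Submodule.mem_span_singleton.2 ⟨w, ?_⟩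
      have e : (1 : ℝ) • magneticFrame κ 0 p + (0 : ℝ) • magneticFrame κ 1 p +
        (0 : ℝ) • magneticFrame κ 2 p = magneticFrame κ 0 p := by module
      rw [e, hτt] at hw
      rw [hw]
      simp only [Matrix.of_apply, Matrix.cons_val', Matrix.cons_val_zero, Matrix.cons_val_one,
        Matrix.cons_val_fin_one]
      module
    · obtain ⟨w, hw⟩ := hd 0 1 0 t
      refine Submodule.mem_span_singleton.2 ⟨w, ?_⟩
      have e : (0 : ℝ) • magneticFrame κ 0 p + (0 : ℝ) • magneticFrame κ 1 p +
        (1 : ℝ) • magneticFrame κ 2 p = magneticFrame κ 2 p := by module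
      rw [e, hτt] at hw
      rw [hw]
      simp only [Matrix.of_apply, Matrix.cons_val', Matrix.cons_val_zero, Matrix.cons_val_one,
        Matrix.cons_val_fin_one]
      module

/-- A generator is h times the magnetic field W, and the speed of the foot point is |h| because W
projects to unit vectors. The bounds on |h| and on the metric are either assumed or follow from
compactness of the prolongation over a compact surface. -/
theorem exists_isFlow_and_types [Nonempty S] (hκ : HasConstantCurvature S κ)
    {X : ∀ p : Prolongation o, TangentSpace prolongModel p}
    (b : QuotientMetric prolongModel (evenContact (o := o)) charLine)
    (hX : IsGenerator prolongModel charLine X)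
    (hb : CompactSpace S ∨ HasBoundedSpeed X ∧ IsUniform b) :
    (∃ φ : ℝ → Prolongation o → Prolongation o, IsFlow prolongModel X φ) ∧
      ∀ φ : ℝ → Prolongation o → Prolongation o, IsFlow prolongModel X φ →
        (IsElliptic b φ ↔ 0 < κ * (κ + 1)) ∧
        (IsGenuineParabolic prolongation b φ ↔ κ * (κ + 1) = 0) ∧
        (IsGenuineHyperbolic prolongation b φ ↔ κ * (κ + 1) < 0) := by
  have hF := isMagneticFrame (o := o) hκ
  have : Nonempty (Prolongation o) := nonempty_prolongation
  rw [charLine_eq_span hκ] at hX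
  obtain ⟨h, hh, h0, hXh⟩ := hF.exists_eq_smul hX
  have hspeed : ∀ p, ‖footDeriv p.1 (prolongProj p (X p))‖ = |h p| := fun p => by
    rw [hXh, norm_footDeriv_smul_magneticFrame]
  have hspeed' : ∃ C > 0, ∀ p, C⁻¹ ≤ |h p| ∧ |h p| ≤ C := by
    rcases hb with hS | ⟨⟨C, hC, hC'⟩, -⟩
    · have := compactSpace_prolongation (o := o)
      exact exists_inv_le_and_le_of_compactSpace hh.continuous.abs fun p => abs_pos.2 (h0 p)
    · exact ⟨C, hC, fun p => by rw [← hspeed]; exact hC' p⟩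
  have hform : CompactSpace S ∨ ∃ C > 0, ∀ p (x y : ℝ), C⁻¹ * (x ^ 2 + y ^ 2) ≤
        b.form p (x • magneticFrame κ 0 p + y • magneticFrame κ 2 p)
          (x • magneticFrame κ 0 p + y • magneticFrame κ 2 p) ∧
      b.form p (x • magneticFrame κ 0 p + y • magneticFrame κ 2 p)
          (x • magneticFrame κ 0 p + y • magneticFrame κ 2 p) ≤ C * (x ^ 2 + y ^ 2) :=
    hb.imp_right fun ⟨_, C, hC, hC'⟩ => ⟨C, hC, fun p =>
      hC' p _ _ (isTheta_magneticFrame κ p) (isTildeY_magneticFrame κ p)⟩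
  clear hb
  obtain ⟨C₁, hC₁, hh₁⟩ := hspeed'
  refine ⟨exists_isFlow_of_norm_footDeriv_le hX.1 fun p => (hspeed p).le.trans (hh₁ p).2,
    fun φ hφ => ?_⟩
  -- The type of the metric depends on the distributions, so the identification of these with spans
  -- of frame fields has to be made for all metrics at once.
  revert b
  refine forall_quotientMetric hκ (Q := fun D W P b => (CompactSpace S ∨ ∃ C > 0,
      ∀ p (x y : ℝ), C⁻¹ * (x ^ 2 + y ^ 2) ≤
        b.form p (x • magneticFrame κ 0 p + y • magneticFrame κ 2 p)
          (x • magneticFrame κ 0 p + y • magneticFrame κ 2 p) ∧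
      b.form p (x • magneticFrame κ 0 p + y • magneticFrame κ 2 p)
          (x • magneticFrame κ 0 p + y • magneticFrame κ 2 p) ≤ C * (x ^ 2 + y ^ 2)) →
      (IsElliptic b φ ↔ 0 < κ * (κ + 1)) ∧ (IsGenuineParabolic P b φ ↔ κ * (κ + 1) = 0) ∧
        (IsGenuineHyperbolic P b φ ↔ κ * (κ + 1) < 0)) fun b hb => ?_
  obtain ⟨C₂, hC₂, hb₂⟩ : ∃ C > 0, ∀ p (x y : ℝ), C⁻¹ * (x ^ 2 + y ^ 2) ≤
        b.form p (x • magneticFrame κ 0 p + y • magneticFrame κ 2 p)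
          (x • magneticFrame κ 0 p + y • magneticFrame κ 2 p) ∧
      b.form p (x • magneticFrame κ 0 p + y • magneticFrame κ 2 p)
          (x • magneticFrame κ 0 p + y • magneticFrame κ 2 p) ≤ C * (x ^ 2 + y ^ 2) := by
    rcases hb with hS | hb
    · have := compactSpace_prolongation (o := o)
      exact hF.exists_metric_bounds b
    · exact hb
  -- A single constant has to serve for the speed and for the metric; enlarging it weakens both
  -- pairs of bounds.
  refine hF.types (C := max C₁ C₂) hh h0 hXh hφ (lt_max_of_lt_left hC₁) (fun p => ⟨?_, ?_⟩)
    fun p x y => ⟨?_, ?_⟩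
  · exact (inv_anti₀ hC₁ (le_max_left _ _)).trans (hh₁ p).1
  · exact (hh₁ p).2.trans (le_max_left _ _)
  · exact (mul_le_mul_of_nonneg_right (inv_anti₀ hC₂ (le_max_right _ _)) (by positivity)).trans
      (hb₂ p x y).1
  · exact (hb₂ p x y).2.trans (mul_le_mul_of_nonneg_right (le_max_right _ _) (by positivity))

end MagneticTypes

theorem theorem4p9 {S : Type*} [MetricSpace S] [ChartedSpace (EuclideanSpace ℝ (Fin 2)) S]
    [IsManifold (𝓡 2) ∞ S] [RiemannianBundle (fun x : S => TangentSpace (𝓡 2) x)]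
    [IsContMDiffRiemannianBundle (𝓡 2) ∞ (EuclideanSpace ℝ (Fin 2))
      (fun x : S => TangentSpace (𝓡 2) x)]
    [IsRiemannianManifold (𝓡 2) S] [CompleteSpace S] [ConnectedSpace S]
    (o : SurfaceOrientation S) (κ : ℝ) (hκ : HasConstantCurvature S κ) :
    (∀ v : UnitTangent o, BijOn (nullLine v) univ (nullCone v)) ∧
    IsEngel prolongModel (prolongation (o := o)) ∧
    (∃ (X Θ Y : ∀ p : Prolongation o, TangentSpace prolongModel p)
        (b : QuotientMetric prolongModel (evenContact (o := o)) charLine)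
        (φ : ℝ → Prolongation o → Prolongation o),
      IsGenerator prolongModel charLine X ∧ HasBoundedSpeed X ∧
      ContMDiff prolongModel prolongModel.tangent ∞
        (fun p => (⟨p, Θ p⟩ : TangentBundle prolongModel (Prolongation o))) ∧
      ContMDiff prolongModel prolongModel.tangent ∞
        (fun p => (⟨p, Y p⟩ : TangentBundle prolongModel (Prolongation o))) ∧
      (∀ p, footDeriv p.1 (prolongProj p (X p)) = rotated p.1 p.2 ∧
        IsTheta p (Θ p) ∧ IsTildeY p (Y p) ∧
        evenContact p = charLine p ⊔ Submodule.span ℝ {Θ p, Y p} ∧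
        b.form p (Θ p) (Θ p) = 1 ∧ b.form p (Y p) (Y p) = 1 ∧ b.form p (Θ p) (Y p) = 0) ∧
      IsUniform b ∧
      IsFlow prolongModel X φ ∧
      ∀ (t : ℝ) (p : Prolongation o), ∀ R : Matrix (Fin 2) (Fin 2) ℝ,
        R = NormedSpace.exp (t • !![0, -(κ * (κ + 1)); 1, 0]) →
        mfderiv prolongModel prolongModel (φ t) p (Θ p)
            - (R 0 0 • Θ (φ t p) + R 1 0 • Y (φ t p)) ∈ charLine (φ t p) ∧
        mfderiv prolongModel prolongModel (φ t) p (Y p)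
            - (R 0 1 • Θ (φ t p) + R 1 1 • Y (φ t p)) ∈ charLine (φ t p)) ∧
    ∀ (X : ∀ p : Prolongation o, TangentSpace prolongModel p)
      (b : QuotientMetric prolongModel (evenContact (o := o)) charLine),
      IsGenerator prolongModel charLine X →
      (CompactSpace S ∨ HasBoundedSpeed X ∧ IsUniform b) →
      (∃ φ : ℝ → Prolongation o → Prolongation o, IsFlow prolongModel X φ) ∧
      ∀ φ : ℝ → Prolongation o → Prolongation o, IsFlow prolongModel X φ →
        (IsElliptic b φ ↔ 0 < κ ∨ κ < -1) ∧
        (IsGenuineParabolic prolongation b φ ↔ κ = 0 ∨ κ = -1) ∧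
        (IsGenuineHyperbolic prolongation b φ ↔ -1 < κ ∧ κ < 0) := by
  have hpos : 0 < κ * (κ + 1) ↔ 0 < κ ∨ κ < -1 := by
    rw [mul_pos_iff]
    constructor
    · rintro (h | h)
      · exact Or.inl h.1
      · exact Or.inr (by linarith [h.2])
    · rintro (h | h)
      · exact Or.inl ⟨h, by linarith⟩
      · exact Or.inr ⟨by linarith, by linarith⟩
  have hzero : κ * (κ + 1) = 0 ↔ κ = 0 ∨ κ = -1 := by
    rw [mul_eq_zero, add_eq_zero_iff_eq_neg]
  have hneg : κ * (κ + 1) < 0 ↔ -1 < κ ∧ κ < 0 := by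
    rw [mul_neg_iff]
    constructor
    · rintro (h | h)
      · exact ⟨by linarith, by linarith⟩
      · exact ⟨by linarith [h.2], h.1⟩
    · rintro ⟨h, h0⟩
      exact Or.inr ⟨h0, by linarith⟩
  rw [← hpos, ← hzero, ← hneg]
  have : Nonempty (Prolongation o) := nonempty_prolongation
  refine ⟨bijOn_nullLine, ?_, exists_structure_and_flow hκ,
    fun X b hX hb => exists_isFlow_and_types hκ b hX hb⟩
  rw [prolongation_eq_frameSpan κ]
  exact (isMagneticFrame hκ).isEngel
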